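/- Let $d\in\{2,3\}$, let $k\ge 0$ be an integer and let $\varrho>0$. There is a constant $C>0$, depending only on $d$, $k$ and $\varrho$, such that the following holds. Let $\Omega\subset\mathbb{R}^d$ be a bounded connected open polyhedral domain and let $(\mathcal{T}_h,\mathcal{F}_h)$ be a polytopal mesh of $\Omega$: $\mathcal{T}_h$ is a finite collection of disjoint open polytopes (nonempty connected sets that are interiors of finite unions of closed simplices) whose closures cover $\overline\Omega$; $\mathcal{F}_h$ is a finite collection of disjoint planar faces (nonempty relatively open subsets of hyperplanes, with relative boundary of zero $(d-1)$-dimensional measure), each contained either in $\partial T_1\cap\partial T_2$ for two distinct elements or in $\partial T\cap\partial\Omega$ for some element; for all $T\in\mathcal{T}_h$, $\partial T$ is the union of the closures of the faces in $\mathcal{F}_T:=\{F\in\mathcal{F}_h : F\subset\partial T\}$, and every $F\in\mathcal{F}_T$ has a constant unit normal $\boldsymbol{n}_{TF}$ pointing out of $T$. Assume that the mesh is regular with parameter $\varrho$, i.e. $\Omega$ has a matching (conforming) simplicial mesh such that each open simplex is contained in one mesh element, the relative interior of each $(d-1)$-dimensional simplicial face is contained in or disjoint from each $F\in\mathcal{F}_h$,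 each simplex $\tau$ has inradius $r_\tau\ge\varrho h_\tau$, and $h_\tau\ge\varrho h_T$ whenever the interior of $\tau$ is contained in $T\in\mathcal{T}_h$; here $h_X$ denotes the diameter of $X$. For $X$ an element or a face, let $\mathbb{P}^k(X)$ be the space of restrictions to $X$ of polynomials of total degree at most $k$ and $\boldsymbol{\pi}^k_X$ the ($L^2(X)$-orthogonal) projector on $\mathbb{P}^k(X)^d$. For $T\in\mathcal{T}_h$ and $\boldsymbol{v}\in H^1(T)^d$, set $\underline{\boldsymbol{I}}_T\boldsymbol{v}:=(\boldsymbol{\pi}_T^k\boldsymbol{v},(\boldsymbol{\pi}_F^k\boldsymbol{v}_{|F})_{F\in\mathcal{F}_T})$, where $\boldsymbol{v}_{|F}$ is the trace of $\boldsymbol{v}$ on $F$. For $\underline{\boldsymbol{w}}_T=(\boldsymbol{w}_T,(\boldsymbol{w}_F)_{F\in\mathcal{F}_T})$ and $\underline{\boldsymbol{v}}_T=(\boldsymbol{v}_T,(\boldsymbol{v}_F)_{F\in\mathcal{F}_T})$ with components in $\mathbb{P}^k(T)^d$ and $\mathbb{P}^k(F)^d$, let $\boldsymbol{G}_{\underline{\boldsymbol{w}}_T}\underline{\boldsymbol{v}}_T\in\mathbb{P}^k(T)^d$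 be such that $$\int_T\boldsymbol{G}_{\underline{\boldsymbol{w}}_T}\underline{\boldsymbol{v}}_T\cdot\boldsymbol{z}=\int_T(\boldsymbol{w}_T\cdot\boldsymbol{\nabla})\boldsymbol{v}_T\cdot\boldsymbol{z}+\sum_{F\in\mathcal{F}_T}\int_F(\boldsymbol{w}_F\cdot\boldsymbol{n}_{TF})(\boldsymbol{v}_F-\boldsymbol{v}_T)\cdot\boldsymbol{z}\qquad\forall\boldsymbol{z}\in\mathbb{P}^k(T)^d.$$ Then, for all $T\in\mathcal{T}_h$, all $\boldsymbol{v}\in W^{1,4}(T)^d\cap H^{k+1}(T)^d$ and all $\boldsymbol{z}\in\mathbb{P}^k(T)^d$, $$\left|\int_T\left(\boldsymbol{G}_{\underline{\boldsymbol{I}}_T\boldsymbol{v}}(\underline{\boldsymbol{I}}_T\boldsymbol{v})-(\boldsymbol{v}\cdot\boldsymbol{\nabla})\boldsymbol{v}\right)\cdot\boldsymbol{z}\right|\le C\,h_T^{k+1}\,|\boldsymbol{v}|_{H^{k+1}(T)^d}\,|\boldsymbol{v}|_{W^{1,4}(T)^d}\,\|\boldsymbol{z}\|_{L^4(T)^d}.$$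 -/

import Mathlib

open MeasureTheory Set Filter Topology
open scoped ContDiff ENNReal

noncomputable section

namespace HHO

/-- The Euclidean space `ℝ^d`. -/
abbrev Space (d : ℕ) : Type := EuclideanSpace ℝ (Fin d)

/-! ### Polytopes and polytopal meshes -/

/-- A finite set of points is the vertex set of a (nondegenerate) `d`-simplex of `ℝ^d`; the closed
simplex itself is `convexHull ℝ s`. -/
def IsSimplex {d : ℕ} (s : Finset (Space d)) : Prop :=
  s.card = d + 1 ∧ AffineIndependent ℝ (Subtype.val : s → Space d)

/-- A (bounded, open) polytope: a nonempty connected set which is the interior of a finite union of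
closed simplices. -/
def IsPolytope {d : ℕ} (P : Set (Space d)) : Prop :=
  IsConnected P ∧ ∃ S : Finset (Finset (Space d)), (∀ s ∈ S, IsSimplex s) ∧
    P = interior (⋃ s ∈ S, convexHull ℝ (s : Set (Space d)))

/-- `F` is a nonempty relatively open subset of a hyperplane of `ℝ^d`, whose relative boundary
has zero `(d-1)`-dimensional measure. -/
def IsPlanarFace {d : ℕ} (F : Set (Space d)) : Prop :=
  F.Nonempty ∧
  (∃ (H : AffineSubspace ℝ (Space d)) (U : Set (Space d)),
    Module.finrank ℝ H.direction + 1 = d ∧ IsOpen U ∧ F = U ∩ (H : Set (Space d))) ∧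
  μHE[d - 1] (closure F \ F) = 0

/-- `n` is the constant unit normal vector to `F ⊆ ∂T` that points out of `T`: it is orthogonal
to `F`, and (almost everywhere on `F`) `T` lies on the side of `-n` and not on the side of `n`. -/
def IsOutwardNormal {d : ℕ} (T F : Set (Space d)) (n : Space d) : Prop :=
  ‖n‖ = 1 ∧ (∀ x ∈ F, ∀ y ∈ F, inner ℝ n (y - x) = 0) ∧
  ∀ᵐ x ∂((μHE[d - 1] : Measure (Space d)).restrict F),
    ∃ ε > 0, ∀ t ∈ Ioo (0 : ℝ) ε, x - t • n ∈ T ∧ x + t • n ∉ closure T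

/-- The unit normal vector `n_{TF}` to `F` pointing out of `T`. -/
def outwardNormal {d : ℕ} (T F : Set (Space d)) : Space d :=
  Classical.epsilon (IsOutwardNormal T F)

/-- A polytopal mesh of `Ω ⊆ ℝ^d`: a finite collection of elements and a finite
collection of planar faces. -/
structure PolytopalMesh {d : ℕ} (Ω : Set (Space d)) where
  /-- the mesh elements -/
  elements : Finset (Set (Space d))
  /-- the mesh faces -/
  faces : Finset (Set (Space d))
  isPolytope : ∀ T ∈ elements, IsPolytope T
  elements_disjoint : ∀ T ∈ elements, ∀ T' ∈ elements, T ≠ T' → Disjoint T T'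
  cover : closure Ω = ⋃ T ∈ elements, closure T
  isPlanarFace : ∀ F ∈ faces, IsPlanarFace F
  faces_disjoint : ∀ F ∈ faces, ∀ F' ∈ faces, F ≠ F' → Disjoint F F'
  /-- every face is either an interface or a boundary face -/
  interface_or_boundary : ∀ F ∈ faces,
    (∃ T ∈ elements, ∃ T' ∈ elements, T ≠ T' ∧ F ⊆ frontier T ∩ frontier T') ∨
    (∃ T ∈ elements, F ⊆ frontier T ∩ frontier Ω)
  /-- the faces lying on the boundary of an element cover this boundary -/
  frontier_eq : ∀ T ∈ elements,
    frontier T = ⋃ F ∈ {F | F ∈ faces ∧ F ⊆ frontier T}, closure F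
  /-- an element lies on one side of each of its faces -/
  exists_normal : ∀ T ∈ elements, ∀ F ∈ faces, F ⊆ frontier T → ∃ n, IsOutwardNormal T F n

open Classical in
/-- The set `𝓕_T` of the faces that lie on the boundary of `T`. -/
def PolytopalMesh.facesOf {d : ℕ} {Ω : Set (Space d)} (M : PolytopalMesh Ω) (T : Set (Space d)) :
    Finset (Set (Space d)) :=
  M.faces.filter (fun F => F ⊆ frontier T)

/-- The inradius: the supremum of the radii of the balls contained in the set. -/
def inradius {d : ℕ} (S : Set (Space d)) : ℝ :=
  sSup {r : ℝ | 0 ≤ r ∧ ∃ x, Metric.ball x r ⊆ S}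

/-- `S` is (the collection of the vertex sets of the simplices of) a matching simplicial submesh
of `M`. -/
structure PolytopalMesh.IsMatchingSimplicialSubmesh {d : ℕ} {Ω : Set (Space d)}
    (M : PolytopalMesh Ω) (S : Finset (Finset (Space d))) : Prop where
  isSimplex : ∀ s ∈ S, IsSimplex s
  cover : closure Ω = ⋃ s ∈ S, convexHull ℝ (s : Set (Space d))
  /-- two closed simplices meet along the convex hull of their common vertices -/
  isMatching : ∀ s ∈ S, ∀ t ∈ S,
    convexHull ℝ (s : Set (Space d)) ∩ convexHull ℝ (t : Set (Space d)) =
      convexHull ℝ ((s : Set (Space d)) ∩ (t : Set (Space d)))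
  /-- every (open) simplex is contained in a mesh element -/
  subset_element : ∀ s ∈ S, ∃ T ∈ M.elements, interior (convexHull ℝ (s : Set (Space d))) ⊆ T
  /-- every (relatively open) simplicial face is contained in or disjoint from each mesh face -/
  face_compat : ∀ s ∈ S, ∀ σ ⊆ s, σ.card = d → ∀ F ∈ M.faces,
    intrinsicInterior ℝ (convexHull ℝ (σ : Set (Space d))) ⊆ F ∨
    Disjoint (intrinsicInterior ℝ (convexHull ℝ (σ : Set (Space d)))) F

/-- The mesh `M` is regular with regularity parameter (at least) `ϱ`. A regular sequence of meshes
is a sequence of meshes that are all regular with the same `ϱ > 0`. -/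
def PolytopalMesh.IsRegular {d : ℕ} {Ω : Set (Space d)} (M : PolytopalMesh Ω) (ϱ : ℝ) : Prop :=
  ∃ S : Finset (Finset (Space d)), M.IsMatchingSimplicialSubmesh S ∧
    (∀ s ∈ S, ϱ * Metric.diam (convexHull ℝ (s : Set (Space d))) ≤
      inradius (convexHull ℝ (s : Set (Space d)))) ∧
    (∀ T ∈ M.elements, ∀ s ∈ S, interior (convexHull ℝ (s : Set (Space d))) ⊆ T →
      ϱ * Metric.diam T ≤ Metric.diam (convexHull ℝ (s : Set (Space d))))

/-! ### Sobolev spaces on an open set `T` -/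

/-- `g` is the weak derivative `∂_{J 0} ⋯ ∂_{J (m-1)} u` on the open set `T`. -/
def IsWeakDeriv {d m : ℕ} (T : Set (Space d)) (J : Fin m → Fin d) (u g : Space d → ℝ) : Prop :=
  LocallyIntegrableOn u T ∧ LocallyIntegrableOn g T ∧
  ∀ φ : Space d → ℝ, ContDiff ℝ ∞ φ → HasCompactSupport φ → tsupport φ ⊆ T →
    ∫ x in T, u x * iteratedFDeriv ℝ m φ x (fun l => EuclideanSpace.single (J l) (1 : ℝ)) =
      (-1) ^ m * ∫ x in T, g x * φ x

/-- The weak derivative `∂_{J 0} ⋯ ∂_{J (m-1)} u` on `T` (unique up to a null set when it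
exists). -/
def weakDeriv {d m : ℕ} (T : Set (Space d)) (J : Fin m → Fin d) (u : Space d → ℝ) : Space d → ℝ :=
  Classical.epsilon (IsWeakDeriv T J u)

/-- `v ∈ W^{m,p}(T)^d`. -/
def MemSobolev {d : ℕ} (T : Set (Space d)) (m : ℕ) (p : ℝ≥0∞) (v : Space d → Space d) : Prop :=
  MemLp v p (volume.restrict T) ∧
  ∀ i : Fin d, ∀ l ≤ m, ∀ J : Fin l → Fin d, ∃ g : Space d → ℝ,
    IsWeakDeriv T J (fun x => v x i) g ∧ MemLp g p (volume.restrict T)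

/-- The seminorm `|v|_{W^{m,p}(T)^d}` (for finite `p ≥ 1`): the `ℓ^p` sum of the `L^p(T)` norms of
all partial derivatives of order `m` of the components of `v`. -/
def sobolevSeminorm {d : ℕ} (T : Set (Space d)) (m : ℕ) (p : ℝ≥0∞) (v : Space d → Space d) : ℝ :=
  (∑ i : Fin d, ∑ J : Fin m → Fin d,
    (eLpNorm (weakDeriv T J (fun x => v x i)) p (volume.restrict T)).toReal ^ p.toReal) ^
      (1 / p.toReal)

/-- The convective derivative `(v·∇)v = ∑_j v_j ∂_j v` on `T`, with weak derivatives. -/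
def convective {d : ℕ} (T : Set (Space d)) (v : Space d → Space d) : Space d → Space d :=
  fun x => WithLp.toLp 2 (fun i => ∑ j : Fin d,
    v x j * weakDeriv T (fun _ : Fin 1 => j) (fun y => v y i) x)

/-- The trace of `v` on the boundary of `T`, given `(d-1)`-almost everywhere on the faces of `T` as
the limit of the averages of `v` over the intersections of `T` with shrinking balls. -/
def trace {d : ℕ} (T : Set (Space d)) (v : Space d → ℝ) : Space d → ℝ :=
  fun x => limUnder (𝓝[>] (0 : ℝ)) (fun r => ⨍ y in Metric.ball x r ∩ T, v y)

/-! ### Polynomials and projectors -/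

/-- The polynomial functions of total degree at most `l`. The elements of `P^l(X)` are the
restrictions of these to `X`. -/
def poly (d l : ℕ) : Set (Space d → ℝ) :=
  {p | ∃ q : MvPolynomial (Fin d) ℝ, q.totalDegree ≤ l ∧
    ∀ x, p x = MvPolynomial.eval (fun i => x i) q}

/-- The vector fields with components in `poly d l`. -/
def vecPoly (d l : ℕ) : Set (Space d → Space d) :=
  {p | ∀ i : Fin d, (fun x => p x i) ∈ poly d l}

/-- `p` is the `L²`-orthogonal projection of `v` on the polynomials of degree at most `l`, with
respect to the measure `μ` (the Lebesgue measure on an element or the surface measure on a face). -/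
def IsL2Proj {d : ℕ} (μ : Measure (Space d)) (l : ℕ) (v p : Space d → ℝ) : Prop :=
  p ∈ poly d l ∧ ∀ w ∈ poly d l, ∫ x, (v x - p x) * w x ∂μ = 0

/-- The `L²`-orthogonal projector on polynomials of degree at most `l`. -/
def lproj {d : ℕ} (μ : Measure (Space d)) (l : ℕ) (v : Space d → ℝ) : Space d → ℝ :=
  open Classical in if h : ∃ p, IsL2Proj μ l v p then h.choose else 0

theorem lproj_mem {d : ℕ} (μ : Measure (Space d)) (l : ℕ) (v : Space d → ℝ) :
    lproj μ l v ∈ poly d l := by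
  classical
  unfold lproj
  split_ifs with h
  · exact h.choose_spec.1
  · exact ⟨0, by simp, by simp⟩

/-! ### Discrete unknowns, interpolation and discrete directional derivative -/

/-- The local space of discrete unknowns on `T`: a polynomial vector field on `T`
and a polynomial vector field on each face of `T`. -/
structure LocalUnknowns {d : ℕ} {Ω : Set (Space d)} (M : PolytopalMesh Ω) (T : Set (Space d))
    (k : ℕ) where
  /-- the element unknown `v_T` -/
  cell : Space d → Space d
  /-- the face unknowns `v_F` -/
  face : M.facesOf T → Space d → Space d
  cell_mem : cell ∈ vecPoly d k
  face_mem : ∀ F, face F ∈ vecPoly d k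

/-- The local interpolator: componentwise `L²`-projections of `v` on `T` and of the trace of `v` on
each face. -/
def interp {d : ℕ} {Ω : Set (Space d)} (M : PolytopalMesh Ω) (T : Set (Space d)) (k : ℕ)
    (v : Space d → Space d) : LocalUnknowns M T k where
  cell := fun x => WithLp.toLp 2 (fun i => lproj (volume.restrict T) k (fun y => v y i) x)
  face := fun F x => WithLp.toLp 2 (fun i =>
    lproj ((μHE[d - 1] : Measure (Space d)).restrict F) k (trace T (fun y => v y i)) x)
  cell_mem := fun _ => lproj_mem _ _ _
  face_mem := fun _ _ => lproj_mem _ _ _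

/-- `g ∈ P^k(T)^d` is the discrete directional derivative of `v` along `w`: for all
`z ∈ P^k(T)^d`, `∫_T g·z = ∫_T (w_T·∇)v_T·z + ∑_{F ∈ 𝓕_T} ∫_F (w_F·n_{TF}) (v_F - v_T)·z`. -/
def IsDirDeriv {d : ℕ} {Ω : Set (Space d)} {M : PolytopalMesh Ω} {T : Set (Space d)} {k : ℕ}
    (w v : LocalUnknowns M T k) (g : Space d → Space d) : Prop :=
  g ∈ vecPoly d k ∧ ∀ z ∈ vecPoly d k,
    ∫ x in T, inner ℝ (g x) (z x) =
      (∫ x in T, inner ℝ (fderiv ℝ v.cell x (w.cell x)) (z x)) +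
      ∑ F : M.facesOf T, ∫ x in (F : Set (Space d)),
        inner ℝ (w.face F x) (outwardNormal T F) * inner ℝ (v.face F x - v.cell x) (z x)
          ∂(μHE[d - 1] : Measure (Space d))

/-- The discrete directional derivative `G_w v` on `T`. -/
def dirDeriv {d : ℕ} {Ω : Set (Space d)} {M : PolytopalMesh Ω} {T : Set (Space d)} {k : ℕ}
    (w v : LocalUnknowns M T k) : Space d → Space d :=
  Classical.epsilon (IsDirDeriv w v)

end HHO

end

noncomputable section

namespace HHO

/-! Testing against `z` and expanding in components splits the error into `d²` scalar terms. For `u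
= v_i`, `u' = v_j`, cell projections `p`, `p'` and face projections `f`, `f'`, such a term is `∫_T
(p' ∂_j p - u' ∂_j u) z + ∑_F n_j ∫_F f' (f - p) z`. Write `p' ∂_j p - u' ∂_j u = -(u' - p') ∂_j u -
p' ∂_j (u - p)` and integrate the last part by parts against `p' z`. What remains is a sum of
products of three factors: a projection error, of order `h^k |v|_{H^{k+1}}` when one power of `h` is
set aside; a first order quantity bounded by `|T|^{1/4} |v|_{W^{1,4}}`; and `z` or `h ∂_j z`, whose
sup norm is at most a constant times `|T|^{-1/4} ‖z‖_{L⁴}`. The powers of `|T|` cancel and the power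
of `h` left over is `k + 1`.

Two contributions contain `p'` itself and not an increment of it: `(u - p) p' ∂_j z` in the cell and
`(u - f) p' z` on a face. Since `∂_j z` and `z` are polynomials of degree at most `k`, orthogonality
of the projections allows `p'` to be replaced by `p' - c` for a constant `c`. This is why the
seminorm of `W^{1,4}` suffices. The argument is `abs_face_le` and `abs_consistency_le`;
`abs_dirDerivTerm_sub_le` inserts the orders of magnitude.

The constants may depend only on the ratio of `diam T` to the radius `r` of balls inscribed in the
simplices of `T`, which regularity fixes. Four tools have to be uniform in this sense. The Poincaré
inequality (`IsSubmesh.poincare`) holds on convex sets and is chained through simplices that share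
facets. Polynomial approximation (`IsJet.exists_poly_le`) subtracts a polynomial matching the means
of all derivatives and iterates Poincaré. Inverse inequalities (`IsSubmesh.inverse_pointwise`)
follow from finite dimensionality after rescaling an inscribed ball. The last tool is trace theory.

The trace is a limit of averages over `T ∩ B(x, ρ)`, so its theory is built by hand. A boundary face
is covered, up to a null set, by feet of columns, that is, of segments in a fixed direction entering
`T`. An `H¹` function is absolutely continuous along almost every column (`IsColumn.ae_eq`), hence
has a value at the foot; Lebesgue points on the hyperplane identify this value with the trace
(`IsColumn.tendsto_average`), and integrating along the columns gives the trace inequality.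
Integration by parts holds in half balls by Fubini along columns, away from ridges by a partition of
unity, and across ridges because sets of codimension two are removable for `H¹` functions
(`HasIBP.of_codimTwoCutoff`). -/

/-- `u ∈ H¹(T)` with weak gradient `G`. -/
structure IsH1 {d : ℕ} (T : Set (Space d)) (u : Space d → ℝ) (G : Space d → Space d) : Prop where
  memLp : MemLp u 2 (volume.restrict T)
  memLp_grad : MemLp G 2 (volume.restrict T)
  weak : ∀ φ : Space d → ℝ, ContDiff ℝ ∞ φ → HasCompactSupport φ → tsupport φ ⊆ T →
    ∀ e : Space d, ∫ x in T, u x * fderiv ℝ φ x e = -∫ x in T, inner ℝ (G x) e * φ x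

/-! ### Mollification: almost everywhere, `L¹` and `L²` estimates -/

/-- Standard mollifier of radius `1 / (n + 1)`. -/
def stdBump (d n : ℕ) : ContDiffBump (0 : Space d) where
  rIn := 1 / (2 * (n + 1))
  rOut := 1 / (n + 1)
  rIn_pos := by positivity
  rIn_lt_rOut := by
    rw [div_lt_div_iff_of_pos_left one_pos (by positivity) (by positivity)]
    have : (0 : ℝ) ≤ n := n.cast_nonneg
    linarith

/-- Mollification of `f`. -/
def moll {d : ℕ} {E : Type*} [NormedAddCommGroup E] [NormedSpace ℝ E] (n : ℕ) (f : Space d → E) :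
    Space d → E :=
  convolution ((stdBump d n).normed volume) f (ContinuousLinearMap.lsmul ℝ ℝ) volume

section moll
variable {d : ℕ} {E : Type*} [NormedAddCommGroup E] [NormedSpace ℝ E]

theorem moll_apply (n : ℕ) (f : Space d → E) (x : Space d) :
    moll n f x = ∫ y, (stdBump d n).normed volume (x - y) • f y := by
  simp [moll, convolution_eq_swap]

theorem contDiff_moll [CompleteSpace E] (n : ℕ) {f : Space d → E} (hf : LocallyIntegrable f) :
    ContDiff ℝ ∞ (moll n f) :=
  (stdBump d n).hasCompactSupport_normed.contDiff_convolution_left _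
    (stdBump d n).contDiff_normed hf

theorem tendsto_rOut_stdBump (d : ℕ) : Tendsto (fun n => (stdBump d n).rOut) atTop (𝓝 0) :=
  tendsto_one_div_add_atTop_nhds_zero_nat

theorem ae_tendsto_moll [CompleteSpace E] {f : Space d → E} (hf : LocallyIntegrable f) :
    ∀ᵐ x, Tendsto (fun n => moll n f x) atTop (𝓝 (f x)) := by
  -- The outer radius is twice the inner one for every `n`; Lebesgue differentiation for bump
  -- functions needs such a uniform ratio.
  refine ContDiffBump.ae_convolution_tendsto_right_of_locallyIntegrable (K := 2)
    (tendsto_rOut_stdBump d) (Eventually.of_forall fun n => ?_) hf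
  simp only [stdBump]
  apply le_of_eq
  have : (0 : ℝ) < n + 1 := by positivity
  field_simp

theorem lintegral_normed_stdBump_sub_left (n : ℕ) (x : Space d) :
    ∫⁻ y, ENNReal.ofReal ((stdBump d n).normed volume (x - y)) = 1 := by
  rw [lintegral_sub_left_eq_self (fun y => ENNReal.ofReal ((stdBump d n).normed volume y)) x,
    ← ofReal_integral_eq_lintegral_ofReal (stdBump d n).integrable_normed
      (Eventually.of_forall (stdBump d n).nonneg_normed), (stdBump d n).integral_normed]
  simp

theorem lintegral_normed_stdBump_sub_right (n : ℕ) (y : Space d) :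
    ∫⁻ x, ENNReal.ofReal ((stdBump d n).normed volume (x - y)) = 1 := by
  rw [lintegral_sub_right_eq_self (fun y => ENNReal.ofReal ((stdBump d n).normed volume y)) y,
    ← ofReal_integral_eq_lintegral_ofReal (stdBump d n).integrable_normed
      (Eventually.of_forall (stdBump d n).nonneg_normed), (stdBump d n).integral_normed]
  simp

theorem lintegral_mul_sq_le {α : Type*} [MeasurableSpace α] (μ : Measure α) {f g : α → ℝ≥0∞}
    (hf : AEMeasurable f μ) (hg : AEMeasurable g μ) :
    (∫⁻ x, f x * g x ∂μ) ^ 2 ≤ (∫⁻ x, f x ^ 2 ∂μ) * ∫⁻ x, g x ^ 2 ∂μ := by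
  have h := ENNReal.lintegral_mul_le_Lp_mul_Lq μ Real.HolderConjugate.two_two hf hg
  simp only [Pi.mul_apply, ENNReal.rpow_ofNat] at h
  calc (∫⁻ x, f x * g x ∂μ) ^ 2 ≤ _ := pow_le_pow_left₀ zero_le h 2
    _ = _ := by
      rw [mul_pow, ← ENNReal.rpow_natCast, ← ENNReal.rpow_natCast, ← ENNReal.rpow_mul,
        ← ENNReal.rpow_mul]
      norm_num

theorem enorm_moll_le (n : ℕ) (f : Space d → E) (x : Space d) :
    ‖moll n f x‖ₑ ≤ ∫⁻ y, ENNReal.ofReal ((stdBump d n).normed volume (x - y)) * ‖f y‖ₑ := by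
  rw [moll_apply]
  refine (enorm_integral_le_lintegral_enorm _).trans (lintegral_mono fun y => ?_)
  rw [enorm_smul, Real.enorm_of_nonneg ((stdBump d n).nonneg_normed _)]

theorem measurable_normed_stdBump (n : ℕ) :
    Measurable ((stdBump d n).normed (volume : Measure (Space d))) :=
  (stdBump d n).contDiff_normed (n := 0).continuous.measurable

theorem lintegral_moll_le (n : ℕ) {f : Space d → E} (hf : AEStronglyMeasurable f) :
    ∫⁻ x, ‖moll n f x‖ₑ ≤ ∫⁻ x, ‖f x‖ₑ := by
  calc ∫⁻ x, ‖moll n f x‖ₑ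
      ≤ ∫⁻ x, ∫⁻ y, ENNReal.ofReal ((stdBump d n).normed volume (x - y)) * ‖f y‖ₑ :=
        lintegral_mono (enorm_moll_le n f)
    _ = ∫⁻ y, ∫⁻ x, ENNReal.ofReal ((stdBump d n).normed volume (x - y)) * ‖f y‖ₑ := by
        apply lintegral_lintegral_swap
        have h1 : Measurable fun p : Space d × Space d =>
            ENNReal.ofReal ((stdBump d n).normed volume (p.1 - p.2)) :=
          ((measurable_normed_stdBump n).comp (measurable_fst.sub measurable_snd)).ennreal_ofReal
        exact h1.aemeasurable.mul (hf.enorm.comp_quasiMeasurePreserving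
          Measure.quasiMeasurePreserving_snd)
    _ = ∫⁻ x, ‖f x‖ₑ := by
        refine lintegral_congr fun y => ?_
        have hy : Measurable fun x => ENNReal.ofReal ((stdBump d n).normed volume (x - y)) :=
          ((measurable_normed_stdBump n).comp (measurable_id.sub_const y)).ennreal_ofReal
        rw [lintegral_mul_const _ hy, lintegral_normed_stdBump_sub_right, one_mul]

/-- Jensen for the probability density `y ↦ ρ (x - y)`: split the kernel into two square roots,
apply Cauchy–Schwarz, then Tonelli. -/
theorem lintegral_moll_sq_le (n : ℕ) {f : Space d → E} (hf : AEStronglyMeasurable f) :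
    ∫⁻ x, ‖moll n f x‖ₑ ^ 2 ≤ ∫⁻ x, ‖f x‖ₑ ^ 2 := by
  have hm (x : Space d) : Measurable fun y =>
      ENNReal.ofReal ((stdBump d n).normed volume (x - y)) :=
    ((measurable_normed_stdBump n).comp (measurable_id.const_sub x)).ennreal_ofReal
  have key (x : Space d) : ‖moll n f x‖ₑ ^ 2 ≤
      ∫⁻ y, ENNReal.ofReal ((stdBump d n).normed volume (x - y)) * ‖f y‖ₑ ^ 2 := by
    have h := lintegral_mul_sq_le volume ((hm x).pow_const (1 / 2 : ℝ)).aemeasurable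
      (((hm x).pow_const (1 / 2 : ℝ)).aemeasurable.mul hf.enorm)
    have e (a b : ℝ≥0∞) : a ^ (1 / 2 : ℝ) * (a ^ (1 / 2 : ℝ) * b) = a * b := by
      rw [← mul_assoc, ← ENNReal.rpow_add_of_nonneg _ _ (by norm_num) (by norm_num)]
      norm_num
    have e2 (a : ℝ≥0∞) : (a ^ (1 / 2 : ℝ)) ^ 2 = a := by
      rw [← ENNReal.rpow_natCast, ← ENNReal.rpow_mul]; norm_num
    simp only [Pi.mul_apply, e, mul_pow, e2, lintegral_normed_stdBump_sub_left, one_mul] at h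
    exact (pow_le_pow_left₀ zero_le (enorm_moll_le n f x) 2).trans h
  calc ∫⁻ x, ‖moll n f x‖ₑ ^ 2
      ≤ ∫⁻ x, ∫⁻ y, ENNReal.ofReal ((stdBump d n).normed volume (x - y)) * ‖f y‖ₑ ^ 2 :=
        lintegral_mono key
    _ = ∫⁻ y, ∫⁻ x, ENNReal.ofReal ((stdBump d n).normed volume (x - y)) * ‖f y‖ₑ ^ 2 := by
        apply lintegral_lintegral_swap
        have h1 : Measurable fun p : Space d × Space d =>
            ENNReal.ofReal ((stdBump d n).normed volume (p.1 - p.2)) :=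
          ((measurable_normed_stdBump n).comp (measurable_fst.sub measurable_snd)).ennreal_ofReal
        exact h1.aemeasurable.mul ((hf.enorm.pow_const 2).comp_quasiMeasurePreserving
          Measure.quasiMeasurePreserving_snd)
    _ = ∫⁻ x, ‖f x‖ₑ ^ 2 := by
        refine lintegral_congr fun y => ?_
        have hy : Measurable fun x => ENNReal.ofReal ((stdBump d n).normed volume (x - y)) :=
          ((measurable_normed_stdBump n).comp (measurable_id.sub_const y)).ennreal_ofReal
        rw [lintegral_mul_const _ hy, lintegral_normed_stdBump_sub_right, one_mul]

/-- Almost everywhere convergence together with the contraction property in `L¹` forces convergence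
in `L¹`: apply Fatou to the nonnegative functions `|f_n| + |f| - |f_n - f|`, whose limit is `2 |f|`.
-/
theorem tendsto_lintegral_moll_sub [CompleteSpace E] {f : Space d → E} (hf : Integrable f) :
    Tendsto (fun n => ∫⁻ x, ‖moll n f x - f x‖ₑ) atTop (𝓝 0) := by
  have hae := ae_tendsto_moll hf.locallyIntegrable
  have hmm (n : ℕ) : AEStronglyMeasurable (moll n f) :=
    (contDiff_moll n hf.locallyIntegrable).continuous.aestronglyMeasurable
  set I := ∫⁻ x, ‖f x‖ₑ with hI
  have hIfin : I ≠ ⊤ := hf.2.ne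
  set h : ℕ → Space d → ℝ≥0∞ := fun n x => ‖moll n f x‖ₑ + ‖f x‖ₑ - ‖moll n f x - f x‖ₑ with hh
  have hsum (n : ℕ) : (∫⁻ x, h n x) + ∫⁻ x, ‖moll n f x - f x‖ₑ ≤ 2 * I := by
    have hm : AEMeasurable (fun x => ‖moll n f x - f x‖ₑ) volume := ((hmm n).sub hf.1).enorm
    rw [← lintegral_add_right' _ hm]
    have : ∀ x, h n x + ‖moll n f x - f x‖ₑ = ‖moll n f x‖ₑ + ‖f x‖ₑ := fun x =>
      tsub_add_cancel_of_le enorm_sub_le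
    simp only [this]
    rw [lintegral_add_right' _ hf.1.enorm, two_mul]
    gcongr
    exact lintegral_moll_le n hf.1
  have hfatou : 2 * I ≤ liminf (fun n => ∫⁻ x, h n x) atTop := by
    calc 2 * I = ∫⁻ x, 2 * ‖f x‖ₑ := by rw [lintegral_const_mul' _ _ (by simp)]
      _ ≤ ∫⁻ x, liminf (fun n => h n x) atTop := by
        refine lintegral_mono_ae ?_
        filter_upwards [hae] with x hx
        have : Tendsto (fun n => h n x) atTop (𝓝 (‖f x‖ₑ + ‖f x‖ₑ - ‖f x - f x‖ₑ)) := by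
          refine ENNReal.Tendsto.sub ((hx.enorm).add tendsto_const_nhds) ?_ (by simp)
          exact (hx.sub tendsto_const_nhds).enorm
        rw [this.liminf_eq]
        simp [two_mul]
      _ ≤ _ := lintegral_liminf_le' fun n =>
        (((hmm n).enorm.add hf.1.enorm).sub ((hmm n).sub hf.1).enorm)
  rw [ENNReal.tendsto_atTop_zero]
  intro ε hε
  by_cases hε' : ε = ⊤
  · exact ⟨0, fun n _ => by simp [hε']⟩
  by_cases hI0 : I = 0
  · refine ⟨0, fun n _ => ?_⟩
    have := hsum n
    rw [hI0, mul_zero] at this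
    exact (le_add_self.trans this).trans zero_le
  have hlt : 2 * I - ε < 2 * I := ENNReal.sub_lt_self (by finiteness) (by simp [hI0]) hε.ne'
  have hev := eventually_lt_of_lt_liminf (lt_of_lt_of_le hlt hfatou)
  obtain ⟨N, hN⟩ := eventually_atTop.1 hev
  refine ⟨N, fun n hn => ?_⟩
  have h1 := hsum n
  have h2 : 2 * I ≤ (∫⁻ x, h n x) + ε := tsub_le_iff_right.1 (hN n hn).le
  have hfin : (∫⁻ x, h n x) ≠ ⊤ := ne_top_of_le_ne_top (by finiteness) (le_self_add.trans h1)
  exact (ENNReal.add_le_add_iff_left hfin).1 (h1.trans h2)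

end moll

/-! ### Weak gradients under mollification, restriction and change of variables -/

theorem IsH1.integrable_indicator {d : ℕ} {T : Set (Space d)} {u : Space d → ℝ}
    {G : Space d → Space d} (h : IsH1 T u G) (hT : MeasurableSet T) (hb : volume T ≠ ⊤) :
    Integrable (T.indicator u) ∧ Integrable (T.indicator G) := by
  have : IsFiniteMeasure (volume.restrict T) := ⟨by simpa using hb.lt_top⟩
  constructor
  · rw [integrable_indicator_iff hT]
    exact h.memLp.integrable (by norm_num)
  · rw [integrable_indicator_iff hT]
    exact h.memLp_grad.integrable (by norm_num)

/-- Mollification commutes with the weak gradient at points whose mollification ball stays in `T`: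
there `y ↦ ρ (x - y)` is an admissible test function, and the sign produced by the reflection
cancels the sign of the weak formulation. -/
theorem IsH1.fderiv_moll {d : ℕ} {T : Set (Space d)} {u : Space d → ℝ}
    {G : Space d → Space d} (h : IsH1 T u G) (hT : MeasurableSet T) (hb : volume T ≠ ⊤)
    {n : ℕ} {x : Space d} (hx : Metric.closedBall x (1 / ((n : ℝ) + 1)) ⊆ T) (e : Space d) :
    fderiv ℝ (moll n (T.indicator u)) x e = inner ℝ (moll n (T.indicator G) x) e := by
  obtain ⟨iu, iG⟩ := h.integrable_indicator hT hb
  set ρ := (stdBump d n).normed (volume : Measure (Space d)) with hρ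
  have hρs : ContDiff ℝ ∞ ρ := (stdBump d n).contDiff_normed
  have hρc : HasCompactSupport ρ := (stdBump d n).hasCompactSupport_normed
  have e1 : moll n (T.indicator u) =
      convolution (T.indicator u) ρ (ContinuousLinearMap.lsmul ℝ ℝ).flip volume := by
    rw [moll, ← convolution_flip]
  have h1 := hρc.hasFDerivAt_convolution_right (ContinuousLinearMap.lsmul ℝ ℝ).flip
    iu.locallyIntegrable (hρs.of_le (by simp)) x
  rw [e1, h1.fderiv, convolution_precompR_apply _ iu.locallyIntegrable (hρc.fderiv ℝ)
    (hρs.continuous_fderiv (by simp))]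
  rw [convolution_def, moll_apply]
  set φ : Space d → ℝ := fun y => ρ (x - y) with hφ
  have hφs : ContDiff ℝ ∞ φ := hρs.comp (contDiff_const.sub contDiff_id)
  have hφt : tsupport φ ⊆ Metric.closedBall x (1 / ((n : ℝ) + 1)) := by
    refine closure_minimal (fun y hy => ?_) Metric.isClosed_closedBall
    have : x - y ∈ Function.support ρ := hy
    rw [hρ, ContDiffBump.support_normed_eq] at this
    rw [Metric.mem_closedBall, dist_comm, dist_eq_norm]
    exact (mem_ball_zero_iff.1 this).le
  have hφc : HasCompactSupport φ :=
    HasCompactSupport.of_support_subset_isCompact (isCompact_closedBall x (1 / ((n : ℝ) + 1)))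
      (subset_closure.trans hφt)
  have hφd (y : Space d) : fderiv ℝ φ y e = -fderiv ℝ ρ (x - y) e := by
    have : HasFDerivAt φ ((fderiv ℝ ρ (x - y)).comp (-ContinuousLinearMap.id ℝ (Space d))) y :=
      ((hρs.differentiable (by simp)) (x - y)).hasFDerivAt.comp y ((hasFDerivAt_id y).const_sub x)
    rw [this.fderiv]; simp
  have hw := h.weak φ hφs hφc (hφt.trans hx) e
  have hl : ∫ t, ((ContinuousLinearMap.lsmul ℝ ℝ).flip (T.indicator u t)) (fderiv ℝ ρ (x - t) e) =
      -∫ t in T, u t * fderiv ℝ φ t e := by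
    rw [← integral_neg, ← integral_indicator hT]
    congr 1; ext t
    by_cases ht : t ∈ T <;> simp [ht, hφd, mul_comm]
  have iρG : Integrable fun y => ρ (x - y) • T.indicator G y := by
    obtain ⟨B, hB⟩ := hρc.exists_bound_of_continuous hρs.continuous
    exact iG.bdd_smul B (hρs.continuous.comp (by fun_prop)).aestronglyMeasurable
      (Eventually.of_forall fun y => hB _)
  rw [hl, hw, neg_neg, real_inner_comm, ← integral_inner iρG, ← integral_indicator hT]
  congr 1; ext t
  by_cases ht : t ∈ T <;> simp [ht, hφ, inner_smul_right, mul_comm, real_inner_comm]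

theorem ofReal_integral_norm_sq {α E : Type*} [MeasurableSpace α] {μ : Measure α}
    [NormedAddCommGroup E] {g : α → E} (hg : MemLp g 2 μ) :
    ENNReal.ofReal (∫ x, ‖g x‖ ^ 2 ∂μ) = ∫⁻ x, ‖g x‖ₑ ^ 2 ∂μ := by
  rw [ofReal_integral_eq_lintegral_ofReal (MemLp.integrable_norm_pow (p := 2) (by exact_mod_cast hg) two_ne_zero)
    (Eventually.of_forall fun x => by positivity)]
  refine lintegral_congr fun x => ?_
  rw [ENNReal.ofReal_pow (norm_nonneg _), ofReal_norm]

theorem lintegral_comp_add_smul {d : ℕ} {F : Space d → ℝ≥0∞} (hF : Measurable F) (b : Space d)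
    {a : ℝ} (ha : a ≠ 0) :
    ∫⁻ y, F (b + a • y) = ENNReal.ofReal |(a ^ d)⁻¹| * ∫⁻ y, F y := by
  have h1 : ∫⁻ y, F (b + a • y) = ∫⁻ y, F (b + y) ∂(Measure.map (a • ·) volume) :=
    (lintegral_map (hF.comp (measurable_const_add b)) (measurable_const_smul a)).symm
  rw [h1, Measure.map_addHaar_smul _ ha, lintegral_smul_measure, finrank_euclideanSpace_fin,
    lintegral_add_left_eq_self, smul_eq_mul]

theorem IsH1.mono {d : ℕ} {T D : Set (Space d)} {u : Space d → ℝ} {G : Space d → Space d}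
    (h : IsH1 T u G) (hDT : D ⊆ T) (hT : MeasurableSet T) : IsH1 D u G where
  memLp := h.memLp.mono_measure (Measure.restrict_mono hDT le_rfl)
  memLp_grad := h.memLp_grad.mono_measure (Measure.restrict_mono hDT le_rfl)
  weak φ hφ hφc hφt e := by
    have key (g : Space d → ℝ) (hg : ∀ x ∉ tsupport φ, g x = 0) :
        ∫ x in D, g x = ∫ x in T, g x := by
      rw [← setIntegral_eq_of_subset_of_forall_sdiff_eq_zero hT hDT]
      intro x hx
      exact hg x fun hx' => hx.2 (hφt hx')
    have h0 (x : Space d) (hx : x ∉ tsupport φ) : φ x = 0 := image_eq_zero_of_notMem_tsupport hx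
    have h1 (x : Space d) (hx : x ∉ tsupport φ) : fderiv ℝ φ x = 0 :=
      image_eq_zero_of_notMem_tsupport fun h => hx (tsupport_fderiv_subset ℝ h)
    rw [key _ fun x hx => by simp [h1 x hx], key _ fun x hx => by simp [h0 x hx]]
    exact h.weak φ hφ hφc (hφt.trans hDT) e

/-! ### Poincaré inequality on convex sets -/

section poincare
variable {d : ℕ}

/-- Fundamental theorem of calculus on the segment, then Cauchy–Schwarz in `t`. The indicator of `D`
costs nothing by convexity and lets later integrals extend to the whole space. -/
theorem enorm_sub_sq_le_lintegral {D : Set (Space d)} (hD : Convex ℝ D) {R : ℝ}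
    (hR : ∀ x ∈ D, ∀ y ∈ D, ‖x - y‖ ≤ R) {f : Space d → ℝ} (hf : ContDiff ℝ 1 f)
    {V : Space d → Space d} (hVc : Continuous V)
    (hV : ∀ x ∈ D, ∀ e, fderiv ℝ f x e = inner ℝ (V x) e) {x y : Space d} (hx : x ∈ D)
    (hy : y ∈ D) :
    ‖f x - f y‖ₑ ^ 2 ≤ ENNReal.ofReal (R ^ 2) *
      ∫⁻ t in Icc (0 : ℝ) 1, D.indicator (fun z => ‖V z‖ₑ ^ 2) ((1 - t) • x + t • y) := by
  set γ : ℝ → Space d := fun t => (1 - t) • x + t • y with hγ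
  have hγD (t : ℝ) (ht : t ∈ Icc (0 : ℝ) 1) : γ t ∈ D :=
    hD hx hy (by linarith [ht.2]) ht.1 (by ring)
  have hγd (t : ℝ) : HasDerivAt γ (y - x) t := by
    have := (((hasDerivAt_id t).const_sub 1).smul_const x).add ((hasDerivAt_id t).smul_const y)
    exact HasDerivAt.congr_deriv this (by module)
  have hγc : Continuous γ := by fun_prop
  have hder (t : ℝ) : HasDerivAt (fun t => f (γ t)) (fderiv ℝ f (γ t) (y - x)) t :=
    ((hf.differentiable one_ne_zero) (γ t)).hasFDerivAt.comp_hasDerivAt t (hγd t)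
  have hcont : Continuous fun t => fderiv ℝ f (γ t) (y - x) :=
    ((hf.continuous_fderiv one_ne_zero).comp hγc).clm_apply continuous_const
  have hftc := intervalIntegral.integral_eq_sub_of_hasDerivAt (a := 0) (b := 1)
    (fun t _ => hder t) (hcont.intervalIntegrable 0 1)
  have hb : f y - f x = ∫ t in (0 : ℝ)..1, fderiv ℝ f (γ t) (y - x) := by
    rw [hftc]; simp [hγ]
  have h1 : ‖f x - f y‖ₑ ≤ ∫⁻ t in Icc (0 : ℝ) 1, ‖V (γ t)‖ₑ * ENNReal.ofReal R := by
    rw [← enorm_neg, neg_sub, hb, intervalIntegral.integral_of_le zero_le_one,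
      ← integral_Icc_eq_integral_Ioc]
    refine (enorm_integral_le_lintegral_enorm _).trans
      (setLIntegral_mono' measurableSet_Icc fun t ht => ?_)
    rw [hV _ (hγD t ht)]
    rw [← ofReal_norm, ← ofReal_norm, ← ENNReal.ofReal_mul (norm_nonneg _)]
    refine ENNReal.ofReal_le_ofReal ((norm_inner_le_norm _ _).trans ?_)
    gcongr
    exact hR y hy x hx
  have hR0 : 0 ≤ R := (norm_nonneg _).trans (hR x hx x hx)
  calc ‖f x - f y‖ₑ ^ 2 ≤ (∫⁻ t in Icc (0 : ℝ) 1, ‖V (γ t)‖ₑ * ENNReal.ofReal R) ^ 2 :=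
        pow_le_pow_left₀ zero_le h1 2
    _ ≤ (∫⁻ t in Icc (0 : ℝ) 1, ‖V (γ t)‖ₑ ^ 2) *
        ∫⁻ _ in Icc (0 : ℝ) 1, ENNReal.ofReal R ^ 2 :=
        lintegral_mul_sq_le _ (hVc.comp hγc).enorm.measurable.aemeasurable aemeasurable_const
    _ = ENNReal.ofReal (R ^ 2) * ∫⁻ t in Icc (0 : ℝ) 1, ‖V (γ t)‖ₑ ^ 2 := by
        rw [mul_comm, ENNReal.ofReal_pow hR0]; simp
    _ = _ := by
        congr 1
        refine setLIntegral_congr_fun measurableSet_Icc fun t ht => ?_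
        rw [indicator_of_mem (hγD t ht)]

/-- For `t ≥ 1/2` substitute in `y`, with Jacobian factor `t⁻ᵈ ≤ 2ᵈ`; for `t ≤ 1/2` substitute in
`x` instead. Choosing the variable this way avoids the singularities at both ends. -/
theorem lintegral_segment_le {D : Set (Space d)} {F : Space d → ℝ≥0∞} (hF : Measurable F) {t : ℝ}
    (_ht : t ∈ Icc (0 : ℝ) 1) :
    ∫⁻ x in D, ∫⁻ y in D, F ((1 - t) • x + t • y) ≤ 2 ^ d * volume D * ∫⁻ x, F x := by
  have hpow (a : ℝ) (ha : 1 / 2 ≤ a) : ENNReal.ofReal |(a ^ d)⁻¹| ≤ 2 ^ d := by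
    have ha0 : 0 < a := by linarith
    rw [abs_of_nonneg (by positivity), ← inv_pow, ENNReal.ofReal_pow (by positivity)]
    refine pow_le_pow_left₀ zero_le ?_ d
    rw [ENNReal.ofReal_le_iff_le_toReal (by simp)]
    simp only [ENNReal.toReal_ofNat]
    rw [inv_le_comm₀ ha0 two_pos]; linarith
  rcases le_total (1 / 2) t with h | h
  · calc ∫⁻ x in D, ∫⁻ y in D, F ((1 - t) • x + t • y)
        ≤ ∫⁻ x in D, 2 ^ d * ∫⁻ y, F y := by
          refine lintegral_mono fun x => ?_
          refine (setLIntegral_le_lintegral D _).trans ?_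
          rw [lintegral_comp_add_smul hF _ (by linarith)]
          gcongr; exact hpow t h
      _ = _ := by rw [setLIntegral_const]; ring
  · have hm : Measurable fun p : Space d × Space d => F ((1 - t) • p.1 + t • p.2) := by
      refine hF.comp ?_
      fun_prop
    rw [lintegral_lintegral_swap hm.aemeasurable]
    calc ∫⁻ y in D, ∫⁻ x in D, F ((1 - t) • x + t • y)
        ≤ ∫⁻ x in D, 2 ^ d * ∫⁻ y, F y := by
          refine lintegral_mono fun y => ?_
          refine (setLIntegral_le_lintegral D _).trans ?_
          simp_rw [add_comm _ (t • y)]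
          rw [lintegral_comp_add_smul hF _ (by linarith)]
          gcongr; exact hpow _ (by linarith)
      _ = _ := by rw [setLIntegral_const]; ring

theorem lintegral_pair_le_of_contDiff {D : Set (Space d)} (hDm : MeasurableSet D)
    (hD : Convex ℝ D) {R : ℝ}
    (hR : ∀ x ∈ D, ∀ y ∈ D, ‖x - y‖ ≤ R) {f : Space d → ℝ} (hf : ContDiff ℝ 1 f)
    {V : Space d → Space d} (hVc : Continuous V)
    (hV : ∀ x ∈ D, ∀ e, fderiv ℝ f x e = inner ℝ (V x) e) :
    ∫⁻ x in D, ∫⁻ y in D, ‖f x - f y‖ₑ ^ 2 ≤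
      ENNReal.ofReal (R ^ 2) * (2 ^ d * volume D * ∫⁻ x in D, ‖V x‖ₑ ^ 2) := by
  set F : Space d → ℝ≥0∞ := D.indicator (fun z => ‖V z‖ₑ ^ 2) with hF
  have hFm : Measurable F := (hVc.enorm.measurable.pow_const 2).indicator hDm
  have hm3 : Measurable fun p : (Space d × ℝ) × Space d => F ((1 - p.1.2) • p.1.1 + p.1.2 • p.2) :=
    hFm.comp (by fun_prop)
  have hm2 : Measurable fun p : Space d × ℝ =>
      ∫⁻ y in D, F ((1 - p.2) • p.1 + p.2 • y) := hm3.lintegral_prod_right'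
  calc ∫⁻ x in D, ∫⁻ y in D, ‖f x - f y‖ₑ ^ 2
      ≤ ∫⁻ x in D, ∫⁻ y in D, ENNReal.ofReal (R ^ 2) *
          ∫⁻ t in Icc (0 : ℝ) 1, F ((1 - t) • x + t • y) :=
        setLIntegral_mono' hDm fun x hx => setLIntegral_mono' hDm fun y hy =>
          enorm_sub_sq_le_lintegral hD hR hf hVc hV hx hy
    _ = ENNReal.ofReal (R ^ 2) * ∫⁻ x in D, ∫⁻ y in D,
          ∫⁻ t in Icc (0 : ℝ) 1, F ((1 - t) • x + t • y) := by
        simp_rw [lintegral_const_mul' _ _ ENNReal.ofReal_ne_top]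
    _ = ENNReal.ofReal (R ^ 2) * ∫⁻ t in Icc (0 : ℝ) 1, ∫⁻ x in D,
          ∫⁻ y in D, F ((1 - t) • x + t • y) := by
        congr 1
        rw [← lintegral_lintegral_swap (f := fun x t =>
          ∫⁻ y in D, F ((1 - t) • x + t • y)) hm2.aemeasurable]
        refine lintegral_congr fun x => lintegral_lintegral_swap ?_
        exact (hFm.comp (by fun_prop :
          Measurable fun p : Space d × ℝ => (1 - p.2) • x + p.2 • p.1)).aemeasurable
    _ ≤ ENNReal.ofReal (R ^ 2) * ∫⁻ _ in Icc (0 : ℝ) 1, 2 ^ d * volume D * ∫⁻ x, F x := by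
        gcongr 1
        exact setLIntegral_mono' measurableSet_Icc fun t ht => lintegral_segment_le hFm ht
    _ = _ := by
        rw [hF, lintegral_indicator hDm]; simp

/-- The smooth estimate applies to mollifications on the inner parallel sets `A n`, where the
mollified gradient is the true gradient; Fatou on the product space passes to the limit. -/
theorem lintegral_pair_le {D : Set (Space d)} (hDo : IsOpen D) (hD : Convex ℝ D) {R : ℝ}
    (hR : ∀ x ∈ D, ∀ y ∈ D, ‖x - y‖ ≤ R) (hb : volume D ≠ ⊤) {w : Space d → ℝ}
    {G : Space d → Space d} (h : IsH1 D w G) :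
    ∫⁻ x in D, ∫⁻ y in D, ‖w x - w y‖ₑ ^ 2 ≤
      ENNReal.ofReal (R ^ 2) * (2 ^ d * volume D * ∫⁻ x in D, ‖G x‖ₑ ^ 2) := by
  obtain ⟨iw, iG⟩ := h.integrable_indicator hDo.measurableSet hb
  set w' := D.indicator w with hw'
  set G' := D.indicator G with hG'
  set A : ℕ → Set (Space d) := fun n => (Metric.thickening (2 / ((n : ℝ) + 1)) Dᶜ)ᶜ with hA
  have hAm (n : ℕ) : MeasurableSet (A n) := Metric.isOpen_thickening.measurableSet.compl
  have hAmem (n : ℕ) (x : Space d) : x ∈ A n ↔ ∀ z, dist x z < 2 / ((n : ℝ) + 1) → z ∈ D := by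
    simp only [hA, mem_compl_iff, Metric.mem_thickening_iff, not_exists, not_and]
    exact ⟨fun H z hz => by_contra fun hzD => H z hzD hz, fun H z hzD hz => hzD (H z hz)⟩
  have hpos (n : ℕ) : (0 : ℝ) < 1 / ((n : ℝ) + 1) := by positivity
  have htwo (n : ℕ) : (2 : ℝ) / ((n : ℝ) + 1) = 2 * (1 / ((n : ℝ) + 1)) := by ring
  have hAD (n : ℕ) : A n ⊆ D := fun x hx =>
    (hAmem n x).1 hx x (by rw [dist_self, htwo]; linarith [hpos n])
  have hAball (n : ℕ) (x : Space d) (hx : x ∈ A n) :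
      Metric.closedBall x (1 / ((n : ℝ) + 1)) ⊆ D := fun z hz => (hAmem n x).1 hx z (by
        rw [dist_comm, htwo]; linarith [hpos n, Metric.mem_closedBall.1 hz])
  -- Inner parallel sets of a convex set are convex: a displacement of a convex combination is the
  -- same displacement of both end points.
  have hAconv (n : ℕ) : Convex ℝ (A n) := by
    intro x hx y hy a b ha hb hab
    rw [hAmem] at hx hy ⊢
    intro z hz
    set v := z - (a • x + b • y) with hv
    have hvn : ‖v‖ < 2 / ((n : ℝ) + 1) := by rwa [hv, ← dist_eq_norm, dist_comm]
    have hz' : z = a • (x + v) + b • (y + v) := by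
      have : a • (x + v) + b • (y + v) = a • x + b • y + (a + b) • v := by module
      rw [this, hab, one_smul, hv]; abel
    rw [hz']
    exact hD (hx _ (by simpa using hvn)) (hy _ (by simpa using hvn)) ha hb hab
  have hAev (x : Space d) (hx : x ∈ D) : ∀ᶠ n in atTop, x ∈ A n := by
    obtain ⟨ε, hε, hball⟩ := Metric.isOpen_iff.1 hDo x hx
    have : Tendsto (fun n : ℕ => (2 : ℝ) / ((n : ℝ) + 1)) atTop (𝓝 0) := by
      simpa [htwo] using tendsto_one_div_add_atTop_nhds_zero_nat.const_mul (2 : ℝ)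
    filter_upwards [this.eventually (gt_mem_nhds hε)] with n hn
    rw [hAmem]
    intro z hz
    exact hball (by rw [Metric.mem_ball, dist_comm]; exact hz.trans hn)
  have hsm (n : ℕ) : ContDiff ℝ ∞ (moll n w') := contDiff_moll n iw.locallyIntegrable
  have hGc (n : ℕ) : Continuous (moll n G') := (contDiff_moll n iG.locallyIntegrable).continuous
  set K := ENNReal.ofReal (R ^ 2) * (2 ^ d * volume D * ∫⁻ x in D, ‖G x‖ₑ ^ 2) with hK
  have hbound (n : ℕ) : ∫⁻ x in A n, ∫⁻ y in A n, ‖moll n w' x - moll n w' y‖ₑ ^ 2 ≤ K := by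
    refine (lintegral_pair_le_of_contDiff (hAm n) (hAconv n)
      (fun x hx y hy => hR x (hAD n hx) y (hAD n hy)) ((hsm n).of_le (by simp)) (hGc n)
      fun x hx e => h.fderiv_moll hDo.measurableSet hb (hAball n x hx) e).trans ?_
    have e1 : volume (A n) ≤ volume D := measure_mono (hAD n)
    have e2 : ∫⁻ x in A n, ‖moll n G' x‖ₑ ^ 2 ≤ ∫⁻ x in D, ‖G x‖ₑ ^ 2 := by
      refine (setLIntegral_le_lintegral _ _).trans ((lintegral_moll_sq_le n iG.1).trans ?_)
      rw [← lintegral_indicator hDo.measurableSet]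
      refine lintegral_mono fun x => ?_
      by_cases hx : x ∈ D <;> simp [hG', hx]
    rw [hK]
    exact mul_le_mul_right (mul_le_mul' (mul_le_mul_right e1 _) e2) _
  set Φ : ℕ → Space d × Space d → ℝ≥0∞ := fun n =>
    (A n ×ˢ A n).indicator fun p => ‖moll n w' p.1 - moll n w' p.2‖ₑ ^ 2 with hΦ
  have hΦm (n : ℕ) : Measurable (Φ n) := by
    refine Measurable.indicator ?_ ((hAm n).prod (hAm n))
    have := (hsm n).continuous
    exact ((by fun_prop : Continuous fun p : Space d × Space d =>
      moll n w' p.1 - moll n w' p.2).enorm.measurable).pow_const 2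
  have hΦK (n : ℕ) : ∫⁻ p, Φ n p ≤ K := by
    refine le_trans (le_of_eq ?_) (hbound n)
    rw [hΦ, lintegral_indicator ((hAm n).prod (hAm n)), Measure.volume_eq_prod,
      ← Measure.prod_restrict, lintegral_prod]
    have := (hsm n).continuous
    exact (((by fun_prop : Continuous fun p : Space d × Space d =>
      moll n w' p.1 - moll n w' p.2).enorm.measurable).pow_const 2).aemeasurable
  have hae := ae_tendsto_moll iw.locallyIntegrable
  have hae2 : ∀ᵐ p : Space d × Space d, p ∈ D ×ˢ D →
      Tendsto (fun n => Φ n p) atTop (𝓝 (‖w' p.1 - w' p.2‖ₑ ^ 2)) := by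
    have q1 := (Measure.quasiMeasurePreserving_fst (μ := (volume : Measure (Space d)))
      (ν := (volume : Measure (Space d)))).ae hae
    have q2 := (Measure.quasiMeasurePreserving_snd (μ := (volume : Measure (Space d)))
      (ν := (volume : Measure (Space d)))).ae hae
    rw [Measure.volume_eq_prod]
    filter_upwards [q1, q2] with p h1 h2 hp
    have h3 : Tendsto (fun n => ‖moll n w' p.1 - moll n w' p.2‖ₑ ^ 2) atTop
        (𝓝 (‖w' p.1 - w' p.2‖ₑ ^ 2)) := ENNReal.Tendsto.pow (h1.sub h2).enorm
    refine h3.congr' ?_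
    filter_upwards [hAev p.1 hp.1, hAev p.2 hp.2] with n a1 a2
    rw [hΦ]; simp [a1, a2]
  have hfin : ∫⁻ p in D ×ˢ D, ‖w' p.1 - w' p.2‖ₑ ^ 2 ≤ K := by
    calc ∫⁻ p in D ×ˢ D, ‖w' p.1 - w' p.2‖ₑ ^ 2
        ≤ ∫⁻ p in D ×ˢ D, liminf (fun n => Φ n p) atTop := by
          refine lintegral_mono_ae ((ae_restrict_iff' (hDo.prod hDo).measurableSet).2 ?_)
          filter_upwards [hae2] with p hp hpD
          rw [(hp hpD).liminf_eq]
      _ ≤ ∫⁻ p, liminf (fun n => Φ n p) atTop := setLIntegral_le_lintegral _ _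
      _ ≤ liminf (fun n => ∫⁻ p, Φ n p) atTop := lintegral_liminf_le hΦm
      _ ≤ K := liminf_le_of_frequently_le' (Frequently.of_forall hΦK)
  refine le_trans (le_of_eq ?_) hfin
  rw [Measure.volume_eq_prod, ← Measure.prod_restrict, lintegral_prod]
  · refine setLIntegral_congr_fun hDo.measurableSet fun x hx =>
      setLIntegral_congr_fun hDo.measurableSet fun y hy => ?_
    simp [hw', hx, hy]
  · refine ((AEStronglyMeasurable.sub ?_ ?_).enorm.pow_const 2)
    · exact iw.1.restrict.comp_fst
    · exact iw.1.restrict.comp_snd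

/-- Poincaré inequality on bounded open convex sets. -/
theorem IsH1.poincare_convex {D : Set (Space d)} (hDo : IsOpen D) (hD : Convex ℝ D)
    (hne : D.Nonempty) {R : ℝ}
    (hR : ∀ x ∈ D, ∀ y ∈ D, ‖x - y‖ ≤ R) (hb : volume D ≠ ⊤) {w : Space d → ℝ}
    {G : Space d → Space d} (h : IsH1 D w G) :
    ∃ c : ℝ, ∫ x in D, (w x - c) ^ 2 ≤ 2 ^ d * R ^ 2 * ∫ x in D, ‖G x‖ ^ 2 := by
  have hpos : volume D ≠ 0 := (hDo.measure_pos volume hne).ne'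
  have hfinm : IsFiniteMeasure (volume.restrict D) := ⟨by simpa using hb.lt_top⟩
  have hm : AEMeasurable (fun p : Space d × Space d => ‖w p.1 - w p.2‖ₑ ^ 2)
      ((volume.restrict D).prod (volume.restrict D)) :=
    (AEStronglyMeasurable.sub h.memLp.1.comp_fst h.memLp.1.comp_snd).enorm.pow_const 2
  -- A point where the inner integral does not exceed its average over `D`; the value of `w` there
  -- serves as the constant, and dividing by `volume D` removes that factor from the double integral
  -- bound.
  obtain ⟨x, hx, hle⟩ := exists_le_setLAverage hpos hb hm.lintegral_prod_right'
  refine ⟨w x, ?_⟩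
  have hmem : MemLp (fun y => w y - w x) 2 (volume.restrict D) := h.memLp.sub (memLp_const _)
  have e1 := ofReal_integral_norm_sq hmem
  have e2 := ofReal_integral_norm_sq h.memLp_grad
  simp only [Real.norm_eq_abs, sq_abs] at e1
  have hK := lintegral_pair_le hDo hD hR hb h
  have : ∫⁻ y in D, ‖w y - w x‖ₑ ^ 2 ≤ ENNReal.ofReal (R ^ 2) * (2 ^ d * ∫⁻ x in D, ‖G x‖ₑ ^ 2) := by
    have h1 : ∫⁻ y in D, ‖w y - w x‖ₑ ^ 2 = ∫⁻ y in D, ‖w x - w y‖ₑ ^ 2 := by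
      refine lintegral_congr fun y => ?_
      rw [← enorm_neg, neg_sub]
    rw [h1]
    refine hle.trans ?_
    rw [setLAverage_eq, ENNReal.div_le_iff hpos hb]
    refine hK.trans (le_of_eq ?_)
    ring
  rw [← e1, ← e2] at this
  rw [← ENNReal.ofReal_le_ofReal_iff (by positivity)]
  refine this.trans (le_of_eq ?_)
  rw [ENNReal.ofReal_mul (by positivity), ENNReal.ofReal_mul (by positivity),
    ENNReal.ofReal_pow zero_le_two]
  simp only [ENNReal.ofReal_ofNat]
  ring

end poincare

/-! ### Surface measure on hyperplanes and Fubini in an oblique direction -/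

/-- The hyperplane through `p` orthogonal to `n`. -/
def hyp {d : ℕ} (n p : Space d) : Set (Space d) := {x | inner ℝ n (x - p) = 0}

/-- The surface measure on the hyperplane through `p` orthogonal to `n`. -/
def hypMeasure {d : ℕ} (n p : Space d) : Measure (Space d) :=
  (μHE[d - 1] : Measure (Space d)).restrict (hyp n p)

variable {d : ℕ} {n p e : Space d}

theorem isClosed_hyp (n p : Space d) : IsClosed (hyp n p) :=
  isClosed_eq (by fun_prop) continuous_const

theorem measurableSet_hyp (n p : Space d) : MeasurableSet (hyp n p) :=
  (isClosed_hyp n p).measurableSet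

/-- Through this parametrisation the Hausdorff measure on the hyperplane becomes Lebesgue measure on
`ℝ^(d-1)`, so that volumes of balls, null sets and Lebesgue points can be pulled back. -/
theorem exists_affineIsometry_hyp (hn : ‖n‖ = 1) (p : Space d) :
    ∃ f : EuclideanSpace ℝ (Fin (d - 1)) →ᵃⁱ[ℝ] Space d, range f = hyp n p := by
  have hn0 : n ≠ 0 := by rintro rfl; simp at hn
  set W := (Submodule.span ℝ {n})ᗮ with hW
  have hfr : Module.finrank ℝ W = d - 1 := by
    have h := (Submodule.span ℝ {n}).finrank_add_finrank_orthogonal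
    rw [finrank_span_singleton hn0, finrank_euclideanSpace_fin] at h
    change 1 + Module.finrank ℝ W = d at h
    omega
  let b : OrthonormalBasis (Fin (d - 1)) ℝ W := (stdOrthonormalBasis ℝ W).reindex (finCongr hfr)
  let g : EuclideanSpace ℝ (Fin (d - 1)) →ₗᵢ[ℝ] Space d :=
    W.subtypeₗᵢ.comp b.repr.symm.toLinearIsometry
  refine ⟨(AffineIsometryEquiv.constVAdd ℝ (Space d) p).toAffineIsometry.comp
    g.toAffineIsometry, ?_⟩
  ext x
  simp only [hyp, mem_range, mem_ofPred_eq]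
  constructor
  · rintro ⟨y, rfl⟩
    have : ((b.repr.symm y : W) : Space d) ∈ W := (b.repr.symm y).2
    replace this := Submodule.mem_orthogonal_singleton_iff_inner_right.1 this
    simpa [g] using this
  · intro hx
    have hxW : x - p ∈ W := by
      rw [hW, Submodule.mem_orthogonal_singleton_iff_inner_right]; exact hx
    refine ⟨b.repr ⟨x - p, hxW⟩, ?_⟩
    simp [g]

theorem hypMeasure_eq_map {f : EuclideanSpace ℝ (Fin (d - 1)) →ᵃⁱ[ℝ] Space d}
    (hf : range f = hyp n p) : hypMeasure n p = Measure.map f volume := by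
  rw [hypMeasure, ← hf, ← f.isometry.map_euclideanHausdorffMeasure,
    EuclideanSpace.euclideanHausdorffMeasure_eq_volume]

theorem measurableEmbedding_affineIsometry (f : EuclideanSpace ℝ (Fin (d - 1)) →ᵃⁱ[ℝ] Space d) :
    MeasurableEmbedding f := f.isometry.isClosedEmbedding.measurableEmbedding

theorem sigmaFinite_hypMeasure (hn : ‖n‖ = 1) (p : Space d) : SigmaFinite (hypMeasure n p) := by
  obtain ⟨f, hf⟩ := exists_affineIsometry_hyp hn p
  rw [hypMeasure_eq_map hf]
  exact (measurableEmbedding_affineIsometry f).sigmaFinite_map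

/-- The volume of the unit ball of `ℝ^(d-1)`. -/
def unitFaceVolume (d : ℕ) : ℝ :=
  (volume (Metric.ball (0 : EuclideanSpace ℝ (Fin (d - 1))) 1)).toReal

theorem unitFaceVolume_pos (d : ℕ) : 0 < unitFaceVolume d :=
  ENNReal.toReal_pos (Metric.measure_ball_pos _ _ one_pos).ne' measure_ball_lt_top.ne

theorem hypMeasure_closedBall (hn : ‖n‖ = 1) {x : Space d} (hx : x ∈ hyp n p) {r : ℝ}
    (hr : 0 ≤ r) :
    hypMeasure n p (Metric.closedBall x r) = ENNReal.ofReal (r ^ (d - 1) * unitFaceVolume d) := by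
  obtain ⟨f, hf⟩ := exists_affineIsometry_hyp hn p
  obtain ⟨y, rfl⟩ : x ∈ range f := hf ▸ hx
  rw [hypMeasure_eq_map hf, (measurableEmbedding_affineIsometry f).map_apply,
    f.isometry.preimage_closedBall, Measure.addHaar_closedBall _ _ hr, unitFaceVolume,
    ENNReal.ofReal_mul (by positivity), ENNReal.ofReal_toReal measure_ball_lt_top.ne,
    finrank_euclideanSpace_fin]

theorem hypMeasure_lt_top (hn : ‖n‖ = 1) {S : Set (Space d)} (hS : Bornology.IsBounded S) :
    hypMeasure n p S < ⊤ := by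
  obtain ⟨R, hR⟩ := hS.subset_closedBall p
  refine (measure_mono (hR.trans (Metric.closedBall_subset_closedBall (le_max_left R 0)))).trans_lt ?_
  rw [hypMeasure_closedBall hn (by simp [hyp]) (le_max_right _ _)]
  exact ENNReal.ofReal_lt_top

/-- Cavalieri with slices orthogonal to `n`. The slice at height `⟨n, e⟩ t` is the base hyperplane
translated by `t • e`, and surface measure is translation invariant; rescaling the height yields the
factor `|⟨n, e⟩|`. -/
theorem volume_eq_lintegral_oblique (hn : ‖n‖ = 1) (he : inner ℝ n e ≠ 0) (p : Space d)
    {s : Set (Space d)} (hs : MeasurableSet s) :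
    volume s = ENNReal.ofReal |inner ℝ n e| * ∫⁻ t : ℝ, hypMeasure n p {y | y + t • e ∈ s} := by
  have hn0 : n ≠ 0 := by rintro rfl; simp at hn
  set α : ℝ := inner ℝ n e with hα
  have h := EuclideanGeometry.euclideanHausdorffMeasure_eq_lintegral p hn0 hs
  rw [InnerProductSpace.euclideanHausdorffMeasure_eq_volume, finrank_euclideanSpace_fin] at h
  have hslice (t : ℝ) : (μHE[d - 1] : Measure (Space d))
      (s ∩ AffineSubspace.mk' ((α * t) • n +ᵥ p) (Submodule.span ℝ {n})ᗮ) =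
      hypMeasure n p {y | y + t • e ∈ s} := by
    have hms : MeasurableSet {y | y + t • e ∈ s} :=
      (by fun_prop : Measurable fun y : Space d => y + t • e) hs
    rw [hypMeasure, Measure.restrict_apply hms,
      ← measure_preimage_add_right (μHE[d - 1] : Measure (Space d)) (t • e)]
    congr 1
    ext y
    simp only [mem_preimage, mem_inter_iff, SetLike.mem_coe, AffineSubspace.mem_mk',
      vsub_eq_sub, vadd_eq_add, Submodule.mem_orthogonal_singleton_iff_inner_right, hyp,
      mem_ofPred_eq]
    refine and_congr Iff.rfl ?_
    have : inner ℝ n (y + t • e - ((α * t) • n + p)) = inner ℝ n (y - p) := by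
      simp only [inner_sub_right, inner_add_right, inner_smul_right, real_inner_self_eq_norm_sq, hn]
      rw [← hα]; ring
    rw [this]
  rw [h]
  have hmeas : ∫⁻ x : ℝ, (μHE[d - 1] : Measure (Space d))
      (s ∩ AffineSubspace.mk' (x • n +ᵥ p) (Submodule.span ℝ {n})ᗮ) =
      ENNReal.ofReal |α| * ∫⁻ t : ℝ, hypMeasure n p {y | y + t • e ∈ s} := by
    have hmap := Real.smul_map_volume_mul_left (a := α) he
    have hme : MeasurableEmbedding (α * · : ℝ → ℝ) :=
      (Homeomorph.mulLeft₀ α he).measurableEmbedding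
    conv_lhs => rw [← hmap]
    rw [lintegral_smul_measure, hme.lintegral_map, smul_eq_mul]
    simp_rw [hslice]
  rw [hmeas, ← ofReal_norm, hn]; simp

/-- Oblique Fubini formula. -/
theorem map_add_smul_prod (hn : ‖n‖ = 1) (he : inner ℝ n e ≠ 0) (p : Space d) :
    Measure.map (fun q : Space d × ℝ => q.1 + q.2 • e) ((hypMeasure n p).prod volume) =
      ENNReal.ofReal |inner ℝ n e|⁻¹ • (volume : Measure (Space d)) := by
  have := sigmaFinite_hypMeasure hn p
  have hm : Measurable fun q : Space d × ℝ => q.1 + q.2 • e := by fun_prop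
  have hpos : 0 < |(inner ℝ n e : ℝ)| := abs_pos.2 he
  ext s hs
  rw [Measure.map_apply hm hs, Measure.prod_apply_symm (hm hs), Measure.smul_apply,
    volume_eq_lintegral_oblique hn he p hs, smul_eq_mul, ← mul_assoc,
    ← ENNReal.ofReal_mul (by positivity), inv_mul_cancel₀ hpos.ne', ENNReal.ofReal_one, one_mul]
  rfl

theorem quasiMeasurePreserving_add_smul (hn : ‖n‖ = 1) (he : inner ℝ n e ≠ 0) (p : Space d) :
    Measure.QuasiMeasurePreserving (fun q : Space d × ℝ => q.1 + q.2 • e)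
      ((hypMeasure n p).prod volume) volume := by
  refine ⟨by fun_prop, ?_⟩
  rw [map_add_smul_prod hn he p]
  exact Measure.smul_absolutelyContinuous

theorem lintegral_oblique (hn : ‖n‖ = 1) (he : inner ℝ n e ≠ 0) (p : Space d)
    {f : Space d → ℝ≥0∞} (hf : AEMeasurable f) :
    ∫⁻ y, (∫⁻ t : ℝ, f (y + t • e)) ∂(hypMeasure n p) =
      ENNReal.ofReal |inner ℝ n e|⁻¹ * ∫⁻ x, f x := by
  have := sigmaFinite_hypMeasure hn p
  have hf' : AEMeasurable f (Measure.map (fun q : Space d × ℝ => q.1 + q.2 • e)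
      ((hypMeasure n p).prod volume)) := by
    rw [map_add_smul_prod hn he p]; exact hf.smul_measure _
  have h := lintegral_map' hf' (by fun_prop)
  rw [map_add_smul_prod hn he p, lintegral_smul_measure, smul_eq_mul] at h
  rw [h, lintegral_prod]
  exact hf.comp_quasiMeasurePreserving (quasiMeasurePreserving_add_smul hn he p)

theorem integral_oblique (hn : ‖n‖ = 1) (he : inner ℝ n e ≠ 0) (p : Space d)
    {f : Space d → ℝ} (hf : Integrable f) :
    ∫ x, f x = |inner ℝ n e| * ∫ y, (∫ t : ℝ, f (y + t • e)) ∂(hypMeasure n p) ∧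
    Integrable (fun q : Space d × ℝ => f (q.1 + q.2 • e)) ((hypMeasure n p).prod volume) := by
  have := sigmaFinite_hypMeasure hn p
  have hpos : 0 < |(inner ℝ n e : ℝ)| := abs_pos.2 he
  have hi : Integrable f (Measure.map (fun q : Space d × ℝ => q.1 + q.2 • e)
      ((hypMeasure n p).prod volume)) := by
    rw [map_add_smul_prod hn he p]; exact hf.smul_measure (by simp)
  have hi2 : Integrable (fun q : Space d × ℝ => f (q.1 + q.2 • e)) ((hypMeasure n p).prod volume) :=
    hi.comp_measurable (by fun_prop)
  refine ⟨?_, hi2⟩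
  have h := integral_map (φ := fun q : Space d × ℝ => q.1 + q.2 • e)
    (by fun_prop) hi.1
  rw [map_add_smul_prod hn he p, integral_smul_measure, ENNReal.toReal_ofReal (by positivity),
    integral_prod _ hi2, smul_eq_mul] at h
  rw [← h, ← mul_assoc, mul_inv_cancel₀ hpos.ne', one_mul]

/-- Lebesgue points on a hyperplane. -/
theorem ae_hypMeasure_tendsto (hn : ‖n‖ = 1) (p : Space d) {g : Space d → ℝ}
    (hg : Integrable g (hypMeasure n p)) :
    ∀ᵐ x ∂(hypMeasure n p), Tendsto (fun r : ℝ => (r ^ (d - 1))⁻¹ *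
      ∫ y in Metric.closedBall x r, |g y - g x| ∂(hypMeasure n p)) (𝓝[>] 0) (𝓝 0) := by
  obtain ⟨f, hf⟩ := exists_affineIsometry_hyp hn p
  have hme := measurableEmbedding_affineIsometry f
  rw [hypMeasure_eq_map hf] at hg ⊢
  rw [hme.ae_map_iff]
  have hgf : LocallyIntegrable (g ∘ f) := (hme.integrable_map_iff.1 hg).locallyIntegrable
  filter_upwards [IsUnifLocDoublingMeasure.ae_tendsto_average_norm_sub volume hgf 0] with x hx
  -- The differentiation theorem normalises by the measure of the ball; multiplying by the volume of
  -- the unit ball leaves the normalisation `r^(d-1)`.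
  have h := (hx (fun _ : ℝ => x) id tendsto_id (Eventually.of_forall fun r => by simp)).const_mul
    (unitFaceVolume d)
  rw [mul_zero] at h
  refine h.congr' ?_
  filter_upwards [self_mem_nhdsWithin] with r hr
  rw [hme.setIntegral_map, f.isometry.preimage_closedBall, setAverage_eq, Measure.real, id,
    Measure.addHaar_closedBall _ _ (le_of_lt hr), ENNReal.toReal_mul, ENNReal.toReal_ofReal
    (pow_nonneg (le_of_lt hr) _), finrank_euclideanSpace_fin]
  have := unitFaceVolume_pos d
  change unitFaceVolume d * ((r ^ (d - 1) * unitFaceVolume d)⁻¹ • _) = _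
  rw [smul_eq_mul, mul_inv, ← mul_assoc, mul_comm (r ^ (d - 1))⁻¹, ← mul_assoc,
    mul_inv_cancel₀ this.ne', one_mul]
  rfl

theorem hypMeasure_affine_eq_zero (hn : ‖n‖ = 1) (ℓ : Space d →ᵃ[ℝ] ℝ)
    (hℓ : ∃ x ∈ hyp n p, ℓ x ≠ 0) : hypMeasure n p {x | ℓ x = 0} = 0 := by
  obtain ⟨f, hf⟩ := exists_affineIsometry_hyp hn p
  rw [hypMeasure_eq_map hf, (measurableEmbedding_affineIsometry f).map_apply]
  let A : AffineSubspace ℝ (EuclideanSpace ℝ (Fin (d - 1))) :=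
    (AffineSubspace.mk' (0 : ℝ) ⊥).comap (ℓ.comp f.toAffineMap)
  have hA : f ⁻¹' {x | ℓ x = 0} = A := by
    ext y; simp [A, AffineSubspace.mem_mk']
  rw [hA]
  refine Measure.addHaar_affineSubspace _ _ fun htop => ?_
  obtain ⟨x, hx, hx0⟩ := hℓ
  rw [← hf] at hx
  obtain ⟨y, rfl⟩ := hx
  have : y ∈ (A : Set _) := by rw [htop]; trivial
  rw [← hA] at this
  exact hx0 this

theorem volume_affine_eq_zero (ℓ : Space d →ᵃ[ℝ] ℝ) (hℓ : ∃ x, ℓ x ≠ 0) :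
    volume {x | ℓ x = 0} = 0 := by
  let A : AffineSubspace ℝ (Space d) := (AffineSubspace.mk' (0 : ℝ) ⊥).comap ℓ
  have hA : {x | ℓ x = 0} = A := by
    ext y; simp [A, AffineSubspace.mem_mk']
  rw [hA]
  refine Measure.addHaar_affineSubspace _ _ fun htop => ?_
  obtain ⟨x, hx0⟩ := hℓ
  have : x ∈ (A : Set _) := by rw [htop]; trivial
  rw [← hA] at this
  exact hx0 this

/-- Choose the subsequence with integrals at most `2⁻ᵏ`: the series of functions is then integrable,
hence finite almost everywhere, and its terms tend to zero. -/
theorem exists_subseq_ae_tendsto_zero {α : Type*} [MeasurableSpace α] {μ : Measure α}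
    {f : ℕ → α → ℝ≥0∞} (hf : ∀ n, AEMeasurable (f n) μ)
    (h : Tendsto (fun n => ∫⁻ x, f n x ∂μ) atTop (𝓝 0)) :
    ∃ φ : ℕ → ℕ, StrictMono φ ∧ ∀ᵐ x ∂μ, Tendsto (fun k => f (φ k) x) atTop (𝓝 0) := by
  have hev (k : ℕ) : ∀ᶠ n in atTop, ∫⁻ x, f n x ∂μ ≤ (1 / 2) ^ k :=
    (h.eventually (gt_mem_nhds (ENNReal.pow_pos (by simp) k : (0 : ℝ≥0∞) < (1 / 2) ^ k))).mono fun n hn => le_of_lt hn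
  obtain ⟨φ, hφ, hle⟩ := extraction_forall_of_eventually hev
  refine ⟨φ, hφ, ?_⟩
  have hsum : ∫⁻ x, ∑' k, f (φ k) x ∂μ ≠ ⊤ := by
    rw [lintegral_tsum fun k => hf _]
    refine ne_top_of_le_ne_top ?_ (ENNReal.tsum_le_tsum hle)
    rw [ENNReal.tsum_geometric]
    simp
  filter_upwards [ae_lt_top' (AEMeasurable.tsum fun k => hf _) hsum] with x hx
  exact ENNReal.tendsto_atTop_zero_of_tsum_ne_top hx.ne

/-- The primitive of an integrable function is absolutely continuous, which is enough to integrate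
by parts; it vanishes at `0`, so only the boundary term at `δ` appears. -/
theorem integral_primitive_mul_deriv {w ψ : ℝ → ℝ} {δ : ℝ}
    (hw : IntervalIntegrable w volume 0 δ) (hψ : ContDiff ℝ 1 ψ) :
    ∫ t in 0..δ, (∫ τ in 0..t, w τ) * deriv ψ t =
      (∫ τ in 0..δ, w τ) * ψ δ - ∫ t in 0..δ, w t * ψ t := by
  have h0 : (0 : ℝ) ∈ uIcc 0 δ := left_mem_uIcc
  have hW := hw.absolutelyContinuousOnInterval_intervalIntegral h0
  have hψ' : AbsolutelyContinuousOnInterval ψ 0 δ := hψ.contDiffOn.absolutelyContinuousOnInterval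
  rw [hW.integral_mul_deriv_eq_deriv_mul hψ']
  simp only [intervalIntegral.integral_same, zero_mul, sub_zero]
  congr 1
  refine intervalIntegral.integral_congr_ae ?_
  filter_upwards [hw.ae_hasDerivAt_integral] with t ht ht'
  rw [(ht (uIoc_subset_uIcc ht') 0 h0).deriv]

/-! ### Sobolev functions along columns and their boundary values -/

/-- Columns in the direction `e` based on the part of the hyperplane in `V` lie in `T`. -/
structure IsColumn {d : ℕ} (T : Set (Space d)) (n p e : Space d) (V : Set (Space d)) (δ : ℝ) :
    Prop where
  norm_eq : ‖n‖ = 1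
  inner_neg : inner ℝ n e < 0
  pos : 0 < δ
  isOpen : IsOpen V
  bounded : Bornology.IsBounded V
  mem : ∀ y ∈ V, y ∈ hyp n p → ∀ t ∈ Ioo 0 δ, y + t • e ∈ T

/-- The directional derivative along a column. -/
def colDeriv {d : ℕ} (T : Set (Space d)) (G : Space d → Space d) (e y : Space d) (t : ℝ) : ℝ :=
  inner ℝ (T.indicator G (y + t • e)) e

/-- The boundary value at the foot of a column. -/
def colTrace {d : ℕ} (T : Set (Space d)) (u : Space d → ℝ) (G : Space d → Space d) (e : Space d)
    (δ : ℝ) (y : Space d) : ℝ :=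
  δ⁻¹ * (∫ t in 0..δ, T.indicator u (y + t • e)) - δ⁻¹ * ∫ t in 0..δ, (δ - t) * colDeriv T G e y t

section column
variable {d : ℕ} {T V : Set (Space d)} {n p e : Space d} {δ : ℝ} {u : Space d → ℝ}
  {G : Space d → Space d}

theorem abs_colDeriv_le (y : Space d) (t : ℝ) :
    ‖colDeriv T G e y t‖ₑ ≤ ‖e‖ₑ * ‖T.indicator G (y + t • e)‖ₑ := by
  rw [colDeriv, ← ofReal_norm, ← ofReal_norm, ← ofReal_norm, ← ENNReal.ofReal_mul (norm_nonneg _)]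
  refine ENNReal.ofReal_le_ofReal ((norm_inner_le_norm _ _).trans (mul_comm _ _).le)

theorem hasDerivAt_comp_line {f : Space d → ℝ} {y e : Space d} {τ : ℝ}
    (hf : DifferentiableAt ℝ f (y + τ • e)) :
    HasDerivAt (fun τ : ℝ => f (y + τ • e)) (fderiv ℝ f (y + τ • e) e) τ := by
  refine hf.hasFDerivAt.comp_hasDerivAt τ ?_
  exact HasDerivAt.congr_deriv (((hasDerivAt_id τ).smul_const e).const_add y) (by simp)

theorem continuous_line (y e : Space d) : Continuous fun τ : ℝ => y + τ • e := by fun_prop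

/-- A compact segment in `T` has a closed neighbourhood in `T`, so for small mollification radii the
derivative along the whole segment is the mollified gradient. -/
theorem IsH1.eventually_moll_sub (h : IsH1 T u G) (hT : IsOpen T) (hb : volume T ≠ ⊤)
    {y e : Space d} {s t : ℝ} (hst : ∀ τ ∈ uIcc s t, y + τ • e ∈ T) :
    ∀ᶠ m : ℕ in atTop, moll m (T.indicator u) (y + t • e) - moll m (T.indicator u) (y + s • e) =
      ∫ τ in s..t, inner ℝ (moll m (T.indicator G) (y + τ • e)) e := by
  obtain ⟨iu, iG⟩ := h.integrable_indicator hT.measurableSet hb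
  have hseg : (fun τ : ℝ => y + τ • e) '' uIcc s t ⊆ T := by
    rintro _ ⟨τ, hτ, rfl⟩
    exact hst τ hτ
  have hcomp : IsCompact ((fun τ : ℝ => y + τ • e) '' uIcc s t) :=
    isCompact_uIcc.image (continuous_line y e)
  obtain ⟨ε, hε, hsub⟩ := hcomp.exists_cthickening_subset_open hT hseg
  filter_upwards [(tendsto_one_div_add_atTop_nhds_zero_nat (𝕜 := ℝ)).eventually
    (gt_mem_nhds hε)] with m hm
  have hdiff : Differentiable ℝ (moll m (T.indicator u)) :=
    (contDiff_moll m iu.locallyIntegrable).differentiable (by simp)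
  have hder (τ : ℝ) (hτ : τ ∈ uIcc s t) :
      HasDerivAt (fun τ => moll m (T.indicator u) (y + τ • e))
        (inner ℝ (moll m (T.indicator G) (y + τ • e)) e) τ := by
    have hmem : y + τ • e ∈ (fun τ : ℝ => y + τ • e) '' uIcc s t := ⟨τ, hτ, rfl⟩
    have hball : Metric.closedBall (y + τ • e) (1 / ((m : ℝ) + 1)) ⊆ T :=
      (Metric.closedBall_subset_closedBall hm.le).trans
        ((Metric.closedBall_subset_cthickening hmem ε).trans hsub)
    rw [← h.fderiv_moll hT.measurableSet hb hball e]
    exact hasDerivAt_comp_line (hdiff _)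
  have hcont : Continuous fun τ : ℝ => inner ℝ (moll m (T.indicator G) (y + τ • e)) e :=
    ((contDiff_moll m iG.locallyIntegrable).continuous.comp
      (continuous_line y e)).inner continuous_const
  rw [intervalIntegral.integral_eq_sub_of_hasDerivAt hder (hcont.intervalIntegrable _ _)]

theorem tendsto_integral_inner_line {F : ℕ → ℝ → Space d} {f : ℝ → Space d}
    (hF : ∀ k, Continuous (F k)) (hf : Integrable f) (e : Space d) (s t : ℝ)
    (h : Tendsto (fun k => ∫⁻ τ, ‖F k τ - f τ‖ₑ) atTop (𝓝 0)) :
    Tendsto (fun k => ∫ τ in s..t, inner ℝ (F k τ) e) atTop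
      (𝓝 (∫ τ in s..t, inner ℝ (f τ) e)) := by
  rw [tendsto_iff_edist_tendsto_0]
  have hup : Tendsto (fun k => ‖e‖ₑ * ∫⁻ τ, ‖F k τ - f τ‖ₑ) atTop (𝓝 0) := by
    have := ENNReal.Tendsto.const_mul h (Or.inr (enorm_ne_top (x := e)))
    rwa [mul_zero] at this
  refine tendsto_of_tendsto_of_tendsto_of_le_of_le tendsto_const_nhds hup
    (fun _ => zero_le) fun k => ?_
  have hcont : Continuous fun τ : ℝ => inner ℝ (F k τ) e := (hF k).inner continuous_const
  rw [edist_eq_enorm_sub, ← intervalIntegral.integral_sub (hcont.intervalIntegrable _ _)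
    (hf.inner_const e).intervalIntegrable]
  calc ‖∫ τ in s..t, (inner ℝ (F k τ) e - inner ℝ (f τ) e)‖ₑ
      ≤ ∫⁻ τ in uIoc s t, ‖inner ℝ (F k τ) e - inner ℝ (f τ) e‖ₑ := by
        rw [← ofReal_norm, intervalIntegral.norm_intervalIntegral_eq, ofReal_norm]
        exact enorm_integral_le_lintegral_enorm _
    _ ≤ ∫⁻ τ : ℝ, ‖inner ℝ (F k τ) e - inner ℝ (f τ) e‖ₑ := setLIntegral_le_lintegral _ _
    _ ≤ ∫⁻ τ : ℝ, ‖e‖ₑ * ‖F k τ - f τ‖ₑ := by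
        refine lintegral_mono fun τ => ?_
        rw [← inner_sub_left, ← ofReal_norm, ← ofReal_norm, ← ofReal_norm,
          ← ENNReal.ofReal_mul (norm_nonneg _)]
        exact ENNReal.ofReal_le_ofReal ((norm_inner_le_norm _ _).trans (mul_comm _ _).le)
    _ = ‖e‖ₑ * ∫⁻ τ, ‖F k τ - f τ‖ₑ := by rw [lintegral_const_mul' _ _ enorm_ne_top]

/-- Absolute continuity on lines. By oblique Fubini, a subsequence of the mollified gradients
converges in `L¹` along almost every line, while the mollified functions converge at almost every
parameter. The fundamental theorem of calculus thus survives in the limit between any two good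
parameters, and one of them fixes the constant. -/
theorem IsColumn.exists_const (hc : IsColumn T n p e V δ) (hT : IsOpen T) (hb : volume T ≠ ⊤)
    (h : IsH1 T u G) :
    ∀ᵐ y ∂(hypMeasure n p).restrict V, IntervalIntegrable (colDeriv T G e y) volume 0 δ ∧
      IntervalIntegrable (fun t => T.indicator u (y + t • e)) volume 0 δ ∧
      ∃ c : ℝ, ∀ᵐ t ∂volume.restrict (Ioo 0 δ),
        T.indicator u (y + t • e) = c + ∫ τ in 0..t, colDeriv T G e y τ := by
  obtain ⟨iu, iG⟩ := h.integrable_indicator hT.measurableSet hb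
  have hsf := sigmaFinite_hypMeasure hc.norm_eq p
  have hα := hc.inner_neg.ne
  set u' := T.indicator u with hu'
  set G' := T.indicator G with hG'
  have hum (m : ℕ) : Continuous (moll m u') := (contDiff_moll m iu.locallyIntegrable).continuous
  have hGm (m : ℕ) : Continuous (moll m G') := (contDiff_moll m iG.locallyIntegrable).continuous
  set a : ℕ → Space d → ℝ≥0∞ := fun m y => ∫⁻ t : ℝ, ‖moll m G' (y + t • e) - G' (y + t • e)‖ₑ
    with ha
  have hqm := quasiMeasurePreserving_add_smul hc.norm_eq hα p
  have haem (m : ℕ) : AEMeasurable (fun x => ‖moll m G' x - G' x‖ₑ) :=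
    ((hGm m).aestronglyMeasurable.sub iG.1).enorm
  have ham (m : ℕ) : AEMeasurable (a m) (hypMeasure n p) :=
    ((haem m).comp_quasiMeasurePreserving hqm).lintegral_prod_right'
  have hlim : Tendsto (fun m => ∫⁻ y, a m y ∂(hypMeasure n p)) atTop (𝓝 0) := by
    have h1 := ENNReal.Tendsto.const_mul (tendsto_lintegral_moll_sub iG)
      (Or.inr (ENNReal.ofReal_ne_top (r := |inner ℝ n e|⁻¹)))
    rw [mul_zero] at h1
    refine h1.congr fun m => ?_
    rw [← lintegral_oblique hc.norm_eq hα p (haem m)]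
  obtain ⟨φ, hφ, hae⟩ := exists_subseq_ae_tendsto_zero ham hlim
  have hae2 : ∀ᵐ y ∂hypMeasure n p, ∀ᵐ t : ℝ,
      Tendsto (fun m => moll m u' (y + t • e)) atTop (𝓝 (u' (y + t • e))) :=
    Measure.ae_ae_of_ae_prod (hqm.ae (ae_tendsto_moll iu.locallyIntegrable))
  have hae3 : ∀ᵐ y ∂hypMeasure n p, Integrable fun t : ℝ => G' (y + t • e) := by
    have h1 : Integrable G' (Measure.map (fun q : Space d × ℝ => q.1 + q.2 • e)
        ((hypMeasure n p).prod volume)) := by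
      rw [map_add_smul_prod hc.norm_eq hα p]; exact iG.smul_measure (by simp)
    exact (h1.comp_measurable (by fun_prop)).prod_right_ae
  have hae4 : ∀ᵐ y ∂hypMeasure n p, Integrable fun t : ℝ => u' (y + t • e) :=
    (integral_oblique hc.norm_eq hα p iu).2.prod_right_ae
  have hH : ∀ᵐ y ∂(hypMeasure n p).restrict V, y ∈ V ∧ y ∈ hyp n p := by
    filter_upwards [ae_restrict_mem hc.isOpen.measurableSet, ae_restrict_of_ae
      (ae_restrict_mem (measurableSet_hyp n p))] with y h1 h2 using ⟨h1, h2⟩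
  filter_upwards [ae_restrict_of_ae hae, ae_restrict_of_ae hae2, ae_restrict_of_ae hae3,
    ae_restrict_of_ae hae4, hH] with y hy1 hy2 hy3 hy4 ⟨hyV, hyH⟩
  have hwint : Integrable (colDeriv T G e y) := hy3.inner_const e
  refine ⟨hwint.intervalIntegrable, hy4.intervalIntegrable, ?_⟩
  have key : ∀ t ∈ Ioo 0 δ, ∀ s ∈ Ioo 0 δ,
      Tendsto (fun m => moll m u' (y + t • e)) atTop (𝓝 (u' (y + t • e))) →
      Tendsto (fun m => moll m u' (y + s • e)) atTop (𝓝 (u' (y + s • e))) →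
      u' (y + t • e) - u' (y + s • e) = ∫ τ in s..t, colDeriv T G e y τ := by
    intro t ht s hs hlt hls
    have hftc := h.eventually_moll_sub hT hb (y := y) (e := e) (s := s) (t := t) fun τ hτ =>
      hc.mem y hyV hyH τ ((ordConnected_Ioo.uIcc_subset hs ht) hτ)
    have hlimI := tendsto_integral_inner_line (fun k => (hGm (φ k)).comp (continuous_line y e))
      hy3 e s t hy1
    have hl2 := (hlt.sub hls).comp hφ.tendsto_atTop
    refine tendsto_nhds_unique hl2 (hlimI.congr' ?_)
    filter_upwards [hφ.tendsto_atTop.eventually hftc] with k hk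
    exact hk.symm
  -- Positivity of the height guarantees that a good reference parameter exists.
  have hne : (ae (volume.restrict (Ioo 0 δ))).NeBot := by
    rw [ae_neBot, Ne, Measure.restrict_eq_zero]
    simpa using hc.pos
  have hgood : ∀ᵐ t ∂volume.restrict (Ioo 0 δ), t ∈ Ioo 0 δ ∧
      Tendsto (fun m => moll m u' (y + t • e)) atTop (𝓝 (u' (y + t • e))) := by
    filter_upwards [ae_restrict_of_ae hy2, ae_restrict_mem measurableSet_Ioo] with t h1 h2
      using ⟨h2, h1⟩
  obtain ⟨s, hs, hsl⟩ := hgood.exists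
  refine ⟨u' (y + s • e) - ∫ τ in 0..s, colDeriv T G e y τ, ?_⟩
  filter_upwards [hgood] with t ⟨ht, htl⟩
  have h1 := key t ht s hs htl hsl
  have h2 := intervalIntegral.integral_add_adjacent_intervals
    (hwint.intervalIntegrable (a := 0) (b := s)) (hwint.intervalIntegrable (a := s) (b := t))
  linarith

theorem IsColumn.ae_eq (hc : IsColumn T n p e V δ) (hT : IsOpen T) (hb : volume T ≠ ⊤)
    (h : IsH1 T u G) :
    ∀ᵐ y ∂(hypMeasure n p).restrict V, IntervalIntegrable (colDeriv T G e y) volume 0 δ ∧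
      IntervalIntegrable (fun t => T.indicator u (y + t • e)) volume 0 δ ∧
      ∀ᵐ t ∂volume.restrict (Ioo 0 δ), T.indicator u (y + t • e) =
        colTrace T u G e δ y + ∫ τ in 0..t, colDeriv T G e y τ := by
  filter_upwards [hc.exists_const hT hb h] with y ⟨hw, hu, c, hcy⟩
  refine ⟨hw, hu, ?_⟩
  suffices hcc : colTrace T u G e δ y = c by simpa [hcc] using hcy
  have hδ := hc.pos
  have h1 : ∫ t in 0..δ, T.indicator u (y + t • e) =
      ∫ t in 0..δ, (c + ∫ τ in 0..t, colDeriv T G e y τ) := by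
    rw [intervalIntegral.integral_of_le hδ.le, intervalIntegral.integral_of_le hδ.le,
      integral_Ioc_eq_integral_Ioo, integral_Ioc_eq_integral_Ioo]
    exact integral_congr_ae hcy
  have hW : IntervalIntegrable (fun t => ∫ τ in 0..t, colDeriv T G e y τ) volume 0 δ :=
    (hw.absolutelyContinuousOnInterval_intervalIntegral left_mem_uIcc).continuousOn.intervalIntegrable
  -- Averaging `u = c + ∫₀ᵗ w` over the column and integrating the primitive by parts against `t -
  -- δ`, which vanishes at `δ`, solves for `c` and produces the two integrals in `colTrace`.
  have h2 := integral_primitive_mul_deriv hw (ψ := fun t => t - δ) (by fun_prop)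
  have h3 (t : ℝ) : deriv (fun t => t - δ) t = 1 := by simp
  simp only [h3, mul_one, sub_self, mul_zero, zero_sub] at h2
  rw [intervalIntegral.integral_add (by simp) hW, h2, intervalIntegral.integral_const] at h1
  have h4 : ∫ t in 0..δ, (δ - t) * colDeriv T G e y t =
      -∫ t in 0..δ, colDeriv T G e y t * (t - δ) := by
    rw [← intervalIntegral.integral_neg]; congr 1; ext t; ring
  rw [colTrace, h1, h4]
  simp only [sub_zero, smul_eq_mul]
  field_simp
  ring

theorem aestronglyMeasurable_colTrace (hn : ‖n‖ = 1) (he : inner ℝ n e ≠ 0) (hT : IsOpen T)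
    (hb : volume T ≠ ⊤) (h : IsH1 T u G) (hδ : 0 < δ) :
    AEStronglyMeasurable (colTrace T u G e δ) (hypMeasure n p) := by
  obtain ⟨iu, iG⟩ := h.integrable_indicator hT.measurableSet hb
  have hsf := sigmaFinite_hypMeasure hn p
  have hqm := quasiMeasurePreserving_add_smul hn he p
  have hac : ((hypMeasure n p).prod (volume.restrict (Ioc 0 δ))) ≪ (hypMeasure n p).prod volume :=
    Measure.AbsolutelyContinuous.prod Measure.AbsolutelyContinuous.rfl
      Measure.restrict_le_self.absolutelyContinuous
  have m1 := (iu.1.comp_quasiMeasurePreserving hqm).mono_ac hac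
  have m2 := (iG.1.comp_quasiMeasurePreserving hqm).mono_ac hac
  unfold colTrace colDeriv
  simp only [intervalIntegral.integral_of_le hδ.le]
  refine AEStronglyMeasurable.sub ?_ ?_
  · exact m1.integral_prod_right'.const_mul _
  · refine AEStronglyMeasurable.const_mul (AEStronglyMeasurable.integral_prod_right'
      (f := fun q : Space d × ℝ => (δ - q.2) * inner ℝ (T.indicator G (q.1 + q.2 • e)) e) ?_) _
    exact (by fun_prop : Measurable fun q : Space d × ℝ => δ - q.2).aestronglyMeasurable.mul
      (m2.inner aestronglyMeasurable_const)

theorem add_sq_le_enn (a b : ℝ≥0∞) : (a + b) ^ 2 ≤ 2 * a ^ 2 + 2 * b ^ 2 := by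
  have := ENNReal.rpow_add_le_mul_rpow_add_rpow a b (p := 2) (by norm_num)
  norm_num at this
  rwa [mul_add] at this

theorem lintegral_enorm_sq_le_mul {f : ℝ → ℝ≥0∞} (hf : AEMeasurable f) :
    (∫⁻ t in Ioo 0 δ, f t) ^ 2 ≤ ENNReal.ofReal δ * ∫⁻ t in Ioo 0 δ, f t ^ 2 := by
  have h := lintegral_mul_sq_le (volume.restrict (Ioo 0 δ)) hf.restrict
    (aemeasurable_const (b := (1 : ℝ≥0∞)))
  simp only [mul_one, one_pow, lintegral_one, Measure.restrict_apply_univ, Real.volume_Ioo,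
    sub_zero] at h
  rwa [mul_comm] at h

theorem enorm_intervalIntegral_le {w : ℝ → ℝ} {t : ℝ} (ht : t ∈ Ioo 0 δ) :
    ‖∫ τ in 0..t, w τ‖ₑ ≤ ∫⁻ τ in Ioo 0 δ, ‖w τ‖ₑ := by
  rw [intervalIntegral.integral_of_le ht.1.le]
  refine (enorm_integral_le_lintegral_enorm _).trans (lintegral_mono_set fun τ hτ => ?_)
  exact ⟨hτ.1, hτ.2.trans_lt ht.2⟩

/-- `L²` trace estimate on the foot of a column. -/
theorem IsColumn.lintegral_colTrace_le (hc : IsColumn T n p e V δ) (hT : IsOpen T)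
    (hb : volume T ≠ ⊤) (h : IsH1 T u G) :
    ∫⁻ y in V, ‖colTrace T u G e δ y‖ₑ ^ 2 ∂hypMeasure n p ≤
      ENNReal.ofReal |inner ℝ n e|⁻¹ * (ENNReal.ofReal (2 * δ⁻¹) * (∫⁻ x in T, ‖u x‖ₑ ^ 2) +
        ENNReal.ofReal (2 * δ) * ‖e‖ₑ ^ 2 * ∫⁻ x in T, ‖G x‖ₑ ^ 2) := by
  obtain ⟨iu, iG⟩ := h.integrable_indicator hT.measurableSet hb
  have hδ := hc.pos
  have hα := hc.inner_neg.ne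
  have hsf := sigmaFinite_hypMeasure hc.norm_eq p
  have hqm := quasiMeasurePreserving_add_smul hc.norm_eq hα p
  have m1 : AEMeasurable fun x => ‖T.indicator u x‖ₑ ^ 2 := iu.1.enorm.pow_const 2
  have m2 : AEMeasurable fun x => ‖T.indicator G x‖ₑ ^ 2 := iG.1.enorm.pow_const 2
  have m3 : ∀ᵐ y ∂hypMeasure n p, AEMeasurable (fun t : ℝ => ‖T.indicator u (y + t • e)‖ₑ ^ 2) := by
    filter_upwards [(iu.1.comp_quasiMeasurePreserving hqm).prodMk_left] with y hy
    exact hy.enorm.pow_const 2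
  have m4 : ∀ᵐ y ∂hypMeasure n p, AEMeasurable (fun t : ℝ => ‖T.indicator G (y + t • e)‖ₑ) := by
    filter_upwards [(iG.1.comp_quasiMeasurePreserving hqm).prodMk_left] with y hy
    exact hy.enorm
  have hpt : ∀ᵐ y ∂(hypMeasure n p).restrict V, ‖colTrace T u G e δ y‖ₑ ^ 2 ≤
      ENNReal.ofReal (2 * δ⁻¹) * (∫⁻ t : ℝ, ‖T.indicator u (y + t • e)‖ₑ ^ 2) +
        ENNReal.ofReal (2 * δ) * ‖e‖ₑ ^ 2 * ∫⁻ t : ℝ, ‖T.indicator G (y + t • e)‖ₑ ^ 2 := by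
    filter_upwards [hc.ae_eq hT hb h, ae_restrict_of_ae m3, ae_restrict_of_ae m4]
      with y ⟨_, _, hy⟩ h3 h4
    set g := colTrace T u G e δ y
    set K := ∫⁻ t : ℝ, ‖T.indicator G (y + t • e)‖ₑ ^ 2 with hK
    have hw : ∫⁻ τ in Ioo 0 δ, ‖colDeriv T G e y τ‖ₑ ≤
        ‖e‖ₑ * ∫⁻ τ in Ioo 0 δ, ‖T.indicator G (y + τ • e)‖ₑ := by
      rw [← lintegral_const_mul' _ _ enorm_ne_top]
      exact lintegral_mono fun τ => abs_colDeriv_le y τ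
    have hw2 : (∫⁻ τ in Ioo 0 δ, ‖colDeriv T G e y τ‖ₑ) ^ 2 ≤ ‖e‖ₑ ^ 2 * (ENNReal.ofReal δ * K) := by
      refine (pow_le_pow_left₀ zero_le hw 2).trans ?_
      rw [mul_pow]
      gcongr
      refine (lintegral_enorm_sq_le_mul h4).trans ?_
      gcongr
      exact setLIntegral_le_lintegral _ _
    -- The boundary value does not depend on `t`: bound its square by the value of `u` at height `t`
    -- and the variation below, integrate over the height, and divide by `δ`.
    have hint : ∫⁻ t in Ioo 0 δ, ‖g‖ₑ ^ 2 ≤ ∫⁻ t in Ioo 0 δ,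
        (2 * ‖T.indicator u (y + t • e)‖ₑ ^ 2 + 2 * (‖e‖ₑ ^ 2 * (ENNReal.ofReal δ * K))) := by
      refine lintegral_mono_ae ?_
      filter_upwards [hy, ae_restrict_mem measurableSet_Ioo] with t ht ht'
      have : g = T.indicator u (y + t • e) - ∫ τ in 0..t, colDeriv T G e y τ := by linarith
      rw [this]
      calc _ ≤ (‖T.indicator u (y + t • e)‖ₑ + ∫⁻ τ in Ioo 0 δ, ‖colDeriv T G e y τ‖ₑ) ^ 2 := by
            refine pow_le_pow_left₀ zero_le (enorm_sub_le.trans ?_) 2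
            gcongr
            exact enorm_intervalIntegral_le ht'
        _ ≤ _ := (add_sq_le_enn _ _).trans (by gcongr)
    rw [setLIntegral_const, lintegral_add_right _ measurable_const, setLIntegral_const,
      lintegral_const_mul' _ _ (by simp), Real.volume_Ioo, sub_zero] at hint
    have hle := mul_le_mul_right hint (ENNReal.ofReal δ⁻¹)
    have e1 : ENNReal.ofReal δ⁻¹ * ENNReal.ofReal δ = 1 := by
      rw [← ENNReal.ofReal_mul (by positivity), inv_mul_cancel₀ hδ.ne', ENNReal.ofReal_one]
    calc ‖g‖ₑ ^ 2 = ENNReal.ofReal δ⁻¹ * (‖g‖ₑ ^ 2 * ENNReal.ofReal δ) := by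
          rw [mul_comm (‖g‖ₑ ^ 2), ← mul_assoc, e1, one_mul]
      _ ≤ _ := hle
      _ = ENNReal.ofReal (2 * δ⁻¹) * (∫⁻ t in Ioo 0 δ, ‖T.indicator u (y + t • e)‖ₑ ^ 2) +
          (ENNReal.ofReal δ⁻¹ * ENNReal.ofReal δ) * (ENNReal.ofReal (2 * δ) * ‖e‖ₑ ^ 2 * K) := by
          rw [ENNReal.ofReal_mul zero_le_two, ENNReal.ofReal_mul zero_le_two]
          simp only [ENNReal.ofReal_ofNat]
          ring
      _ ≤ _ := by
          rw [e1, one_mul]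
          gcongr
          exact Measure.restrict_le_self
  calc ∫⁻ y in V, ‖colTrace T u G e δ y‖ₑ ^ 2 ∂hypMeasure n p
      ≤ ∫⁻ y, (ENNReal.ofReal (2 * δ⁻¹) * (∫⁻ t : ℝ, ‖T.indicator u (y + t • e)‖ₑ ^ 2) +
        ENNReal.ofReal (2 * δ) * ‖e‖ₑ ^ 2 * ∫⁻ t : ℝ, ‖T.indicator G (y + t • e)‖ₑ ^ 2)
          ∂hypMeasure n p := (lintegral_mono_ae hpt).trans (setLIntegral_le_lintegral _ _)
    _ = _ := by
      rw [lintegral_add_left', lintegral_const_mul' _ _ ENNReal.ofReal_ne_top,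
        lintegral_const_mul' _ _ (by finiteness), lintegral_oblique hc.norm_eq hα p m1,
        lintegral_oblique hc.norm_eq hα p m2]
      · have e1 : ∫⁻ x, ‖T.indicator u x‖ₑ ^ 2 = ∫⁻ x in T, ‖u x‖ₑ ^ 2 := by
          rw [← lintegral_indicator hT.measurableSet]
          congr 1; ext x; by_cases hx : x ∈ T <;> simp [hx]
        have e2 : ∫⁻ x, ‖T.indicator G x‖ₑ ^ 2 = ∫⁻ x in T, ‖G x‖ₑ ^ 2 := by
          rw [← lintegral_indicator hT.measurableSet]
          congr 1; ext x; by_cases hx : x ∈ T <;> simp [hx]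
        rw [e1, e2]
        ring
      · exact ((m1.comp_quasiMeasurePreserving hqm).lintegral_prod_right').const_mul _

end column

/-! ### Averages over balls converge to the boundary value along columns -/

section ball
variable {d : ℕ} {T V : Set (Space d)} {n p e : Space d} {δ : ℝ} {u : Space d → ℝ}
  {G : Space d → Space d}

/-- The total variation along the foot of a column. -/
def colVar (T : Set (Space d)) (G : Space d → Space d) (e : Space d) (s : ℝ) (y : Space d) : ℝ :=
  ∫ t in 0..s, |colDeriv T G e y t|

theorem integrable_colDeriv_prod (hn : ‖n‖ = 1) (he : inner ℝ n e ≠ 0) (hT : IsOpen T)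
    (hb : volume T ≠ ⊤) (h : IsH1 T u G) :
    Integrable (fun q : Space d × ℝ => colDeriv T G e q.1 q.2) ((hypMeasure n p).prod volume) := by
  obtain ⟨iu, iG⟩ := h.integrable_indicator hT.measurableSet hb
  have h1 : Integrable (fun x => inner ℝ (T.indicator G x) e) := iG.inner_const e
  exact (integral_oblique hn he p h1).2

theorem integrable_colVar (hn : ‖n‖ = 1) (he : inner ℝ n e ≠ 0) (hT : IsOpen T)
    (hb : volume T ≠ ⊤) (h : IsH1 T u G) {s : ℝ} (hs : 0 ≤ s) :
    Integrable (colVar T G e s) (hypMeasure n p) := by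
  have := sigmaFinite_hypMeasure hn p
  have h1 := (integrable_colDeriv_prod (p := p) hn he hT hb h).abs
  have h2 : Integrable (fun q : Space d × ℝ => |colDeriv T G e q.1 q.2|)
      ((hypMeasure n p).prod (volume.restrict (Ioc 0 s))) :=
    h1.mono_measure (Measure.prod_mono le_rfl Measure.restrict_le_self)
  have h3 := h2.integral_prod_left
  refine h3.congr (Eventually.of_forall fun y => ?_)
  simp only [colVar, intervalIntegral.integral_of_le hs]

theorem colVar_nonneg {s : ℝ} (hs : 0 ≤ s) (y : Space d) : 0 ≤ colVar T G e s y :=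
  intervalIntegral.integral_nonneg hs fun _ _ => abs_nonneg _

theorem ae_tendsto_colVar (hn : ‖n‖ = 1) (he : inner ℝ n e ≠ 0) (hT : IsOpen T)
    (hb : volume T ≠ ⊤) (h : IsH1 T u G) :
    ∀ᵐ y ∂hypMeasure n p, Integrable (colDeriv T G e y) ∧
      Tendsto (fun s => colVar T G e s y) (𝓝[>] 0) (𝓝 0) := by
  have := sigmaFinite_hypMeasure hn p
  filter_upwards [(integrable_colDeriv_prod (p := p) hn he hT hb h).prod_right_ae] with y hy
  refine ⟨hy, ?_⟩
  have hc := intervalIntegral.continuous_primitive (f := fun t => |colDeriv T G e y t|)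
    (fun a b => hy.abs.intervalIntegrable) 0
  have h0 := hc.tendsto 0
  rw [intervalIntegral.integral_same] at h0
  exact h0.mono_left nhdsWithin_le_nhds

/-- The aspect ratio of the columns covering half-balls. -/
def colRatio (n e : Space d) : ℝ := 1 + (1 + ‖e‖) / |inner ℝ n e|

theorem colRatio_pos (n e : Space d) : 0 < colRatio n e := by
  unfold colRatio; positivity

/-- Pairing with `n` gives `t |⟨n, e⟩| < r`, hence `‖t • e‖ ≤ r ‖e‖ / |⟨n, e⟩|`, which bounds the
distance from `x` to the foot. The three summands of `colRatio` come from these estimates. -/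
theorem IsColumn.mem_of_mem_ball (hc : IsColumn T n p e V δ) {x : Space d} (hx : x ∈ hyp n p)
    {y : Space d} (hy : y ∈ hyp n p) {r t : ℝ}
    (hz : y + t • e ∈ Metric.ball x r) (hneg : inner ℝ n (y + t • e - p) < 0) :
    y ∈ Metric.closedBall x (colRatio n e * r) ∧ t ∈ Ioo 0 (colRatio n e * r) := by
  have hα := hc.inner_neg
  set α : ℝ := inner ℝ n e with hαdef
  have hαabs : |α| = -α := abs_of_neg hα
  have hαpos : 0 < -α := by linarith
  have hr : 0 < r := dist_nonneg.trans_lt (Metric.mem_ball.1 hz)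
  simp only [hyp, mem_ofPred_eq] at hx hy
  have e1 : inner ℝ n (y + t • e - p) = t * α := by
    have : y + t • e - p = (y - p) + t • e := by abel
    rw [this, inner_add_right, hy, inner_smul_right, zero_add]
  have e2 : inner ℝ n (y + t • e - x) = t * α := by
    have : y + t • e - x = (y + t • e - p) - (x - p) := by abel
    rw [this, inner_sub_right, e1, hx, sub_zero]
  rw [e1] at hneg
  have ht : 0 < t := by nlinarith
  have hzx : ‖y + t • e - x‖ < r := by rwa [← dist_eq_norm]
  have h3 : t * (-α) < r := by
    have := (abs_real_inner_le_norm n (y + t • e - x)).trans_lt (by rw [hc.norm_eq, one_mul]; exact hzx)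
    rw [e2, abs_lt] at this
    linarith [this.1]
  have h4 : t < r / (-α) := by rwa [lt_div_iff₀ hαpos]
  have hCr : colRatio n e * r = r + r / (-α) + ‖e‖ * (r / (-α)) := by
    rw [colRatio, ← hαdef, hαabs]; field_simp; ring
  have hpos2 : 0 < r / (-α) := by positivity
  have he0 := norm_nonneg e
  refine ⟨?_, ht, ?_⟩
  · rw [Metric.mem_closedBall, dist_eq_norm, hCr]
    have : y - x = (y + t • e - x) - t • e := by abel
    rw [this]
    refine (norm_sub_le _ _).trans ?_
    rw [norm_smul, Real.norm_of_nonneg ht.le]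
    have : t * ‖e‖ ≤ ‖e‖ * (r / (-α)) := by rw [mul_comm]; gcongr
    linarith
  · rw [hCr]
    have : 0 ≤ ‖e‖ * (r / (-α)) := by positivity
    linarith

/-- Sweep the half ball by columns. On each of them `u - c` is the error at the foot plus an
integral of the derivative, and the height inside the ball is at most `colRatio n e * r`. The
variation is taken up to a height `s` that is not tied to `r`, so that it is one fixed integrable
function to which Lebesgue points apply as `r` tends to `0`. -/
theorem IsColumn.lintegral_ball_le (hc : IsColumn T n p e V δ) (hT : IsOpen T)
    (hb : volume T ≠ ⊤) (h : IsH1 T u G) {x : Space d} (hx : x ∈ hyp n p) {r s c : ℝ}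
    (hloc : ∀ z ∈ Metric.ball x r, z ∈ T → inner ℝ n (z - p) < 0)
    (hr : 0 < r) (hrs : colRatio n e * r ≤ s) (hsδ : s ≤ δ)
    (hV : Metric.closedBall x (colRatio n e * r) ∩ hyp n p ⊆ V) :
    ∫⁻ z in Metric.ball x r ∩ T, ‖u z - c‖ₑ ≤
      ENNReal.ofReal (|inner ℝ n e| * (colRatio n e * r)) *
        ∫⁻ y in Metric.closedBall x (colRatio n e * r),
          ENNReal.ofReal (|colTrace T u G e δ y - c| + colVar T G e s y) ∂hypMeasure n p := by
  obtain ⟨iu, iG⟩ := h.integrable_indicator hT.measurableSet hb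
  have hα := hc.inner_neg.ne
  have hαpos : 0 < |(inner ℝ n e : ℝ)| := abs_pos.2 hα
  set Cr := colRatio n e * r with hCr
  have hCr0 : 0 < Cr := mul_pos (colRatio_pos n e) hr
  have hSm : MeasurableSet (Metric.ball x r ∩ T) := measurableSet_ball.inter hT.measurableSet
  set f : Space d → ℝ≥0∞ := (Metric.ball x r ∩ T).indicator fun z => ‖T.indicator u z - c‖ₑ with hf
  have hfm : AEMeasurable f :=
    ((iu.1.sub aestronglyMeasurable_const).enorm).indicator hSm
  have e1 : ∫⁻ z in Metric.ball x r ∩ T, ‖u z - c‖ₑ = ∫⁻ z, f z := by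
    rw [hf, lintegral_indicator hSm]
    refine setLIntegral_congr_fun hSm fun z hz => ?_
    simp [hz.2]
  have e2 := lintegral_oblique hc.norm_eq hα p hfm
  have e3 : ∫⁻ z, f z = ENNReal.ofReal |inner ℝ n e| *
      ∫⁻ y, (∫⁻ t : ℝ, f (y + t • e)) ∂hypMeasure n p := by
    rw [e2, ← mul_assoc, ← ENNReal.ofReal_mul (abs_nonneg _), mul_inv_cancel₀ hαpos.ne']
    simp
  rw [e1, e3, ENNReal.ofReal_mul (abs_nonneg _), mul_assoc]
  gcongr
  rw [← lintegral_const_mul' _ _ ENNReal.ofReal_ne_top,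
    ← lintegral_indicator Metric.isClosed_closedBall.measurableSet]
  have hH : ∀ᵐ y ∂hypMeasure n p, y ∈ hyp n p := ae_restrict_mem (measurableSet_hyp n p)
  have hVae := (ae_restrict_iff' hc.isOpen.measurableSet).1 (hc.ae_eq hT hb h)
  refine lintegral_mono_ae ?_
  filter_upwards [hH, hVae, ae_tendsto_colVar hc.norm_eq hα hT hb h] with y hy hyV hyI
  have hzero (t : ℝ) (hne : f (y + t • e) ≠ 0) : y ∈ Metric.closedBall x Cr ∧ t ∈ Ioo 0 Cr := by
    have hmem : y + t • e ∈ Metric.ball x r ∩ T := by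
      by_contra hcon
      exact hne (indicator_of_notMem hcon _)
    exact hc.mem_of_mem_ball hx hy hmem.1 (hloc _ hmem.1 hmem.2)
  by_cases hyB : y ∈ Metric.closedBall x Cr
  swap
  · have : ∀ t : ℝ, f (y + t • e) = 0 := fun t => by_contra fun hne => hyB (hzero t hne).1
    simp [this]
  rw [indicator_of_mem hyB]
  obtain ⟨-, -, hyt⟩ := hyV (hV ⟨hyB, hy⟩)
  calc ∫⁻ t : ℝ, f (y + t • e)
      = ∫⁻ t in Ioo 0 Cr, f (y + t • e) := by
        rw [← lintegral_indicator measurableSet_Ioo]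
        congr 1; ext t
        by_cases ht : t ∈ Ioo 0 Cr
        · rw [indicator_of_mem ht]
        · rw [indicator_of_notMem ht]
          exact by_contra fun hne => ht (hzero t hne).2
    _ ≤ ∫⁻ t in Ioo 0 Cr, ENNReal.ofReal (|colTrace T u G e δ y - c| + colVar T G e s y) := by
        refine lintegral_mono_ae ?_
        have hsub : Ioo 0 Cr ⊆ Ioo 0 δ := Ioo_subset_Ioo_right (hrs.trans hsδ)
        filter_upwards [ae_mono (Measure.restrict_mono hsub le_rfl) hyt,
          ae_restrict_mem measurableSet_Ioo] with t ht htm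
        refine (indicator_le_self' (fun _ _ => zero_le) _).trans ?_
        rw [ht, ← ofReal_norm, Real.norm_eq_abs]
        refine ENNReal.ofReal_le_ofReal ?_
        have e4 : colTrace T u G e δ y + (∫ τ in 0..t, colDeriv T G e y τ) - c =
          (colTrace T u G e δ y - c) + ∫ τ in 0..t, colDeriv T G e y τ := by ring
        rw [e4]
        refine (abs_add_le _ _).trans (add_le_add_right ?_ _)
        refine (intervalIntegral.abs_integral_le_integral_abs htm.1.le).trans ?_
        exact intervalIntegral.integral_mono_interval le_rfl htm.1.le (htm.2.le.trans hrs)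
          (Eventually.of_forall fun _ => abs_nonneg _) hyI.1.abs.intervalIntegrable
    _ = _ := by
        rw [setLIntegral_const, Real.volume_Ioo, sub_zero, mul_comm]

theorem IsColumn.integrable_indicator_colTrace (hc : IsColumn T n p e V δ) (hT : IsOpen T)
    (hb : volume T ≠ ⊤) (h : IsH1 T u G) :
    MemLp (colTrace T u G e δ) 2 ((hypMeasure n p).restrict V) ∧
    Integrable (V.indicator (colTrace T u G e δ)) (hypMeasure n p) := by
  have hm := aestronglyMeasurable_colTrace (p := p) hc.norm_eq hc.inner_neg.ne hT hb h hc.pos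
  have hfin : IsFiniteMeasure ((hypMeasure n p).restrict V) :=
    ⟨by simpa using hypMeasure_lt_top hc.norm_eq hc.bounded⟩
  have h2 : MemLp (colTrace T u G e δ) 2 ((hypMeasure n p).restrict V) := by
    refine ⟨hm.restrict, ?_⟩
    rw [eLpNorm_lt_top_iff_lintegral_rpow_enorm_lt_top two_ne_zero ENNReal.ofNat_ne_top]
    simp only [ENNReal.toReal_ofNat, ENNReal.rpow_ofNat]
    refine (hc.lintegral_colTrace_le hT hb h).trans_lt ?_
    rw [← ofReal_integral_norm_sq h.memLp, ← ofReal_integral_norm_sq h.memLp_grad]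
    finiteness
  refine ⟨h2, ?_⟩
  rw [integrable_indicator_iff hc.isOpen.measurableSet]
  exact h2.integrable (by norm_num)

/-- The half ball contains the ball of radius `r / 2` centred at `x - (r / 2) • n`. -/
theorem volume_half_ball_ge (hn : ‖n‖ = 1) {x : Space d} (hx : x ∈ hyp n p) {r : ℝ} (hr : 0 < r)
    (hloc : ∀ z ∈ Metric.ball x r, inner ℝ n (z - p) < 0 → z ∈ T) :
    ENNReal.ofReal ((r / 2) ^ d) * volume (Metric.ball (0 : Space d) 1) ≤
      volume (Metric.ball x r ∩ T) := by
  have h1 := Measure.addHaar_ball_of_pos (volume : Measure (Space d)) (x - (r / 2) • n) (half_pos hr)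
  rw [finrank_euclideanSpace_fin] at h1
  rw [← h1]
  refine measure_mono fun z hz => ?_
  rw [Metric.mem_ball, dist_eq_norm] at hz
  set v := z - (x - (r / 2) • n) with hv
  have hzx : z - x = v - (r / 2) • n := by rw [hv]; abel
  have hzb : z ∈ Metric.ball x r := by
    rw [Metric.mem_ball, dist_eq_norm, hzx]
    refine (norm_sub_le _ _).trans_lt ?_
    rw [norm_smul, hn, Real.norm_of_nonneg (half_pos hr).le]; linarith
  refine ⟨hzb, hloc z hzb ?_⟩
  have e1 : z - p = (x - p) + (v - (r / 2) • n) := by rw [← hzx]; abel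
  simp only [hyp, mem_ofPred_eq] at hx
  rw [e1, inner_add_right, hx, inner_sub_right, inner_smul_right, real_inner_self_eq_norm_sq, hn]
  have := (real_inner_le_norm n v)
  rw [hn, one_mul] at this
  linarith

theorem abs_average_sub_le {S : Set (Space d)} (hS : volume S ≠ ⊤) (hS0 : volume S ≠ 0)
    (hu : IntegrableOn u S) (c : ℝ) {B : ℝ} (hB : 0 ≤ B)
    (h : ∫⁻ z in S, ‖u z - c‖ₑ ≤ ENNReal.ofReal B) :
    |(⨍ z in S, u z) - c| ≤ (volume S).toReal⁻¹ * B := by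
  have hpos : 0 < (volume S).toReal := ENNReal.toReal_pos hS0 hS
  have hfin : IsFiniteMeasure (volume.restrict S) := ⟨by simpa using hS.lt_top⟩
  have e1 : (⨍ z in S, u z) - c = (volume S).toReal⁻¹ * ∫ z in S, (u z - c) := by
    rw [setAverage_eq, integral_sub hu (integrable_const c), setIntegral_const]
    simp only [Measure.real, smul_eq_mul]
    field_simp
  rw [e1, abs_mul, abs_of_pos (inv_pos.2 hpos)]
  gcongr
  rw [← Real.norm_eq_abs, ← ENNReal.ofReal_le_ofReal_iff hB, ofReal_norm]
  exact (enorm_integral_le_lintegral_enorm _).trans h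

/-- The trace, defined through averages over balls, is the boundary value along columns. -/
theorem IsColumn.tendsto_average (hc : IsColumn T n p e V δ) (hT : IsOpen T)
    (hb : volume T ≠ ⊤) (h : IsH1 T u G) :
    ∀ᵐ x ∂(hypMeasure n p).restrict V,
      (∃ r > 0, ∀ z ∈ Metric.ball x r, z ∈ T ↔ inner ℝ n (z - p) < 0) →
      Tendsto (fun r => ⨍ z in Metric.ball x r ∩ T, u z) (𝓝[>] 0)
        (𝓝 (colTrace T u G e δ x)) := by
  have hα := hc.inner_neg.ne
  have hδ := hc.pos
  have hfin : IsFiniteMeasure (volume.restrict T) := ⟨by simpa using hb.lt_top⟩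
  set C := colRatio n e with hC
  have hC0 : 0 < C := colRatio_pos n e
  have hgi := (hc.integrable_indicator_colTrace hT hb h).2
  set g := colTrace T u G e δ with hg
  have hs0 (m : ℕ) : 0 < δ / ((m : ℝ) + 1) := by positivity
  have hL1 := ae_hypMeasure_tendsto hc.norm_eq p hgi
  -- Lebesgue points are needed simultaneously for all heights that may be chosen later; a sequence
  -- of heights tending to `0` keeps the exceptional set null.
  have hL2 : ∀ᵐ x ∂hypMeasure n p, ∀ m : ℕ, Tendsto (fun r : ℝ => (r ^ (d - 1))⁻¹ *
      ∫ y in Metric.closedBall x r, |colVar T G e (δ / ((m : ℝ) + 1)) y -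
        colVar T G e (δ / ((m : ℝ) + 1)) x| ∂(hypMeasure n p)) (𝓝[>] 0) (𝓝 0) :=
    ae_all_iff.2 fun m => ae_hypMeasure_tendsto hc.norm_eq p
      (integrable_colVar hc.norm_eq hα hT hb h (hs0 m).le)
  filter_upwards [ae_restrict_of_ae hL1, ae_restrict_of_ae hL2,
    ae_restrict_of_ae (ae_tendsto_colVar (p := p) hc.norm_eq hα hT hb h),
    ae_restrict_of_ae (ae_restrict_mem (measurableSet_hyp n p)),
    ae_restrict_mem hc.isOpen.measurableSet] with x h1 h2 h3 hxH hxV ⟨r0, hr0, hloc⟩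
  -- A unit vector exists, so `d` is not `0` and the subtraction is not truncated.
  have hd : d - 1 + 1 = d := by
    rcases Nat.eq_zero_or_pos d with h0 | h0
    · exfalso
      subst h0
      have := hc.norm_eq
      rw [Subsingleton.elim n 0, norm_zero] at this
      exact zero_ne_one this
    · omega
  set v1 := (volume (Metric.ball (0 : Space d) 1)).toReal with hv1
  have hv1pos : 0 < v1 := ENNReal.toReal_pos (Metric.measure_ball_pos _ _ one_pos).ne'
    measure_ball_lt_top.ne
  -- The swept volume, of order `|⟨n, e⟩| (C r)^d`, divided by the lower bound `(r / 2)^d v1` for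
  -- the volume of the half ball.
  set K := |(inner ℝ n e : ℝ)| * C ^ d * 2 ^ d / v1 with hK
  have hK0 : 0 ≤ K := by positivity
  set A : ℝ → ℝ := fun r => (r ^ (d - 1))⁻¹ *
      ∫ y in Metric.closedBall x r, |V.indicator g y - V.indicator g x| ∂(hypMeasure n p) with hA
  set B : ℕ → ℝ → ℝ := fun m r => (r ^ (d - 1))⁻¹ *
      ∫ y in Metric.closedBall x r, |colVar T G e (δ / ((m : ℝ) + 1)) y -
        colVar T G e (δ / ((m : ℝ) + 1)) x| ∂(hypMeasure n p) with hB
  obtain ⟨ρ, hρ, hρV⟩ := Metric.isOpen_iff.1 hc.isOpen x hxV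
  have main (m : ℕ) (r : ℝ) (hr : 0 < r) (hrr0 : r ≤ r0) (hrs : C * r ≤ δ / ((m : ℝ) + 1))
      (hrρ : C * r < ρ) : |(⨍ z in Metric.ball x r ∩ T, u z) - g x| ≤
      K * (A (C * r) + B m (C * r) + unitFaceVolume d * colVar T G e (δ / ((m : ℝ) + 1)) x) := by
    have hCr : 0 < C * r := mul_pos hC0 hr
    set s := δ / ((m : ℝ) + 1) with hs
    have hsub : Metric.closedBall x (C * r) ⊆ V :=
      (Metric.closedBall_subset_ball hrρ).trans hρV
    have hbd := hc.lintegral_ball_le hT hb h hxH (r := r) (s := s) (c := g x)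
      (fun z hz hzT => (hloc z (Metric.ball_subset_ball hrr0 hz)).1 hzT) hr hrs
      (div_le_self hδ.le (by simp)) (inter_subset_left.trans hsub)
    rw [← hC] at hbd
    have hmb : hypMeasure n p (Metric.closedBall x (C * r)) =
        ENNReal.ofReal ((C * r) ^ (d - 1) * unitFaceVolume d) :=
      hypMeasure_closedBall hc.norm_eq hxH hCr.le
    have hfinb : IsFiniteMeasure ((hypMeasure n p).restrict (Metric.closedBall x (C * r))) :=
      ⟨by rw [Measure.restrict_apply_univ, hmb]; exact ENNReal.ofReal_lt_top⟩
    have hmc := Metric.isClosed_closedBall.measurableSet (s := Metric.closedBall x (C * r))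
    have hvi := integrable_colVar (p := p) hc.norm_eq hα hT hb h (s := s) (hs0 m).le
    have i1 : Integrable (fun y => |V.indicator g y - V.indicator g x|)
        ((hypMeasure n p).restrict (Metric.closedBall x (C * r))) :=
      (hgi.integrableOn.sub (integrable_const _)).abs
    have i2 : Integrable (fun y => |colVar T G e s y - colVar T G e s x|)
        ((hypMeasure n p).restrict (Metric.closedBall x (C * r))) :=
      (hvi.integrableOn.sub (integrable_const _)).abs
    have i12 : Integrable (fun y => |V.indicator g y - V.indicator g x| +
        |colVar T G e s y - colVar T G e s x|)
        ((hypMeasure n p).restrict (Metric.closedBall x (C * r))) := i1.add i2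
    have i123 : Integrable (fun y => |V.indicator g y - V.indicator g x| +
        |colVar T G e s y - colVar T G e s x| + colVar T G e s x)
        ((hypMeasure n p).restrict (Metric.closedBall x (C * r))) :=
      i12.add (integrable_const _)
    set J := (C * r) ^ (d - 1) * (A (C * r) + B m (C * r) +
      unitFaceVolume d * colVar T G e s x) with hJ
    have hJle : ∫⁻ y in Metric.closedBall x (C * r),
        ENNReal.ofReal (|g y - g x| + colVar T G e s y) ∂hypMeasure n p ≤ ENNReal.ofReal J := by
      have hJ' : J = ∫ y in Metric.closedBall x (C * r), (|V.indicator g y - V.indicator g x| +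
          |colVar T G e s y - colVar T G e s x| + colVar T G e s x) ∂hypMeasure n p := by
        rw [integral_add i12 (integrable_const _), integral_add i1 i2, setIntegral_const,
          Measure.real, hmb, ENNReal.toReal_ofReal (mul_nonneg (by positivity)
            (unitFaceVolume_pos d).le), hJ, hA, hB]
        simp only [smul_eq_mul, ← hs]
        field_simp
      rw [hJ', ofReal_integral_eq_lintegral_ofReal i123
        (Eventually.of_forall fun y => add_nonneg (add_nonneg (abs_nonneg _) (abs_nonneg _))
          (colVar_nonneg (hs0 m).le x))]
      refine setLIntegral_mono' hmc fun y hy => ENNReal.ofReal_le_ofReal ?_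
      rw [indicator_of_mem (hsub hy), indicator_of_mem hxV]
      linarith [le_abs_self (colVar T G e s y - colVar T G e s x)]
    have hJ0 : 0 ≤ J := by
      have a1 : 0 ≤ A (C * r) := mul_nonneg (by positivity)
        (integral_nonneg fun _ => abs_nonneg _)
      have a2 : 0 ≤ B m (C * r) := mul_nonneg (by positivity)
        (integral_nonneg fun _ => abs_nonneg _)
      have a3 := mul_nonneg (unitFaceVolume_pos d).le
        (colVar_nonneg (T := T) (G := G) (e := e) (hs0 m).le x)
      positivity
    have hbd2 : ∫⁻ z in Metric.ball x r ∩ T, ‖u z - g x‖ₑ ≤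
        ENNReal.ofReal (|inner ℝ n e| * (C * r) * J) := by
      rw [ENNReal.ofReal_mul (by positivity)]
      exact hbd.trans (mul_le_mul_right hJle _)
    have hvol := volume_half_ball_ge (T := T) hc.norm_eq hxH hr
      (fun z hz hneg => (hloc z (Metric.ball_subset_ball hrr0 hz)).2 hneg)
    have hvfin : volume (Metric.ball x r ∩ T) ≠ ⊤ := measure_ne_top_of_subset inter_subset_right hb
    have hvol' : (r / 2) ^ d * v1 ≤ (volume (Metric.ball x r ∩ T)).toReal := by
      have := ENNReal.toReal_mono hvfin hvol
      rwa [ENNReal.toReal_mul, ENNReal.toReal_ofReal (by positivity)] at this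
    have hvpos : 0 < (r / 2) ^ d * v1 := by positivity
    have hne : volume (Metric.ball x r ∩ T) ≠ 0 := fun h0 => by
      rw [h0] at hvol'; simp at hvol'; linarith
    have hui : IntegrableOn u (Metric.ball x r ∩ T) :=
      (show IntegrableOn u T volume from h.memLp.integrable (by norm_num)).mono_set inter_subset_right
    refine (abs_average_sub_le hvfin hne hui (g x) (by positivity) hbd2).trans ?_
    calc _ ≤ ((r / 2) ^ d * v1)⁻¹ * (|inner ℝ n e| * (C * r) * J) := by gcongr
      _ = _ := by
        rw [hJ, hK]
        have : (C * r) ^ d = (C * r) ^ (d - 1) * (C * r) := by rw [← pow_succ, hd]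
        have e5 : |inner ℝ n e| * (C * r) * ((C * r) ^ (d - 1) * (A (C * r) + B m (C * r) +
            unitFaceVolume d * colVar T G e s x)) = |inner ℝ n e| * (C * r) ^ d *
            (A (C * r) + B m (C * r) + unitFaceVolume d * colVar T G e s x) := by
          rw [this]; ring
        rw [e5, div_pow, mul_pow]
        field_simp
  rw [Metric.tendsto_nhds]
  intro ε hε
  have hCtend : Tendsto (fun r : ℝ => C * r) (𝓝[>] 0) (𝓝[>] 0) := by
    refine tendsto_nhdsWithin_iff.2 ⟨?_, ?_⟩
    · have : Tendsto (fun r : ℝ => C * r) (𝓝 0) (𝓝 (C * 0)) := tendsto_id.const_mul C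
      rw [mul_zero] at this
      exact this.mono_left nhdsWithin_le_nhds
    · filter_upwards [self_mem_nhdsWithin] with r hr using mul_pos hC0 hr
  have hstend : Tendsto (fun m : ℕ => δ / ((m : ℝ) + 1)) atTop (𝓝[>] 0) := by
    refine tendsto_nhdsWithin_iff.2 ⟨?_, Eventually.of_forall hs0⟩
    have := (tendsto_one_div_add_atTop_nhds_zero_nat (𝕜 := ℝ)).const_mul δ
    simpa [mul_one_div, div_eq_mul_inv] using this
  -- First fix a height that makes the variation at `x` small, then let the radius tend to `0`.
  have hm : ∃ m : ℕ, K * (unitFaceVolume d * colVar T G e (δ / ((m : ℝ) + 1)) x) < ε / 2 := by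
    have := ((h3.2.comp hstend).const_mul (unitFaceVolume d)).const_mul K
    simp only [mul_zero] at this
    exact (this.eventually (gt_mem_nhds (half_pos hε))).exists
  obtain ⟨m, hm⟩ := hm
  have hAB : Tendsto (fun r => K * (A (C * r) + B m (C * r))) (𝓝[>] 0) (𝓝 0) := by
    have := ((h1.comp hCtend).add ((h2 m).comp hCtend)).const_mul K
    simpa using this
  have hsmall : ∀ᶠ r in 𝓝[>] (0 : ℝ), C * r < min ρ (δ / ((m : ℝ) + 1)) := by
    have := (tendsto_nhdsWithin_iff.1 hCtend).1
    exact this.eventually (gt_mem_nhds (lt_min hρ (hs0 m)))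
  have hr0' : ∀ᶠ r in 𝓝[>] (0 : ℝ), r < r0 :=
    nhdsWithin_le_nhds (gt_mem_nhds hr0)
  filter_upwards [hAB.eventually (gt_mem_nhds (half_pos hε)), hsmall, hr0', self_mem_nhdsWithin]
    with r a1 a2 a3 a4
  rw [Real.dist_eq]
  refine (main m r a4 a3.le (a2.le.trans (min_le_right _ _)) (a2.trans_le (min_le_left _ _))).trans_lt ?_
  have : K * (A (C * r) + B m (C * r) + unitFaceVolume d * colVar T G e (δ / ((m : ℝ) + 1)) x) =
    K * (A (C * r) + B m (C * r)) + K * (unitFaceVolume d * colVar T G e (δ / ((m : ℝ) + 1)) x) := by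
    ring
  linarith

theorem IsColumn.trace_eq (hc : IsColumn T n p e V δ) (hT : IsOpen T)
    (hb : volume T ≠ ⊤) (h : IsH1 T u G)
    (hloc : ∀ x ∈ V, x ∈ hyp n p →
      ∃ r > 0, ∀ z ∈ Metric.ball x r, z ∈ T ↔ inner ℝ n (z - p) < 0) :
    trace T u =ᵐ[(hypMeasure n p).restrict V] colTrace T u G e δ := by
  filter_upwards [hc.tendsto_average hT hb h,
    ae_restrict_of_ae (ae_restrict_mem (measurableSet_hyp n p)),
    ae_restrict_mem hc.isOpen.measurableSet] with x hx hxH hxV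
  exact (hx (hloc x hxV hxH)).limUnder_eq

end ball

/-! ### Integration by parts near a flat piece of the boundary -/

section localIBP
variable {d : ℕ} {T : Set (Space d)} {n x₀ : Space d} {r₀ : ℝ} {u : Space d → ℝ}
  {G : Space d → Space d}

theorem integrable_mul_smooth {f φ : Space d → ℝ} {μ : Measure (Space d)} (hf : Integrable f μ)
    (hφ : Continuous φ) (hc : HasCompactSupport φ) : Integrable (fun x => f x * φ x) μ := by
  obtain ⟨C, hC⟩ := hφ.bounded_above_of_compact_support hc
  exact hf.mul_bdd hφ.aestronglyMeasurable (Eventually.of_forall hC)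

theorem continuous_fderiv_apply {φ : Space d → ℝ} (hφ : ContDiff ℝ ∞ φ) (e : Space d) :
    Continuous fun x => fderiv ℝ φ x e :=
  (hφ.continuous_fderiv (by simp)).clm_apply continuous_const

theorem hasCompactSupport_fderiv_apply {φ : Space d → ℝ} (hc : HasCompactSupport φ) (e : Space d) :
    HasCompactSupport fun x => fderiv ℝ φ x e :=
  HasCompactSupport.fderiv_apply (𝕜 := ℝ) hc e

/-- The integrand of the integration by parts formula. -/
def ibpIntegrand (u : Space d → ℝ) (G : Space d → Space d) (φ : Space d → ℝ) (e x : Space d) : ℝ :=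
  inner ℝ (G x) e * φ x + u x * fderiv ℝ φ x e

theorem IsH1.integrable_ibpIntegrand (h : IsH1 T u G) (hb : volume T ≠ ⊤)
    {φ : Space d → ℝ} (hφ : ContDiff ℝ ∞ φ) (hc : HasCompactSupport φ) (e : Space d) :
    IntegrableOn (ibpIntegrand u G φ e) T := by
  have hfin : IsFiniteMeasure (volume.restrict T) := ⟨by simpa using hb.lt_top⟩
  have i1 : Integrable (fun x => (inner ℝ (G x) e : ℝ)) (volume.restrict T) :=
    (h.memLp_grad.integrable (by norm_num)).inner_const e
  have i2 : Integrable u (volume.restrict T) := h.memLp.integrable (by norm_num)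
  exact (integrable_mul_smooth i1 hφ.continuous hc).add
    (integrable_mul_smooth i2 (continuous_fderiv_apply hφ e) (hasCompactSupport_fderiv_apply hc e))

theorem notMem_tsupport_fderiv {φ : Space d → ℝ} {x : Space d} (hx : x ∉ tsupport φ) (e : Space d) :
    φ x = 0 ∧ fderiv ℝ φ x e = 0 := by
  refine ⟨image_eq_zero_of_notMem_tsupport hx, ?_⟩
  have : fderiv ℝ φ x = 0 := by
    by_contra h
    exact hx (support_fderiv_subset ℝ h)
  simp [this]

theorem isColumn_of_half_ball (hn : ‖n‖ = 1) (hr : 0 < r₀)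
    (hloc : ∀ z ∈ Metric.ball x₀ r₀, z ∈ T ↔ inner ℝ n (z - x₀) < 0) {e : Space d}
    (he : (inner ℝ n e : ℝ) < 0) :
    IsColumn T n x₀ e (Metric.ball x₀ (r₀ / 2)) (r₀ / (2 * ‖e‖)) := by
  have he0 : 0 < ‖e‖ := norm_pos_iff.2 fun h => by simp [h] at he
  refine ⟨hn, he, by positivity, Metric.isOpen_ball, Metric.isBounded_ball, fun y hy hyH t ht => ?_⟩
  have hyH' : (inner ℝ n (y - x₀) : ℝ) = 0 := hyH
  have hz : y + t • e ∈ Metric.ball x₀ r₀ := by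
    rw [Metric.mem_ball, dist_eq_norm] at hy ⊢
    have : ‖t • e‖ < r₀ / 2 := by
      rw [norm_smul, Real.norm_of_nonneg ht.1.le]
      calc t * ‖e‖ < r₀ / (2 * ‖e‖) * ‖e‖ := by gcongr; exact ht.2
        _ = r₀ / 2 := by field_simp
    calc ‖y + t • e - x₀‖ = ‖(y - x₀) + t • e‖ := by congr 1; abel
      _ ≤ _ := norm_add_le _ _
      _ < r₀ := by linarith
  rw [hloc _ hz, show y + t • e - x₀ = (y - x₀) + t • e by abel, inner_add_right, hyH',
    inner_smul_right]
  nlinarith [ht.1]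

/-- Fubini along columns reduces the formula to `∫ (w ψ + u ψ') = -c ψ(0)` on `(0, δ)`, where `c` is
the boundary value. The cone condition `‖e‖ ≤ -2 ⟨n, e⟩` makes lines meeting the ball of radius `r₀
/ 8` do so with `|t| ‖e‖ < r₀ / 4`, below the top `δ ‖e‖ = r₀ / 2` of the column; therefore `ψ(δ) =
0` and the feet stay in the base. -/
theorem IsH1.integral_half_ball_of_inward (hn : ‖n‖ = 1) (hr : 0 < r₀)
    (hloc : ∀ z ∈ Metric.ball x₀ r₀, z ∈ T ↔ inner ℝ n (z - x₀) < 0) (hT : IsOpen T)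
    (hb : volume T ≠ ⊤) (h : IsH1 T u G) {e : Space d} (he : ‖e‖ ≤ -2 * inner ℝ n e) (he0 : e ≠ 0)
    {φ : Space d → ℝ} (hφ : ContDiff ℝ ∞ φ) (hφc : HasCompactSupport φ)
    (hs : tsupport φ ⊆ Metric.ball x₀ (r₀ / 8)) :
    ∫ x in T, ibpIntegrand u G φ e x =
      inner ℝ n e * ∫ x, trace T u x * φ x ∂hypMeasure n x₀ := by
  have hne : 0 < ‖e‖ := norm_pos_iff.2 he0
  have hα : (inner ℝ n e : ℝ) < 0 := by linarith
  have hc := isColumn_of_half_ball hn hr hloc hα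
  set δ := r₀ / (2 * ‖e‖) with hδd
  set V := Metric.ball x₀ (r₀ / 2) with hV
  have hδ : 0 < δ := hc.pos
  have hδe : δ * ‖e‖ = r₀ / 2 := by rw [hδd]; field_simp
  -- geometry of the lines
  have hnorm (y : Space d) (hy : y ∈ hyp n x₀) (t : ℝ) (ht : y + t • e ∈ tsupport φ) :
      |t| * ‖e‖ < r₀ / 4 ∧ y ∈ V := by
    have hyH' : (inner ℝ n (y - x₀) : ℝ) = 0 := hy
    have h1 : ‖y + t • e - x₀‖ < r₀ / 8 := by
      have := hs ht; rwa [Metric.mem_ball, dist_eq_norm] at this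
    have h2 : |(inner ℝ n (y + t • e - x₀) : ℝ)| ≤ ‖y + t • e - x₀‖ := by
      simpa [hn] using abs_real_inner_le_norm n (y + t • e - x₀)
    rw [show y + t • e - x₀ = (y - x₀) + t • e by abel, inner_add_right, hyH', inner_smul_right,
      zero_add, abs_mul, abs_of_neg hα] at h2
    have h3 : |t| * ‖e‖ < r₀ / 4 := by
      rw [show y + t • e - x₀ = (y - x₀) + t • e by abel] at h1
      nlinarith [abs_nonneg t]
    refine ⟨h3, ?_⟩
    rw [hV, Metric.mem_ball, dist_eq_norm]
    calc ‖y - x₀‖ = ‖(y + t • e - x₀) - t • e‖ := by congr 1; abel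
      _ ≤ ‖y + t • e - x₀‖ + ‖t • e‖ := norm_sub_le _ _
      _ < r₀ / 2 := by rw [norm_smul, Real.norm_eq_abs]; linarith
  set f : Space d → ℝ := T.indicator (ibpIntegrand u G φ e) with hf
  have hfi : Integrable f := (integrable_indicator_iff hT.measurableSet).2
    (h.integrable_ibpIntegrand hb hφ hφc e)
  have hline : ∀ᵐ y ∂hypMeasure n x₀,
      ∫ t : ℝ, f (y + t • e) = -(trace T u y * φ y) := by
    have hH : ∀ᵐ y ∂hypMeasure n x₀, y ∈ hyp n x₀ := ae_restrict_mem (measurableSet_hyp n x₀)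
    have htr := hc.trace_eq hT hb h (fun x hx hxH => ⟨r₀ / 2, half_pos hr, fun z hz => hloc z <| by
      rw [Metric.mem_ball] at hx hz ⊢
      linarith [dist_triangle z x x₀]⟩)
    have hae := hc.ae_eq hT hb h
    rw [EventuallyEq, ae_restrict_iff' Metric.isOpen_ball.measurableSet] at htr
    rw [ae_restrict_iff' Metric.isOpen_ball.measurableSet] at hae
    filter_upwards [hH, htr, hae] with y hy h1 h2
    have hyH' : (inner ℝ n (y - x₀) : ℝ) = 0 := hy
    by_cases hyV : y ∈ V
    swap
    · have e1 : φ y = 0 := by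
        refine image_eq_zero_of_notMem_tsupport fun hm => hyV ?_
        exact (hnorm y hy 0 (by simpa using hm)).2
      have e2 (t : ℝ) : f (y + t • e) = 0 := by
        have hnm : y + t • e ∉ tsupport φ := fun hm => hyV (hnorm y hy t hm).2
        have := notMem_tsupport_fderiv hnm e
        simp [hf, ibpIntegrand, this]
      simp [e1, e2]
    rw [h1 hyV]
    obtain ⟨hw, hu, hcy⟩ := h2 hyV
    set c := colTrace T u G e δ y
    set w := colDeriv T G e y
    set ψ : ℝ → ℝ := fun t => φ (y + t • e) with hψ
    have hψ1 : ContDiff ℝ 1 ψ := (hφ.of_le (by exact_mod_cast le_top)).comp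
      (contDiff_const.add (contDiff_id.smul contDiff_const))
    have hψd (t : ℝ) : deriv ψ t = fderiv ℝ φ (y + t • e) e :=
      (hasDerivAt_comp_line (hφ.differentiable (by simp) _)).deriv
    have hψδ : φ (y + δ • e) = 0 := by
      refine image_eq_zero_of_notMem_tsupport fun hm => ?_
      have := (hnorm y hy δ hm).1
      rw [abs_of_pos hδ] at this
      linarith
    -- Below the foot the line is outside `T`; above the column it is outside the support of `φ`.
    have e1 : ∫ t : ℝ, f (y + t • e) = ∫ t in Ioo 0 δ, f (y + t • e) := by
      refine (setIntegral_eq_integral_of_forall_compl_eq_zero fun t ht => ?_).symm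
      by_cases hm : y + t • e ∈ tsupport φ
      swap
      · have := notMem_tsupport_fderiv hm e
        simp [hf, ibpIntegrand, this]
      have h3 := (hnorm y hy t hm).1
      have htδ : t < δ := by
        by_contra hcon
        have : δ * ‖e‖ ≤ |t| * ‖e‖ := by
          gcongr; exact (not_lt.1 hcon).trans (le_abs_self _)
        linarith
      have ht0 : t ≤ 0 := by
        by_contra hcon; exact ht ⟨not_le.1 hcon, htδ⟩
      have hnT : y + t • e ∉ T := by
        rw [hloc _ (Metric.ball_subset_ball (by linarith) (hs hm)),
          show y + t • e - x₀ = (y - x₀) + t • e by abel, inner_add_right, hyH', inner_smul_right]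
        nlinarith
      simp [hf, hnT]
    have e2 : ∫ t in Ioo 0 δ, f (y + t • e) =
        ∫ t in Ioo 0 δ, (w t * ψ t + (c * deriv ψ t + (∫ τ in 0..t, w τ) * deriv ψ t)) := by
      refine integral_congr_ae ?_
      filter_upwards [hcy, ae_restrict_mem measurableSet_Ioo] with t h3 ht
      have hmem : y + t • e ∈ T := hc.mem y hyV hy t ht
      have h4 : u (y + t • e) = c + ∫ τ in 0..t, w τ := by
        rw [← h3, indicator_of_mem hmem]
      simp only [hf, indicator_of_mem hmem, ibpIntegrand, h4, hψd, w, colDeriv]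
      ring
    have cψ' : Continuous (deriv ψ) := hψ1.continuous_deriv le_rfl
    have i1 : IntervalIntegrable (fun t => w t * ψ t) volume 0 δ :=
      hw.mul_continuousOn hψ1.continuous.continuousOn
    have i2 : IntervalIntegrable (fun t => c * deriv ψ t) volume 0 δ :=
      (cψ'.const_mul c).intervalIntegrable _ _
    have hWc : ContinuousOn (fun t => ∫ τ in 0..t, w τ) (uIcc 0 δ) :=
      (hw.absolutelyContinuousOnInterval_intervalIntegral left_mem_uIcc).continuousOn
    have i3 : IntervalIntegrable (fun t => (∫ τ in 0..t, w τ) * deriv ψ t) volume 0 δ :=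
      (hWc.mul cψ'.continuousOn).intervalIntegrable
    rw [e1, e2, ← integral_Ioc_eq_integral_Ioo, ← intervalIntegral.integral_of_le hδ.le,
      intervalIntegral.integral_add i1 (i2.add i3), intervalIntegral.integral_add i2 i3,
      integral_primitive_mul_deriv hw hψ1, intervalIntegral.integral_const_mul,
      intervalIntegral.integral_deriv_eq_sub (fun t _ => hψ1.differentiable (by simp) t)
        (cψ'.intervalIntegrable _ _)]
    simp [hψ, hψδ]
  rw [← integral_indicator hT.measurableSet, (integral_oblique hn hα.ne x₀ hfi).1,
    integral_congr_ae hline, integral_neg, abs_of_neg hα]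
  ring

/-- Both sides are linear in the direction, and `j = (j - m • n) - (-(m • n))` is a difference of
two inward directions; `m ≥ 3 ‖j‖` puts the first one in the required cone. -/
theorem IsH1.integral_half_ball (hn : ‖n‖ = 1) (hr : 0 < r₀)
    (hloc : ∀ z ∈ Metric.ball x₀ r₀, z ∈ T ↔ inner ℝ n (z - x₀) < 0) (hT : IsOpen T)
    (hb : volume T ≠ ⊤) (h : IsH1 T u G) (j : Space d)
    {φ : Space d → ℝ} (hφ : ContDiff ℝ ∞ φ) (hφc : HasCompactSupport φ)
    (hs : tsupport φ ⊆ Metric.ball x₀ (r₀ / 8)) :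
    ∫ x in T, ibpIntegrand u G φ j x =
      inner ℝ n j * ∫ x, trace T u x * φ x ∂hypMeasure n x₀ := by
  set m := 3 * ‖j‖ + 1 with hm
  have hj := norm_nonneg j
  have hm0 : 0 < m := by positivity
  have hnn : (inner ℝ n n : ℝ) = 1 := by rw [real_inner_self_eq_norm_sq, hn]; norm_num
  have hnj : (inner ℝ n j : ℝ) ≤ ‖j‖ := by simpa [hn] using real_inner_le_norm n j
  have hin1 : (inner ℝ n (j - m • n) : ℝ) = inner ℝ n j - m := by
    rw [inner_sub_right, inner_smul_right, hnn, mul_one]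
  have hin2 : (inner ℝ n (-(m • n)) : ℝ) = - m := by
    rw [inner_neg_right, inner_smul_right, hnn, mul_one]
  have hmn : ‖m • n‖ = m := by rw [norm_smul, hn, mul_one, Real.norm_of_nonneg hm0.le]
  have h1 := h.integral_half_ball_of_inward hn hr hloc hT hb (e := j - m • n)
    (by rw [hin1]; have := norm_sub_le j (m • n); rw [hmn] at this; linarith)
    (fun h0 => by rw [h0] at hin1; simp at hin1; linarith) hφ hφc hs
  have h2 := h.integral_half_ball_of_inward hn hr hloc hT hb (e := -(m • n))
    (by rw [hin2, norm_neg, hmn]; linarith)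
    (fun h0 => by rw [h0] at hin2; simp at hin2; linarith) hφ hφc hs
  have h3 : ∫ x in T, ibpIntegrand u G φ j x = (∫ x in T, ibpIntegrand u G φ (j - m • n) x) -
      ∫ x in T, ibpIntegrand u G φ (-(m • n)) x := by
    rw [← integral_sub (h.integrable_ibpIntegrand hb hφ hφc _)
      (h.integrable_ibpIntegrand hb hφ hφc _)]
    refine integral_congr_ae (Eventually.of_forall fun x => ?_)
    simp only [ibpIntegrand, inner_sub_right, inner_neg_right, map_sub, map_neg]
    ring
  rw [h3, h1, h2, hin1, hin2]
  ring

end localIBP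

/-! ### From local to global integration by parts -/

section globalIBP
variable {d : ℕ} {T : Set (Space d)} {u : Space d → ℝ} {G : Space d → Space d}
  {ι : Type*} [Fintype ι] {ν : ι → Measure (Space d)} {N : ι → Space d} {τ : Space d → ℝ}

/-- The integration by parts formula for `u`, with boundary measures `ν`, normals `N` and boundary
values `τ`, tested with `φ` in the direction `j`. -/
def HasIBP (T : Set (Space d)) (u : Space d → ℝ) (G : Space d → Space d)
    (ν : ι → Measure (Space d)) (N : ι → Space d) (τ φ : Space d → ℝ) (j : Space d) : Prop :=
  ∫ x in T, ibpIntegrand u G φ j x = ∑ i, inner ℝ (N i) j * ∫ x, τ x * φ x ∂ν i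

theorem ibpIntegrand_mul {φ ψ : Space d → ℝ} (hφ : ContDiff ℝ ∞ φ) (hψ : ContDiff ℝ ∞ ψ)
    (j x : Space d) : ibpIntegrand u G (fun x => φ x * ψ x) j x =
      ibpIntegrand u G φ j x * ψ x + u x * (φ x * fderiv ℝ ψ x j) := by
  have h1 : DifferentiableAt ℝ φ x := hφ.differentiable (by simp) x
  have h2 : DifferentiableAt ℝ ψ x := hψ.differentiable (by simp) x
  simp only [ibpIntegrand, fderiv_fun_mul h1 h2]
  simp
  ring

theorem hasIBP_sum (hb : volume T ≠ ⊤) (h : IsH1 T u G) (hτ : ∀ i, Integrable τ (ν i))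
    {κ : Type*} (s : Finset κ) {φ : κ → Space d → ℝ} (j : Space d)
    (hφ : ∀ i ∈ s, ContDiff ℝ ∞ (φ i) ∧ HasCompactSupport (φ i))
    (hi : ∀ i ∈ s, HasIBP T u G ν N τ (φ i) j) :
    HasIBP T u G ν N τ (fun x => ∑ i ∈ s, φ i x) j := by
  have e1 : ∫ x in T, ibpIntegrand u G (fun x => ∑ i ∈ s, φ i x) j x =
      ∑ i ∈ s, ∫ x in T, ibpIntegrand u G (φ i) j x := by
    rw [← integral_finsetSum _ fun i hi => h.integrable_ibpIntegrand hb (hφ i hi).1 (hφ i hi).2 j]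
    refine integral_congr_ae (Eventually.of_forall fun x => ?_)
    simp only [ibpIntegrand]
    rw [fderiv_fun_sum fun i hi => (hφ i hi).1.differentiable (by simp) x]
    simp only [Finset.sum_add_distrib, Finset.mul_sum, sum_apply]
  unfold HasIBP
  rw [e1, Finset.sum_congr rfl hi, Finset.sum_comm]
  refine Finset.sum_congr rfl fun i _ => ?_
  rw [← Finset.mul_sum, ← integral_finsetSum _ fun k hk =>
    integrable_mul_smooth (hτ i) (hφ k hk).1.continuous (hφ k hk).2]
  simp only [Finset.mul_sum]

/-- The formula is linear in the test function, which a smooth partition of unity, subordinate to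
finitely many of the given neighbourhoods, cuts into local pieces. -/
theorem hasIBP_of_local (hb : volume T ≠ ⊤) (h : IsH1 T u G) (hτ : ∀ i, Integrable τ (ν i))
    (j : Space d) {φ : Space d → ℝ} (hφ : ContDiff ℝ ∞ φ) (hc : HasCompactSupport φ)
    (hloc : ∀ x ∈ tsupport φ, ∃ U : Set (Space d), IsOpen U ∧ x ∈ U ∧ ∀ ψ : Space d → ℝ,
      ContDiff ℝ ∞ ψ → HasCompactSupport ψ → tsupport ψ ⊆ U → HasIBP T u G ν N τ ψ j) :
    HasIBP T u G ν N τ φ j := by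
  choose! U hUo hxU hU using hloc
  obtain ⟨t, ht⟩ := hc.isCompact.elim_nhds_subcover' (fun x _ => U x)
    fun x hx => (hUo x hx).mem_nhds (hxU x hx)
  obtain ⟨f, hf⟩ := SmoothPartitionOfUnity.exists_isSubordinate (modelWithCornersSelf ℝ (Space d))
    (isClosed_tsupport φ) (fun i : t => U i.1) (fun i => hUo _ i.1.2)
    (ht.trans fun x hx => by simpa using hx)
  have hfc (i : t) : ContDiff ℝ ∞ (f i) := contMDiff_iff_contDiff.1 (f i).contMDiff
  have hsum : φ = fun x => ∑ i ∈ (Finset.univ : Finset t), φ x * f i x := by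
    funext x
    rw [← Finset.mul_sum]
    by_cases hx : x ∈ tsupport φ
    · rw [← finsum_eq_sum_of_fintype, f.sum_eq_one hx, mul_one]
    · rw [image_eq_zero_of_notMem_tsupport hx, zero_mul]
  rw [hsum]
  have hk (i : t) : ContDiff ℝ ∞ (fun x => φ x * f i x) ∧ HasCompactSupport fun x => φ x * f i x :=
    ⟨hφ.mul (hfc i), hc.mul_right⟩
  refine hasIBP_sum hb h hτ _ j (fun i _ => hk i) fun i _ => ?_
  exact hU _ i.1.2 _ (hk i).1 (hk i).2 (tsupport_mul_subset_right.trans (hf i))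

/-! ### Removing sets of codimension two -/

/-- The affine subspace of codimension two through `p` orthogonal to `a` and `b`. -/
def codimTwo (a b p : Space d) : Set (Space d) := {x | inner ℝ a (x - p) = 0 ∧ inner ℝ b (x - p) = 0}

/-- The box neighbourhood of `codimTwo`. -/
def codimTwoNhd (a b p : Space d) (ε : ℝ) : Set (Space d) :=
  {x | |inner ℝ a (x - p)| ≤ ε ∧ |inner ℝ b (x - p)| ≤ ε}

theorem isClosed_codimTwoNhd (a b p : Space d) (ε : ℝ) : IsClosed (codimTwoNhd a b p ε) :=
  (isClosed_le (f := fun x : Space d => |(inner ℝ a (x - p) : ℝ)|) (by fun_prop)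
    continuous_const).inter
  (isClosed_le (f := fun x : Space d => |(inner ℝ b (x - p) : ℝ)|) (by fun_prop) continuous_const)

/-- In an orthonormal basis completing `a`, `b` the set lies in a box with two sides of length `2 ε`
and `d - 2` sides of length `2 R`. The power `ε²` is what makes the set removable. -/
theorem volume_codimTwoNhd_le (hd : 2 ≤ d) {a b p : Space d} (ha : ‖a‖ = 1) (hbn : ‖b‖ = 1)
    (hab : inner ℝ a b = (0 : ℝ)) {ε R : ℝ} (hε : 0 ≤ ε) (hR : 0 ≤ R) :
    volume (codimTwoNhd a b p ε ∩ Metric.closedBall p R) ≤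
      ENNReal.ofReal ((2 * ε) ^ 2 * (2 * R) ^ (d - 2)) := by
  set i0 : Fin d := ⟨0, by omega⟩
  set i1 : Fin d := ⟨1, by omega⟩
  have h01 : i0 ≠ i1 := by simp [i0, i1]
  obtain ⟨B, hB⟩ := Orthonormal.exists_orthonormalBasis_extension_of_card_eq (𝕜 := ℝ)
    (E := Space d) (ι := Fin d) (by simp) (v := fun i => if i = i0 then a else b) (s := {i0, i1}) (by
      rw [orthonormal_iff_ite]
      rintro ⟨i, hi⟩ ⟨j, hj⟩
      have hba : (inner ℝ b a : ℝ) = 0 := by rw [real_inner_comm]; exact hab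
      have haa : (inner ℝ a a : ℝ) = 1 := by rw [real_inner_self_eq_norm_sq, ha]; norm_num
      have hbb : (inner ℝ b b : ℝ) = 1 := by rw [real_inner_self_eq_norm_sq, hbn]; norm_num
      change (inner ℝ (if i = i0 then a else b) (if j = i0 then a else b) : ℝ) = _
      simp only [Subtype.mk.injEq]
      rcases hi with hi | hi <;> rcases hj with hj | hj <;>
        (try rw [mem_singleton_iff] at hi) <;> (try rw [mem_singleton_iff] at hj) <;>
        simp only [hi, hj, h01, h01.symm, if_true, if_false, hab, hba, haa, hbb])
  have hB0 : B i0 = a := by simpa using hB i0 (by simp)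
  have hB1 : B i1 = b := by simpa [h01.symm] using hB i1 (by simp)
  have hmp : MeasurePreserving (fun x : Space d => (WithLp.ofLp (B.repr (x - p)) : Fin d → ℝ)) :=
    (PiLp.volume_preserving_ofLp (Fin d)).comp
      (B.measurePreserving_repr.comp (measurePreserving_sub_right volume p))
  set w : Fin d → ℝ := fun i => if i = i0 ∨ i = i1 then ε else R with hw
  have hsub : codimTwoNhd a b p ε ∩ Metric.closedBall p R ⊆
      (fun x : Space d => (WithLp.ofLp (B.repr (x - p)) : Fin d → ℝ)) ⁻¹'
        (Icc (fun i => - w i) w) := by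
    rintro x ⟨⟨h1, h2⟩, h3⟩
    have key (i : Fin d) : |WithLp.ofLp (B.repr (x - p)) i| ≤ w i := by
      rw [B.repr_apply_apply, hw]
      dsimp only
      split_ifs with hi
      · rcases hi with rfl | rfl
        · rwa [hB0]
        · rwa [hB1]
      · refine (abs_real_inner_le_norm _ _).trans ?_
        rw [B.norm_eq_one, one_mul]
        simpa [dist_eq_norm] using h3
    exact ⟨fun i => (abs_le.1 (key i)).1, fun i => (abs_le.1 (key i)).2⟩
  refine (measure_mono hsub).trans ?_
  rw [hmp.measure_preimage measurableSet_Icc.nullMeasurableSet, Real.volume_Icc_pi,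
    ← ENNReal.ofReal_prod_of_nonneg (fun i _ => by
      have : 0 ≤ w i := by rw [hw]; dsimp only; split_ifs <;> assumption
      linarith)]
  refine ENNReal.ofReal_le_ofReal (le_of_eq ?_)
  rw [← Finset.prod_mul_prod_compl ({i0, i1} : Finset (Fin d)), Finset.prod_pair h01]
  rw [Finset.prod_congr rfl (g := fun _ => 2 * R) (fun i hi => ?_), Finset.prod_const,
    Finset.card_compl, Finset.card_pair h01, Fintype.card_fin]
  · simp only [hw, true_or, or_true, if_true]; ring
  · simp only [Finset.mem_compl, Finset.mem_insert, Finset.mem_singleton] at hi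
    simp only [hw, if_neg hi]; ring

/-- A smooth even step function. -/
def evenStep (s : ℝ) : ℝ := Real.smoothTransition (s ^ 2 - 1)

theorem contDiff_evenStep : ContDiff ℝ ∞ evenStep :=
  Real.smoothTransition.contDiff.comp ((contDiff_id.pow 2).sub contDiff_const)

theorem evenStep_of_le {s : ℝ} (hs : |s| ≤ 1) : evenStep s = 0 :=
  Real.smoothTransition.zero_of_nonpos (by nlinarith [sq_abs s, abs_nonneg s])

theorem evenStep_of_ge {s : ℝ} (hs : 2 ≤ |s|) : evenStep s = 1 :=
  Real.smoothTransition.one_of_one_le (by nlinarith [sq_abs s, abs_nonneg s])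

theorem evenStep_mem (s : ℝ) : evenStep s ∈ Icc (0 : ℝ) 1 :=
  ⟨Real.smoothTransition.nonneg _, Real.smoothTransition.le_one _⟩

theorem exists_abs_deriv_evenStep_le : ∃ C : ℝ, 0 ≤ C ∧ ∀ s, |deriv evenStep s| ≤ C := by
  have hcs : HasCompactSupport (deriv evenStep) := by
    refine HasCompactSupport.intro' (isCompact_Icc (a := -2) (b := 2)) isClosed_Icc fun s hs => ?_
    have hs2 : 2 < |s| := by
      by_contra hcon
      exact hs ⟨(abs_le.1 (not_lt.1 hcon)).1, (abs_le.1 (not_lt.1 hcon)).2⟩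
    have : evenStep =ᶠ[𝓝 s] fun _ => 1 := by
      filter_upwards [continuous_abs.continuousAt.eventually (lt_mem_nhds hs2)] with r hr
      exact evenStep_of_ge hr.le
    rw [this.deriv_eq]; simp
  obtain ⟨C, hC⟩ := (contDiff_evenStep.continuous_deriv (by simp)).bounded_above_of_compact_support
    hcs
  exact ⟨C, (norm_nonneg _).trans (hC 0), hC⟩

/-- A cutoff that vanishes near `codimTwo a b p`. -/
def codimTwoCutoff (a b p : Space d) (m : ℝ) (x : Space d) : ℝ :=
  1 - (1 - evenStep (m * inner ℝ a (x - p))) * (1 - evenStep (m * inner ℝ b (x - p)))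

theorem contDiff_codimTwoCutoff (a b p : Space d) (m : ℝ) :
    ContDiff ℝ ∞ (codimTwoCutoff a b p m) := by
  have h (a : Space d) : ContDiff ℝ ∞ fun x : Space d => evenStep (m * inner ℝ a (x - p)) :=
    contDiff_evenStep.comp (contDiff_const.mul (contDiff_const.inner ℝ (contDiff_id.sub contDiff_const)))
  exact contDiff_const.sub ((contDiff_const.sub (h a)).mul (contDiff_const.sub (h b)))

theorem codimTwoCutoff_mem (a b p : Space d) (m : ℝ) (x : Space d) :
    codimTwoCutoff a b p m x ∈ Icc (0 : ℝ) 1 := by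
  have h1 := evenStep_mem (m * inner ℝ a (x - p))
  have h2 := evenStep_mem (m * inner ℝ b (x - p))
  constructor <;> simp only [codimTwoCutoff] <;> nlinarith [h1.1, h1.2, h2.1, h2.2]

theorem codimTwoCutoff_eq_one {a b p : Space d} {m : ℝ} (hm : 0 < m) {x : Space d}
    (hx : x ∉ codimTwoNhd a b p (2 / m)) : codimTwoCutoff a b p m x = 1 := by
  have key (y : ℝ) (hy : ¬ |y| ≤ 2 / m) : evenStep (m * y) = 1 := by
    refine evenStep_of_ge ?_
    rw [abs_mul, abs_of_pos hm]
    rw [not_le, div_lt_iff₀ hm] at hy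
    linarith
  simp only [codimTwoNhd, mem_ofPred_eq, not_and_or] at hx
  rcases hx with hx | hx <;> simp [codimTwoCutoff, key _ hx]

theorem disjoint_tsupport_codimTwoCutoff {a b p : Space d} {m : ℝ} :
    Disjoint (tsupport (codimTwoCutoff a b p m)) (codimTwo a b p) := by
  rw [Set.disjoint_right]
  rintro x ⟨h1, h2⟩ hx
  rw [tsupport, mem_closure_iff_nhds] at hx
  have c1 : Continuous fun y : Space d => |m * inner ℝ a (y - p)| := by fun_prop
  have c2 : Continuous fun y : Space d => |m * inner ℝ b (y - p)| := by fun_prop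
  have hU : {y | |m * inner ℝ a (y - p)| < 1 ∧ |m * inner ℝ b (y - p)| < 1} ∈ 𝓝 x :=
    ((isOpen_lt c1 continuous_const).inter (isOpen_lt c2 continuous_const)).mem_nhds
      (by simp [h1, h2])
  obtain ⟨y, ⟨hy1, hy2⟩, hy⟩ := hx _ hU
  exact hy (by simp [codimTwoCutoff, evenStep_of_le hy1.le, evenStep_of_le hy2.le])

theorem fderiv_codimTwoCutoff_eq_zero {a b p : Space d} {m : ℝ} (hm : 0 < m) {x : Space d}
    (hx : x ∉ codimTwoNhd a b p (2 / m)) : fderiv ℝ (codimTwoCutoff a b p m) x = 0 := by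
  have : codimTwoCutoff a b p m =ᶠ[𝓝 x] fun _ => 1 := by
    filter_upwards [(isClosed_codimTwoNhd a b p (2 / m)).isOpen_compl.mem_nhds hx] with y hy
    exact codimTwoCutoff_eq_one hm hy
  rw [this.fderiv_eq]; simp

theorem exists_abs_fderiv_codimTwoCutoff_le {a b : Space d} (ha : ‖a‖ = 1) (hb : ‖b‖ = 1)
    (p j : Space d) : ∃ C : ℝ, 0 ≤ C ∧ ∀ m : ℝ, 0 < m → ∀ x,
      |fderiv ℝ (codimTwoCutoff a b p m) x j| ≤ C * m := by
  obtain ⟨C, hC0, hC⟩ := exists_abs_deriv_evenStep_le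
  refine ⟨2 * C * ‖j‖, by positivity, fun m hm x => ?_⟩
  have key (a : Space d) : HasDerivAt (fun t : ℝ => evenStep (m * inner ℝ a (x + t • j - p)))
      (deriv evenStep (m * inner ℝ a (x - p)) * (m * inner ℝ a j)) 0 := by
    have h1 : HasDerivAt (fun t : ℝ => m * (inner ℝ a (x + t • j - p) : ℝ)) (m * inner ℝ a j) 0 := by
      have : (fun t : ℝ => m * (inner ℝ a (x + t • j - p) : ℝ)) =
          fun t => m * inner ℝ a (x - p) + t * (m * inner ℝ a j) := by
        funext t
        rw [show x + t • j - p = (x - p) + t • j by abel, inner_add_right, inner_smul_right]; ring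
      rw [this]
      simpa using ((hasDerivAt_id (0 : ℝ)).mul_const (m * inner ℝ a j)).const_add
        (m * inner ℝ a (x - p))
    have h2 : HasDerivAt evenStep (deriv evenStep (m * inner ℝ a (x - p)))
        (m * inner ℝ a (x + (0 : ℝ) • j - p)) := by
      simp only [zero_smul, add_zero]
      exact (contDiff_evenStep.differentiable (by simp) _).hasDerivAt
    exact HasDerivAt.comp (h₂ := evenStep) (0 : ℝ) h2 h1
  have hd1 := (((key a).const_sub 1).mul ((key b).const_sub 1)).const_sub 1
  have hd2 : HasDerivAt (fun t : ℝ => codimTwoCutoff a b p m (x + t • j))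
      (fderiv ℝ (codimTwoCutoff a b p m) (x + (0 : ℝ) • j) j) 0 :=
    hasDerivAt_comp_line ((contDiff_codimTwoCutoff a b p m).differentiable (by simp) _)
  have heq := hd2.unique hd1
  simp only [zero_smul, add_zero] at heq
  rw [heq]
  have bd (a b : Space d) (ha : ‖a‖ = 1) :
      |deriv evenStep (m * inner ℝ a (x - p)) * (m * inner ℝ a j) *
        (1 - evenStep (m * inner ℝ b (x - p)))| ≤ C * (m * ‖j‖) * 1 := by
    have h1 : |(inner ℝ a j : ℝ)| ≤ ‖j‖ := by simpa [ha] using abs_real_inner_le_norm a j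
    have h2 := evenStep_mem (m * inner ℝ b (x - p))
    rw [abs_mul, abs_mul, abs_mul, abs_of_pos hm]
    gcongr
    · exact hC _
    · rw [abs_le]; constructor <;> linarith [h2.1, h2.2]
  have b1 := abs_le.1 (bd a b ha)
  have b2 := abs_le.1 (bd b a hb)
  rw [abs_le]
  constructor <;> linarith [b1.1, b1.2, b2.1, b2.2]

/-- Sets of codimension two are removable for functions in `L²`. The only nontrivial error is `∫ u φ
∂χ_m`: the derivative of the cutoff is `O(m)` on a set of measure `O(m⁻²)`, so by Cauchy–Schwarz the
square of the error is at most a constant times the integral of `u²` over a shrinking set. -/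
theorem HasIBP.of_codimTwoCutoff (hd : 2 ≤ d) (hb : volume T ≠ ⊤) (h : IsH1 T u G)
    (hτ : ∀ i, Integrable τ (ν i)) (j : Space d) {φ : Space d → ℝ} (hφ : ContDiff ℝ ∞ φ)
    (hc : HasCompactSupport φ) {a b p : Space d} (ha : ‖a‖ = 1) (hbn : ‖b‖ = 1)
    (hab : inner ℝ a b = (0 : ℝ)) (hν : ∀ i, ν i (codimTwo a b p) = 0)
    (hm : ∀ m : ℝ, 0 < m →
      HasIBP T u G ν N τ (fun x => φ x * codimTwoCutoff a b p m x) j) :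
    HasIBP T u G ν N τ φ j := by
  have hcut : ∀ x ∉ codimTwo a b p,
      ∀ᶠ m : ℕ in atTop, codimTwoCutoff a b p ((m : ℝ) + 1) x = 1 := by
    intro x hx
    have hpos : ∃ ε > 0, x ∉ codimTwoNhd a b p ε := by
      simp only [codimTwo, mem_ofPred_eq, not_and_or] at hx
      rcases hx with hx | hx
      · exact ⟨_, half_pos (abs_pos.2 hx), fun hcon => by
          have := hcon.1; linarith [abs_pos.2 hx]⟩
      · exact ⟨_, half_pos (abs_pos.2 hx), fun hcon => by
          have := hcon.2; linarith [abs_pos.2 hx]⟩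
    obtain ⟨ε, hε, hxε⟩ := hpos
    obtain ⟨M, hM⟩ := exists_nat_gt (2 / ε)
    filter_upwards [eventually_ge_atTop M] with m hmM
    refine codimTwoCutoff_eq_one (by positivity) fun hcon => hxε ?_
    have : 2 / ((m : ℝ) + 1) ≤ ε := by
      rw [div_le_iff₀ (by positivity)]
      rw [div_lt_iff₀ hε] at hM
      have : (M : ℝ) ≤ m := by exact_mod_cast hmM
      nlinarith
    exact ⟨hcon.1.trans this, hcon.2.trans this⟩
  have hcutc (m : ℝ) := (contDiff_codimTwoCutoff a b p m).continuous
  have hcutb (m : ℝ) (x : Space d) : |codimTwoCutoff a b p m x| ≤ 1 := by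
    have := codimTwoCutoff_mem a b p m x
    rw [abs_of_nonneg this.1]; exact this.2
  -- the boundary terms
  have hR : Tendsto (fun m : ℕ => ∑ i, inner ℝ (N i) j *
      ∫ x, τ x * (φ x * codimTwoCutoff a b p ((m : ℝ) + 1) x) ∂ν i) atTop
      (𝓝 (∑ i, inner ℝ (N i) j * ∫ x, τ x * φ x ∂ν i)) := by
    refine tendsto_finsetSum _ fun i _ => Tendsto.const_mul _ ?_
    have hi := integrable_mul_smooth (hτ i) hφ.continuous hc
    refine tendsto_integral_filter_of_dominated_convergence (fun x => ‖τ x * φ x‖)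
      (Eventually.of_forall fun m => ?_) (Eventually.of_forall fun m =>
        Eventually.of_forall fun x => ?_) hi.norm ?_
    · exact (hτ i).1.mul (hφ.continuous.mul (hcutc _)).aestronglyMeasurable
    · rw [← mul_assoc, norm_mul]
      exact mul_le_of_le_one_right (norm_nonneg _) (hcutb _ x)
    · have : ∀ᵐ x ∂ν i, x ∉ codimTwo a b p := measure_eq_zero_iff_ae_notMem.1 (hν i)
      filter_upwards [this] with x hx
      refine tendsto_const_nhds.congr' ?_
      filter_upwards [hcut x hx] with m hm
      rw [hm, mul_one]
  -- the volume terms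
  have hvol0 : volume (codimTwo a b p) = 0 := by
    have hne : ∃ x : Space d, ((innerSL ℝ a).toLinearMap.toAffineMap -
        AffineMap.const ℝ (Space d) (inner ℝ a p : ℝ)) x ≠ 0 :=
      ⟨p + a, by simp [inner_add_right, ha]⟩
    refine measure_mono_null (fun x hx => ?_) (volume_affine_eq_zero _ hne)
    have := hx.1
    rw [inner_sub_right] at this
    simpa using this
  have hL1 : Tendsto (fun m : ℕ => ∫ x in T,
      ibpIntegrand u G φ j x * codimTwoCutoff a b p ((m : ℝ) + 1) x) atTop
      (𝓝 (∫ x in T, ibpIntegrand u G φ j x)) := by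
    have hi := h.integrable_ibpIntegrand hb hφ hc j
    refine tendsto_integral_filter_of_dominated_convergence (fun x => ‖ibpIntegrand u G φ j x‖)
      (Eventually.of_forall fun m => ?_) (Eventually.of_forall fun m =>
        Eventually.of_forall fun x => ?_) hi.norm ?_
    · exact hi.1.mul (hcutc _).aestronglyMeasurable
    · rw [norm_mul]
      exact mul_le_of_le_one_right (norm_nonneg _) (hcutb _ x)
    · have : ∀ᵐ x ∂volume.restrict T, x ∉ codimTwo a b p :=
        ae_restrict_of_ae (measure_eq_zero_iff_ae_notMem.1 hvol0)
      filter_upwards [this] with x hx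
      refine tendsto_const_nhds.congr' ?_
      filter_upwards [hcut x hx] with m hm
      rw [hm, mul_one]
  -- the commutator term
  obtain ⟨Cφ, hCφ⟩ := hφ.continuous.bounded_above_of_compact_support hc
  have hCφ0 : 0 ≤ Cφ := (norm_nonneg _).trans (hCφ 0)
  obtain ⟨Cc, hCc0, hCc⟩ := exists_abs_fderiv_codimTwoCutoff_le ha hbn p j
  obtain ⟨R, hR0, hRs⟩ : ∃ R, 0 ≤ R ∧ tsupport φ ⊆ Metric.closedBall p R := by
    obtain ⟨R, hR⟩ := hc.isCompact.isBounded.subset_closedBall p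
    exact ⟨max R 0, le_max_right _ _, hR.trans (Metric.closedBall_subset_closedBall (le_max_left _ _))⟩
  set D : ℕ → Set (Space d) := fun m =>
    codimTwoNhd a b p (2 / ((m : ℝ) + 1)) ∩ Metric.closedBall p R with hD
  have hDm (m : ℕ) : MeasurableSet (D m) :=
    (isClosed_codimTwoNhd _ _ _ _).measurableSet.inter Metric.isClosed_closedBall.measurableSet
  have hDv (m : ℕ) : volume (D m) ≤
      ENNReal.ofReal ((2 * (2 / ((m : ℝ) + 1))) ^ 2 * (2 * R) ^ (d - 2)) :=
    volume_codimTwoNhd_le hd ha hbn hab (by positivity) hR0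
  have hD0 : Tendsto (fun m => volume (D m)) atTop (𝓝 0) := by
    refine tendsto_of_tendsto_of_tendsto_of_le_of_le tendsto_const_nhds ?_ (fun _ => zero_le) hDv
    rw [← ENNReal.ofReal_zero]
    refine ENNReal.tendsto_ofReal ?_
    have h1 : Tendsto (fun m : ℕ => 1 / ((m : ℝ) + 1)) atTop (𝓝 0) :=
      tendsto_one_div_add_atTop_nhds_zero_nat
    have := ((h1.const_mul 4).pow 2).mul_const ((2 * R) ^ (d - 2))
    simp only [mul_zero, ne_eq, OfNat.ofNat_ne_zero, not_false_eq_true, zero_pow, zero_mul] at this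
    refine this.congr fun m => ?_
    congr 2
    ring
  have hufin : ∫⁻ x in T, ‖u x‖ₑ ^ 2 ≠ ⊤ := by
    rw [← ofReal_integral_norm_sq h.memLp]; exact ENNReal.ofReal_ne_top
  have hu0 : Tendsto (fun m => ∫⁻ x in D m, ‖u x‖ₑ ^ 2 ∂volume.restrict T) atTop (𝓝 0) := by
    refine tendsto_setLIntegral_zero hufin ?_
    refine tendsto_of_tendsto_of_tendsto_of_le_of_le tendsto_const_nhds hD0 (fun _ => zero_le)
      fun m => Measure.restrict_apply_le _ _
  -- The squared gradient bound and the volume bound are multiplied: the powers of `m + 1` cancel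
  -- and `(2 * 2)² = 16` remains.
  set K : ℝ := (Cφ * Cc) ^ 2 * (16 * (2 * R) ^ (d - 2)) with hK
  have hbound (m : ℕ) : ‖∫ x in T, u x * (φ x * fderiv ℝ (codimTwoCutoff a b p ((m : ℝ) + 1)) x j)‖ₑ ^ 2
      ≤ ENNReal.ofReal K * ∫⁻ x in D m, ‖u x‖ₑ ^ 2 ∂volume.restrict T := by
    have hm1 : (0 : ℝ) < (m : ℝ) + 1 := by positivity
    have h1 : ‖∫ x in T, u x * (φ x * fderiv ℝ (codimTwoCutoff a b p ((m : ℝ) + 1)) x j)‖ₑ ≤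
        ENNReal.ofReal (Cφ * (Cc * ((m : ℝ) + 1))) * ∫⁻ x in D m, ‖u x‖ₑ * 1 ∂volume.restrict T := by
      refine (enorm_integral_le_lintegral_enorm _).trans ?_
      rw [← lintegral_const_mul' _ _ ENNReal.ofReal_ne_top, ← lintegral_indicator (hDm m)]
      refine lintegral_mono fun x => ?_
      by_cases hx : x ∈ D m
      · rw [indicator_of_mem hx, enorm_mul, mul_one, mul_comm]
        gcongr
        rw [← ofReal_norm, norm_mul]
        refine ENNReal.ofReal_le_ofReal ?_
        gcongr
        · exact hCφ x
        · exact hCc _ hm1 x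
      · rw [indicator_of_notMem hx]
        have : φ x * fderiv ℝ (codimTwoCutoff a b p ((m : ℝ) + 1)) x j = 0 := by
          rw [hD, mem_inter_iff, not_and_or] at hx
          rcases hx with hx | hx
          · rw [fderiv_codimTwoCutoff_eq_zero hm1 hx]; simp
          · rw [image_eq_zero_of_notMem_tsupport fun hcon => hx (hRs hcon), zero_mul]
        simp [this]
    have hum : AEMeasurable (fun x => ‖u x‖ₑ) ((volume.restrict T).restrict (D m)) :=
      h.memLp.1.enorm.restrict
    have h2 := lintegral_mul_sq_le ((volume.restrict T).restrict (D m)) hum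
      (aemeasurable_const (b := (1 : ℝ≥0∞)))
    have h3 : ∫⁻ _ in D m, (1 : ℝ≥0∞) ^ 2 ∂volume.restrict T ≤
        ENNReal.ofReal ((2 * (2 / ((m : ℝ) + 1))) ^ 2 * (2 * R) ^ (d - 2)) := by
      simp only [one_pow, lintegral_const, one_mul, Measure.restrict_apply_univ]
      exact (Measure.restrict_apply_le _ _).trans (hDv m)
    calc _ ≤ (ENNReal.ofReal (Cφ * (Cc * ((m : ℝ) + 1))) *
          ∫⁻ x in D m, ‖u x‖ₑ * 1 ∂volume.restrict T) ^ 2 := by gcongr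
      _ = ENNReal.ofReal (Cφ * (Cc * ((m : ℝ) + 1))) ^ 2 *
          (∫⁻ x in D m, ‖u x‖ₑ * 1 ∂volume.restrict T) ^ 2 := by rw [mul_pow]
      _ ≤ ENNReal.ofReal (Cφ * (Cc * ((m : ℝ) + 1))) ^ 2 *
          ((∫⁻ x in D m, ‖u x‖ₑ ^ 2 ∂volume.restrict T) *
            ENNReal.ofReal ((2 * (2 / ((m : ℝ) + 1))) ^ 2 * (2 * R) ^ (d - 2))) := by
        gcongr
        exact h2.trans (by gcongr)
      _ = ENNReal.ofReal ((Cφ * (Cc * ((m : ℝ) + 1))) ^ 2 *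
          ((2 * (2 / ((m : ℝ) + 1))) ^ 2 * (2 * R) ^ (d - 2))) *
            ∫⁻ x in D m, ‖u x‖ₑ ^ 2 ∂volume.restrict T := by
        rw [ENNReal.ofReal_mul (p := (Cφ * (Cc * ((m : ℝ) + 1))) ^ 2) (sq_nonneg _),
          ENNReal.ofReal_pow (by positivity)]
        rw [mul_assoc, mul_comm (∫⁻ x in D m, ‖u x‖ₑ ^ 2 ∂volume.restrict T)]
      _ = _ := by
        congr 2
        rw [hK]; field_simp; ring
  have hL2 : Tendsto (fun m : ℕ => ∫ x in T,
      u x * (φ x * fderiv ℝ (codimTwoCutoff a b p ((m : ℝ) + 1)) x j)) atTop (𝓝 0) := by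
    have h1 : Tendsto (fun m : ℕ => ‖∫ x in T,
        u x * (φ x * fderiv ℝ (codimTwoCutoff a b p ((m : ℝ) + 1)) x j)‖ₑ ^ 2) atTop (𝓝 0) := by
      refine tendsto_of_tendsto_of_tendsto_of_le_of_le tendsto_const_nhds ?_ (fun _ => zero_le)
        hbound
      simpa using ENNReal.Tendsto.const_mul hu0 (Or.inr (ENNReal.ofReal_ne_top (r := K)))
    have h2 := (ENNReal.continuous_rpow_const (y := 1 / 2)).tendsto 0 |>.comp h1
    rw [tendsto_zero_iff_enorm_tendsto_zero]
    rw [ENNReal.zero_rpow_of_pos (by norm_num)] at h2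
    refine h2.congr fun m => ?_
    rw [Function.comp_apply, ← ENNReal.rpow_natCast, ← ENNReal.rpow_mul]
    norm_num
  have hlim := hL1.add hL2
  rw [add_zero] at hlim
  refine tendsto_nhds_unique (hlim.congr fun m => ?_) hR
  have hcut := contDiff_codimTwoCutoff a b p ((m : ℝ) + 1)
  have := hm ((m : ℝ) + 1) (by positivity)
  rw [HasIBP] at this
  rw [← this, ← integral_add]
  · exact integral_congr_ae (Eventually.of_forall fun x => (ibpIntegrand_mul hφ hcut j x).symm)
  · have hi := h.integrable_ibpIntegrand hb hφ hc j
    exact hi.mul_bdd (hcutc _).aestronglyMeasurable (Eventually.of_forall (hcutb _))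
  · have hfin : IsFiniteMeasure (volume.restrict T) := ⟨by simpa using hb.lt_top⟩
    exact integrable_mul_smooth (h.memLp.integrable (by norm_num))
      (hφ.continuous.mul (continuous_fderiv_apply hcut j)) hc.mul_right

/-- The exceptional subspaces are removed one at a time; the product with a further cutoff still
avoids those that the support avoided before. -/
theorem hasIBP_of_local_off_codimTwo (hd : 2 ≤ d) (hb : volume T ≠ ⊤)
    (h : IsH1 T u G) (hτ : ∀ i, Integrable τ (ν i)) (j : Space d) {κ : Type*} [DecidableEq κ] (s : Finset κ)
    {a b p : κ → Space d} (hs : ∀ k ∈ s, ‖a k‖ = 1 ∧ ‖b k‖ = 1 ∧ inner ℝ (a k) (b k) = (0 : ℝ) ∧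
      ∀ i, ν i (codimTwo (a k) (b k) (p k)) = 0)
    (hloc : ∀ x, (∀ k ∈ s, x ∉ codimTwo (a k) (b k) (p k)) →
      ∃ U : Set (Space d), IsOpen U ∧ x ∈ U ∧ ∀ ψ : Space d → ℝ,
        ContDiff ℝ ∞ ψ → HasCompactSupport ψ → tsupport ψ ⊆ U → HasIBP T u G ν N τ ψ j)
    {φ : Space d → ℝ} (hφ : ContDiff ℝ ∞ φ) (hc : HasCompactSupport φ) :
    HasIBP T u G ν N τ φ j := by
  -- The set `t` consists of the subspaces that the support may still meet; for `t = ∅` the formula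
  -- is local.
  suffices key : ∀ t ⊆ s, ∀ φ : Space d → ℝ, ContDiff ℝ ∞ φ → HasCompactSupport φ →
      (∀ k ∈ s \ t, Disjoint (tsupport φ) (codimTwo (a k) (b k) (p k))) →
      HasIBP T u G ν N τ φ j from key s subset_rfl φ hφ hc (by simp)
  intro t
  induction t using Finset.induction_on with
  | empty =>
    intro _ φ hφ hc hdis
    refine hasIBP_of_local hb h hτ j hφ hc fun x hx => hloc x fun k hk hxk => ?_
    exact Set.disjoint_left.1 (hdis k (by simpa using hk)) hx hxk
  | insert k t hkt ih =>
    intro hts φ hφ hc hdis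
    obtain ⟨h1, h2, h3, h4⟩ := hs k (hts (Finset.mem_insert_self _ _))
    refine HasIBP.of_codimTwoCutoff hd hb h hτ j hφ hc h1 h2 h3 h4 fun m _ => ?_
    refine ih ((Finset.subset_insert _ _).trans hts) _ (hφ.mul (contDiff_codimTwoCutoff _ _ _ _))
      hc.mul_right fun k' hk' => ?_
    rw [Finset.mem_sdiff] at hk'
    by_cases hkk : k' = k
    · subst hkk
      exact disjoint_tsupport_codimTwoCutoff.mono_left tsupport_mul_subset_right
    · refine (hdis k' ?_).mono_left tsupport_mul_subset_left
      simp [hk'.1, hk'.2, hkk]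

end globalIBP

/-! ### Barycentric coordinates, facets and ridges of a simplex -/

section simplex
variable {d : ℕ} {s t : Finset (Space d)} {a b : Space d}

/-- The affine basis given by the vertices of a simplex. -/
def IsSimplex.basis (hs : IsSimplex s) : AffineBasis s ℝ (Space d) :=
  ⟨Subtype.val, hs.2, by
    rw [hs.2.affineSpan_eq_top_iff_card_eq_finrank_add_one]
    simp [hs.1]⟩

open Classical in
/-- The barycentric coordinate of the simplex `s` with respect to the vertex `a`. -/
def bary (s : Finset (Space d)) (a : Space d) : Space d →ᵃ[ℝ] ℝ :=
  if h : IsSimplex s ∧ a ∈ s then h.1.basis.coord ⟨a, h.2⟩ else 0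

theorem bary_eq (hs : IsSimplex s) (ha : a ∈ s) : bary s a = hs.basis.coord ⟨a, ha⟩ :=
  dif_pos ⟨hs, ha⟩

theorem bary_self (hs : IsSimplex s) (ha : a ∈ s) : bary s a a = 1 := by
  rw [bary_eq hs ha]; exact hs.basis.coord_apply_eq ⟨a, ha⟩

theorem bary_of_ne (hs : IsSimplex s) (ha : a ∈ s) (hb : b ∈ s) (h : a ≠ b) : bary s a b = 0 := by
  rw [bary_eq hs ha]
  exact hs.basis.coord_apply_ne (i := ⟨a, ha⟩) (j := ⟨b, hb⟩) (by simpa using h)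

theorem sum_bary (hs : IsSimplex s) (x : Space d) : ∑ a ∈ s, bary s a x = 1 := by
  rw [← hs.basis.sum_coord_apply_eq_one x, ← Finset.sum_coe_sort]
  exact Finset.sum_congr rfl fun i _ => by rw [bary_eq hs i.2]

theorem sum_bary_smul (hs : IsSimplex s) (x : Space d) : ∑ a ∈ s, bary s a x • a = x := by
  conv_rhs => rw [← hs.basis.linear_combination_coord_eq_self x]
  rw [← Finset.sum_coe_sort]
  exact Finset.sum_congr rfl fun i _ => by rw [bary_eq hs i.2]; rfl

theorem range_basis (hs : IsSimplex s) : Set.range hs.basis = (s : Set (Space d)) := by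
  change Set.range (Subtype.val : s → Space d) = s
  simp

theorem mem_convexHull_iff_bary (hs : IsSimplex s) {x : Space d} :
    x ∈ convexHull ℝ (s : Set (Space d)) ↔ ∀ a ∈ s, 0 ≤ bary s a x := by
  rw [← range_basis hs, hs.basis.convexHull_eq_nonneg_coord]
  constructor
  · intro h a ha; rw [bary_eq hs ha]; exact h ⟨a, ha⟩
  · intro h a; have := h a a.2; rwa [bary_eq hs a.2] at this

theorem mem_interior_iff_bary (hs : IsSimplex s) {x : Space d} :
    x ∈ interior (convexHull ℝ (s : Set (Space d))) ↔ ∀ a ∈ s, 0 < bary s a x := by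
  rw [← range_basis hs, hs.basis.interior_convexHull]
  constructor
  · intro h a ha; rw [bary_eq hs ha]; exact h ⟨a, ha⟩
  · intro h a; have := h a a.2; rwa [bary_eq hs a.2] at this

theorem bary_le_one (hs : IsSimplex s) {x : Space d} (hx : x ∈ convexHull ℝ (s : Set (Space d)))
    (ha : a ∈ s) : bary s a x ≤ 1 := by
  rw [← sum_bary hs x]
  exact Finset.single_le_sum (f := fun a => bary s a x)
    (fun a ha => (mem_convexHull_iff_bary hs).1 hx a ha) ha

theorem mem_convexHull_subset (hs : IsSimplex s) (hts : t ⊆ s) {x : Space d}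
    (h0 : ∀ a ∈ t, 0 ≤ bary s a x) (h1 : ∀ a ∈ s, a ∉ t → bary s a x = 0) :
    x ∈ convexHull ℝ (t : Set (Space d)) := by
  rw [Finset.mem_convexHull']
  refine ⟨fun a => bary s a x, h0, ?_, ?_⟩
  · rw [Finset.sum_subset hts fun a ha hat => h1 a ha hat, sum_bary hs]
  · rw [Finset.sum_subset hts fun a ha hat => by
      simp only [h1 a ha hat, zero_smul], sum_bary_smul hs]

theorem bary_eq_zero_of_mem_convexHull (hs : IsSimplex s) (ha : a ∈ s) {A : Set (Space d)}
    (hA : A ⊆ s) (haA : a ∉ A) {x : Space d} (hx : x ∈ convexHull ℝ A) : bary s a x = 0 := by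
  have : convexHull ℝ A ⊆ bary s a ⁻¹' {0} :=
    convexHull_min (fun b hb => bary_of_ne hs ha (hA hb) fun h => haA (h ▸ hb))
      ((convex_singleton 0).affine_preimage _)
  exact this hx

theorem continuous_bary (s : Finset (Space d)) (a : Space d) : Continuous (bary s a) :=
  AffineMap.continuous_of_finiteDimensional _

/-- The gradient of a barycentric coordinate. -/
def baryGrad (s : Finset (Space d)) (a : Space d) : Space d :=
  (InnerProductSpace.toDual ℝ (Space d)).symm (LinearMap.toContinuousLinearMap (bary s a).linear)

theorem inner_baryGrad (s : Finset (Space d)) (a v : Space d) :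
    inner ℝ (baryGrad s a) v = (bary s a).linear v := by
  simp [baryGrad]

theorem bary_sub (s : Finset (Space d)) (a x y : Space d) :
    bary s a x - bary s a y = inner ℝ (baryGrad s a) (x - y) := by
  rw [inner_baryGrad]
  exact ((bary s a).linearMap_vsub x y).symm

theorem bary_add (s : Finset (Space d)) (a x v : Space d) :
    bary s a (x + v) = bary s a x + inner ℝ (baryGrad s a) v := by
  have := bary_sub s a (x + v) x
  rw [add_sub_cancel_left] at this
  linarith

/-- The coordinate stays in `[0, 1]` on the ball, and moving from its centre by almost `r` along the
gradient raises it by almost `r ‖baryGrad s a‖`. -/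
theorem norm_baryGrad_le (hs : IsSimplex s) (ha : a ∈ s) {x : Space d} {r : ℝ} (hr : 0 < r)
    (hx : Metric.ball x r ⊆ convexHull ℝ (s : Set (Space d))) : r * ‖baryGrad s a‖ ≤ 1 := by
  set g := baryGrad s a with hg
  by_cases hg0 : ‖g‖ = 0
  · rw [hg0]; simp
  have hgp : 0 < ‖g‖ := lt_of_le_of_ne (norm_nonneg _) (Ne.symm hg0)
  refine le_of_forall_lt_imp_le_of_dense (fun c hc => ?_)
  have hc1 : c / ‖g‖ < r := by rw [div_lt_iff₀ hgp]; exact hc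
  by_cases hc0 : c ≤ 0
  · linarith
  have hcp : 0 < c := not_le.1 hc0
  have hy : x + (c / ‖g‖ / ‖g‖) • g ∈ Metric.ball x r := by
    rw [mem_ball_iff_norm, add_sub_cancel_left, norm_smul, Real.norm_of_nonneg (by positivity),
      div_mul_cancel₀ _ hg0]
    exact hc1
  have h1 := bary_le_one hs (hx hy) ha
  have h2 := (mem_convexHull_iff_bary hs).1 (hx (Metric.mem_ball_self hr)) a ha
  rw [bary_add, inner_smul_right, ← hg, real_inner_self_eq_norm_sq] at h1
  have : c / ‖g‖ / ‖g‖ * ‖g‖ ^ 2 = c := by field_simp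
  linarith

theorem IsSimplex.interior_nonempty (hs : IsSimplex s) :
    (interior (convexHull ℝ (s : Set (Space d)))).Nonempty := by
  rw [← range_basis hs]
  exact ⟨_, hs.basis.centroid_mem_interior_convexHull⟩

theorem isCompact_simplex (s : Finset (Space d)) : IsCompact (convexHull ℝ (s : Set (Space d))) :=
  s.finite_toSet.isCompact_convexHull ℝ

theorem isClosed_simplex (s : Finset (Space d)) : IsClosed (convexHull ℝ (s : Set (Space d))) :=
  (isCompact_simplex s).isClosed

theorem IsSimplex.closure_interior (hs : IsSimplex s) :
    closure (interior (convexHull ℝ (s : Set (Space d)))) = convexHull ℝ (s : Set (Space d)) := by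
  rw [(convex_convexHull ℝ _).closure_interior_eq_closure_of_nonempty_interior
    hs.interior_nonempty, (isClosed_simplex s).closure_eq]

/-- The relatively open facet of `s` opposite to the vertex `a`. -/
def openFacet (s : Finset (Space d)) (a : Space d) : Set (Space d) :=
  {x | bary s a x = 0 ∧ ∀ b ∈ s, b ≠ a → 0 < bary s b x}

theorem openFacet_subset_convexHull (hs : IsSimplex s) :
    openFacet s a ⊆ convexHull ℝ (s : Set (Space d)) := fun x hx => by
  rw [mem_convexHull_iff_bary hs]
  intro b hb
  by_cases h : b = a
  · rw [h, hx.1]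
  · exact (hx.2 b hb h).le

/-- On the affine span of the remaining vertices the coordinate of `a` vanishes, so positivity of
the others cuts out a relatively open subset of the hull. This connects facets with the face
compatibility of the mesh, which speaks of intrinsic interiors. -/
theorem openFacet_subset_intrinsicInterior [DecidableEq (Space d)] (hs : IsSimplex s) (ha : a ∈ s) :
    openFacet s a ⊆ intrinsicInterior ℝ (convexHull ℝ ((s.erase a : Finset (Space d)) :
      Set (Space d))) := by
  have hmem : ∀ y, bary s a y = 0 → (∀ b ∈ s, b ≠ a → 0 < bary s b y) →
      y ∈ convexHull ℝ ((s.erase a : Finset (Space d)) : Set (Space d)) := by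
    intro y h0 h1
    refine mem_convexHull_subset hs (Finset.erase_subset _ _) (fun b hb => ?_) fun b hb hbn => ?_
    · rw [Finset.mem_erase] at hb; exact (h1 b hb.2 hb.1).le
    · have : b = a := by by_contra h; exact hbn (Finset.mem_erase.2 ⟨h, hb⟩)
      rw [this, h0]
  have hspan : ∀ y ∈ affineSpan ℝ (convexHull ℝ ((s.erase a : Finset (Space d)) : Set (Space d))),
      bary s a y = 0 := by
    intro y hy
    have : EqOn (bary s a) (AffineMap.const ℝ (Space d) (0 : ℝ))
        (convexHull ℝ ((s.erase a : Finset (Space d)) : Set (Space d))) := fun x hx => by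
      simpa using bary_eq_zero_of_mem_convexHull hs ha (by simp) (by simp) hx
    simpa using AffineMap.eqOn_affineSpan this hy
  intro x hx
  rw [mem_intrinsicInterior]
  refine ⟨⟨x, subset_affineSpan ℝ _ (hmem x hx.1 hx.2)⟩, ?_, rfl⟩
  rw [mem_interior]
  refine ⟨⋂ b ∈ s.erase a, {y | 0 < bary s b y}, fun y hy => ?_, ?_, ?_⟩
  · simp only [Finset.mem_erase, mem_iInter, mem_ofPred_eq] at hy
    exact hmem y (hspan y y.2) fun b hb hba => hy b ⟨hba, hb⟩
  · refine isOpen_biInter_finset fun b _ => isOpen_lt continuous_const ?_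
    exact (continuous_bary s b).comp continuous_subtype_val
  · simp only [Finset.mem_erase, mem_iInter, mem_ofPred_eq]
    exact fun b hb => hx.2 b hb.2 hb.1

theorem exists_third_vertex (hd : 2 ≤ d) (hs : IsSimplex s) (a b : Space d) :
    ∃ c ∈ s, c ≠ a ∧ c ≠ b := by
  classical
  have : 0 < ((s.erase a).erase b).card := by
    have h1 := Finset.pred_card_le_card_erase (s := s) (a := a)
    have h2 := Finset.pred_card_le_card_erase (s := s.erase a) (a := b)
    have := hs.1
    omega
  obtain ⟨c, hc⟩ := Finset.card_pos.1 this
  simp only [Finset.mem_erase] at hc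
  exact ⟨c, hc.2.2, hc.2.1, hc.1⟩

/-- The affine subspace spanned by the vertices of `s` other than `a` and `b`. -/
def ridge (s : Finset (Space d)) (a b : Space d) : Set (Space d) :=
  {x | bary s a x = 0 ∧ bary s b x = 0}

theorem isClosed_ridge (s : Finset (Space d)) (a b : Space d) : IsClosed (ridge s a b) :=
  (isClosed_eq (continuous_bary s a) continuous_const).inter
    (isClosed_eq (continuous_bary s b) continuous_const)

/-- Gram–Schmidt applied to the two gradients. The base point is a third vertex `c`, where both
coordinates vanish; testing with `a - c` and `b - c` shows that the gradients are independent. -/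
theorem exists_ridge_eq_codimTwo (hd : 2 ≤ d) (hs : IsSimplex s) (ha : a ∈ s) (hb : b ∈ s)
    (hab : a ≠ b) : ∃ q : Space d × Space d × Space d, ‖q.1‖ = 1 ∧ ‖q.2.1‖ = 1 ∧
      inner ℝ q.1 q.2.1 = (0 : ℝ) ∧ ridge s a b = codimTwo q.1 q.2.1 q.2.2 := by
  obtain ⟨c, hc, hca, hcb⟩ := exists_third_vertex hd hs a b
  have va : (inner ℝ (baryGrad s a) (a - c) : ℝ) = 1 := by
    rw [← bary_sub, bary_self hs ha, bary_of_ne hs ha hc hca.symm]; norm_num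
  have vb : (inner ℝ (baryGrad s b) (b - c) : ℝ) = 1 := by
    rw [← bary_sub, bary_self hs hb, bary_of_ne hs hb hc hcb.symm]; norm_num
  have vab : (inner ℝ (baryGrad s a) (b - c) : ℝ) = 0 := by
    rw [← bary_sub, bary_of_ne hs ha hb hab, bary_of_ne hs ha hc hca.symm]; norm_num
  set g := baryGrad s a
  set g' := baryGrad s b
  have hg : g ≠ 0 := fun h => by rw [h] at va; simp at va
  have hgn : ‖g‖ ≠ 0 := norm_ne_zero_iff.2 hg
  set f := g' - (inner ℝ g g' / ‖g‖ ^ 2 : ℝ) • g with hf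
  have hfb : (inner ℝ f (b - c) : ℝ) = 1 := by
    rw [hf, inner_sub_left, vb, inner_smul_left, vab]; simp
  have hf0 : f ≠ 0 := fun h => by rw [h] at hfb; simp at hfb
  have hfn : ‖f‖ ≠ 0 := norm_ne_zero_iff.2 hf0
  have hgf : (inner ℝ g f : ℝ) = 0 := by
    rw [hf, inner_sub_right, inner_smul_right, real_inner_self_eq_norm_sq]
    field_simp; ring
  refine ⟨(‖g‖⁻¹ • g, ‖f‖⁻¹ • f, c), norm_smul_inv_norm hg, norm_smul_inv_norm hf0, ?_, ?_⟩
  · simp only [inner_smul_left, inner_smul_right, hgf]; simp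
  · ext x
    have e1 : bary s a x = inner ℝ g (x - c) := by
      rw [← bary_sub, bary_of_ne hs ha hc hca.symm, sub_zero]
    have e2 : bary s b x = inner ℝ g' (x - c) := by
      rw [← bary_sub, bary_of_ne hs hb hc hcb.symm, sub_zero]
    have e3 : (inner ℝ f (x - c) : ℝ) = inner ℝ g' (x - c) -
        (inner ℝ g g' / ‖g‖ ^ 2 : ℝ) * inner ℝ g (x - c) := by
      rw [hf, inner_sub_left, inner_smul_left]; simp
    simp only [ridge, codimTwo, mem_ofPred_eq, e1, e2, inner_smul_left, e3]
    simp only [conj_trivial, mul_eq_zero, inv_eq_zero, hgn, hfn, false_or]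
    constructor
    · rintro ⟨h1, h2⟩; exact ⟨h1, by rw [h1, h2]; ring⟩
    · rintro ⟨h1, h2⟩; rw [h1] at h2; exact ⟨h1, by linarith⟩

/-- Two coordinates with independent gradients cannot both vanish on one hyperplane, since both
gradients would be multiples of `n`. So the ridge meets the hyperplane inside the zero set of an
affine function that is not identically zero there. -/
theorem hypMeasure_ridge (hd : 2 ≤ d) (hs : IsSimplex s) (ha : a ∈ s) (hb : b ∈ s)
    (hab : a ≠ b) {n p : Space d} (hn : ‖n‖ = 1) : hypMeasure n p (ridge s a b) = 0 := by
  by_cases h1 : ∃ x ∈ hyp n p, bary s a x ≠ 0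
  · exact measure_mono_null (fun x hx => hx.1) (hypMeasure_affine_eq_zero hn _ h1)
  by_cases h2 : ∃ x ∈ hyp n p, bary s b x ≠ 0
  · exact measure_mono_null (fun x hx => hx.2) (hypMeasure_affine_eq_zero hn _ h2)
  push Not at h1 h2
  exfalso
  obtain ⟨c, hc, hca, hcb⟩ := exists_third_vertex hd hs a b
  have hnn : (inner ℝ n n : ℝ) = 1 := by rw [real_inner_self_eq_norm_sq, hn]; norm_num
  have key (a : Space d) (h : ∀ x ∈ hyp n p, bary s a x = 0) (v : Space d) :
      (inner ℝ (baryGrad s a) v : ℝ) = inner ℝ n v * inner ℝ (baryGrad s a) n := by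
    have h3 : p + (v - (inner ℝ n v : ℝ) • n) ∈ hyp n p := by
      change (inner ℝ n (p + (v - (inner ℝ n v : ℝ) • n) - p) : ℝ) = 0
      rw [add_sub_cancel_left, inner_sub_right, inner_smul_right, hnn]; ring
    have h4 := h _ h3
    rw [bary_add, h p (by simp [hyp]), zero_add, inner_sub_right, inner_smul_right] at h4
    linarith
  have va : (inner ℝ (baryGrad s a) (a - c) : ℝ) = 1 := by
    rw [← bary_sub, bary_self hs ha, bary_of_ne hs ha hc hca.symm]; norm_num
  have vb : (inner ℝ (baryGrad s b) (b - c) : ℝ) = 1 := by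
    rw [← bary_sub, bary_self hs hb, bary_of_ne hs hb hc hcb.symm]; norm_num
  have vab : (inner ℝ (baryGrad s a) (b - c) : ℝ) = 0 := by
    rw [← bary_sub, bary_of_ne hs ha hb hab, bary_of_ne hs ha hc hca.symm]; norm_num
  rw [key a h1] at va vab
  rw [key b h2] at vb
  rcases mul_eq_zero.1 vab with h | h
  · rw [h] at vb; simp at vb
  · rw [h] at va; simp at va

theorem volume_bary_eq_zero (hs : IsSimplex s) (ha : a ∈ s) : volume {x | bary s a x = 0} = 0 :=
  volume_affine_eq_zero _ ⟨a, by rw [bary_self hs ha]; norm_num⟩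

end simplex

/-! ### Simplicial submeshes of an element -/

section submesh
variable {d : ℕ} {T : Set (Space d)} {S : Finset (Finset (Space d))} {r : ℝ}

/-- `S` is a matching simplicial mesh of the polytope `T`, whose simplices contain balls of
radius `r`. -/
structure IsSubmesh (T : Set (Space d)) (S : Finset (Finset (Space d))) (r : ℝ) : Prop where
  isOpen : IsOpen T
  isConnected : IsConnected T
  interior_closure : interior (closure T) = T
  isSimplex : ∀ s ∈ S, IsSimplex s
  isMatching : ∀ s ∈ S, ∀ t ∈ S,
    convexHull ℝ (s : Set (Space d)) ∩ convexHull ℝ (t : Set (Space d)) =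
      convexHull ℝ ((s : Set (Space d)) ∩ (t : Set (Space d)))
  closure_eq : closure T = ⋃ s ∈ S, convexHull ℝ (s : Set (Space d))
  interior_subset_element : ∀ s ∈ S, interior (convexHull ℝ (s : Set (Space d))) ⊆ T
  pos : 0 < r
  exists_ball : ∀ s ∈ S, ∃ x, Metric.ball x r ⊆ convexHull ℝ (s : Set (Space d))

/-- A point of a closed simplex outside its interior lies on one of finitely many hyperplanes, and
these cannot fill an open set of positive volume. -/
theorem interior_biUnion_simplex_eq_empty_or {A : Finset (Finset (Space d))}
    (hA : ∀ s ∈ A, IsSimplex s) {U : Set (Space d)} (hU : IsOpen U) (hne : U.Nonempty)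
    (hsub : U ⊆ ⋃ s ∈ A, convexHull ℝ (s : Set (Space d))) :
    ∃ s ∈ A, (U ∩ interior (convexHull ℝ (s : Set (Space d)))).Nonempty := by
  by_contra! hcon
  have hnull : volume U = 0 := by
    refine measure_mono_null (t := ⋃ s ∈ A, ⋃ a ∈ s, {x | bary s a x = 0}) (fun x hx => ?_) ?_
    · obtain ⟨s, hs, hxs⟩ := mem_iUnion₂.1 (hsub hx)
      have hni : x ∉ interior (convexHull ℝ (s : Set (Space d))) := fun h =>
        (hcon s hs).subset ⟨hx, h⟩
      rw [mem_interior_iff_bary (hA s hs)] at hni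
      push Not at hni
      obtain ⟨a, ha, hle⟩ := hni
      exact mem_iUnion₂.2 ⟨s, hs, mem_iUnion₂.2 ⟨a, ha,
        le_antisymm hle ((mem_convexHull_iff_bary (hA s hs)).1 hxs a ha)⟩⟩
    · refine (measure_biUnion_null_iff A.countable_toSet).2 fun s hs =>
        (measure_biUnion_null_iff s.countable_toSet).2 fun a ha => volume_bary_eq_zero (hA s hs) ha
  exact (hU.measure_pos volume hne).ne' hnull

theorem IsPolytope.isBounded (hT : IsPolytope T) : Bornology.IsBounded T := by
  obtain ⟨_, S, hS, rfl⟩ := hT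
  refine Bornology.IsBounded.subset ?_ interior_subset
  exact (S.finite_toSet.isCompact_biUnion fun s _ => isCompact_simplex s).isBounded

theorem IsPolytope.isOpen (hT : IsPolytope T) : IsOpen T := by
  obtain ⟨_, S, hS, rfl⟩ := hT
  exact isOpen_interior

theorem IsPolytope.interior_closure (hT : IsPolytope T) : interior (closure T) = T := by
  have ho := hT.isOpen
  obtain ⟨_, S, hS, hTS⟩ := hT
  refine (interior_maximal subset_closure ho).antisymm' ?_
  have hcl : IsClosed (⋃ s ∈ S, convexHull ℝ (s : Set (Space d))) :=
    S.finite_toSet.isClosed_biUnion fun s _ => isClosed_simplex s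
  have h1 : closure T ⊆ ⋃ s ∈ S, convexHull ℝ (s : Set (Space d)) :=
    closure_minimal (hTS ▸ interior_subset) hcl
  conv_rhs => rw [hTS]
  exact interior_mono h1

theorem diam_pos_of_isOpen (hd : 1 ≤ d) (hT : IsOpen T) (hne : T.Nonempty)
    (hb : Bornology.IsBounded T) : 0 < Metric.diam T := by
  obtain ⟨x, hx⟩ := hne
  obtain ⟨ε, hε, hsub⟩ := Metric.isOpen_iff.1 hT x hx
  have hy : x + EuclideanSpace.single (⟨0, hd⟩ : Fin d) (ε / 2) ∈ T := hsub (by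
    rw [mem_ball_iff_norm, add_sub_cancel_left, PiLp.norm_single,
      Real.norm_of_nonneg (by positivity)]
    linarith)
  have := Metric.dist_le_diam_of_mem hb hy hx
  rw [dist_eq_norm, add_sub_cancel_left, PiLp.norm_single,
      Real.norm_of_nonneg (by positivity)] at this
  linarith

/-- Keep the simplices whose interior lies in `T`. An open part of `T` that they miss would meet the
interior of a simplex contained in a different element, against disjointness. The inradius is at
least `ϱ² diam T`; the factor `1 / 2` is lost because the inradius is a supremum. -/
theorem exists_isSubmesh (hd : 1 ≤ d) {Ω : Set (Space d)} {M : PolytopalMesh Ω} {ϱ : ℝ}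
    (hϱ : 0 < ϱ) (hM : M.IsRegular ϱ) (hT : T ∈ M.elements) :
    ∃ S, IsSubmesh T S (ϱ ^ 2 / 2 * Metric.diam T) ∧
      ∀ s ∈ S, ∀ σ ⊆ s, σ.card = d → ∀ F ∈ M.faces,
        intrinsicInterior ℝ (convexHull ℝ (σ : Set (Space d))) ⊆ F ∨
        Disjoint (intrinsicInterior ℝ (convexHull ℝ (σ : Set (Space d)))) F := by
  classical
  obtain ⟨S, hS, hfat, hdiam⟩ := hM
  have hP := M.isPolytope T hT
  have hpos := diam_pos_of_isOpen hd hP.isOpen hP.1.nonempty hP.isBounded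
  set ST := Finset.filter (fun s : Finset (Space d) => interior (convexHull ℝ (s : Set (Space d))) ⊆ T) S with hST
  have hmem (s : Finset (Space d)) : s ∈ ST ↔ s ∈ S ∧ interior (convexHull ℝ (s : Set (Space d))) ⊆ T := by
    rw [hST, Finset.mem_filter]
  refine ⟨ST, ⟨hP.isOpen, hP.1, hP.interior_closure, fun s hs => hS.isSimplex s ((hmem s).1 hs).1,
    fun s hs t ht => hS.isMatching s ((hmem s).1 hs).1 t ((hmem t).1 ht).1, ?_,
    fun s hs => ((hmem s).1 hs).2, by positivity, ?_⟩,
    fun s hs => hS.face_compat s ((hmem s).1 hs).1⟩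
  · have hcl : IsClosed (⋃ s ∈ ST, convexHull ℝ (s : Set (Space d))) :=
      ST.finite_toSet.isClosed_biUnion fun s _ => isClosed_simplex s
    refine Subset.antisymm (closure_minimal ?_ hcl) (iUnion₂_subset fun s hs => ?_)
    · by_contra hcon
      rw [Set.not_subset] at hcon
      obtain ⟨x, hxT, hx⟩ := hcon
      obtain ⟨s, hs, y, ⟨hyT, hyn⟩, hys⟩ := interior_biUnion_simplex_eq_empty_or hS.isSimplex
        (hP.isOpen.sdiff hcl) ⟨x, hxT, hx⟩ (fun y hy => by
          rw [← hS.cover, M.cover]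
          exact mem_iUnion₂.2 ⟨T, hT, subset_closure hy.1⟩)
      obtain ⟨T', hT', hsT'⟩ := hS.subset_element s hs
      have : T = T' := by
        by_contra hne
        exact Set.disjoint_left.1 (M.elements_disjoint T hT T' hT' hne) hyT (hsT' hys)
      subst this
      exact hyn (mem_iUnion₂.2 ⟨s, (hmem s).2 ⟨hs, hsT'⟩, interior_subset hys⟩)
    · rw [← (hS.isSimplex s ((hmem s).1 hs).1).closure_interior]
      exact closure_mono ((hmem s).1 hs).2
  · intro s hs
    obtain ⟨hsS, hsT⟩ := (hmem s).1 hs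
    have h1 := hfat s hsS
    have h2 := hdiam T hT s hsS hsT
    have h3 : ϱ ^ 2 / 2 * Metric.diam T < inradius (convexHull ℝ (s : Set (Space d))) := by
      refine lt_of_lt_of_le ?_ h1
      nlinarith [mul_le_mul_of_nonneg_left h2 hϱ.le, mul_pos (pow_pos hϱ 2) hpos]
    rw [inradius] at h3
    obtain ⟨r, ⟨_, x, hx⟩, hr⟩ := exists_lt_of_lt_csSup (s := {r : ℝ | 0 ≤ r ∧ ∃ x,
      Metric.ball x r ⊆ convexHull ℝ (s : Set (Space d))}) ⟨0, le_rfl, 0, by simp⟩ h3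
    exact ⟨x, (Metric.ball_subset_ball hr.le).trans hx⟩

namespace IsSubmesh

/-- Distinct simplices have equally many vertices, so some vertex of `s` is not one of `t`; its
coordinate vanishes on the common part by matching, but is positive in the interior of `s`. -/
theorem disjoint_interior (hS : IsSubmesh T S r) {s t : Finset (Space d)} (hs : s ∈ S) (ht : t ∈ S)
    (hst : s ≠ t) : Disjoint (interior (convexHull ℝ (s : Set (Space d))))
      (convexHull ℝ (t : Set (Space d))) := by
  rw [Set.disjoint_left]
  intro x hxs hxt
  have hss := hS.isSimplex s hs
  obtain ⟨a, ha, hat⟩ : ∃ a ∈ s, a ∉ t := by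
    by_contra! hcon
    exact hst (Finset.eq_of_subset_of_card_le hcon (by rw [hss.1, (hS.isSimplex t ht).1]))
  have hx : x ∈ convexHull ℝ ((s : Set (Space d)) ∩ t) := by
    rw [← hS.isMatching s hs t ht]; exact ⟨interior_subset hxs, hxt⟩
  have h0 := bary_eq_zero_of_mem_convexHull hss ha inter_subset_left (fun h => hat h.2) hx
  exact ((mem_interior_iff_bary hss).1 hxs a ha).ne' h0

theorem nonempty_simplices (hS : IsSubmesh T S r) : S.Nonempty := by
  by_contra h
  have h1 := hS.closure_eq
  rw [Finset.not_nonempty_iff_eq_empty] at h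
  obtain ⟨x, hx⟩ := hS.isConnected.nonempty
  have := subset_closure (s := T) hx
  rw [h1, h] at this
  simp at this

theorem isBounded (hS : IsSubmesh T S r) : Bornology.IsBounded T := by
  refine Bornology.IsBounded.subset ?_ subset_closure
  rw [hS.closure_eq]
  exact (S.finite_toSet.isCompact_biUnion fun s _ => isCompact_simplex s).isBounded

theorem ball_subset_interior {s : Finset (Space d)} {x : Space d}
    (hx : Metric.ball x r ⊆ convexHull ℝ (s : Set (Space d))) :
    Metric.ball x r ⊆ interior (convexHull ℝ (s : Set (Space d))) :=
  interior_maximal hx Metric.isOpen_ball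

theorem simplex_subset_closure {s : Finset (Space d)} (hS : IsSubmesh T S r) (hs : s ∈ S) :
    convexHull ℝ (s : Set (Space d)) ⊆ closure T := by
  rw [hS.closure_eq]
  exact subset_biUnion_of_mem (u := fun s : Finset (Space d) => convexHull ℝ (s : Set (Space d))) hs

theorem dist_le (hS : IsSubmesh T S r) {x y : Space d} (hx : x ∈ closure T) (hy : y ∈ closure T) :
    dist x y ≤ Metric.diam T := by
  rw [← Metric.diam_closure]
  exact Metric.dist_le_diam_of_mem hS.isBounded.closure hx hy

theorem le_diam (hS : IsSubmesh T S r) (hd : 1 ≤ d) : r ≤ Metric.diam T := by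
  obtain ⟨s, hs⟩ := hS.nonempty_simplices
  obtain ⟨x, hx⟩ := hS.exists_ball s hs
  refine le_of_forall_lt_imp_le_of_dense fun c hc => ?_
  by_cases hc0 : c < 0
  · exact hc0.le.trans Metric.diam_nonneg
  rw [not_lt] at hc0
  have hn : ‖EuclideanSpace.single (⟨0, hd⟩ : Fin d) c‖ = c := by
    rw [PiLp.norm_single, Real.norm_of_nonneg hc0]
  have hy : x + EuclideanSpace.single (⟨0, hd⟩ : Fin d) c ∈ Metric.ball x r := by
    rw [mem_ball_iff_norm, add_sub_cancel_left, hn]; exact hc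
  have := hS.dist_le (hS.simplex_subset_closure hs (hx hy))
    (hS.simplex_subset_closure hs (hx (Metric.mem_ball_self hS.pos)))
  rwa [dist_eq_norm, add_sub_cancel_left, hn] at this

theorem volume_lt_top (hS : IsSubmesh T S r) : volume T ≠ ⊤ := hS.isBounded.measure_lt_top.ne

/-- The inscribed balls of radius `r` are disjoint and lie in one ball of radius `diam T`; compare
volumes. -/
theorem card_le (hS : IsSubmesh T S r) (hd : 1 ≤ d) : (S.card : ℝ) ≤ (Metric.diam T / r) ^ d := by
  have hr := hS.pos
  choose! x hx using hS.exists_ball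
  obtain ⟨z, hz⟩ := hS.isConnected.nonempty
  have : Nonempty (Fin d) := ⟨⟨0, hd⟩⟩
  have hdisj : (S : Set (Finset (Space d))).PairwiseDisjoint fun s => Metric.ball (x s) r := by
    intro s hs t ht hst
    exact (hS.disjoint_interior hs ht hst).mono (ball_subset_interior (hx s hs)) (hx t ht)
  have hle : volume (⋃ s ∈ S, Metric.ball (x s) r) ≤
      volume (Metric.closedBall z (Metric.diam T)) := by
    refine measure_mono (iUnion₂_subset fun s hs y hy => ?_)
    exact hS.dist_le (hS.simplex_subset_closure hs (hx s hs hy)) (_root_.subset_closure hz)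
  rw [measure_biUnion_finset hdisj fun s _ => Metric.isOpen_ball.measurableSet,
    Measure.addHaar_closedBall _ _ Metric.diam_nonneg] at hle
  simp only [Measure.addHaar_ball_of_pos _ _ hr, Finset.sum_const, nsmul_eq_mul,
    finrank_euclideanSpace_fin, ← mul_assoc] at hle
  have hv0 : volume (Metric.ball (0 : Space d) 1) ≠ 0 :=
    (Metric.measure_ball_pos volume _ one_pos).ne'
  have hvt : volume (Metric.ball (0 : Space d) 1) ≠ ⊤ := Metric.isBounded_ball.measure_lt_top.ne
  rw [ENNReal.mul_le_mul_iff_left hv0 hvt] at hle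
  have h2 := ENNReal.toReal_mono ENNReal.ofReal_ne_top hle
  have hD : 0 ≤ Metric.diam T := Metric.diam_nonneg
  rw [ENNReal.toReal_mul, ENNReal.toReal_natCast, ENNReal.toReal_ofReal (by positivity),
    ENNReal.toReal_ofReal (by positivity)] at h2
  rw [div_pow, le_div_iff₀ (by positivity)]
  exact h2

end IsSubmesh

/-- The center of the simplex with the `d` vertices `σ`. -/
def facetCenter (σ : Finset (Space d)) : Space d := (d : ℝ)⁻¹ • ∑ y ∈ σ, y

open Classical in
theorem bary_facetCenter (hd : 1 ≤ d) {s σ : Finset (Space d)} (hs : IsSimplex s) (hσ : σ ⊆ s)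
    (hc : σ.card = d) {a : Space d} (ha : a ∈ s) :
    bary s a (facetCenter σ) = if a ∈ σ then (d : ℝ)⁻¹ else 0 := by
  have hdpos : (0 : ℝ) < d := by exact_mod_cast hd
  have hlin : bary s a (facetCenter σ) = ∑ y ∈ σ, (d : ℝ)⁻¹ * bary s a y := by
    have h0 := bary_add s a 0 (facetCenter σ)
    have h1 (y : Space d) : (inner ℝ (baryGrad s a) y : ℝ) = bary s a y - bary s a 0 := by
      rw [bary_sub, sub_zero]
    rw [zero_add] at h0
    rw [h0, facetCenter, inner_smul_right, inner_sum]
    simp only [h1, Finset.sum_sub_distrib, Finset.sum_const, hc, nsmul_eq_mul, ← Finset.mul_sum]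
    field_simp
    ring
  rw [hlin]
  split_ifs with haσ
  · rw [Finset.sum_eq_single_of_mem a haσ fun y hy hya => by
      rw [bary_of_ne hs ha (hσ hy) hya.symm, mul_zero], bary_self hs ha, mul_one]
  · refine Finset.sum_eq_zero fun y hy => ?_
    rw [bary_of_ne hs ha (hσ hy) fun h => haσ (h ▸ hy), mul_zero]

namespace IsSubmesh

/-- Two simplices that share all vertices but one lie on both sides of their common facet. -/
theorem bary_neg_of_adjacent (hd : 1 ≤ d) (hS : IsSubmesh T S r) {s t σ : Finset (Space d)}
    (hs : s ∈ S) (ht : t ∈ S) (hst : s ≠ t) (hσs : σ ⊆ s) (hσt : σ ⊆ t) (hσ : σ.card = d)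
    {a b : Space d} (ha : a ∈ s) (hb : b ∈ t) (haσ : ∀ y ∈ s, y ∉ σ → y = a)
    (hbσ : ∀ y ∈ t, y ∉ σ → y = b) (ha' : a ∉ σ) (hb' : b ∉ σ) :
    ∃ c : ℝ, c < 0 ∧ ∀ x, bary t b x = c * bary s a x := by
  have hss := hS.isSimplex s hs
  have htt := hS.isSimplex t ht
  -- Two affine functions that agree at the vertices of `s`: both vanish on `σ`, and `a` is the only
  -- other vertex.
  have hbary : bary t b = bary t b a • bary s a := by
    refine AffineMap.ext_on hss.basis.tot fun y hy => ?_
    rw [range_basis hss] at hy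
    by_cases hya : y ∈ σ
    · rw [bary_of_ne htt hb (hσt hya) fun h => hb' (h ▸ hya)]
      simp [bary_of_ne hss ha hy fun h => ha' (h ▸ hya)]
    · rw [haσ y hy hya]; simp [bary_self hss ha]
  have heq (x : Space d) : bary t b x = bary t b a * bary s a x := by
    conv_lhs => rw [hbary]
    simp
  refine ⟨bary t b a, ?_, heq⟩
  by_contra hc
  rw [not_lt] at hc
  have hc0 : bary t b a ≠ 0 := fun h => by
    have := heq b
    rw [h, bary_self htt hb] at this; simp at this
  have hcpos := lt_of_le_of_ne hc (Ne.symm hc0)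
  set g := facetCenter σ
  have hdi : (0 : ℝ) < (d : ℝ)⁻¹ := inv_pos.2 (by exact_mod_cast hd)
  -- If the factor were positive, points slightly off the facet centre in the direction of `a` would
  -- be interior to both simplices.
  have hev (u : Finset (Space d)) (hu : IsSimplex u) (hσu : σ ⊆ u) (q : Space d) (hq : q ∈ u)
      (hqσ : ∀ y ∈ u, y ∉ σ → y = q) (hq' : q ∉ σ) (hqa : 0 < bary u q a) :
      ∀ᶠ ε in 𝓝[>] (0 : ℝ), g + ε • (a - g) ∈ interior (convexHull ℝ (u : Set (Space d))) := by
    simp only [mem_interior_iff_bary hu]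
    rw [eventually_all_finset]
    intro w hwu
    have h1 := bary_facetCenter hd hu hσu hσ hwu
    by_cases hwq : w ∈ σ
    · have hcont : Continuous fun ε : ℝ => bary u w (g + ε • (a - g)) :=
        (continuous_bary u w).comp (by fun_prop)
      refine nhdsWithin_le_nhds (hcont.continuousAt.eventually (lt_mem_nhds ?_))
      simp only [zero_smul, add_zero]
      rw [h1, if_pos hwq]
      exact hdi
    · have := hqσ w hwu hwq
      subst this
      filter_upwards [self_mem_nhdsWithin] with ε hε
      rw [if_neg hwq] at h1
      have h2 := bary_sub u w a g
      rw [h1, sub_zero] at h2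
      rw [bary_add, h1, zero_add, inner_smul_right, ← h2]
      exact mul_pos hε hqa
  obtain ⟨ε, h1, h2⟩ := ((hev s hss hσs a ha haσ ha' (by rw [bary_self hss ha]; norm_num)).and
    (hev t htt hσt b hb hbσ hb' hcpos)).exists
  exact Set.disjoint_left.1 (hS.disjoint_interior hs ht hst) h1 (interior_subset h2)

/-- A ball around the center of a facet shared by two simplices is contained in the element. -/
theorem ball_facetCenter_subset (hd : 1 ≤ d) (hS : IsSubmesh T S r) {s t σ : Finset (Space d)}
    (hs : s ∈ S) (ht : t ∈ S) (hst : s ≠ t) (hσs : σ ⊆ s) (hσt : σ ⊆ t) (hσ : σ.card = d) :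
    Metric.ball (facetCenter σ) (r / d) ⊆ T := by
  have hdpos : (0 : ℝ) < d := by exact_mod_cast hd
  have hr := hS.pos
  have key (u : Finset (Space d)) (hu : IsSimplex u) (hσu : σ ⊆ u) :
      ∃ a ∈ u, a ∉ σ ∧ ∀ y ∈ u, y ∉ σ → y = a := by
    classical
    have h1 : (u \ σ).card = 1 := by
      rw [Finset.card_sdiff_of_subset hσu, hu.1, hσ]; omega
    obtain ⟨a, ha⟩ := Finset.card_eq_one.1 h1
    have h2 (y) : y ∈ u ∧ y ∉ σ ↔ y = a := by rw [← Finset.mem_sdiff, ha, Finset.mem_singleton]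
    exact ⟨a, ((h2 a).2 rfl).1, ((h2 a).2 rfl).2, fun y h h' => (h2 y).1 ⟨h, h'⟩⟩
  have hss := hS.isSimplex s hs
  have htt := hS.isSimplex t ht
  obtain ⟨a, ha, ha', haσ⟩ := key s hss hσs
  obtain ⟨b, hb, hb', hbσ⟩ := key t htt hσt
  obtain ⟨c, hc, hcb⟩ := hS.bary_neg_of_adjacent hd hs ht hst hσs hσt hσ ha hb haσ hbσ ha' hb'
  -- It suffices that the ball lies in the union of the two closed simplices. The coordinates of
  -- vertices in `σ` equal `1 / d` at the centre and have gradients of norm at most `1 / r`, so they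
  -- stay nonnegative; the sign of `bary s a` then selects the simplex.
  rw [← hS.interior_closure]
  refine interior_maximal (fun y hy => ?_) Metric.isOpen_ball
  have hpos (u : Finset (Space d)) (huS : u ∈ S) (hu : IsSimplex u) (hσu : σ ⊆ u) (w : Space d)
      (hw : w ∈ σ) : 0 ≤ bary u w y := by
    obtain ⟨x, hx⟩ := hS.exists_ball u huS
    have h1 := norm_baryGrad_le hu (hσu hw) hr hx
    have h2 := bary_sub u w y (facetCenter σ)
    rw [bary_facetCenter hd hu hσu hσ (hσu hw), if_pos hw] at h2
    have h3 := abs_real_inner_le_norm (baryGrad u w) (y - facetCenter σ)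
    rw [mem_ball_iff_norm] at hy
    have h4 : ‖baryGrad u w‖ * ‖y - facetCenter σ‖ ≤ (d : ℝ)⁻¹ := by
      calc _ ≤ ‖baryGrad u w‖ * (r / d) := by gcongr
        _ = (r * ‖baryGrad u w‖) * (d : ℝ)⁻¹ := by rw [div_eq_mul_inv]; ring
        _ ≤ 1 * (d : ℝ)⁻¹ := by gcongr
        _ = _ := one_mul _
    have := (abs_le.1 h3).1
    linarith
  rcases le_or_gt 0 (bary s a y) with h | h
  · refine hS.simplex_subset_closure hs ((mem_convexHull_iff_bary hss).2 fun w hw => ?_)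
    by_cases hwσ : w ∈ σ
    · exact hpos s hs hss hσs w hwσ
    · rwa [haσ w hw hwσ]
  · refine hS.simplex_subset_closure ht ((mem_convexHull_iff_bary htt).2 fun w hw => ?_)
    by_cases hwσ : w ∈ σ
    · exact hpos t ht htt hσt w hwσ
    · rw [hbσ w hw hwσ, hcb]
      exact (mul_pos_of_neg_of_neg hc h).le

/-- A convex set containing a ball contains its image under a homothety centered in the set. -/
theorem ball_homothety_subset {A : Set (Space d)} (hA : Convex ℝ A) {g x : Space d} (hg : g ∈ A)
    (hx : Metric.ball x r ⊆ A) {l : ℝ} (hl0 : 0 < l) (hl1 : l ≤ 1) :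
    Metric.ball (g + l • (x - g)) (l * r) ⊆ A := by
  intro y hy
  have h1 : x + l⁻¹ • (y - (g + l • (x - g))) ∈ A := by
    refine hx ?_
    rw [mem_ball_iff_norm] at hy ⊢
    rw [add_sub_cancel_left, norm_smul, norm_inv, Real.norm_of_nonneg hl0.le, inv_mul_lt_iff₀ hl0]
    exact hy
  have h2 := hA hg h1 (sub_nonneg.2 hl1) hl0.le (by ring)
  convert h2 using 1
  rw [smul_add, smul_smul, mul_inv_cancel₀ hl0.ne', one_smul]
  module

theorem facetCenter_mem {s σ : Finset (Space d)} (hd : 1 ≤ d) (hs : IsSimplex s) (hσs : σ ⊆ s)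
    (hσ : σ.card = d) : facetCenter σ ∈ convexHull ℝ (s : Set (Space d)) := by
  rw [mem_convexHull_iff_bary hs]
  intro a ha
  rw [bary_facetCenter hd hs hσs hσ ha]
  split_ifs <;> positivity

/-- The simplices of a submesh are connected through common facets. -/
theorem exists_adjacent (hS : IsSubmesh T S r) {A : Finset (Finset (Space d))}
    (hA : A ⊆ S) (hAne : A.Nonempty) (hAS : A ≠ S) :
    ∃ s ∈ A, ∃ t ∈ S, t ∉ A ∧ ∃ σ, σ ⊆ s ∧ σ ⊆ t ∧ σ.card = d := by
  classical
  set K : Finset (Finset (Space d)) → Set (Space d) :=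
    fun A => ⋃ s ∈ A, convexHull ℝ (s : Set (Space d)) with hK
  have hKc (A) : IsClosed (K A) := A.finite_toSet.isClosed_biUnion fun s _ => isClosed_simplex s
  have hKun : K A ∪ K (S \ A) = closure T := by
    rw [hS.closure_eq, hK]
    simp only
    rw [← Finset.set_biUnion_union, Finset.union_sdiff_of_subset hA]
  have hBne : (S \ A).Nonempty := by
    rw [Finset.sdiff_nonempty]
    exact fun h => hAS (hA.antisymm h)
  have hmeet (B : Finset (Finset (Space d))) (hB : B ⊆ S) (hBne : B.Nonempty) :
      (T ∩ K B).Nonempty := by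
    obtain ⟨s, hs⟩ := hBne
    obtain ⟨x, hx⟩ := (hS.isSimplex s (hB hs)).interior_nonempty
    exact ⟨x, hS.interior_subset_element s (hB hs) hx, mem_iUnion₂.2 ⟨s, hs, interior_subset hx⟩⟩
  -- Connectedness yields a point of `T` in both unions, but simplices may meet there only in a low
  -- dimensional face. A generic segment nearby is used to cross from one union to the other through
  -- a facet.
  obtain ⟨x, hxT, hxA, hxB⟩ := isPreconnected_closed_iff.1 hS.isConnected.isPreconnected _ _ (hKc A)
    (hKc (S \ A)) (hKun ▸ _root_.subset_closure) (hmeet A hA hAne)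
    (hmeet _ Finset.sdiff_subset hBne)
  obtain ⟨s, hs, hxs⟩ := mem_iUnion₂.1 hxA
  obtain ⟨t, ht, hxt⟩ := mem_iUnion₂.1 hxB
  obtain ⟨ε, hε, hball⟩ := Metric.isOpen_iff.1 hS.isOpen x hxT
  -- generic points near `x`
  have hopen (u : Finset (Space d)) (hu : IsSimplex u) (hxu : x ∈ convexHull ℝ (u : Set (Space d)))
      {Z : Set (Space d)} (hZ : volume Z = 0) : ∃ y ∈ Metric.ball x ε,
      y ∈ convexHull ℝ (u : Set (Space d)) ∧ y ∉ Z := by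
    have hne : (Metric.ball x ε ∩ interior (convexHull ℝ (u : Set (Space d)))).Nonempty := by
      rw [← hu.closure_interior] at hxu
      exact mem_closure_iff.1 hxu _ Metric.isOpen_ball (Metric.mem_ball_self hε)
    have hpos := (Metric.isOpen_ball.inter isOpen_interior).measure_pos volume hne
    obtain ⟨y, hy, hyZ⟩ := Set.not_subset.1 fun h => hpos.ne' (measure_mono_null h hZ)
    exact ⟨y, hy.1, interior_subset hy.2, hyZ⟩
  have hAsi : ∀ s ∈ A, IsSimplex s := fun s hs => hS.isSimplex s (hA hs)
  obtain ⟨y, hyb, hys, hyZ⟩ := hopen s (hAsi s hs) hxs (Z := ⋃ u ∈ A, ⋃ a ∈ u, {z | bary u a z = 0})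
    ((measure_biUnion_null_iff A.countable_toSet).2 fun u hu =>
      (measure_biUnion_null_iff u.countable_toSet).2 fun a ha => volume_bary_eq_zero (hAsi u hu) ha)
  simp only [mem_iUnion, not_exists, mem_ofPred_eq] at hyZ
  -- The excluded sets are the hyperplanes spanned by `y` and the ridges of the simplices in `A`;
  -- they are proper because no coordinate vanishes at `y`. The segment from `y` to `z` therefore
  -- misses all these ridges.
  obtain ⟨z, hzb, hzt, hzZ⟩ := hopen t (hS.isSimplex t (Finset.mem_sdiff.1 ht).1) hxt
    (Z := ⋃ u ∈ A, ⋃ a ∈ u, ⋃ b ∈ u.erase a,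
      {z | (bary u a y • bary u b - bary u b y • bary u a) z = 0})
    ((measure_biUnion_null_iff A.countable_toSet).2 fun u hu =>
      (measure_biUnion_null_iff u.countable_toSet).2 fun a ha =>
      (measure_biUnion_null_iff (u.erase a).countable_toSet).2 fun b hb => by
        refine volume_affine_eq_zero _ ⟨b, ?_⟩
        rw [Finset.mem_coe, Finset.mem_erase] at hb
        simp [bary_self (hAsi u hu) hb.2, bary_of_ne (hAsi u hu) ha hb.2 hb.1.symm,
          hyZ u hu a ha])
  simp only [mem_iUnion, not_exists, mem_ofPred_eq] at hzZ
  -- a common point on the segment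
  have hseg : segment ℝ y z ⊆ T := ((convex_ball x ε).segment_subset hyb hzb).trans hball
  obtain ⟨w, hwseg, hwA, hwB⟩ := isPreconnected_closed_iff.1
    (convex_segment (𝕜 := ℝ) y z).isPreconnected _ _ (hKc A)
    (hKc (S \ A)) (hKun ▸ hseg.trans _root_.subset_closure)
    ⟨y, left_mem_segment ℝ y z, mem_iUnion₂.2 ⟨s, hs, hys⟩⟩
    ⟨z, right_mem_segment ℝ y z, mem_iUnion₂.2 ⟨t, ht, hzt⟩⟩
  obtain ⟨s', hs', hws⟩ := mem_iUnion₂.1 hwA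
  obtain ⟨t', ht', hwt⟩ := mem_iUnion₂.1 hwB
  rw [Finset.mem_sdiff] at ht'
  have hss := hAsi s' hs'
  have hne : s' ≠ t' := fun h => ht'.2 (h ▸ hs')
  refine ⟨s', hs', t', ht'.1, ht'.2, s' ∩ t', Finset.inter_subset_left, Finset.inter_subset_right,
    ?_⟩
  have hw : w ∈ convexHull ℝ ((s' : Set (Space d)) ∩ t') := by
    rw [← hS.isMatching s' (hA hs') t' ht'.1]; exact ⟨hws, hwt⟩
  have hzero (a : Space d) (ha : a ∈ s' \ t') : bary s' a w = 0 := by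
    rw [Finset.mem_sdiff] at ha
    exact bary_eq_zero_of_mem_convexHull hss ha.1 inter_subset_left (fun h => ha.2 h.2) hw
  -- Every vertex outside the common face has zero coordinate at `w`. Two of them would place `w` on
  -- a ridge, which the choice of `y` and `z` excludes.
  have hcard : (s' \ t').card = 1 := by
    refine le_antisymm ?_ ?_
    · rw [Finset.card_le_one]
      intro a ha b hb
      by_contra hab
      have ha0 := hzero a ha
      have hb0 := hzero b hb
      rw [Finset.mem_sdiff] at ha hb
      rw [segment_eq_image_lineMap] at hwseg
      obtain ⟨τ, ⟨hτ0, hτ1⟩, rfl⟩ := hwseg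
      have hτ : τ ≠ 0 := fun h => by
        rw [h, AffineMap.lineMap_apply_zero] at ha0
        exact hyZ s' hs' a ha.1 ha0
      rw [AffineMap.apply_lineMap, AffineMap.lineMap_apply_ring'] at ha0 hb0
      refine hzZ s' hs' a ha.1 b (Finset.mem_erase.2 ⟨Ne.symm hab, hb.1⟩) ?_
      change bary s' a y * bary s' b z - bary s' b y * bary s' a z = 0
      have : τ * (bary s' a y * bary s' b z - bary s' b y * bary s' a z) = 0 := by
        linear_combination bary s' a y * hb0 - bary s' b y * ha0
      exact (mul_eq_zero.1 this).resolve_left hτ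
    · rw [Nat.one_le_iff_ne_zero, Finset.card_ne_zero]
      by_contra hemp
      rw [Finset.not_nonempty_iff_eq_empty, Finset.sdiff_eq_empty_iff_subset] at hemp
      exact hne (Finset.eq_of_subset_of_card_le hemp (by rw [hss.1, (hS.isSimplex t' ht'.1).1]))
  have := Finset.card_inter_add_card_sdiff s' t'
  rw [hss.1, hcard] at this
  omega

end IsSubmesh

end submesh

/-- Propagation of a bound through a connected finite graph. -/
theorem abs_sub_le_card_mul {κ : Type*} [DecidableEq κ] {S : Finset κ} {c : κ → ℝ} {δ : ℝ}
    (hδ : 0 ≤ δ)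
    (h : ∀ A ⊆ S, A.Nonempty → A ≠ S → ∃ s ∈ A, ∃ t ∈ S, t ∉ A ∧ |c t - c s| ≤ δ) {s₀ : κ}
    (hs₀ : s₀ ∈ S) : ∀ s ∈ S, |c s - c s₀| ≤ S.card * δ := by
  -- The set grows from `{s₀}` by one vertex per step, and each step costs at most `δ`.
  have key : ∀ m < S.card, ∃ A ⊆ S, s₀ ∈ A ∧ m + 1 = A.card ∧ ∀ s ∈ A, |c s - c s₀| ≤ m * δ := by
    intro m
    induction m with
    | zero => exact fun _ => ⟨{s₀}, by simpa using hs₀, by simp, by simp, by simp⟩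
    | succ m ih =>
      intro hm
      obtain ⟨A, hAS, h0, hcard, hA⟩ := ih (by omega)
      obtain ⟨s, hs, t, ht, htA, hst⟩ := h A hAS ⟨s₀, h0⟩ (by rintro rfl; omega)
      refine ⟨insert t A, Finset.insert_subset ht hAS, Finset.mem_insert_of_mem h0,
        by rw [Finset.card_insert_of_notMem htA]; omega, fun u hu => ?_⟩
      push_cast
      rcases Finset.mem_insert.1 hu with rfl | hu
      · have := abs_sub_le (c u) (c s) (c s₀)
        linarith [hA s hs]
      · linarith [hA u hu]
  intro s hs
  have hpos : 0 < S.card := Finset.card_pos.2 ⟨s₀, hs₀⟩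
  obtain ⟨A, hAS, _, hcard, hA⟩ := key (S.card - 1) (by omega)
  have : A = S := Finset.eq_of_subset_of_card_le hAS (by omega)
  subst this
  refine (hA s hs).trans ?_
  gcongr
  omega

section hypLemmas
variable {d : ℕ} {n p x : Space d}

theorem self_mem_hyp (n p : Space d) : p ∈ hyp n p := by
  change (inner ℝ n (p - p) : ℝ) = 0
  simp

theorem inner_sub_of_mem_hyp (hx : x ∈ hyp n p) (z : Space d) :
    (inner ℝ n (z - x) : ℝ) = inner ℝ n (z - p) := by
  have : (inner ℝ n (x - p) : ℝ) = 0 := hx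
  rw [show z - x = (z - p) - (x - p) by abel, inner_sub_right, this, sub_zero]

theorem hypMeasure_pos (hn : ‖n‖ = 1) (hx : x ∈ hyp n p) {O : Set (Space d)} (hO : IsOpen O)
    (hxO : x ∈ O) : 0 < hypMeasure n p O := by
  obtain ⟨ε, hε, hsub⟩ := Metric.isOpen_iff.1 hO x hxO
  refine lt_of_lt_of_le ?_ (measure_mono
    ((Metric.closedBall_subset_ball (half_lt_self hε)).trans hsub))
  rw [hypMeasure_closedBall hn hx (half_pos hε).le, ENNReal.ofReal_pos]
  exact mul_pos (pow_pos (half_pos hε) _) (unitFaceVolume_pos d)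

end hypLemmas

/-! ### The exceptional set of codimension two -/

section ridges
variable {d : ℕ} {S : Finset (Finset (Space d))}

/-- The union of the affine subspaces of codimension two spanned by the simplices. -/
def ridges (S : Finset (Finset (Space d))) : Set (Space d) :=
  {x | ∃ s ∈ S, ∃ a ∈ s, ∃ b ∈ s, a ≠ b ∧ x ∈ ridge s a b}

open Classical in
/-- The index set of `ridges`. -/
def ridgeIndex (S : Finset (Finset (Space d))) : Finset (Finset (Space d) × Space d × Space d) :=
  S.biUnion fun s => s.offDiag.image fun q => (s, q)

theorem mem_ridgeIndex {q : Finset (Space d) × Space d × Space d} :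
    q ∈ ridgeIndex S ↔ q.1 ∈ S ∧ q.2.1 ∈ q.1 ∧ q.2.2 ∈ q.1 ∧ q.2.1 ≠ q.2.2 := by
  classical
  obtain ⟨s, a, b⟩ := q
  simp only [ridgeIndex, Finset.mem_biUnion, Finset.mem_image, Finset.mem_offDiag, Prod.mk.injEq]
  constructor
  · rintro ⟨s', hs', q, hq, rfl, h⟩
    subst h
    exact ⟨hs', hq⟩
  · rintro ⟨h1, h2⟩
    exact ⟨s, h1, (a, b), h2, rfl, rfl⟩

theorem ridges_eq : ridges S = ⋃ q ∈ ridgeIndex S, ridge q.1 q.2.1 q.2.2 := by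
  ext x
  simp only [ridges, mem_ofPred_eq, mem_iUnion, mem_ridgeIndex]
  constructor
  · rintro ⟨s, hs, a, ha, b, hb, hab, hx⟩
    exact ⟨(s, a, b), ⟨hs, ha, hb, hab⟩, hx⟩
  · rintro ⟨⟨s, a, b⟩, ⟨hs, ha, hb, hab⟩, hx⟩
    exact ⟨s, hs, a, ha, b, hb, hab, hx⟩

theorem isClosed_ridges : IsClosed (ridges S) := by
  rw [ridges_eq]
  exact (ridgeIndex S).finite_toSet.isClosed_biUnion fun q _ => isClosed_ridge _ _ _

theorem hypMeasure_ridges (hd : 2 ≤ d) (hS : ∀ s ∈ S, IsSimplex s) {n p : Space d}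
    (hn : ‖n‖ = 1) : hypMeasure n p (ridges S) = 0 := by
  rw [ridges_eq]
  refine (measure_biUnion_null_iff (ridgeIndex S).countable_toSet).2 fun q hq => ?_
  obtain ⟨h1, h2, h3, h4⟩ := mem_ridgeIndex.1 hq
  exact hypMeasure_ridge hd (hS _ h1) h2 h3 h4 hn

end ridges

/-! ### Local structure of the boundary of an element -/

section local_structure
variable {d : ℕ} {Ω T : Set (Space d)} {M : PolytopalMesh Ω} {S : Finset (Finset (Space d))}
  {r : ℝ} {F : Set (Space d)}

/-- `S` is a submesh of the element `T` that is compatible with the faces. -/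
structure IsCompatible (M : PolytopalMesh Ω) (T : Set (Space d)) (S : Finset (Finset (Space d)))
    (r : ℝ) : Prop extends IsSubmesh T S r where
  mem : T ∈ M.elements
  two_le : 2 ≤ d
  compat : ∀ s ∈ S, ∀ σ ⊆ s, σ.card = d → ∀ F ∈ M.faces,
    intrinsicInterior ℝ (convexHull ℝ (σ : Set (Space d))) ⊆ F ∨
    Disjoint (intrinsicInterior ℝ (convexHull ℝ (σ : Set (Space d)))) F

theorem mem_facesOf : F ∈ M.facesOf T ↔ F ∈ M.faces ∧ F ⊆ frontier T := by
  simp [PolytopalMesh.facesOf]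

namespace IsCompatible

theorem isOutwardNormal (h : IsCompatible M T S r) (hF : F ∈ M.facesOf T) :
    IsOutwardNormal T F (outwardNormal T F) := by
  obtain ⟨hFM, hFT⟩ := mem_facesOf.1 hF
  exact Classical.epsilon_spec (M.exists_normal T h.mem F hFM hFT)

theorem norm_normal (h : IsCompatible M T S r) (hF : F ∈ M.facesOf T) :
    ‖outwardNormal T F‖ = 1 := (h.isOutwardNormal hF).1

theorem nonempty_face (hF : F ∈ M.facesOf T) : F.Nonempty :=
  (M.isPlanarFace F (mem_facesOf.1 hF).1).1

/-- A face is relatively open in some hyperplane and orthogonal to its normal, so by dimension the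
direction of the hyperplane is the orthogonal complement of the normal. -/
theorem exists_face_eq (h : IsCompatible M T S r) (hF : F ∈ M.facesOf T) :
    ∃ U : Set (Space d), IsOpen U ∧ ∀ p ∈ F, F = U ∩ hyp (outwardNormal T F) p := by
  obtain ⟨hFM, hFT⟩ := mem_facesOf.1 hF
  obtain ⟨hn, horth, _⟩ := h.isOutwardNormal hF
  obtain ⟨_, ⟨H, U, hdim, hU, hFU⟩, _⟩ := M.isPlanarFace F hFM
  set n := outwardNormal T F
  have hn0 : n ≠ 0 := by rintro h0; simp [h0] at hn
  refine ⟨U, hU, fun p hp => ?_⟩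
  have hpH : p ∈ H := by rw [hFU] at hp; exact hp.2
  have hpU : p ∈ U := by rw [hFU] at hp; exact hp.1
  have hle : H.direction ≤ (Submodule.span ℝ {n})ᗮ := by
    intro v hv
    rw [Submodule.mem_orthogonal_singleton_iff_inner_right]
    have hcont : Continuous fun ε : ℝ => p + ε • v := by fun_prop
    have hev : ∀ᶠ ε in 𝓝[>] (0 : ℝ), p + ε • v ∈ U :=
      nhdsWithin_le_nhds (hcont.continuousAt.eventually (hU.mem_nhds (by simpa using hpU)))
    obtain ⟨ε, hε, hε0⟩ := (hev.and self_mem_nhdsWithin).exists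
    have hmem : p + ε • v ∈ F := by
      rw [hFU]
      refine ⟨hε, ?_⟩
      have := AffineSubspace.vadd_mem_of_mem_direction (H.direction.smul_mem ε hv) hpH
      rwa [vadd_eq_add, add_comm] at this
    have h1 := horth p hp _ hmem
    rw [add_sub_cancel_left, inner_smul_right] at h1
    exact (mul_eq_zero.1 h1).resolve_left (ne_of_gt hε0)
  have hfr : Module.finrank ℝ (Submodule.span ℝ {n})ᗮ + 1 = d := by
    have h1 := (Submodule.span ℝ {n}).finrank_add_finrank_orthogonal
    rw [finrank_span_singleton hn0, finrank_euclideanSpace_fin] at h1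
    omega
  have heq := Submodule.eq_of_le_of_finrank_eq hle (by omega)
  conv_lhs => rw [hFU]
  congr 1
  ext x
  rw [SetLike.mem_coe, ← AffineSubspace.vsub_right_mem_direction_iff_mem hpH, heq,
    Submodule.mem_orthogonal_singleton_iff_inner_right]
  rfl

theorem restrict_face (h : IsCompatible M T S r) (hF : F ∈ M.facesOf T) {p : Space d} (hp : p ∈ F) :
    ∃ U : Set (Space d), IsOpen U ∧ F = U ∩ hyp (outwardNormal T F) p ∧
      (μHE[d - 1] : Measure (Space d)).restrict F =
        (hypMeasure (outwardNormal T F) p).restrict U := by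
  obtain ⟨U, hU, hFU⟩ := h.exists_face_eq hF
  refine ⟨U, hU, hFU p hp, ?_⟩
  conv_lhs => rw [hFU p hp]
  rw [hypMeasure, Measure.restrict_restrict hU.measurableSet]

/-- Nonempty relatively open parts of a hyperplane have positive surface measure. -/
theorem exists_mem_face_notMem (h : IsCompatible M T S r) (hF : F ∈ M.facesOf T) {p : Space d}
    (hp : p ∈ F) {O Z : Set (Space d)} (hO : IsOpen O) (hpO : p ∈ O)
    (hZ : hypMeasure (outwardNormal T F) p Z = 0) : ∃ y ∈ F, y ∈ O ∧ y ∉ Z := by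
  obtain ⟨U, hU, hFU⟩ := h.exists_face_eq hF
  have hn := h.norm_normal hF
  have hpU : p ∈ U := by have := hp; rw [hFU p hp] at this; exact this.1
  have hpos := hypMeasure_pos hn (self_mem_hyp (outwardNormal T F) p) (hO.inter hU) ⟨hpO, hpU⟩
  have hnot : ¬ (O ∩ U) ∩ hyp (outwardNormal T F) p ⊆ Z := fun hsub => by
    refine hpos.ne' (measure_mono_null (t := Z ∪ (hyp (outwardNormal T F) p)ᶜ) (fun y hy => ?_)
      (measure_union_null hZ ?_))
    · by_cases hyH : y ∈ hyp (outwardNormal T F) p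
      · exact Or.inl (hsub ⟨hy, hyH⟩)
      · exact Or.inr hyH
    · rw [hypMeasure, Measure.restrict_apply (measurableSet_hyp _ _).compl, compl_inter_self,
        measure_empty]
  obtain ⟨y, ⟨⟨hyO, hyU⟩, hyH⟩, hyZ⟩ := Set.not_subset.1 hnot
  exact ⟨y, by rw [hFU p hp]; exact ⟨hyU, hyH⟩, hyO, hyZ⟩

theorem openFacet_compat (h : IsCompatible M T S r) {s : Finset (Space d)} (hs : s ∈ S)
    {a : Space d} (ha : a ∈ s) (hF : F ∈ M.faces) {x : Space d} (hx : x ∈ openFacet s a)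
    (hxF : x ∈ F) : openFacet s a ⊆ F := by
  classical
  have h1 := openFacet_subset_intrinsicInterior (h.isSimplex s hs) ha
  have hc : (s.erase a).card = d := by
    rw [Finset.card_erase_of_mem ha, (h.isSimplex s hs).1]; rfl
  rcases h.compat s hs (s.erase a) (Finset.erase_subset _ _) hc F hF with h2 | h2
  · exact h1.trans h2
  · exact absurd hxF (Set.disjoint_left.1 h2 (h1 hx))

/-- A frontier point lies in a closed simplex but not in its interior, so some coordinate vanishes;
away from the ridges only one does. -/
theorem exists_mem_openFacet (h : IsCompatible M T S r) {x : Space d} (hx : x ∈ frontier T)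
    (hxr : x ∉ ridges S) : ∃ s ∈ S, ∃ a ∈ s, x ∈ openFacet s a := by
  have hxc := frontier_subset_closure hx
  rw [h.closure_eq] at hxc
  obtain ⟨s, hs, hxs⟩ := mem_iUnion₂.1 hxc
  have hss := h.isSimplex s hs
  have hnT : x ∉ T := by
    rw [h.isOpen.frontier_eq] at hx; exact hx.2
  have hni : ¬ ∀ a ∈ s, 0 < bary s a x := fun hcon =>
    hnT (h.interior_subset_element s hs ((mem_interior_iff_bary hss).2 hcon))
  push Not at hni
  obtain ⟨a, ha, hle⟩ := hni
  have h0 := (mem_convexHull_iff_bary hss).1 hxs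
  have ha0 : bary s a x = 0 := le_antisymm hle (h0 a ha)
  refine ⟨s, hs, a, ha, ha0, fun b hb hba => lt_of_le_of_ne (h0 b hb) fun hb0 => hxr ?_⟩
  exact ⟨s, hs, a, ha, b, hb, hba.symm, ha0, hb0.symm⟩

/-- Near `x` only those closed facets are met that contain `x`, as there are finitely many. A
generic point of `F` close to `x` lies in an open facet, which compatibility places inside `F`; as
`x` is in the closed facet and off the ridges, it is in the open one. -/
theorem mem_face_of_mem_closure (h : IsCompatible M T S r) (hF : F ∈ M.facesOf T) {x : Space d}
    (hx : x ∈ closure F) (hxr : x ∉ ridges S) : x ∈ F := by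
  obtain ⟨hFM, hFT⟩ := mem_facesOf.1 hF
  set Z : Finset (Space d) → Space d → Set (Space d) :=
    fun s a => convexHull ℝ (s : Set (Space d)) ∩ {y | bary s a y = 0} with hZ
  have hZc (s a) : IsClosed (Z s a) :=
    (isClosed_simplex s).inter (isClosed_eq (continuous_bary s a) continuous_const)
  have hev : ∀ᶠ y in 𝓝 x, ∀ s ∈ S, ∀ a ∈ s, x ∉ Z s a → y ∉ Z s a := by
    rw [eventually_all_finset]
    intro s _
    rw [eventually_all_finset]
    intro a _
    by_cases hxZ : x ∈ Z s a
    · exact Eventually.of_forall fun y hn => absurd hxZ hn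
    · filter_upwards [(hZc s a).isOpen_compl.mem_nhds hxZ] with y hy _ using hy
  obtain ⟨O, hOs, hO, hxO⟩ := eventually_nhds_iff.1 hev
  obtain ⟨p, hpO, hpF⟩ := mem_closure_iff.1 hx O hO hxO
  obtain ⟨y, hyF, hyO, hyr⟩ := h.exists_mem_face_notMem hF hpF hO hpO
    (hypMeasure_ridges h.two_le h.isSimplex (h.norm_normal hF))
  obtain ⟨s, hs, a, ha, hya⟩ := h.exists_mem_openFacet (hFT hyF) hyr
  have hsub := h.openFacet_compat hs ha hFM hya hyF
  refine hsub ?_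
  have hxZ : x ∈ Z s a := by
    by_contra hcon
    exact hOs y hyO s hs a ha hcon ⟨openFacet_subset_convexHull (h.isSimplex s hs) hya, hya.1⟩
  refine ⟨hxZ.2, fun b hb hba => lt_of_le_of_ne
    ((mem_convexHull_iff_bary (h.isSimplex s hs)).1 hxZ.1 b hb) fun hb0 => hxr ?_⟩
  exact ⟨s, hs, a, ha, b, hb, hba.symm, hxZ.2, hb0.symm⟩

theorem exists_face_of_mem_frontier (h : IsCompatible M T S r) {x : Space d} (hx : x ∈ frontier T)
    (hxr : x ∉ ridges S) : ∃ F ∈ M.facesOf T, x ∈ F := by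
  rw [M.frontier_eq T h.mem] at hx
  obtain ⟨F, hF, hxF⟩ := mem_iUnion₂.1 hx
  have hF' : F ∈ M.facesOf T := mem_facesOf.2 hF
  exact ⟨F, hF', h.mem_face_of_mem_closure hF' hxF hxr⟩

/-- Near `x` the frontier lies in the hyperplane of `F`, because the closures of the other faces
stay away. Each open half ball is connected and avoids the frontier, hence is inside `T` or outside
its closure; a nearby point where the defining property of the outward normal holds decides which.
-/
theorem exists_local (h : IsCompatible M T S r) (hF : F ∈ M.facesOf T) {x : Space d} (hx : x ∈ F)
    (hxr : x ∉ ridges S) : ∃ ρ > 0,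
      (∀ z ∈ Metric.ball x ρ, z ∈ T ↔ inner ℝ (outwardNormal T F) (z - x) < 0) ∧
      (∀ F' ∈ M.facesOf T, F' ≠ F → Disjoint F' (Metric.ball x ρ)) ∧
      F ∩ Metric.ball x ρ = hyp (outwardNormal T F) x ∩ Metric.ball x ρ := by
  obtain ⟨hFM, hFT⟩ := mem_facesOf.1 hF
  obtain ⟨U, hU, hFU, hres⟩ := h.restrict_face hF hx
  have hnorm := h.norm_normal hF
  have hae := (h.isOutwardNormal hF).2.2
  set n := outwardNormal T F
  have hxU : x ∈ U := by have := hx; rw [hFU] at this; exact this.1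
  have hev : ∀ᶠ y in 𝓝 x, y ∈ U ∧ ∀ F' ∈ M.facesOf T, F' ≠ F → y ∉ closure F' := by
    have hU' : ∀ᶠ y in 𝓝 x, y ∈ U := hU.mem_nhds hxU
    refine hU'.and ?_
    rw [eventually_all_finset]
    intro F' hF'
    by_cases hne : F' = F
    · exact Eventually.of_forall fun y hn => absurd hne hn
    · have hnc : x ∉ closure F' := fun hcon => by
        have := h.mem_face_of_mem_closure hF' hcon hxr
        exact Set.disjoint_left.1 (M.faces_disjoint F' (mem_facesOf.1 hF').1 F hFM hne) this hx
      filter_upwards [isClosed_closure.isOpen_compl.mem_nhds hnc] with y hy _ using hy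
  obtain ⟨ρ, hρ, hball⟩ := Metric.eventually_nhds_iff_ball.1 hev
  set B := Metric.ball x ρ
  have hFB : F ∩ B = hyp n x ∩ B := by
    conv_lhs => rw [hFU]
    ext z
    exact ⟨fun hz => ⟨hz.1.2, hz.2⟩, fun hz => ⟨⟨(hball z hz.2).1, hz.1⟩, hz.2⟩⟩
  have hfr : ∀ z ∈ B, z ∈ frontier T → z ∈ hyp n x := by
    intro z hz hzf
    rw [M.frontier_eq T h.mem] at hzf
    obtain ⟨F', hF', hzF⟩ := mem_iUnion₂.1 hzf
    have hF'' : F' ∈ M.facesOf T := mem_facesOf.2 hF'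
    by_cases hne : F' = F
    · subst hne
      refine closure_minimal ?_ (isClosed_hyp n x) hzF
      conv_lhs => rw [hFU]
      exact inter_subset_right
    · exact absurd hzF ((hball z hz).2 F' hF'' hne)
  -- a good point of the face
  have hgood : ∃ y ∈ F, y ∈ B ∧ ¬ ¬ (∃ ε > 0, ∀ t ∈ Ioo (0 : ℝ) ε,
      y - t • n ∈ T ∧ y + t • n ∉ closure T) := by
    rw [hres, ae_restrict_iff' hU.measurableSet] at hae
    obtain ⟨y, h1, ⟨h2, h2'⟩, h3⟩ := h.exists_mem_face_notMem hF hx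
      (Metric.isOpen_ball.inter hU) ⟨Metric.mem_ball_self hρ, hxU⟩ (ae_iff.1 hae)
    exact ⟨y, h1, h2, fun hcon => h3 fun hcon2 => hcon (hcon2 h2')⟩
  obtain ⟨y, hyF, hyB, hy⟩ := hgood
  rw [not_not] at hy
  obtain ⟨ε, hε, hyε⟩ := hy
  have hyH : (inner ℝ n (y - x) : ℝ) = 0 := (hFB.subset ⟨hyF, hyB⟩).1
  have hnn : (inner ℝ n n : ℝ) = 1 := by rw [real_inner_self_eq_norm_sq, hnorm]; norm_num
  have hsmall (c : ℝ) : ∀ᶠ t in 𝓝[>] (0 : ℝ), y + t • (c • n) ∈ B := by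
    have hcont : Continuous fun t : ℝ => y + t • (c • n) := by fun_prop
    exact nhdsWithin_le_nhds (hcont.continuousAt.eventually
      (Metric.isOpen_ball.mem_nhds (by simpa only [zero_smul, add_zero] using hyB)))
  obtain ⟨t, ⟨ht1, ht2⟩, ht0, htε⟩ := (((hsmall 1).and (hsmall (-1))).and
    (Ioo_mem_nhdsGT hε)).exists
  rw [one_smul] at ht1
  rw [neg_smul, one_smul, smul_neg, ← sub_eq_add_neg] at ht2
  obtain ⟨hyT, hyC⟩ := hyε t ⟨ht0, htε⟩
  have hconv (c : ℝ) : IsPreconnected (B ∩ {z | 0 < c * inner ℝ n (z - x)}) := by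
    refine ((convex_ball x ρ).inter ?_).isPreconnected
    have : {z : Space d | 0 < c * inner ℝ n (z - x)} =
        {z | c * inner ℝ n x < (c • innerSL ℝ n) z} := by
      ext z
      simp [inner_sub_right, mul_sub]
    rw [this]
    exact convex_halfSpace_gt (c • innerSL ℝ n).toLinearMap.isLinear _
  have hcov (c : ℝ) : B ∩ {z | 0 < c * inner ℝ n (z - x)} ⊆ T ∪ (closure T)ᶜ := by
    rintro z ⟨hzB, hz⟩
    by_contra hcon
    rw [mem_union, not_or, mem_compl_iff, not_not] at hcon
    have hzf : z ∈ frontier T := by rw [h.isOpen.frontier_eq]; exact ⟨hcon.2, hcon.1⟩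
    have : (inner ℝ n (z - x) : ℝ) = 0 := hfr z hzB hzf
    rw [mem_ofPred_eq, this, mul_zero] at hz
    exact lt_irrefl _ hz
  have hdis : Disjoint T (closure T)ᶜ := disjoint_compl_right_iff_subset.2 subset_closure
  have hlow : B ∩ {z | 0 < (-1) * inner ℝ n (z - x)} ⊆ T := by
    refine (hconv (-1)).subset_left_of_subset_union h.isOpen isClosed_closure.isOpen_compl hdis
      (hcov _) ⟨y - t • n, ⟨ht2, ?_⟩, hyT⟩
    rw [mem_ofPred_eq, show y - t • n - x = (y - x) - t • n by abel, inner_sub_right, hyH,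
      inner_smul_right, hnn]
    linarith
  have hup : B ∩ {z | 0 < 1 * inner ℝ n (z - x)} ⊆ (closure T)ᶜ := by
    refine (hconv 1).subset_right_of_subset_union h.isOpen isClosed_closure.isOpen_compl hdis
      (hcov _) ⟨y + t • n, ⟨ht1, ?_⟩, hyC⟩
    rw [mem_ofPred_eq, show y + t • n - x = (y - x) + t • n by abel, inner_add_right, hyH,
      inner_smul_right, hnn]
    linarith
  refine ⟨ρ, hρ, fun z hz => ?_, fun F' hF' hne => ?_, hFB⟩
  · constructor
    · intro hzT
      by_contra hcon
      rw [not_lt] at hcon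
      rcases hcon.lt_or_eq with h1 | h1
      · exact hup ⟨hz, by rw [mem_ofPred_eq]; linarith⟩ (subset_closure hzT)
      · have hzF : z ∈ F := (hFB.symm.subset ⟨h1.symm, hz⟩).1
        have := hFT hzF
        rw [h.isOpen.frontier_eq] at this
        exact this.2 hzT
    · intro hz0
      exact hlow ⟨hz, by rw [mem_ofPred_eq]; linarith⟩
  · exact Set.disjoint_left.2 fun z hzF hz => (hball z hz).2 F' hF' hne (subset_closure hzF)

end IsCompatible

end local_structure

/-! ### Columns over a face and the trace inequality -/

section face
variable {d : ℕ} {Ω T : Set (Space d)} {M : PolytopalMesh Ω} {S : Finset (Finset (Space d))}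
  {r : ℝ} {F : Set (Space d)} {u : Space d → ℝ} {G : Space d → Space d}

namespace IsCompatible

theorem openFacet_nonempty (hd : 1 ≤ d) {s : Finset (Space d)} (hs : IsSimplex s) {a : Space d}
    (ha : a ∈ s) : (openFacet s a).Nonempty := by
  classical
  have hc : (s.erase a).card = d := by rw [Finset.card_erase_of_mem ha, hs.1]; rfl
  have hb (b) (hb : b ∈ s) := bary_facetCenter hd hs (Finset.erase_subset a s) hc hb
  refine ⟨facetCenter (s.erase a), ?_, fun b hbs hba => ?_⟩
  · simpa using hb a ha
  · rw [hb b hbs, if_pos (Finset.mem_erase.2 ⟨hba, hbs⟩)]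
    positivity

/-- The normal of a face is a multiple of the gradient of the barycentric coordinate of each
facet contained in it. -/
theorem exists_normal_eq_smul (h : IsCompatible M T S r) (hF : F ∈ M.facesOf T)
    {s : Finset (Space d)} (hs : s ∈ S) {a : Space d} (ha : a ∈ s) (hsub : openFacet s a ⊆ F) :
    ∃ c : ℝ, c ≤ -r ∧ outwardNormal T F = c • baryGrad s a := by
  have hd := h.two_le
  have hss := h.isSimplex s hs
  obtain ⟨x, hx⟩ := openFacet_nonempty (by omega) hss ha
  have hnorm := h.norm_normal hF
  obtain ⟨_, horth, _⟩ := h.isOutwardNormal hF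
  set n := outwardNormal T F with hn
  set g := baryGrad s a with hg
  obtain ⟨b, hb, hba, -⟩ := exists_third_vertex hd hss a a
  have hgab : (inner ℝ g (a - b) : ℝ) = 1 := by
    rw [← bary_sub, bary_self hss ha, bary_of_ne hss ha hb hba.symm, sub_zero]
  have hg0 : g ≠ 0 := fun h0 => by rw [h0] at hgab; simp at hgab
  have hgn : ‖g‖ ^ 2 ≠ 0 := pow_ne_zero 2 (norm_ne_zero_iff.2 hg0)
  -- small displacements along the facet
  have hperp (v : Space d) (hv : (inner ℝ g v : ℝ) = 0) : (inner ℝ n v : ℝ) = 0 := by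
    have hev : ∀ᶠ ε in 𝓝[>] (0 : ℝ), ∀ c ∈ s, c ≠ a → 0 < bary s c (x + ε • v) := by
      rw [eventually_all_finset]
      intro c hc
      by_cases hca : c = a
      · exact Eventually.of_forall fun _ hne => absurd hca hne
      · have hcont : Continuous fun ε : ℝ => bary s c (x + ε • v) :=
          (continuous_bary s c).comp (by fun_prop)
        have := hcont.continuousAt (x := (0 : ℝ)) |>.eventually (lt_mem_nhds (a := 0)
          (by simpa only [zero_smul, add_zero] using hx.2 c hc hca))
        filter_upwards [nhdsWithin_le_nhds this] with ε hε _ using hε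
    obtain ⟨ε, hε, hε0⟩ := (hev.and self_mem_nhdsWithin).exists
    have hmem : x + ε • v ∈ openFacet s a := by
      refine ⟨?_, hε⟩
      rw [bary_add, inner_smul_right, ← hg, hv, hx.1]; simp
    have h1 := horth x (hsub hx) _ (hsub hmem)
    rw [add_sub_cancel_left, inner_smul_right] at h1
    exact (mul_eq_zero.1 h1).resolve_left (ne_of_gt hε0)
  set c : ℝ := inner ℝ g n / ‖g‖ ^ 2 with hc
  have hnc : n = c • g := by
    have hv : (inner ℝ g (n - c • g) : ℝ) = 0 := by
      rw [inner_sub_right, inner_smul_right, real_inner_self_eq_norm_sq, hc]; field_simp; ring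
    have h1 := hperp _ hv
    have h2 : (inner ℝ (n - c • g) (n - c • g) : ℝ) = 0 := by
      rw [inner_sub_left, h1, inner_smul_left, hv]; simp
    exact sub_eq_zero.1 (inner_self_eq_zero.1 h2)
  refine ⟨c, ?_, hnc⟩
  -- The sign: at a point of the face over the facet where the local description is available,
  -- moving in the direction `a - b` enters the simplex and thus `T`, which lies on the negative
  -- side of the normal.
  have hcneg : c < 0 := by
    have hopen : IsOpen {y | ∀ b ∈ s, b ≠ a → 0 < bary s b y} := by
      have : {y | ∀ b ∈ s, b ≠ a → 0 < bary s b y} =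
          ⋂ b ∈ s, {y | b ≠ a → 0 < bary s b y} := by ext; simp
      rw [this]
      refine isOpen_biInter_finset fun b _ => ?_
      by_cases hba : b = a
      · simp [hba]
      · simpa [hba] using isOpen_lt continuous_const (continuous_bary s b)
    obtain ⟨y, hyF, hyO, hyr⟩ := h.exists_mem_face_notMem hF (hsub hx) hopen hx.2
      (hypMeasure_ridges hd h.isSimplex hnorm)
    obtain ⟨ρ, hρ, hloc, -, -⟩ := h.exists_local hF hyF hyr
    have hya : bary s a y = 0 := by
      have h1 := horth x (hsub hx) y hyF
      rw [hnc, inner_smul_left] at h1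
      have hc0 : c ≠ 0 := fun h0 => by rw [h0, zero_smul] at hnc; rw [hnc] at hnorm; simp at hnorm
      have h2 := bary_sub s a y x
      rw [hx.1, sub_zero, ← hg] at h2
      rw [h2]
      exact (mul_eq_zero.1 h1).resolve_left (by simpa using hc0)
    have hev1 : ∀ᶠ t in 𝓝[>] (0 : ℝ), y + t • (a - b) ∈ interior (convexHull ℝ (s : Set (Space d))) := by
      simp only [mem_interior_iff_bary hss]
      rw [eventually_all_finset]
      intro w hw
      by_cases hwa : w = a
      · subst hwa
        filter_upwards [self_mem_nhdsWithin] with t ht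
        rw [bary_add, inner_smul_right, ← hg, hgab, hya]
        simpa using ht
      · have hcont : Continuous fun ε : ℝ => bary s w (y + ε • (a - b)) :=
          (continuous_bary s w).comp (by fun_prop)
        exact nhdsWithin_le_nhds (hcont.continuousAt (x := (0 : ℝ)) |>.eventually
          (lt_mem_nhds (a := 0) (by simpa only [zero_smul, add_zero] using hyO w hw hwa)))
    have hev2 : ∀ᶠ t in 𝓝[>] (0 : ℝ), y + t • (a - b) ∈ Metric.ball y ρ := by
      have hcont : Continuous fun t : ℝ => y + t • (a - b) := by fun_prop
      exact nhdsWithin_le_nhds (hcont.continuousAt.eventually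
        (Metric.isOpen_ball.mem_nhds (by simpa using hρ)))
    obtain ⟨t, ⟨h1, h2⟩, ht⟩ := ((hev1.and hev2).and self_mem_nhdsWithin).exists
    have h3 := (hloc _ h2).1 (h.interior_subset_element s hs h1)
    rw [add_sub_cancel_left, inner_smul_right, ← hn, hnc, inner_smul_left, hgab] at h3
    simp only [conj_trivial, mul_one] at h3
    by_contra hcon
    have := mul_nonneg (le_of_lt ht) (not_lt.1 hcon)
    linarith
  -- The gradient has norm at most `1 / r` and the normal has norm `1`, so the factor is at least
  -- `r` in absolute value.
  obtain ⟨x0, hx0⟩ := h.exists_ball s hs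
  have h1 := norm_baryGrad_le hss ha h.pos hx0
  rw [← hg] at h1
  have h2 : -c * ‖g‖ = 1 := by
    have := hnorm
    rw [hnc, norm_smul, Real.norm_eq_abs, abs_of_neg hcneg] at this
    exact this
  have hgpos : 0 < ‖g‖ := norm_pos_iff.2 hg0
  nlinarith

/-- The columns over the part of the facet of `s` opposite to `q.1` in the direction of the vertex
`q.2`. -/
def columnBase (S : Finset (Finset (Space d))) (s : Finset (Space d)) (p : Space d) (R : ℝ)
    (a b : Space d) : Set (Space d) :=
  (Metric.ball p R ∩ {y | 1 / (2 * (d : ℝ)) < bary s b y} ∩ {y | ∀ w ∈ s, w ≠ a → 0 < bary s w y}) \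
    ridges S

theorem isOpen_columnBase (S : Finset (Finset (Space d))) (s : Finset (Space d)) (p : Space d)
    (R : ℝ) (a b : Space d) : IsOpen (columnBase S s p R a b) := by
  refine ((Metric.isOpen_ball.inter (isOpen_lt continuous_const (continuous_bary s b))).inter
    ?_).sdiff isClosed_ridges
  have : {y | ∀ b ∈ s, b ≠ a → 0 < bary s b y} =
      ⋂ b ∈ s, {y | b ≠ a → 0 < bary s b y} := by ext; simp
  rw [this]
  refine isOpen_biInter_finset fun b _ => ?_
  by_cases hba : b = a
  · simp [hba]
  · simpa [hba] using isOpen_lt continuous_const (continuous_bary s b)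

/-- A face is covered, up to ridges, by the bases of columns. -/
theorem exists_columns (h : IsCompatible M T S r) (hF : F ∈ M.facesOf T) {p : Space d}
    (hp : p ∈ F) : ∃ J : Finset (Finset (Space d) × Space d × Space d),
      J.card ≤ S.card * (d + 1) ^ 2 ∧ ∃ V : Finset (Space d) × Space d × Space d → Set (Space d),
      F ⊆ ridges S ∪ ⋃ q ∈ J, V q ∧ ∀ q ∈ J,
        IsColumn T (outwardNormal T F) p (q.2.1 - q.2.2) (V q) (1 / (2 * (d : ℝ))) ∧
        r ≤ |inner ℝ (outwardNormal T F) (q.2.1 - q.2.2)| ∧ ‖q.2.1 - q.2.2‖ ≤ Metric.diam T ∧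
        V q ∩ hyp (outwardNormal T F) p ⊆ F \ ridges S := by
  classical
  obtain ⟨hFM, hFT⟩ := mem_facesOf.1 hF
  have hd := h.two_le
  have hdpos : (0 : ℝ) < d := by exact_mod_cast (by omega : 0 < d)
  have hnorm := h.norm_normal hF
  obtain ⟨_, horth, _⟩ := h.isOutwardNormal hF
  obtain ⟨U, _, hFU, _⟩ := h.restrict_face hF hp
  set n := outwardNormal T F with hn
  set J : Finset (Finset (Space d) × Space d × Space d) :=
    S.biUnion fun s => (s.offDiag.filter fun q => openFacet s q.1 ⊆ F).image fun q => (s, q) with hJ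
  have hmem (q) : q ∈ J ↔ q.1 ∈ S ∧ (q.2.1 ∈ q.1 ∧ q.2.2 ∈ q.1 ∧ q.2.1 ≠ q.2.2) ∧
      openFacet q.1 q.2.1 ⊆ F := by
    obtain ⟨s, a, b⟩ := q
    simp only [hJ, Finset.mem_biUnion, Finset.mem_image, Finset.mem_filter, Finset.mem_offDiag,
      Prod.mk.injEq]
    constructor
    · rintro ⟨s', hs', q, hq, rfl, h⟩
      subst h
      exact ⟨hs', hq⟩
    · rintro ⟨h1, h2⟩
      exact ⟨s, h1, (a, b), h2, rfl, rfl⟩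
  set R := Metric.diam T + 1 with hR
  refine ⟨J, ?_, fun q => columnBase S q.1 p R q.2.1 q.2.2, ?_, ?_⟩
  · refine (Finset.card_biUnion_le_card_mul _ _ ((d + 1) ^ 2) fun s hs => ?_)
    refine Finset.card_image_le.trans ((Finset.card_filter_le _ _).trans ?_)
    rw [Finset.offDiag_card, (h.isSimplex s hs).1, sq]
    exact Nat.sub_le _ _
  · intro x hx
    by_cases hxr : x ∈ ridges S
    · exact Or.inl hxr
    refine Or.inr ?_
    obtain ⟨s, hs, a, ha, hxa⟩ := h.exists_mem_openFacet (hFT hx) hxr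
    have hss := h.isSimplex s hs
    have hsub := h.openFacet_compat hs ha hFM hxa hx
    -- The `d` remaining coordinates sum to `1`, so one exceeds `1 / (2 d)`. Along `a - b` the
    -- coordinate of `a` grows by `t`, that of `b` decreases by `t` and the others are constant; a
    -- column of height `1 / (2 d)` hence stays in the simplex.
    obtain ⟨b, hb, hbx⟩ : ∃ b ∈ s.erase a, 1 / (2 * (d : ℝ)) < bary s b x := by
      by_contra! hcon
      have h1 := sum_bary hss x
      rw [← Finset.add_sum_erase s _ ha, hxa.1, zero_add] at h1
      have h2 := Finset.sum_le_card_nsmul _ _ _ hcon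
      rw [h1, Finset.card_erase_of_mem ha, hss.1, nsmul_eq_mul] at h2
      have : ((d + 1 - 1 : ℕ) : ℝ) * (1 / (2 * (d : ℝ))) = 1 / 2 := by
        rw [Nat.add_sub_cancel]; field_simp
      rw [this] at h2
      norm_num at h2
    rw [Finset.mem_erase] at hb
    refine mem_iUnion₂.2 ⟨(s, a, b), (hmem _).2 ⟨hs, ⟨ha, hb.2, hb.1.symm⟩, hsub⟩,
      ⟨⟨?_, hbx⟩, hxa.2⟩, hxr⟩
    have := h.dist_le (frontier_subset_closure (hFT hx)) (frontier_subset_closure (hFT hp))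
    rw [Metric.mem_ball]; linarith
  · intro q hq
    obtain ⟨hs, ⟨ha, hb, hab⟩, hsub⟩ := (hmem q).1 hq
    obtain ⟨s, a, b⟩ := q
    simp only at hs ha hb hab hsub ⊢
    have hss := h.isSimplex s hs
    obtain ⟨c, hc, hnc⟩ := h.exists_normal_eq_smul hF hs ha hsub
    rw [← hn] at hnc
    have hr := h.pos
    have hgab : (inner ℝ (baryGrad s a) (a - b) : ℝ) = 1 := by
      rw [← bary_sub, bary_self hss ha, bary_of_ne hss ha hb hab, sub_zero]
    have hnab : (inner ℝ n (a - b) : ℝ) = c := by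
      rw [hnc, inner_smul_left, hgab]; simp
    have hcneg : c < 0 := by linarith
    obtain ⟨x, hx⟩ := openFacet_nonempty (by omega) hss ha
    have hzero : ∀ y ∈ hyp n p, bary s a y = 0 := by
      intro y hy
      have hxp : (inner ℝ n (x - p) : ℝ) = 0 := horth p hp x (hsub hx)
      have h1 : (inner ℝ n (y - x) : ℝ) = 0 := by
        rw [inner_sub_of_mem_hyp hxp]; exact hy
      rw [hnc, inner_smul_left] at h1
      have h2 := bary_sub s a y x
      rw [hx.1, sub_zero] at h2
      rw [h2]
      exact (mul_eq_zero.1 h1).resolve_left (by simpa using hcneg.ne)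
    refine ⟨⟨hnorm, by rw [hnab]; exact hcneg, by positivity, isOpen_columnBase _ _ _ _ _ _,
      Metric.isBounded_ball.subset (fun y hy => hy.1.1.1), fun y hy hyH t ht => ?_⟩, ?_, ?_,
      fun y hy => ⟨hsub ⟨hzero y hy.2, hy.1.1.2⟩, hy.1.2⟩⟩
    · refine h.interior_subset_element s hs ((mem_interior_iff_bary hss).2 fun w hw => ?_)
      rw [bary_add, inner_smul_right, ← bary_sub]
      by_cases hwa : w = a
      · rw [hwa, hzero y hyH, bary_self hss ha, bary_of_ne hss ha hb hab]
        linarith [ht.1]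
      · by_cases hwb : w = b
        · rw [hwb, bary_self hss hb, bary_of_ne hss hb ha hab.symm]
          have : 1 / (2 * (d : ℝ)) < bary s b y := hy.1.1.2
          linarith [ht.2]
        · rw [bary_of_ne hss hw ha hwa, bary_of_ne hss hw hb hwb]
          have := hy.1.2 w hw hwa
          linarith
    · rw [hnab, abs_of_neg hcneg]; linarith
    · rw [← dist_eq_norm]
      have hcl := h.simplex_subset_closure hs
      exact h.dist_le (hcl (subset_convexHull ℝ _ ha)) (hcl (subset_convexHull ℝ _ hb))

/-- `u` has the boundary value `trace T u` at almost every point of a face, and the trace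
inequality holds. -/
theorem trace_properties (h : IsCompatible M T S r) (hu : IsH1 T u G) (hF : F ∈ M.facesOf T) :
    (∀ᵐ x ∂(μHE[d - 1] : Measure (Space d)).restrict F,
      Tendsto (fun ρ => ⨍ z in Metric.ball x ρ ∩ T, u z) (𝓝[>] 0) (𝓝 (trace T u x))) ∧
    AEStronglyMeasurable (trace T u) ((μHE[d - 1] : Measure (Space d)).restrict F) ∧
    ∫⁻ x in F, ‖trace T u x‖ₑ ^ 2 ∂(μHE[d - 1] : Measure (Space d)) ≤
      ENNReal.ofReal (S.card * (d + 1) ^ 2 * r⁻¹) * (ENNReal.ofReal (4 * d) * (∫⁻ x in T, ‖u x‖ₑ ^ 2) +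
        ENNReal.ofReal (Metric.diam T ^ 2) * ∫⁻ x in T, ‖G x‖ₑ ^ 2) := by
  obtain ⟨p, hp⟩ := nonempty_face hF
  have hd := h.two_le
  have hdpos : (0 : ℝ) < d := by exact_mod_cast (by omega : 0 < d)
  have hr := h.pos
  obtain ⟨J, hJc, V, hFV, hV⟩ := h.exists_columns hF hp
  obtain ⟨U, hU, hFU, hres⟩ := h.restrict_face hF hp
  have hnorm := h.norm_normal hF
  set n := outwardNormal T F with hn
  have hb := h.volume_lt_top
  have hVm (q) (hq : q ∈ J) : MeasurableSet (V q) := (hV q hq).1.isOpen.measurableSet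
  have hloc (q) (hq : q ∈ J) : ∀ x ∈ V q, x ∈ hyp n p →
      ∃ r > 0, ∀ z ∈ Metric.ball x r, z ∈ T ↔ inner ℝ n (z - p) < 0 := by
    intro x hx hxH
    obtain ⟨hxF, hxr⟩ := (hV q hq).2.2.2 ⟨hx, hxH⟩
    obtain ⟨ρ, hρ, h1, -, -⟩ := h.exists_local hF hxF hxr
    exact ⟨ρ, hρ, fun z hz => by rw [h1 z hz, inner_sub_of_mem_hyp hxH]⟩
  -- almost everywhere on the face one is in the base of a column
  have hae : ∀ᵐ x ∂(μHE[d - 1] : Measure (Space d)).restrict F, x ∈ ⋃ q ∈ J, V q := by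
    have h1 : ∀ᵐ x ∂(μHE[d - 1] : Measure (Space d)).restrict F, x ∉ ridges S := by
      rw [hres]
      exact ae_restrict_of_ae (measure_eq_zero_iff_ae_notMem.1
        (hypMeasure_ridges hd h.isSimplex hnorm))
    have h2 : ∀ᵐ x ∂(μHE[d - 1] : Measure (Space d)).restrict F, x ∈ F := by
      refine ae_restrict_mem ?_
      rw [hFU]; exact hU.measurableSet.inter (measurableSet_hyp _ _)
    filter_upwards [h1, h2] with x hx1 hx2
    exact (hFV hx2).resolve_left hx1
  -- Almost all of the face lies in the bases, so its measure is dominated by the hyperplane measure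
  -- on their union, and statements over single bases transfer.
  have hle : (μHE[d - 1] : Measure (Space d)).restrict F ≤
      (hypMeasure n p).restrict (⋃ q ∈ J, V q) := by
    rw [← Measure.restrict_eq_self_of_ae_mem hae]
    refine Measure.restrict_mono le_rfl ?_
    rw [hres]; exact Measure.restrict_le_self
  have htr (q) (hq : q ∈ J) := (hV q hq).1.trace_eq h.isOpen hb hu (hloc q hq)
  have haeV {P : Space d → Prop} (hP : ∀ q ∈ J, ∀ᵐ x ∂(hypMeasure n p).restrict (V q), P x) :
      ∀ᵐ x ∂(μHE[d - 1] : Measure (Space d)).restrict F, P x := by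
    have h1 : ∀ᵐ x ∂(hypMeasure n p).restrict (⋃ q ∈ J, V q), P x := by
      rw [ae_restrict_biUnion_finset_iff]; exact hP
    exact (Measure.absolutelyContinuous_of_le hle).ae_le h1
  have hUn : ⋃ q ∈ J, V q = ⋃ q : J, V q := by ext; simp
  refine ⟨haeV fun q hq => ?_, ?_, ?_⟩
  · filter_upwards [(hV q hq).1.tendsto_average h.isOpen hb hu, htr q hq,
      ae_restrict_of_ae (ae_restrict_mem (measurableSet_hyp n p)),
      ae_restrict_mem (hVm q hq)] with x h1 h2 h3 h4
    rw [h2]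
    exact h1 (hloc q hq x h4 h3)
  · refine AEStronglyMeasurable.mono_measure ?_ hle
    rw [hUn]
    refine AEStronglyMeasurable.iUnion fun q => ?_
    refine AEStronglyMeasurable.congr ?_ (htr q q.2).symm
    exact (aestronglyMeasurable_colTrace hnorm (hV q q.2).1.inner_neg.ne h.isOpen hb hu
      (hV q q.2).1.pos).restrict
  · have hq (q) (hq : q ∈ J) : ∫⁻ x in V q, ‖trace T u x‖ₑ ^ 2 ∂hypMeasure n p ≤
        ENNReal.ofReal r⁻¹ * (ENNReal.ofReal (4 * d) * (∫⁻ x in T, ‖u x‖ₑ ^ 2) +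
          ENNReal.ofReal (Metric.diam T ^ 2) * ∫⁻ x in T, ‖G x‖ₑ ^ 2) := by
      obtain ⟨hcol, hα, hdiam, -⟩ := hV q hq
      rw [lintegral_congr_ae (g := fun x => ‖colTrace T u G (q.2.1 - q.2.2) (1 / (2 * d)) x‖ₑ ^ 2)
        (by filter_upwards [htr q hq] with x hx; rw [hx])]
      refine (hcol.lintegral_colTrace_le h.isOpen hb hu).trans ?_
      -- For the column height `δ = 1 / (2 d)`, the factors in the column estimate are `2 δ⁻¹ = 4 d`
      -- and `2 δ ≤ 1`.
      have e1 : (2 * (1 / (2 * (d : ℝ)))⁻¹) = 4 * d := by field_simp; norm_num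
      have e2 : ENNReal.ofReal (2 * (1 / (2 * (d : ℝ)))) * ‖q.2.1 - q.2.2‖ₑ ^ 2 ≤
          ENNReal.ofReal (Metric.diam T ^ 2) := by
        rw [← ofReal_norm, ← ENNReal.ofReal_pow (norm_nonneg _),
          ← ENNReal.ofReal_mul (by positivity)]
        refine ENNReal.ofReal_le_ofReal ?_
        have h1 : 2 * (1 / (2 * (d : ℝ))) ≤ 1 := by
          rw [mul_one_div, div_le_one (by positivity)]
          have : (1 : ℝ) ≤ d := by exact_mod_cast (by omega : 1 ≤ d)
          linarith
        have h2 : ‖q.2.1 - q.2.2‖ ^ 2 ≤ Metric.diam T ^ 2 := by gcongr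
        nlinarith [sq_nonneg ‖q.2.1 - q.2.2‖]
      rw [e1]
      gcongr
    calc _ ≤ ∫⁻ x in ⋃ q ∈ J, V q, ‖trace T u x‖ₑ ^ 2 ∂hypMeasure n p := lintegral_mono' hle le_rfl
      _ ≤ ∑ q ∈ J, ∫⁻ x in V q, ‖trace T u x‖ₑ ^ 2 ∂hypMeasure n p := by
        rw [hUn, ← Finset.sum_coe_sort, ← tsum_fintype (L := .unconditional J)]
        exact lintegral_iUnion_le (fun q : J => V q) _
      _ ≤ J.card • _ := Finset.sum_le_card_nsmul _ _ _ hq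
      _ ≤ _ := by
        have hc : (J.card : ℝ≥0∞) * ENNReal.ofReal r⁻¹ ≤
            ENNReal.ofReal (S.card * (d + 1) ^ 2 * r⁻¹) := by
          rw [← ENNReal.ofReal_natCast, ← ENNReal.ofReal_mul (Nat.cast_nonneg _)]
          refine ENNReal.ofReal_le_ofReal ?_
          have : (J.card : ℝ) ≤ S.card * (d + 1) ^ 2 := by exact_mod_cast hJc
          gcongr
        rw [nsmul_eq_mul, ← mul_assoc]
        gcongr

end IsCompatible

end face

/-! ### Traces and integration by parts on an element -/

section meshIBP
variable {d : ℕ} {Ω T : Set (Space d)} {M : PolytopalMesh Ω} {S : Finset (Finset (Space d))}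
  {r : ℝ} {F : Set (Space d)} {u : Space d → ℝ} {G : Space d → Space d}

/-- Averages of a continuous function converge to its value at any point of `closure T`, where the
intersections with balls have positive volume; the trace is hence additive once the average of `u`
is known to converge. -/
theorem trace_sub_continuous {x : Space d} (hT : IsOpen T) (hb : volume T ≠ ⊤)
    (hx : x ∈ closure T) (hu : IntegrableOn u T) {q : Space d → ℝ} (hq : Continuous q) {t : ℝ}
    (ht : Tendsto (fun ρ => ⨍ z in Metric.ball x ρ ∩ T, u z) (𝓝[>] 0) (𝓝 t)) :
    trace T (fun y => u y - q y) x = t - q x := by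
  refine Tendsto.limUnder_eq ?_
  have hvol (ρ : ℝ) (hρ : 0 < ρ) : 0 < volume (Metric.ball x ρ ∩ T) :=
    (Metric.isOpen_ball.inter hT).measure_pos volume
      (mem_closure_iff.1 hx _ Metric.isOpen_ball (Metric.mem_ball_self hρ))
  have hfin (ρ : ℝ) : volume (Metric.ball x ρ ∩ T) ≠ ⊤ :=
    measure_ne_top_of_subset inter_subset_right hb
  have hqi (ρ : ℝ) : IntegrableOn q (Metric.ball x ρ ∩ T) :=
    (hq.continuousOn.integrableOn_compact (isCompact_closedBall x ρ)).mono_set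
      (inter_subset_left.trans Metric.ball_subset_closedBall)
  have hqt : Tendsto (fun ρ => ⨍ z in Metric.ball x ρ ∩ T, q z) (𝓝[>] 0) (𝓝 (q x)) := by
    rw [Metric.tendsto_nhds]
    intro ε hε
    obtain ⟨δ, hδ, hball⟩ := Metric.continuousAt_iff.1 hq.continuousAt (ε / 2) (half_pos hε)
    filter_upwards [Ioo_mem_nhdsGT hδ] with ρ hρ
    have hmem := (convex_closedBall (q x) (ε / 2)).set_average_mem Metric.isClosed_closedBall
      (hvol ρ hρ.1).ne' (hfin ρ) (f := q) (by
        filter_upwards [ae_restrict_mem ((Metric.isOpen_ball.inter hT).measurableSet)] with y hy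
        exact (hball (lt_trans hy.1 hρ.2)).le) (hqi ρ)
    exact lt_of_le_of_lt hmem (half_lt_self hε)
  refine (ht.sub hqt).congr' ?_
  filter_upwards [self_mem_nhdsWithin] with ρ hρ
  simp only [setAverage_eq]
  rw [integral_sub (hu.mono_set inter_subset_right) (hqi ρ), smul_sub]

namespace IsCompatible

theorem measure_face_le (h : IsCompatible M T S r) (hF : F ∈ M.facesOf T) :
    (μHE[d - 1] : Measure (Space d)) F ≤
      ENNReal.ofReal (Metric.diam T ^ (d - 1) * unitFaceVolume d) := by
  obtain ⟨p, hp⟩ := nonempty_face hF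
  obtain ⟨U, hU, hFU, hres⟩ := h.restrict_face hF hp
  have hFT := (mem_facesOf.1 hF).2
  rw [← hypMeasure_closedBall (h.norm_normal hF) (self_mem_hyp (outwardNormal T F) p)
    Metric.diam_nonneg, hypMeasure,
    Measure.restrict_apply Metric.isClosed_closedBall.measurableSet]
  refine measure_mono fun x hx => ⟨?_, ?_⟩
  · exact h.dist_le (frontier_subset_closure (hFT hx)) (frontier_subset_closure (hFT hp))
  · rw [hFU] at hx; exact hx.2

theorem isFiniteMeasure_face (h : IsCompatible M T S r) (hF : F ∈ M.facesOf T) :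
    IsFiniteMeasure ((μHE[d - 1] : Measure (Space d)).restrict F) :=
  ⟨by rw [Measure.restrict_apply_univ]
      exact (h.measure_face_le hF).trans_lt ENNReal.ofReal_lt_top⟩

theorem measurableSet_face (h : IsCompatible M T S r) (hF : F ∈ M.facesOf T) :
    MeasurableSet F := by
  obtain ⟨p, hp⟩ := nonempty_face hF
  obtain ⟨U, hU, hFU, hres⟩ := h.restrict_face hF hp
  rw [hFU]; exact hU.measurableSet.inter (measurableSet_hyp _ _)

theorem memLp_trace (h : IsCompatible M T S r) (hu : IsH1 T u G) (hF : F ∈ M.facesOf T) :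
    MemLp (trace T u) 2 ((μHE[d - 1] : Measure (Space d)).restrict F) := by
  obtain ⟨-, h1, h2⟩ := h.trace_properties hu hF
  refine ⟨h1, ?_⟩
  rw [eLpNorm_lt_top_iff_lintegral_rpow_enorm_lt_top (by norm_num) (by norm_num)]
  simp only [ENNReal.toReal_ofNat, ENNReal.rpow_ofNat]
  refine h2.trans_lt ?_
  rw [← ofReal_integral_norm_sq hu.memLp, ← ofReal_integral_norm_sq hu.memLp_grad]
  finiteness

theorem integrable_trace (h : IsCompatible M T S r) (hu : IsH1 T u G) (hF : F ∈ M.facesOf T) :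
    Integrable (trace T u) ((μHE[d - 1] : Measure (Space d)).restrict F) := by
  have := h.isFiniteMeasure_face hF
  exact (h.memLp_trace hu hF).integrable (by norm_num)

theorem trace_sub_continuous (h : IsCompatible M T S r) (hu : IsH1 T u G) (hF : F ∈ M.facesOf T)
    {q : Space d → ℝ} (hq : Continuous q) :
    ∀ᵐ x ∂(μHE[d - 1] : Measure (Space d)).restrict F,
      trace T (fun y => u y - q y) x = trace T u x - q x := by
  have hfin : IsFiniteMeasure (volume.restrict T) :=
    ⟨by simpa using h.volume_lt_top.lt_top⟩
  filter_upwards [(h.trace_properties hu hF).1, ae_restrict_mem (h.measurableSet_face hF)]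
    with x hx hxF
  exact HHO.trace_sub_continuous h.isOpen h.volume_lt_top
    (frontier_subset_closure ((mem_facesOf.1 hF).2 hxF)) (hu.memLp.integrable (by norm_num)) hq hx

/-- Each face contains an open facet of some simplex, and disjoint faces contain different ones. -/
theorem card_facesOf_le (h : IsCompatible M T S r) :
    (M.facesOf T).card ≤ S.card * (d + 1) := by
  classical
  have hex : ∀ F ∈ M.facesOf T, ∃ q : Finset (Space d) × Space d,
      q ∈ S.biUnion (fun s => s.image fun a => (s, a)) ∧ openFacet q.1 q.2 ⊆ F := by
    intro F hF
    obtain ⟨p, hp⟩ := nonempty_face hF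
    obtain ⟨hFM, hFT⟩ := mem_facesOf.1 hF
    obtain ⟨y, hy, -, hyr⟩ := h.exists_mem_face_notMem hF hp isOpen_univ (mem_univ p)
      (hypMeasure_ridges h.two_le h.isSimplex (h.norm_normal hF))
    obtain ⟨s, hs, a, ha, hya⟩ := h.exists_mem_openFacet (hFT hy) hyr
    refine ⟨(s, a), ?_, h.openFacet_compat hs ha hFM hya hy⟩
    simp only [Finset.mem_biUnion, Finset.mem_image]
    exact ⟨s, hs, a, ha, rfl⟩
  choose! f hf1 hf2 using hex
  have hcard : (S.biUnion (fun s => s.image fun a => (s, a))).card ≤ S.card * (d + 1) :=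
    Finset.card_biUnion_le_card_mul _ _ _ fun s hs =>
      Finset.card_image_le.trans (h.isSimplex s hs).1.le
  refine le_trans (Finset.card_le_card_of_injOn f hf1 ?_) hcard
  intro F hF F' hF' heq
  by_contra hne
  have hq := hf1 F hF
  simp only [Finset.mem_biUnion, Finset.mem_image] at hq
  obtain ⟨s, hs, a, ha, hsa⟩ := hq
  obtain ⟨x, hx⟩ := openFacet_nonempty (by have := h.two_le; omega) (h.isSimplex s hs) ha
  have h1 := hf2 F hF
  have h2 := hf2 F' hF'
  rw [← heq] at h2
  rw [← hsa] at h1 h2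
  exact Set.disjoint_left.1 (M.faces_disjoint F (mem_facesOf.1 hF).1 F' (mem_facesOf.1 hF').1 hne)
    (h1 hx) (h2 hx)

/-- Off the ridges there are three kinds of points: in `T` the formula is the definition of the weak
gradient, outside `closure T` both sides vanish, and on the frontier exactly one face is seen and
`T` is a half ball. -/
theorem hasIBP (h : IsCompatible M T S r) (hu : IsH1 T u G) (j : Space d) {φ : Space d → ℝ}
    (hφ : ContDiff ℝ ∞ φ) (hc : HasCompactSupport φ) :
    HasIBP T u G (fun F : M.facesOf T => (μHE[d - 1] : Measure (Space d)).restrict F)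
      (fun F => outwardNormal T F) (trace T u) φ j := by
  classical
  have hb := h.volume_lt_top
  have hq : ∀ q ∈ ridgeIndex S, ∃ c : Space d × Space d × Space d, ‖c.1‖ = 1 ∧ ‖c.2.1‖ = 1 ∧
      inner ℝ c.1 c.2.1 = (0 : ℝ) ∧ ridge q.1 q.2.1 q.2.2 = codimTwo c.1 c.2.1 c.2.2 := by
    intro q hq
    obtain ⟨h1, h2, h3, h4⟩ := mem_ridgeIndex.1 hq
    exact exists_ridge_eq_codimTwo h.two_le (h.isSimplex _ h1) h2 h3 h4
  choose! c hc1 hc2 hc3 hc4 using hq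
  refine hasIBP_of_local_off_codimTwo h.two_le hb hu (fun F => h.integrable_trace hu F.2) j
    (ridgeIndex S) (a := fun q => (c q).1) (b := fun q => (c q).2.1) (p := fun q => (c q).2.2)
    (fun q hq => ⟨hc1 q hq, hc2 q hq, hc3 q hq, fun F => ?_⟩) (fun x hx => ?_) hφ hc
  · obtain ⟨p, hp⟩ := nonempty_face F.2
    obtain ⟨U, hU, hFU, hres⟩ := h.restrict_face F.2 hp
    rw [hres, ← hc4 q hq]
    obtain ⟨h1, h2, h3, h4⟩ := mem_ridgeIndex.1 hq
    exact le_antisymm ((Measure.restrict_apply_le _ _).trans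
      (hypMeasure_ridge h.two_le (h.isSimplex _ h1) h2 h3 h4 (h.norm_normal F.2)).le) zero_le
  · have hxr : x ∉ ridges S := by
      rw [ridges_eq]
      simp only [mem_iUnion, not_exists]
      intro q hq
      rw [hc4 q hq]
      exact hx q hq
    have hface (F : M.facesOf T) : (F : Set (Space d)) ⊆ frontier T := (mem_facesOf.1 F.2).2
    by_cases hxT : x ∈ T
    · refine ⟨T, h.isOpen, hxT, fun ψ hψ hψc hψs => ?_⟩
      have e1 (F : M.facesOf T) :
          ∫ x, trace T u x * ψ x ∂(μHE[d - 1] : Measure (Space d)).restrict F = 0 := by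
        refine setIntegral_eq_zero_of_forall_eq_zero fun y hy => ?_
        have : y ∉ tsupport ψ := fun hcon => by
          have h1 := hface F hy
          rw [h.isOpen.frontier_eq] at h1
          exact h1.2 (hψs hcon)
        rw [image_eq_zero_of_notMem_tsupport this, mul_zero]
      have hfin : IsFiniteMeasure (volume.restrict T) := ⟨by simpa using hb.lt_top⟩
      have i1 : Integrable (fun x => (inner ℝ (G x) j : ℝ)) (volume.restrict T) :=
        (hu.memLp_grad.integrable (by norm_num)).inner_const j
      have i2 : Integrable u (volume.restrict T) := hu.memLp.integrable (by norm_num)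
      simp only [HasIBP, e1, mul_zero, Finset.sum_const_zero, ibpIntegrand]
      rw [integral_add (integrable_mul_smooth i1 hψ.continuous hψc)
        (integrable_mul_smooth i2 (continuous_fderiv_apply hψ j)
          (hasCompactSupport_fderiv_apply hψc j)), hu.weak ψ hψ hψc hψs j]
      ring
    by_cases hxc : x ∈ closure T
    swap
    · refine ⟨(closure T)ᶜ, isClosed_closure.isOpen_compl, hxc, fun ψ hψ hψc hψs => ?_⟩
      have hz (y) (hy : y ∈ closure T) : y ∉ tsupport ψ := fun hcon => hψs hcon hy
      have e1 (F : M.facesOf T) :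
          ∫ x, trace T u x * ψ x ∂(μHE[d - 1] : Measure (Space d)).restrict F = 0 := by
        refine setIntegral_eq_zero_of_forall_eq_zero fun y hy => ?_
        rw [image_eq_zero_of_notMem_tsupport (hz y (frontier_subset_closure (hface F hy))), mul_zero]
      have e2 : ∫ x in T, ibpIntegrand u G ψ j x = 0 := by
        refine setIntegral_eq_zero_of_forall_eq_zero fun y hy => ?_
        obtain ⟨h1, h2⟩ := notMem_tsupport_fderiv (hz y (subset_closure hy)) j
        rw [ibpIntegrand, h1, h2]; ring
      simp only [HasIBP, e1, e2, mul_zero, Finset.sum_const_zero]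
    have hxf : x ∈ frontier T := by rw [h.isOpen.frontier_eq]; exact ⟨hxc, hxT⟩
    obtain ⟨F, hF, hxF⟩ := h.exists_face_of_mem_frontier hxf hxr
    obtain ⟨ρ, hρ, hloc, hdis, hFB⟩ := h.exists_local hF hxF hxr
    have hnorm := h.norm_normal hF
    refine ⟨Metric.ball x (ρ / 8), Metric.isOpen_ball, Metric.mem_ball_self (by positivity),
      fun ψ hψ hψc hψs => ?_⟩
    have hψs' : tsupport ψ ⊆ Metric.ball x ρ :=
      hψs.trans (Metric.ball_subset_ball (by linarith))
    rw [HasIBP, hu.integral_half_ball hnorm hρ hloc h.isOpen hb j hψ hψc hψs,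
      Finset.sum_eq_single (⟨F, hF⟩ : M.facesOf T)]
    · congr 1
      have hz (y) (hy : y ∉ Metric.ball x ρ) : trace T u y * ψ y = 0 := by
        rw [image_eq_zero_of_notMem_tsupport fun hcon => hy (hψs' hcon), mul_zero]
      have hmeas := h.measurableSet_face hF
      rw [hypMeasure]
      change ∫ y in _, _ ∂_ = ∫ y in F, _ ∂_
      rw [← integral_indicator (measurableSet_hyp _ _), ← integral_indicator hmeas]
      refine integral_congr_ae (Eventually.of_forall fun y => ?_)
      by_cases hyB : y ∈ Metric.ball x ρ
      · have : y ∈ hyp (outwardNormal T F) x ↔ y ∈ F :=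
          ⟨fun hy => (hFB.symm.subset ⟨hy, hyB⟩).1, fun hy => (hFB.subset ⟨hy, hyB⟩).1⟩
        simp only [indicator_apply, this]
      · simp only [indicator_apply, hz y hyB, ite_self]
    · intro F' _ hne
      have e1 : ∫ x, trace T u x * ψ x ∂(μHE[d - 1] : Measure (Space d)).restrict F' = 0 := by
        refine setIntegral_eq_zero_of_forall_eq_zero fun y hy => ?_
        have : y ∉ tsupport ψ := fun hcon =>
          Set.disjoint_left.1 (hdis F' F'.2 fun heq => hne (Subtype.ext heq)) hy (hψs' hcon)
        rw [image_eq_zero_of_notMem_tsupport this, mul_zero]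
      rw [e1, mul_zero]
    · exact fun hcon => absurd (Finset.mem_univ _) hcon

/-- Integration by parts on an element. -/
theorem integral_by_parts (h : IsCompatible M T S r) (hu : IsH1 T u G) (j : Space d)
    {φ : Space d → ℝ} (hφ : ContDiff ℝ ∞ φ) :
    ∫ x in T, ibpIntegrand u G φ j x = ∑ F : M.facesOf T, inner ℝ (outwardNormal T F) j *
      ∫ x in (F : Set (Space d)), trace T u x * φ x ∂(μHE[d - 1] : Measure (Space d)) := by
  obtain ⟨z, hz⟩ := h.isConnected.nonempty
  have hD : 0 ≤ Metric.diam T := Metric.diam_nonneg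
  -- A bump equal to `1` near `closure T` makes the support of the test function compact without
  -- changing either side.
  let χ : ContDiffBump z := ⟨Metric.diam T + 1, Metric.diam T + 2, by linarith, by linarith⟩
  have hball : closure T ⊆ Metric.ball z (Metric.diam T + 1) := fun y hy => by
    have := h.dist_le hy (subset_closure hz)
    rw [Metric.mem_ball]; linarith
  have hev (y) (hy : y ∈ closure T) : (fun x => φ x * χ x) =ᶠ[𝓝 y] φ := by
    filter_upwards [Metric.isOpen_ball.mem_nhds (hball hy)] with x hx
    rw [χ.one_of_mem_closedBall (Metric.ball_subset_closedBall hx), mul_one]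
  have key := h.hasIBP hu j (hφ.mul χ.contDiff) χ.hasCompactSupport.mul_left
  rw [HasIBP] at key
  convert key using 1
  · refine setIntegral_congr_fun h.isOpen.measurableSet fun y hy => ?_
    have := hev y (subset_closure hy)
    simp only [ibpIntegrand]
    rw [this.fderiv_eq, this.eq_of_nhds]
  · refine Finset.sum_congr rfl fun F _ => ?_
    congr 1
    refine setIntegral_congr_fun (h.measurableSet_face F.2) fun y hy => ?_
    have := (hev y (frontier_subset_closure ((mem_facesOf.1 F.2).2 hy))).eq_of_nhds
    rw [this]

end IsCompatible

end meshIBP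

/-! ### Poincaré inequality on an element, with explicit constant -/

section poincare
variable {d : ℕ} {T : Set (Space d)} {S : Finset (Finset (Space d))}
  {r : ℝ} {w : Space d → ℝ} {G : Space d → Space d}

theorem integrable_sub_sq_of_memLp {μ : Measure (Space d)} [IsFiniteMeasure μ] (hw : MemLp w 2 μ)
    (c : ℝ) : Integrable (fun x => (w x - c) ^ 2) μ :=
  (hw.sub (memLp_const c)).integrable_sq

/-- Two approximating constants are compared on an overlap through `(a - b)² ≤ 2 (w - a)² + 2 (w -
b)²`. -/
theorem sq_sub_mul_volume_le {A B O : Set (Space d)} (hOA : O ⊆ A)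
    (hOB : O ⊆ B) {a b : ℝ} (hA : IntegrableOn (fun x => (w x - a) ^ 2) A)
    (hB : IntegrableOn (fun x => (w x - b) ^ 2) B) (hfin : volume O ≠ ⊤) :
    (a - b) ^ 2 * (volume O).toReal ≤
      2 * (∫ x in A, (w x - a) ^ 2) + 2 * ∫ x in B, (w x - b) ^ 2 := by
  have h1 : ∫ x in O, (w x - a) ^ 2 ≤ ∫ x in A, (w x - a) ^ 2 :=
    setIntegral_mono_set hA (Eventually.of_forall fun _ => sq_nonneg _) hOA.eventuallyLE
  have h2 : ∫ x in O, (w x - b) ^ 2 ≤ ∫ x in B, (w x - b) ^ 2 :=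
    setIntegral_mono_set hB (Eventually.of_forall fun _ => sq_nonneg _) hOB.eventuallyLE
  have i1 := (hA.mono_set hOA).const_mul 2
  have i2 := (hB.mono_set hOB).const_mul 2
  have h3 : ∫ x in O, (a - b) ^ 2 ≤ ∫ x in O, (2 * (w x - a) ^ 2 + 2 * (w x - b) ^ 2) := by
    have : Integrable (fun x => 2 * (w x - a) ^ 2 + 2 * (w x - b) ^ 2) (volume.restrict O) :=
      i1.add i2
    refine integral_mono_ae ?_ this (Eventually.of_forall fun x => ?_)
    · exact integrableOn_const hfin
    · simp only
      nlinarith [sq_nonneg ((w x - a) + (w x - b))]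
  rw [setIntegral_const, integral_add i1 i2, integral_const_mul, integral_const_mul, smul_eq_mul,
    Measure.real] at h3
  linarith

/-- The constant of the Poincaré inequality. -/
def poincareConst (d : ℕ) (q : ℝ) : ℝ :=
  4 * 2 ^ d * (2 * q ^ d + 32 * (q ^ d) ^ 3 * (2 * d * q ^ 2) ^ d)

theorem poincareConst_nonneg {q : ℝ} (hq : 0 ≤ q) : 0 ≤ poincareConst d q := by
  unfold poincareConst; positivity

/-- Each open simplex has its own constant by convexity. Neighbouring simplices are compared through
a third convex set in `T`, a ball about the centre of their common facet, which overlaps both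
substantially; connectedness through facets and the bound on the number of simplices control all the
differences. -/
theorem IsSubmesh.poincare (hS : IsSubmesh T S r) (hd : 1 ≤ d) (hw : IsH1 T w G) :
    ∃ c, ∫ x in T, (w x - c) ^ 2 ≤
      poincareConst d (Metric.diam T / r) * Metric.diam T ^ 2 * ∫ x in T, ‖G x‖ ^ 2 := by
  classical
  set h := Metric.diam T with hh
  have hr := hS.pos
  have hrh : r ≤ h := hS.le_diam hd
  have hhpos : 0 < h := hr.trans_le hrh
  have hdpos : (0 : ℝ) < d := by exact_mod_cast hd
  have hb := hS.volume_lt_top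
  have hfin : IsFiniteMeasure (volume.restrict T) := ⟨by simpa using hb.lt_top⟩
  have : Nonempty (Fin d) := ⟨⟨0, hd⟩⟩
  set E := 2 ^ d * (2 * h) ^ 2 * ∫ x in T, ‖G x‖ ^ 2 with hE
  have hGi : IntegrableOn (fun x => ‖G x‖ ^ 2) T := hw.memLp_grad.integrable_norm_pow (by norm_num)
  have hE0 : 0 ≤ E := mul_nonneg (by positivity) (integral_nonneg fun _ => sq_nonneg _)
  have hwi (c : ℝ) : IntegrableOn (fun x => (w x - c) ^ 2) T := integrable_sub_sq_of_memLp hw.memLp c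
  have hconv {D : Set (Space d)} (hDo : IsOpen D) (hD : Convex ℝ D) (hne : D.Nonempty)
      (hDT : D ⊆ T) : ∃ c, ∫ x in D, (w x - c) ^ 2 ≤ E := by
    obtain ⟨c, hc⟩ := IsH1.poincare_convex hDo hD hne (R := 2 * h) (fun x hx y hy => by
      have := hS.dist_le (subset_closure (hDT hx)) (subset_closure (hDT hy))
      rw [dist_eq_norm] at this; linarith) (measure_ne_top_of_subset hDT hb)
      (hw.mono hDT hS.isOpen.measurableSet)
    refine ⟨c, hc.trans ?_⟩
    rw [hE]
    exact mul_le_mul_of_nonneg_left (setIntegral_mono_set hGi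
      (Eventually.of_forall fun _ => sq_nonneg _) hDT.eventuallyLE) (by positivity)
  set D : Finset (Space d) → Set (Space d) := fun s => interior (convexHull ℝ (s : Set (Space d)))
  have hDc : ∀ s ∈ S, ∃ c, ∫ x in D s, (w x - c) ^ 2 ≤ E := fun s hs =>
    hconv isOpen_interior (convex_convexHull ℝ _).interior (hS.isSimplex s hs).interior_nonempty
      (hS.interior_subset_element s hs)
  choose! c hc using hDc
  -- A homothety of ratio `l` about the facet centre sends an inscribed ball into the simplex and,
  -- as `l * r + l * h ≤ 2 * l * h = r / d`, also into the ball about the facet centre.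
  set l := r / (2 * d * h) with hl
  have hl0 : 0 < l := by positivity
  have hl1 : l ≤ 1 := by
    rw [hl, div_le_one (by positivity)]
    have : (1 : ℝ) ≤ d := by exact_mod_cast hd
    nlinarith
  set v1 := (volume (Metric.ball (0 : Space d) 1)).toReal with hv1
  have hv1pos : 0 < v1 := ENNReal.toReal_pos (Metric.measure_ball_pos volume _ one_pos).ne'
    Metric.isBounded_ball.measure_lt_top.ne
  have hvball (x : Space d) {ρ : ℝ} (hρ : 0 < ρ) :
      (volume (Metric.ball x ρ)).toReal = ρ ^ d * v1 := by
    rw [Measure.addHaar_ball_of_pos _ _ hρ, ENNReal.toReal_mul, ENNReal.toReal_ofReal (by positivity),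
      finrank_euclideanSpace_fin]
  set V := (l * r) ^ d * v1 with hV
  have hVpos : 0 < V := by positivity
  -- On an overlap of volume `V` the two errors contribute `2 E` each, so a simplex constant differs
  -- from the ball constant by at most `√(4 E / V)`; the outer factor comes from passing through the
  -- ball.
  set δ := 2 * Real.sqrt (4 * E / V) with hδ
  -- neighbouring constants
  have hadj : ∀ A ⊆ S, A.Nonempty → A ≠ S → ∃ s ∈ A, ∃ t ∈ S, t ∉ A ∧ |c t - c s| ≤ δ := by
    intro A hA hAne hAS
    obtain ⟨s, hs, t, ht, htA, σ, hσs, hσt, hσ⟩ := hS.exists_adjacent hA hAne hAS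
    refine ⟨s, hs, t, ht, htA, ?_⟩
    have hst : s ≠ t := fun h => htA (h ▸ hs)
    have hBT := hS.ball_facetCenter_subset hd (hA hs) ht hst hσs hσt hσ
    set B := Metric.ball (facetCenter σ) (r / d)
    obtain ⟨b, hb'⟩ := hconv Metric.isOpen_ball (convex_ball _ _)
      ⟨_, Metric.mem_ball_self (by positivity)⟩ hBT
    have key (u : Finset (Space d)) (hu : u ∈ S) (hσu : σ ⊆ u) :
        |c u - b| ≤ Real.sqrt (4 * E / V) := by
      obtain ⟨x, hx⟩ := hS.exists_ball u hu
      have hg := IsSubmesh.facetCenter_mem hd (hS.isSimplex u hu) hσu hσ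
      set g := facetCenter σ
      set O := Metric.ball (g + l • (x - g)) (l * r) with hO
      have hOA : O ⊆ D u := interior_maximal
        (IsSubmesh.ball_homothety_subset (convex_convexHull ℝ _) hg hx hl0 hl1) Metric.isOpen_ball
      have hOB : O ⊆ B := by
        intro y hy
        rw [hO, mem_ball_iff_norm] at hy
        have hcl := hS.simplex_subset_closure hu
        have h1 : ‖x - g‖ ≤ h := by
          rw [← dist_eq_norm]
          exact hS.dist_le (hcl (hx (Metric.mem_ball_self hr))) (hcl hg)
        rw [mem_ball_iff_norm]
        calc ‖y - g‖ = ‖(y - (g + l • (x - g))) + l • (x - g)‖ := by congr 1; abel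
          _ ≤ _ := norm_add_le _ _
          _ < l * r + l * h := by
            rw [norm_smul, Real.norm_of_nonneg hl0.le]
            exact add_lt_add_of_lt_of_le hy (by gcongr)
          _ ≤ l * (2 * h) := by nlinarith
          _ = r / d := by rw [hl]; field_simp
      have h2 := sq_sub_mul_volume_le (w := w) (a := c u) (b := b)
        hOA hOB ((hwi _).mono_set (hS.interior_subset_element u hu)) ((hwi _).mono_set hBT)
        Metric.isBounded_ball.measure_lt_top.ne
      rw [hvball _ (by positivity), ← hV] at h2
      refine Real.abs_le_sqrt ?_
      rw [le_div_iff₀ hVpos]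
      linarith [hc u hu]
    have h1 := key s (hA hs) hσs
    have h2 := key t ht hσt
    have h3 := abs_sub_le (c t) b (c s)
    rw [abs_sub_comm b] at h3
    rw [hδ]; linarith
  have hδ0 : 0 ≤ δ := by positivity
  obtain ⟨s₀, hs₀⟩ := hS.nonempty_simplices
  have hall := abs_sub_le_card_mul hδ0 hadj hs₀
  refine ⟨c s₀, ?_⟩
  -- decomposition of the integral
  have hTD : (T : Set (Space d)) =ᵐ[volume] ⋃ s ∈ S, D s := by
    refine EventuallyLE.antisymm ?_ (LE.le.eventuallyLE
      (iUnion₂_subset fun s hs => hS.interior_subset_element s hs))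
    have hnull : volume (⋃ s ∈ S, ⋃ a ∈ s, {x | bary s a x = 0}) = 0 :=
      (measure_biUnion_null_iff S.countable_toSet).2 fun s hs =>
        (measure_biUnion_null_iff s.countable_toSet).2 fun a ha =>
          volume_bary_eq_zero (hS.isSimplex s hs) ha
    filter_upwards [measure_eq_zero_iff_ae_notMem.1 hnull] with x hx hxT
    have hxc : x ∈ closure T := subset_closure hxT
    rw [hS.closure_eq] at hxc
    obtain ⟨s, hs, hxs⟩ := mem_iUnion₂.1 hxc
    refine mem_iUnion₂.2 ⟨s, hs, ?_⟩
    rw [mem_interior_iff_bary (hS.isSimplex s hs)]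
    rw [mem_convexHull_iff_bary (hS.isSimplex s hs)] at hxs
    refine fun a ha => lt_of_le_of_ne (hxs a ha) fun h0 => hx ?_
    exact mem_iUnion₂.2 ⟨s, hs, mem_iUnion₂.2 ⟨a, ha, h0.symm⟩⟩
  have hsum : ∫ x in T, (w x - c s₀) ^ 2 = ∑ s ∈ S, ∫ x in D s, (w x - c s₀) ^ 2 := by
    rw [setIntegral_congr_set hTD]
    refine integral_biUnion_finset S (fun s _ => isOpen_interior.measurableSet) ?_
      fun s hs => (hwi _).mono_set (hS.interior_subset_element s hs)
    intro s hs t ht hst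
    exact (hS.disjoint_interior hs ht hst).mono_right interior_subset
  have hvD (s) (hs : s ∈ S) : (volume (D s)).toReal ≤ h ^ d * v1 := by
    obtain ⟨z, hz⟩ := hS.isConnected.nonempty
    have : volume (D s) ≤ volume (Metric.closedBall z h) := by
      refine measure_mono fun y hy => ?_
      exact hS.dist_le (subset_closure (hS.interior_subset_element s hs hy)) (subset_closure hz)
    have h2 := ENNReal.toReal_mono Metric.isBounded_closedBall.measure_lt_top.ne this
    rwa [Measure.addHaar_closedBall _ _ hhpos.le, ENNReal.toReal_mul,
      ENNReal.toReal_ofReal (by positivity), finrank_euclideanSpace_fin] at h2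
  have hterm (s) (hs : s ∈ S) : ∫ x in D s, (w x - c s₀) ^ 2 ≤
      2 * E + 2 * (S.card * δ) ^ 2 * (h ^ d * v1) := by
    have hDT := hS.interior_subset_element s hs
    have hDfin := measure_ne_top_of_subset hDT hb
    have i1 : IntegrableOn (fun x => 2 * (w x - c s) ^ 2) (D s) :=
      ((hwi (c s)).mono_set hDT).const_mul 2
    have i2 : IntegrableOn (fun _ => 2 * (c s - c s₀) ^ 2) (D s) := integrableOn_const hDfin
    have h1 : ∫ x in D s, (w x - c s₀) ^ 2 ≤
        ∫ x in D s, (2 * (w x - c s) ^ 2 + 2 * (c s - c s₀) ^ 2) := by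
      refine integral_mono_ae ((hwi _).mono_set hDT) (i1.add i2) (Eventually.of_forall fun x => ?_)
      simp only
      nlinarith [sq_nonneg ((w x - c s) - (c s - c s₀))]
    rw [integral_add i1 i2, integral_const_mul, setIntegral_const, smul_eq_mul, Measure.real] at h1
    have h2 : (c s - c s₀) ^ 2 ≤ (S.card * δ) ^ 2 := by
      rw [← sq_abs (c s - c s₀)]
      exact pow_le_pow_left₀ (abs_nonneg _) (hall s hs) 2
    have h3 : (volume (D s)).toReal * (2 * (c s - c s₀) ^ 2) ≤
        (h ^ d * v1) * (2 * (S.card * δ) ^ 2) := by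
      gcongr
      exact hvD s hs
    linarith [hc s hs]
  rw [hsum]
  refine (Finset.sum_le_card_nsmul _ _ _ hterm).trans ?_
  rw [nsmul_eq_mul]
  set q := h / r with hq
  have hq0 : 0 ≤ q := by positivity
  have hN : (S.card : ℝ) ≤ q ^ d := hS.card_le hd
  have hδ2 : δ ^ 2 = 16 * E / V := by
    rw [hδ, mul_pow, Real.sq_sqrt (by positivity)]; ring
  have hratio : h ^ d * v1 / V = (2 * d * q ^ 2) ^ d := by
    rw [hV, mul_div_mul_right _ _ hv1pos.ne', ← div_pow, hl, hq]
    congr 1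
    field_simp
  have hmain : (S.card : ℝ) * (2 * E + 2 * (S.card * δ) ^ 2 * (h ^ d * v1)) =
      E * (2 * S.card + 32 * (S.card : ℝ) ^ 3 * (2 * d * q ^ 2) ^ d) := by
    rw [mul_pow, hδ2, ← hratio]
    field_simp
    ring
  rw [hmain]
  calc _ ≤ E * (2 * q ^ d + 32 * (q ^ d) ^ 3 * (2 * d * q ^ 2) ^ d) := by gcongr
    _ = _ := by rw [hE, poincareConst]; ring

/-- The mean value is the best constant: for zero mean the cross term drops and `∫ w² ≤ ∫ (w - c)²`.
-/
theorem IsSubmesh.poincare_of_integral_eq_zero (hS : IsSubmesh T S r) (hd : 1 ≤ d)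
    (hw : IsH1 T w G) (h0 : ∫ x in T, w x = 0) :
    ∫ x in T, w x ^ 2 ≤
      poincareConst d (Metric.diam T / r) * Metric.diam T ^ 2 * ∫ x in T, ‖G x‖ ^ 2 := by
  obtain ⟨c, hc⟩ := hS.poincare hd hw
  refine le_trans ?_ hc
  have hb := hS.volume_lt_top
  have hfin : IsFiniteMeasure (volume.restrict T) := ⟨by simpa using hb.lt_top⟩
  have i1 : Integrable (fun x => w x ^ 2) (volume.restrict T) := hw.memLp.integrable_sq
  have i2 : Integrable (fun x => 2 * c * w x) (volume.restrict T) :=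
    (hw.memLp.integrable (by norm_num)).const_mul _
  have i3 : Integrable (fun _ : Space d => c ^ 2) (volume.restrict T) := integrable_const _
  have i12 : Integrable (fun x => w x ^ 2 - 2 * c * w x) (volume.restrict T) := i1.sub i2
  have e : ∫ x in T, (w x - c) ^ 2 = (∫ x in T, w x ^ 2) + ∫ _ in T, c ^ 2 := by
    have : ∀ x, (w x - c) ^ 2 = (w x ^ 2 - 2 * c * w x) + c ^ 2 := fun x => by ring
    simp only [this]
    rw [integral_add i12 i3, integral_sub i1 i2, integral_const_mul, h0]
    ring
  rw [e]
  have : 0 ≤ ∫ _ in T, c ^ 2 := integral_nonneg fun _ => sq_nonneg c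
  linarith

end poincare

/-! ### Polynomial functions -/

section polynomial
variable {d l m : ℕ}

theorem poly_const (c : ℝ) (l : ℕ) : (fun _ => c) ∈ poly d l :=
  ⟨MvPolynomial.C c, by simp, by simp⟩

theorem poly_mono (h : l ≤ m) : poly d l ⊆ poly d m := by
  rintro p ⟨q, hq, hp⟩
  exact ⟨q, hq.trans h, hp⟩

theorem poly_add {p p' : Space d → ℝ} (hp : p ∈ poly d l) (hp' : p' ∈ poly d l) :
    (fun x => p x + p' x) ∈ poly d l := by
  obtain ⟨q, hq, h⟩ := hp
  obtain ⟨q', hq', h'⟩ := hp'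
  exact ⟨q + q', (MvPolynomial.totalDegree_add _ _).trans (max_le hq hq'), by simp [h, h']⟩

theorem poly_mul {p p' : Space d → ℝ} (hp : p ∈ poly d l) (hp' : p' ∈ poly d m) :
    (fun x => p x * p' x) ∈ poly d (l + m) := by
  obtain ⟨q, hq, h⟩ := hp
  obtain ⟨q', hq', h'⟩ := hp'
  exact ⟨q * q', (MvPolynomial.totalDegree_mul _ _).trans (add_le_add hq hq'), by simp [h, h']⟩

theorem poly_const_mul {p : Space d → ℝ} (c : ℝ) (hp : p ∈ poly d l) :
    (fun x => c * p x) ∈ poly d l := by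
  simpa using poly_mul (poly_const c 0) hp

theorem poly_sub {p p' : Space d → ℝ} (hp : p ∈ poly d l) (hp' : p' ∈ poly d l) :
    (fun x => p x - p' x) ∈ poly d l := by
  simpa [sub_eq_add_neg] using poly_add hp (poly_const_mul (-1) hp')

theorem poly_sum {ι : Type*} (s : Finset ι) {p : ι → Space d → ℝ}
    (hp : ∀ i ∈ s, p i ∈ poly d l) : (fun x => ∑ i ∈ s, p i x) ∈ poly d l := by
  classical
  induction s using Finset.induction_on with
  | empty => simpa using poly_const 0 l
  | insert a s ha ih =>
    simp only [Finset.sum_insert ha]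
    exact poly_add (hp a (by simp)) (ih fun i hi => hp i (by simp [hi]))

theorem poly_coord (i : Fin d) : (fun x : Space d => x i) ∈ poly d 1 :=
  ⟨MvPolynomial.X i, by simp, by simp⟩

theorem poly_prod {ι : Type*} (s : Finset ι) {p : ι → Space d → ℝ}
    (hp : ∀ i ∈ s, p i ∈ poly d 1) : (fun x => ∏ i ∈ s, p i x) ∈ poly d s.card := by
  classical
  induction s using Finset.induction_on with
  | empty => simpa using poly_const 1 0
  | insert a s ha ih =>
    simp only [Finset.prod_insert ha, Finset.card_insert_of_notMem ha, add_comm s.card]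
    exact poly_mul (hp a (by simp)) (ih fun i hi => hp i (by simp [hi]))

/-- Polynomials are generated by constants, sums, and multiplication by coordinates. -/
theorem poly_induction {C : ℕ → (Space d → ℝ) → Prop} (const : ∀ l c, C l (fun _ => c))
    (add : ∀ l p p', p ∈ poly d l → p' ∈ poly d l → C l p → C l p' → C l (fun x => p x + p' x))
    (mul : ∀ l p i, p ∈ poly d l → C l p → C (l + 1) (fun x => x i * p x))
    {p : Space d → ℝ} (hp : p ∈ poly d l) : C l p := by
  have hmono : ∀ (n : ℕ) (s : Fin d →₀ ℕ) (c : ℝ), s.degree = n → ∀ l, n ≤ l →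
      C l (fun x => MvPolynomial.eval (fun i => x i) (MvPolynomial.monomial s c)) := by
    intro n
    induction n with
    | zero =>
      intro s c hs l _
      obtain rfl : s = 0 := by simpa [Finsupp.degree_eq_zero_iff] using hs
      simpa using const l c
    | succ n ih =>
      intro s c hs l hl
      obtain ⟨l, rfl⟩ : ∃ l', l = l' + 1 := ⟨l - 1, by omega⟩
      obtain ⟨i, hi⟩ : ∃ i, s i ≠ 0 := by
        by_contra! h
        obtain rfl : s = 0 := Finsupp.ext h
        simp at hs
      obtain ⟨t, rfl⟩ : ∃ t, s = Finsupp.single i 1 + t :=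
        ⟨s - Finsupp.single i 1, (add_tsub_cancel_of_le (by
          simpa using Nat.one_le_iff_ne_zero.2 hi)).symm⟩
      have ht : t.degree = n := by
        rw [map_add, Finsupp.degree_single] at hs
        omega
      have := mul l _ i ⟨MvPolynomial.monomial t c, by
        refine (MvPolynomial.totalDegree_monomial_le _ _).trans ?_
        have : (t.sum fun _ e => e) = t.degree := rfl
        simp only [Function.id_def] at *
        omega, fun x => rfl⟩ (ih t c ht l (by omega))
      convert this using 2 with x
      rw [MvPolynomial.monomial_single_add, map_mul, pow_one, MvPolynomial.eval_X]
  obtain ⟨q, hq, h⟩ := hp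
  have key : ∀ s : Finset (Fin d →₀ ℕ), s ⊆ q.support →
      C l (fun x => ∑ t ∈ s, MvPolynomial.eval (fun i => x i)
        (MvPolynomial.monomial t (q.coeff t))) := by
    classical
    intro s
    have hmem : ∀ t ∈ q.support, (fun x : Space d => MvPolynomial.eval (fun i => x i)
        (MvPolynomial.monomial t (q.coeff t))) ∈ poly d l := fun t ht =>
      ⟨_, (MvPolynomial.totalDegree_monomial_le _ _).trans
        ((MvPolynomial.le_totalDegree ht).trans hq), fun x => rfl⟩
    induction s using Finset.induction_on with
    | empty => simpa using const l 0
    | insert a s ha ih =>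
      intro hs
      simp only [Finset.sum_insert ha]
      exact add l _ _ (hmem a (hs (by simp)))
        (poly_sum s fun t ht => hmem t (hs (by simp [ht])))
        (hmono _ a _ rfl l ((MvPolynomial.le_totalDegree (hs (by simp))).trans hq))
        (ih fun t ht => hs (by simp [ht]))
  convert key q.support subset_rfl using 2 with x
  rw [h x, ← map_sum, MvPolynomial.support_sum_monomial_coeff]

theorem poly_contDiff {p : Space d → ℝ} (hp : p ∈ poly d l) {n : WithTop ℕ∞} : ContDiff ℝ n p := by
  refine poly_induction (C := fun _ p => ContDiff ℝ n p) (fun _ _ => contDiff_const)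
    (fun _ _ _ _ _ h h' => h.add h') (fun _ p i _ h => ?_) hp
  exact (contDiff_piLp_apply (p := 2) (i := i)).mul h

theorem poly_continuous {p : Space d → ℝ} (hp : p ∈ poly d l) : Continuous p :=
  (poly_contDiff hp (n := 0)).continuous

/-- The clause for `l = 0` carries the induction past the truncation in `l - 1`: by the product rule
`x_i ∂_j p` has degree `1 + (l - 1)`, which is `l` only for `l > 0`; for `l = 0` this term vanishes.
-/
theorem poly_fderiv {p : Space d → ℝ} (hp : p ∈ poly d l) (j : Fin d) :
    (l = 0 → (fun x => fderiv ℝ p x (EuclideanSpace.single j 1)) = fun _ => 0) ∧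
      (fun x => fderiv ℝ p x (EuclideanSpace.single j 1)) ∈ poly d (l - 1) := by
  refine poly_induction (C := fun l p =>
    (l = 0 → (fun x => fderiv ℝ p x (EuclideanSpace.single j 1)) = fun _ => 0) ∧
      (fun x => fderiv ℝ p x (EuclideanSpace.single j 1)) ∈ poly d (l - 1)) ?_ ?_ ?_ hp
  · intro l c
    simpa using poly_const 0 _
  · intro l p p' hp hp' h h'
    have : ∀ x, fderiv ℝ (fun x => p x + p' x) x (EuclideanSpace.single j 1) =
        fderiv ℝ p x (EuclideanSpace.single j 1) + fderiv ℝ p' x (EuclideanSpace.single j 1) := by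
      intro x
      rw [fderiv_fun_add ((poly_contDiff hp (n := 1)).differentiable (by simp) x)
        ((poly_contDiff hp' (n := 1)).differentiable (by simp) x)]
      rfl
    simp only [this]
    refine ⟨fun hl => ?_, poly_add h.2 h'.2⟩
    ext x
    rw [congrFun (h.1 hl) x, congrFun (h'.1 hl) x, add_zero]
  · intro l p i hp h
    have : ∀ x : Space d, fderiv ℝ (fun x : Space d => x i * p x) x (EuclideanSpace.single j 1) =
        x i * fderiv ℝ p x (EuclideanSpace.single j 1) + (if i = j then 1 else 0) * p x := by
      intro x
      have h1 : HasFDerivAt (fun x : Space d => x i) (EuclideanSpace.proj i : Space d →L[ℝ] ℝ) x :=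
        (EuclideanSpace.proj i : Space d →L[ℝ] ℝ).hasFDerivAt
      rw [(h1.fun_mul ((poly_contDiff hp (n := 1)).differentiable (by simp) x).hasFDerivAt).fderiv]
      simp [mul_comm]
    simp only [this]
    refine ⟨by simp, ?_⟩
    rw [Nat.add_sub_cancel]
    refine poly_add ?_ (poly_const_mul _ hp)
    rcases Nat.eq_zero_or_pos l with hl | hl
    · simpa [congrFun (h.1 hl)] using poly_const 0 l
    · have := poly_mul (poly_coord i) h.2
      rwa [show 1 + (l - 1) = l by omega] at this

theorem poly_fderiv_mem {p : Space d → ℝ} (hp : p ∈ poly d l) (j : Fin d) :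
    (fun x => fderiv ℝ p x (EuclideanSpace.single j 1)) ∈ poly d l :=
  poly_mono (Nat.sub_le _ _) (poly_fderiv hp j).2

theorem poly_comp_affine {p : Space d → ℝ} (hp : p ∈ poly d l) (z : Space d) (h : ℝ) :
    (fun x => p (z + h • x)) ∈ poly d l := by
  refine poly_induction (C := fun l p => (fun x => p (z + h • x)) ∈ poly d l)
    (fun l c => poly_const c l) (fun _ _ _ _ _ h h' => poly_add h h') (fun l p i _ hp => ?_) hp
  rw [add_comm l]
  refine poly_mul (l := 1) ?_ hp
  simpa using poly_add (poly_const (z i) 1) (poly_const_mul h (poly_coord i))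

theorem poly_eq_zero {p : Space d → ℝ} (hp : p ∈ poly d l) {U : Set (Space d)} (hU : IsOpen U)
    (hne : U.Nonempty) (h : ∀ x ∈ U, p x = 0) : ∀ x, p x = 0 := by
  obtain ⟨x₀, hx₀⟩ := hne
  have ha : AnalyticOnNhd ℝ p univ := fun x _ => (poly_contDiff hp (n := ω)).contDiffAt.analyticAt
  have := ha.eqOn_zero_of_preconnected_of_eventuallyEq_zero isPreconnected_univ (mem_univ x₀)
    (by filter_upwards [hU.mem_nhds hx₀] with x hx using h x hx)
  exact fun x => this (mem_univ x)

/-- `poly d l` as a vector space. -/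
def polySubmodule (d l : ℕ) : Submodule ℝ (Space d → ℝ) where
  carrier := poly d l
  add_mem' := poly_add
  zero_mem' := poly_const 0 l
  smul_mem' c _ hp := poly_const_mul c hp

instance : FiniteDimensional ℝ (polySubmodule d l) := by
  let ev : MvPolynomial.restrictTotalDegree (Fin d) ℝ l →ₗ[ℝ] polySubmodule d l :=
    { toFun := fun q => ⟨fun x => MvPolynomial.eval (fun i => x i) q.1,
        q.1, (MvPolynomial.mem_restrictTotalDegree _ _ _).1 q.2, fun _ => rfl⟩
      map_add' := fun q q' => by ext x; simp
      map_smul' := fun c q => by ext x; simp }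
  refine Module.Finite.of_surjective ev ?_
  rintro ⟨p, q, hq, h⟩
  exact ⟨⟨q, (MvPolynomial.mem_restrictTotalDegree _ _ _).2 hq⟩, by
    ext x
    exact (h x).symm⟩

end polynomial

/-! ### Representation of linear forms and existence of projections -/

section representation
variable {d l : ℕ}

/-- In finite dimension the forms represented by `B` are those that annihilate its kernel.
Degenerate `B` must be allowed, since a nonzero polynomial can vanish on a whole face. -/
theorem exists_forall_eq_of_symm {V : Type*} [AddCommGroup V] [Module ℝ V] [FiniteDimensional ℝ V]
    (B : V →ₗ[ℝ] V →ₗ[ℝ] ℝ) (hB : ∀ x y, B x y = B y x) (L : V →ₗ[ℝ] ℝ)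
    (hL : ∀ x, B x x = 0 → L x = 0) : ∃ g, ∀ z, B g z = L z := by
  have h1 : L ∈ (LinearMap.ker B).dualAnnihilator := by
    rw [Submodule.mem_dualAnnihilator]
    intro z hz
    refine hL z ?_
    rw [LinearMap.mem_ker.1 hz]
    rfl
  rw [← LinearMap.range_dualMap_eq_dualAnnihilator_ker] at h1
  obtain ⟨e, he⟩ := h1
  obtain ⟨g, rfl⟩ := (Module.evalEquiv ℝ V).surjective e
  refine ⟨g, fun z => ?_⟩
  rw [← he, hB]
  simp

/-- A linear form that vanishes on the polynomials of zero `L²` norm is represented by a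
polynomial. -/
theorem exists_poly_integral_eq {μ : Measure (Space d)}
    (hμ : ∀ p ∈ poly d l, ∀ q ∈ poly d l, Integrable (fun x => p x * q x) μ)
    (L : polySubmodule d l →ₗ[ℝ] ℝ)
    (hL : ∀ p : polySubmodule d l, (p : Space d → ℝ) =ᵐ[μ] 0 → L p = 0) :
    ∃ g ∈ poly d l, ∀ p : polySubmodule d l, ∫ x, g x * (p : Space d → ℝ) x ∂μ = L p := by
  let B : polySubmodule d l →ₗ[ℝ] polySubmodule d l →ₗ[ℝ] ℝ :=
    LinearMap.mk₂ ℝ (fun p q => ∫ x, p.1 x * q.1 x ∂μ)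
      (fun p p' q => by
        rw [← integral_add (hμ _ p.2 _ q.2) (hμ _ p'.2 _ q.2)]
        simp [add_mul])
      (fun c p q => by
        rw [smul_eq_mul, ← integral_const_mul]
        simp [mul_assoc])
      (fun p q q' => by
        rw [← integral_add (hμ _ p.2 _ q.2) (hμ _ p.2 _ q'.2)]
        simp [mul_add])
      (fun c p q => by
        rw [smul_eq_mul, ← integral_const_mul]
        simp [mul_left_comm])
  obtain ⟨g, hg⟩ := exists_forall_eq_of_symm B (fun p q => by simp [B, mul_comm]) L (fun p hp => by
    refine hL p ?_
    have hp' : ∫ x, p.1 x * p.1 x ∂μ = 0 := hp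
    rw [integral_eq_zero_iff_of_nonneg (fun x => mul_self_nonneg _) (hμ _ p.2 _ p.2)] at hp'
    filter_upwards [hp'] with x hx using mul_self_eq_zero.1 hx)
  exact ⟨g.1, g.2, hg⟩

theorem isL2Proj_lproj {μ : Measure (Space d)} {v : Space d → ℝ}
    (hμ : ∀ p ∈ poly d l, ∀ q ∈ poly d l, Integrable (fun x => p x * q x) μ)
    (hv : ∀ p ∈ poly d l, Integrable (fun x => v x * p x) μ) : IsL2Proj μ l v (lproj μ l v) := by
  have hex : ∃ p, IsL2Proj μ l v p := by
    obtain ⟨g, hg, h⟩ := exists_poly_integral_eq hμ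
      { toFun := fun p => ∫ x, v x * p.1 x ∂μ
        map_add' := fun p q => by
          rw [← integral_add (hv _ p.2) (hv _ q.2)]
          simp [mul_add]
        map_smul' := fun c p => by
          rw [smul_eq_mul, ← integral_const_mul]
          simp [mul_left_comm] }
      (fun p hp => by
        refine integral_eq_zero_of_ae ?_
        filter_upwards [hp] with x hx
        simp [hx])
    refine ⟨g, hg, fun w hw => ?_⟩
    have := h ⟨w, hw⟩
    simp only [LinearMap.coe_mk, AddHom.coe_mk] at this
    simp only [sub_mul]
    rw [integral_sub (hv w hw) (hμ g hg w hw), this, sub_self]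
  unfold lproj
  rw [dif_pos hex]
  exact hex.choose_spec

end representation

/-! ### Iterated partial derivatives -/

/-- The partial derivative `∂_j f`. -/
def partialDeriv {d : ℕ} (j : Fin d) (f : Space d → ℝ) : Space d → ℝ :=
  fun x => fderiv ℝ f x (EuclideanSpace.single j 1)

/-- The iterated partial derivative `∂_{J 0} ⋯ ∂_{J (m-1)} f`. -/
def iterPartial {d m : ℕ} (J : Fin m → Fin d) (f : Space d → ℝ) : Space d → ℝ :=
  fun x => iteratedFDeriv ℝ m f x fun l => EuclideanSpace.single (J l) 1

section iterPartial
variable {d m l : ℕ} {f : Space d → ℝ}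

theorem contDiff_partialDeriv (hf : ContDiff ℝ ∞ f) (j : Fin d) :
    ContDiff ℝ ∞ (partialDeriv j f) :=
  (hf.fderiv_right (m := ∞) (by simp)).clm_apply contDiff_const

theorem iterPartial_zero (J : Fin 0 → Fin d) (f : Space d → ℝ) : iterPartial J f = f := by
  ext x
  simp [iterPartial]

theorem iterPartial_succ (hf : ContDiff ℝ ∞ f) (J : Fin (m + 1) → Fin d) :
    iterPartial J f = iterPartial (Fin.init J) (partialDeriv (J (Fin.last m)) f) := by
  ext x
  have h1 : partialDeriv (J (Fin.last m)) f =
      (ContinuousLinearMap.apply ℝ ℝ (EuclideanSpace.single (J (Fin.last m)) (1 : ℝ))) ∘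
        (fun y => fderiv ℝ f y) := rfl
  unfold iterPartial
  rw [iteratedFDeriv_succ_apply_right, h1, ContinuousLinearMap.iteratedFDeriv_comp_left (n := ∞) _
    (hf.fderiv_right (m := ∞) (by simp)).contDiffAt (by exact_mod_cast le_top)]
  rfl

theorem iterPartial_snoc (hf : ContDiff ℝ ∞ f) (J : Fin m → Fin d) (j : Fin d) :
    iterPartial (Fin.snoc J j : Fin (m + 1) → Fin d) f = iterPartial J (partialDeriv j f) := by
  rw [iterPartial_succ hf]
  simp

theorem partialDeriv_comm (hf : ContDiff ℝ ∞ f) (i j : Fin d) :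
    partialDeriv i (partialDeriv j f) = partialDeriv j (partialDeriv i f) := by
  ext x
  have hs : IsSymmSndFDerivAt ℝ f x := hf.contDiffAt.isSymmSndFDerivAt (by
    simp only [minSmoothness_of_isRCLikeNormedField]
    exact WithTop.coe_le_coe.2 le_top)
  have hd : DifferentiableAt ℝ (fderiv ℝ f) x :=
    (hf.fderiv_right (m := ∞) (by simp)).differentiable (by simp) x
  unfold partialDeriv
  simp only [fderiv_clm_apply hd (differentiableAt_const _)]
  simpa using hs _ _

/-- The space of smooth functions. -/
def smoothFunctions (d : ℕ) : Submodule ℝ (Space d → ℝ) where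
  carrier := {f | ContDiff ℝ ∞ f}
  add_mem' := fun {f g} (hf : ContDiff ℝ ∞ f) (hg : ContDiff ℝ ∞ g) => by exact hf.add hg
  zero_mem' := by exact (contDiff_const : ContDiff ℝ ∞ fun _ : Space d => (0 : ℝ))
  smul_mem' := fun c f (hf : ContDiff ℝ ∞ f) => by exact contDiff_const.smul hf

/-- The partial derivative as an endomorphism of the space of smooth functions. -/
def partialEnd (d : ℕ) (j : Fin d) : Module.End ℝ (smoothFunctions d) where
  toFun := fun f => ⟨partialDeriv j f.1, contDiff_partialDeriv f.2 j⟩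
  map_add' := fun f g => by
    ext x
    have hf : ContDiff ℝ ∞ f.1 := f.2
    have hg : ContDiff ℝ ∞ g.1 := g.2
    simp [partialDeriv, fderiv_add (hf.differentiable (by simp) x)
      (hg.differentiable (by simp) x)]
  map_smul' := fun c f => by
    ext x
    have hf : ContDiff ℝ ∞ f.1 := f.2
    simp [partialDeriv, fderiv_const_smul (hf.differentiable (by simp) x)]

theorem commute_partialEnd (i j : Fin d) : Commute (partialEnd d i) (partialEnd d j) := by
  ext f : 2
  exact partialDeriv_comm f.2 i j

/-- As a product of commuting endomorphisms of the smooth functions, the iterated derivative is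
visibly independent of the order of the indices. -/
theorem iterPartial_eq_prod (hf : ContDiff ℝ ∞ f) (J : Fin m → Fin d) :
    iterPartial J f = ((List.ofFn fun i => partialEnd d (J i)).prod ⟨f, hf⟩).1 := by
  induction m generalizing f with
  | zero => simp [iterPartial_zero]
  | succ m ih =>
    rw [iterPartial_succ hf, ih (contDiff_partialDeriv hf _), List.ofFn_succ', List.concat_eq_append,
      List.prod_append, List.prod_singleton]
    rfl

theorem iterPartial_perm (hf : ContDiff ℝ ∞ f) (J : Fin m → Fin d) (σ : Equiv.Perm (Fin m)) :
    iterPartial (J ∘ σ) f = iterPartial J f := by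
  rw [iterPartial_eq_prod hf, iterPartial_eq_prod hf]
  congr 2
  refine List.Perm.prod_eq' (σ.ofFn_comp_perm fun i => partialEnd d (J i)) ?_
  rw [List.pairwise_ofFn]
  exact fun i j _ => commute_partialEnd _ _

theorem contDiff_iterPartial (hf : ContDiff ℝ ∞ f) (J : Fin m → Fin d) :
    ContDiff ℝ ∞ (iterPartial J f) := by
  rw [iterPartial_eq_prod hf]
  exact Subtype.prop _

theorem partialDeriv_iterPartial (hf : ContDiff ℝ ∞ f) (J : Fin m → Fin d) (j : Fin d) :
    partialDeriv j (iterPartial J f) = iterPartial (Fin.snoc J j : Fin (m + 1) → Fin d) f := by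
  rw [iterPartial_snoc hf, iterPartial_eq_prod hf, iterPartial_eq_prod (contDiff_partialDeriv hf j)]
  have : Commute (partialEnd d j) (List.ofFn fun i => partialEnd d (J i)).prod := by
    refine Commute.list_prod_right _ _ fun x hx => ?_
    obtain ⟨i, rfl⟩ := List.mem_ofFn.1 hx
    exact commute_partialEnd _ _
  exact congrArg Subtype.val (LinearMap.congr_fun this.eq ⟨f, hf⟩)

theorem iterPartial_add {g : Space d → ℝ} (hf : ContDiff ℝ ∞ f) (hg : ContDiff ℝ ∞ g)
    (J : Fin m → Fin d) :
    iterPartial J (fun x => f x + g x) = fun x => iterPartial J f x + iterPartial J g x := by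
  rw [iterPartial_eq_prod hf, iterPartial_eq_prod hg, iterPartial_eq_prod (hf.add hg)]
  exact congrArg Subtype.val (map_add (List.ofFn fun i => partialEnd d (J i)).prod
    (⟨f, hf⟩ : smoothFunctions d) ⟨g, hg⟩)

theorem iterPartial_poly {p : Space d → ℝ} (hp : p ∈ poly d l) (hlm : l < m) (J : Fin m → Fin d) :
    iterPartial J p = fun _ => 0 := by
  induction l generalizing m p with
  | zero =>
    obtain ⟨m, rfl⟩ : ∃ m', m = m' + 1 := ⟨m - 1, by omega⟩
    rw [iterPartial_succ (poly_contDiff hp),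
      show partialDeriv (J (Fin.last m)) p = fun _ => 0 from (poly_fderiv hp _).1 rfl]
    ext x
    rcases m with _ | m
    · simp [iterPartial]
    · simp [iterPartial, iteratedFDeriv_const_of_ne (Nat.succ_ne_zero m)]
  | succ l ih =>
    obtain ⟨m, rfl⟩ : ∃ m', m = m' + 1 := ⟨m - 1, by omega⟩
    rw [iterPartial_succ (poly_contDiff hp)]
    exact ih (poly_fderiv hp _).2 (by omega) _

/-- A homogeneous polynomial of degree `m` with prescribed (symmetric) derivatives of order `m`. -/
theorem exists_poly_iterPartial_eq (c : (Fin m → Fin d) → ℝ)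
    (hc : ∀ J (σ : Equiv.Perm (Fin m)), c (J ∘ σ) = c J) :
    ∃ p ∈ poly d m, ∀ J x, iterPartial J p x = c J := by
  classical
  let L : ContinuousMultilinearMap ℝ (fun _ : Fin m => Space d) ℝ :=
    ∑ J : Fin m → Fin d, ((m.factorial : ℝ)⁻¹ * c J) •
      (ContinuousMultilinearMap.mkPiAlgebra ℝ (Fin m) ℝ).compContinuousLinearMap
        fun l => (EuclideanSpace.proj (J l) : Space d →L[ℝ] ℝ)
  have hL : ∀ v : Fin m → Space d,
      L v = ∑ J : Fin m → Fin d, ((m.factorial : ℝ)⁻¹ * c J) * ∏ l, v l (J l) := by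
    intro v
    simp [L]
  refine ⟨fun x => L fun _ => x, ?_, fun J x => ?_⟩
  · simp only [hL]
    refine poly_sum _ fun J _ => poly_const_mul _ ?_
    simpa using poly_prod Finset.univ fun l _ => poly_coord (J l)
  -- The derivative of order `m` of `x ↦ L (x, …, x)` is the sum of `L` over all permutations of its
  -- arguments. Symmetry of `c` makes the `m!` terms equal, which accounts for the normalisation of
  -- `L`.
  · have h2 : ∀ σ : Equiv.Perm (Fin m),
        L (fun i => EuclideanSpace.single (J (σ i)) 1) = (m.factorial : ℝ)⁻¹ * c J := by
      intro σ
      have h3 : ∀ J' : Fin m → Fin d,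
          ∏ l, (EuclideanSpace.single (J (σ l)) (1 : ℝ) : Space d) (J' l) =
            if J' = J ∘ σ then 1 else 0 := by
        intro J'
        split_ifs with h
        · simp [h]
        · obtain ⟨l, hl⟩ := Function.ne_iff.1 h
          exact Finset.prod_eq_zero (Finset.mem_univ l) (by simpa using hl)
      simp only [hL, h3]
      simp [hc J σ]
    unfold iterPartial
    rw [L.iteratedFDeriv_comp_diagonal]
    simp only [h2, Finset.sum_const, Finset.card_univ, Fintype.card_perm, Fintype.card_fin,
      nsmul_eq_mul]
    rw [← mul_assoc, mul_inv_cancel₀ (by positivity), one_mul]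
end iterPartial

/-- The gradient of `f`, as the vector of its partial derivatives. -/
def gradient {d : ℕ} (f : Space d → ℝ) : Space d → Space d :=
  fun x => WithLp.toLp 2 fun j => partialDeriv j f x

/-! ### Weak derivatives and `H¹` functions -/

section sobolev
variable {d m : ℕ} {T : Set (Space d)} {u v : Space d → ℝ} {G H : Space d → Space d}

theorem inner_eq_sum_mul (x e : Space d) : inner ℝ x e = ∑ j, x j * e j := by
  simp [PiLp.inner_apply, mul_comm]

theorem inner_gradient (f : Space d → ℝ) (x e : Space d) :
    inner ℝ (gradient f x) e = fderiv ℝ f x e := by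
  have h : e = ∑ j, e j • EuclideanSpace.single j (1 : ℝ) := by
    ext i
    simp [Finset.sum_apply, Pi.single_apply]
  conv_rhs => rw [h]
  simp [inner_eq_sum_mul, gradient, partialDeriv, mul_comm]

theorem memLp_of_continuous {E : Type*} [NormedAddCommGroup E] {μ : Measure (Space d)}
    [IsFiniteMeasure μ] {f : Space d → E} (hf : Continuous f) {K : Set (Space d)}
    (hK : Bornology.IsBounded K) (hμ : ∀ᵐ x ∂μ, x ∈ K) (p : ℝ≥0∞) : MemLp f p μ := by
  obtain ⟨C, hC⟩ := (hK.isCompact_closure.image hf).isBounded.exists_norm_le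
  refine MemLp.of_bound hf.aestronglyMeasurable C ?_
  filter_upwards [hμ] with x hx
  exact hC _ (mem_image_of_mem _ (subset_closure hx))

theorem IsH1.congr (hu : IsH1 T u G) (huv : u =ᵐ[volume.restrict T] v)
    (hGH : G =ᵐ[volume.restrict T] H) : IsH1 T v H where
  memLp := (memLp_congr_ae huv).1 hu.memLp
  memLp_grad := (memLp_congr_ae hGH).1 hu.memLp_grad
  weak φ hφ hc hs e := by
    have h1 : ∫ x in T, v x * fderiv ℝ φ x e = ∫ x in T, u x * fderiv ℝ φ x e :=
      integral_congr_ae (by filter_upwards [huv] with x hx; rw [hx])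
    have h2 : ∫ x in T, inner ℝ (H x) e * φ x = ∫ x in T, inner ℝ (G x) e * φ x :=
      integral_congr_ae (by filter_upwards [hGH] with x hx; rw [hx])
    rw [h1, h2, hu.weak φ hφ hc hs e]

theorem IsH1.sub [IsFiniteMeasure (volume.restrict T)] (hu : IsH1 T u G) (hv : IsH1 T v H) :
    IsH1 T (fun x => u x - v x) (fun x => G x - H x) where
  memLp := hu.memLp.sub hv.memLp
  memLp_grad := hu.memLp_grad.sub hv.memLp_grad
  weak φ hφ hc hs e := by
    have i1 := integrable_mul_smooth (hu.memLp.integrable (by norm_num))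
      (continuous_fderiv_apply hφ e) (hasCompactSupport_fderiv_apply hc e)
    have i2 := integrable_mul_smooth (hv.memLp.integrable (by norm_num))
      (continuous_fderiv_apply hφ e) (hasCompactSupport_fderiv_apply hc e)
    have i3 := integrable_mul_smooth ((hu.memLp_grad.integrable (by norm_num)).inner_const (𝕜 := ℝ) e)
      hφ.continuous hc
    have i4 := integrable_mul_smooth ((hv.memLp_grad.integrable (by norm_num)).inner_const (𝕜 := ℝ) e)
      hφ.continuous hc
    simp only [sub_mul, inner_sub_left]
    rw [integral_sub i1 i2, integral_sub i3 i4, hu.weak φ hφ hc hs e, hv.weak φ hφ hc hs e]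
    ring

theorem continuous_gradient {f : Space d → ℝ} (hf : ContDiff ℝ ∞ f) : Continuous (gradient f) :=
  (PiLp.continuous_toLp 2 _).comp (continuous_pi fun j => (contDiff_partialDeriv hf j).continuous)

theorem isH1_of_contDiff (hT : Bornology.IsBounded T) {f : Space d → ℝ}
    (hf : ContDiff ℝ ∞ f) : IsH1 T f (gradient f) := by
  have hfin : IsFiniteMeasure (volume.restrict T) := ⟨by simpa using hT.measure_lt_top⟩
  have hT' : ∀ᵐ x ∂(volume.restrict T), x ∈ closure T :=
    ae_restrict_of_ae_restrict_of_subset subset_closure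
      (ae_restrict_mem isClosed_closure.measurableSet)
  refine ⟨memLp_of_continuous hf.continuous hT.closure hT' 2,
    memLp_of_continuous (continuous_gradient hf) hT.closure hT' 2, fun φ hφ hc hs e => ?_⟩
  simp only [inner_gradient]
  have hz : ∀ x, x ∉ T → φ x = 0 ∧ fderiv ℝ φ x e = 0 := fun x hx =>
    notMem_tsupport_fderiv (fun h => hx (hs h)) e
  rw [setIntegral_eq_integral_of_forall_compl_eq_zero fun x hx => by simp [(hz x hx).2],
    setIntegral_eq_integral_of_forall_compl_eq_zero fun x hx => by simp [(hz x hx).1]]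
  refine integral_mul_fderiv_eq_neg_fderiv_mul_of_integrable ?_ ?_ ?_
    (fun x _ => hf.differentiable (by simp) x)
    (fun x _ => hφ.differentiable (by simp) x)
  · exact ((continuous_fderiv_apply hf e).mul hφ.continuous).integrable_of_hasCompactSupport
      hc.mul_left
  · exact (hf.continuous.mul (continuous_fderiv_apply hφ e)).integrable_of_hasCompactSupport
      (hasCompactSupport_fderiv_apply hc e).mul_left
  · exact (hf.continuous.mul hφ.continuous).integrable_of_hasCompactSupport hc.mul_left

theorem ae_eq_of_integral_test_eq (hT : IsOpen T) {g g' : Space d → ℝ}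
    (hg : LocallyIntegrableOn g T) (hg' : LocallyIntegrableOn g' T)
    (h : ∀ φ : Space d → ℝ, ContDiff ℝ ∞ φ → HasCompactSupport φ → tsupport φ ⊆ T →
      ∫ x in T, g x * φ x = ∫ x in T, g' x * φ x) : g =ᵐ[volume.restrict T] g' := by
  have := hT.ae_eq_zero_of_integral_contDiff_smul_eq_zero (hg.sub hg') fun φ hφ hc hs => by
    have hz : ∀ x, x ∉ T → φ x = 0 := fun x hx => image_eq_zero_of_notMem_tsupport fun h => hx (hs h)
    have hi : ∀ f : Space d → ℝ, LocallyIntegrableOn f T →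
        IntegrableOn (fun x => f x * φ x) T := by
      intro f hf
      have h1 : IntegrableOn (fun x => f x * φ x) (tsupport φ) :=
        (hf.integrableOn_compact_subset hs hc).mul_continuousOn hφ.continuous.continuousOn hc
      have h2 : Function.support (fun x => f x * φ x) ⊆ tsupport φ := fun x hx =>
        subset_tsupport φ fun h => hx (by simp [h])
      exact ((integrableOn_iff_integrable_of_support_subset h2).1 h1).integrableOn
    rw [← setIntegral_eq_integral_of_forall_compl_eq_zero (s := T) fun x hx => by simp [hz x hx]]
    have he : ∀ x, φ x • (g - g') x = g x * φ x - g' x * φ x := fun x => by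
      simp only [Pi.sub_apply, smul_eq_mul]
      ring
    simp only [he]
    rw [integral_sub (hi g hg) (hi g' hg'), h φ hφ hc hs, sub_self]
  rw [Filter.EventuallyEq, ae_restrict_iff' hT.measurableSet]
  filter_upwards [this] with x hx hxT
  exact sub_eq_zero.1 (hx hxT)

theorem IsWeakDeriv.ae_eq {J : Fin m → Fin d} {g g' : Space d → ℝ} (hT : IsOpen T)
    (h : IsWeakDeriv T J u g) (h' : IsWeakDeriv T J u g') : g =ᵐ[volume.restrict T] g' := by
  refine ae_eq_of_integral_test_eq hT h.2.1 h'.2.1 fun φ hφ hc hs => ?_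
  have := (h.2.2 φ hφ hc hs).symm.trans (h'.2.2 φ hφ hc hs)
  exact mul_left_cancel₀ (pow_ne_zero _ (by norm_num)) this

theorem IsWeakDeriv.weakDeriv {J : Fin m → Fin d} {g : Space d → ℝ} (h : IsWeakDeriv T J u g) :
    IsWeakDeriv T J u (weakDeriv T J u) :=
  Classical.epsilon_spec ⟨g, h⟩

theorem IsWeakDeriv.perm {J : Fin m → Fin d} {g : Space d → ℝ} (h : IsWeakDeriv T J u g)
    (σ : Equiv.Perm (Fin m)) : IsWeakDeriv T (J ∘ σ) u g := by
  refine ⟨h.1, h.2.1, fun φ hφ hc hs => ?_⟩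
  rw [← h.2.2 φ hφ hc hs]
  congr 1 with x
  congr 1
  exact congrFun (iterPartial_perm hφ J σ) x

theorem IsWeakDeriv.ae_eq_self {J : Fin 0 → Fin d} {g : Space d → ℝ} (hT : IsOpen T)
    (h : IsWeakDeriv T J u g) : g =ᵐ[volume.restrict T] u := by
  refine ae_eq_of_integral_test_eq hT h.2.1 h.1 fun φ hφ hc hs => ?_
  simpa using (h.2.2 φ hφ hc hs).symm

/-- Consecutive weak derivatives form a pair of an `H¹` function and its gradient. -/
theorem isH1_weakDeriv [IsFiniteMeasure (volume.restrict T)] {J : Fin m → Fin d}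
    {g : Space d → ℝ} (h : IsWeakDeriv T J u g) (hg : MemLp g 2 (volume.restrict T))
    {g' : Fin d → Space d → ℝ}
    (h' : ∀ j, IsWeakDeriv T (Fin.snoc J j : Fin (m + 1) → Fin d) u (g' j))
    (hg' : ∀ j, MemLp (g' j) 2 (volume.restrict T)) :
    IsH1 T g fun x => WithLp.toLp 2 fun j => g' j x := by
  refine ⟨hg, MemLp.of_eval_piLp hg', fun φ hφ hc hs e => ?_⟩
  -- Test the derivative of order `m` with `∂_j φ` and that of order `m + 1` with `φ`; the two signs
  -- `(-1)^m` and `(-1)^(m+1)` differ by the sign required here.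
  have h1 : ∀ j, ∫ x in T, g x * partialDeriv j φ x = -∫ x in T, g' j x * φ x := by
    intro j
    have a1 := h.2.2 (partialDeriv j φ) (contDiff_partialDeriv hφ j)
      (hasCompactSupport_fderiv_apply hc _)
      ((tsupport_fderiv_apply_subset ℝ _).trans hs)
    have a2 := (h' j).2.2 φ hφ hc hs
    have a3 : ∀ x, iteratedFDeriv ℝ (m + 1) φ x (fun l => EuclideanSpace.single
        ((Fin.snoc J j : Fin (m + 1) → Fin d) l) (1 : ℝ)) =
        iteratedFDeriv ℝ m (partialDeriv j φ) x (fun l => EuclideanSpace.single (J l) (1 : ℝ)) :=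
      fun x => congrFun (iterPartial_snoc hφ J j) x
    simp only [a3] at a2
    rw [a1, pow_succ, mul_assoc] at a2
    simpa using mul_left_cancel₀ (pow_ne_zero _ (by norm_num)) a2
  simp only [← inner_gradient, inner_eq_sum_mul, gradient, Finset.mul_sum, Finset.sum_mul]
  rw [integral_finsetSum, integral_finsetSum, ← Finset.sum_neg_distrib]
  · refine Finset.sum_congr rfl fun j _ => ?_
    have := h1 j
    simp only [← mul_assoc, mul_right_comm _ (e j)]
    rw [integral_mul_const, integral_mul_const, this]
    ring
  · intro j _
    exact integrable_mul_smooth (((hg' j).integrable (by norm_num)).mul_const _) hφ.continuous hc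
  · intro j _
    simp only [← mul_assoc]
    exact (integrable_mul_smooth (hg.integrable (by norm_num))
      (contDiff_partialDeriv hφ j).continuous (hasCompactSupport_fderiv_apply hc _)).mul_const _

end sobolev

/-! ### Jets and polynomial approximation -/

/-- A family of functions that behave like the weak derivatives, of order at most `K`, of a
function of `H^K(T)`. -/
structure IsJet {d : ℕ} (T : Set (Space d)) (K : ℕ)
    (D : ∀ m : ℕ, (Fin m → Fin d) → Space d → ℝ) : Prop where
  memLp : ∀ m ≤ K, ∀ J, MemLp (D m J) 2 (volume.restrict T)
  isH1 : ∀ m < K, ∀ J, IsH1 T (D m J) fun x => WithLp.toLp 2 fun j => D (m + 1) (Fin.snoc J j) x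
  symm : ∀ m ≤ K, ∀ J (σ : Equiv.Perm (Fin m)), ∫ x in T, D m (J ∘ σ) x = ∫ x in T, D m J x

section jet
variable {d K : ℕ} {T : Set (Space d)} {D D' : ∀ m : ℕ, (Fin m → Fin d) → Space d → ℝ}

theorem isJet_iterPartial (hT : Bornology.IsBounded T) {f : Space d → ℝ} (hf : ContDiff ℝ ∞ f)
    (K : ℕ) : IsJet T K fun _ J => iterPartial J f where
  memLp m _ J := (isH1_of_contDiff hT (contDiff_iterPartial hf J)).memLp
  isH1 m _ J := by
    convert isH1_of_contDiff hT (contDiff_iterPartial hf J) using 1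
    ext x : 1
    unfold gradient
    congr 1
    ext j
    rw [partialDeriv_iterPartial hf]
  symm m _ J σ := by rw [iterPartial_perm hf]

theorem IsJet.sub [IsFiniteMeasure (volume.restrict T)] (h : IsJet T K D) (h' : IsJet T K D') :
    IsJet T K fun m J x => D m J x - D' m J x where
  memLp m hm J := (h.memLp m hm J).sub (h'.memLp m hm J)
  isH1 m hm J := (h.isH1 m hm J).sub (h'.isH1 m hm J)
  symm m hm J σ := by
    have i : ∀ J, Integrable (D m J) (volume.restrict T) := fun J =>
      (h.memLp m hm J).integrable (by norm_num)
    have i' : ∀ J, Integrable (D' m J) (volume.restrict T) := fun J =>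
      (h'.memLp m hm J).integrable (by norm_num)
    rw [integral_sub (i _) (i' _), integral_sub (i _) (i' _), h.symm m hm, h'.symm m hm]

theorem IsJet.mono {K' : ℕ} (h : IsJet T K D) (hK : K' ≤ K) : IsJet T K' D where
  memLp m hm := h.memLp m (hm.trans hK)
  isH1 m hm := h.isH1 m (hm.trans_le hK)
  symm m hm := h.symm m (hm.trans hK)

/-- There is a polynomial whose derivatives have the same integrals as the given ones. -/
theorem IsJet.exists_poly (hb : Bornology.IsBounded T) (ho : IsOpen T) (hne : T.Nonempty)
    (h : IsJet T K D) :
    ∃ P ∈ poly d K, ∀ m ≤ K, ∀ J, ∫ x in T, (D m J x - iterPartial J P x) = 0 := by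
  have hfin : IsFiniteMeasure (volume.restrict T) := ⟨by simpa using hb.measure_lt_top⟩
  have hvol : (volume : Measure (Space d)).real T ≠ 0 := by
    rw [measureReal_ne_zero_iff hb.measure_lt_top.ne]
    exact (ho.measure_pos volume hne).ne'
  -- Once the orders from `n + 1` on have zero mean, subtract a homogeneous polynomial of degree `n`
  -- that matches the means of order `n`. Its derivatives of higher order vanish, so nothing already
  -- achieved is lost.
  have key : ∀ n ≤ K + 1, ∀ D, IsJet T K D → (∀ m ≤ K, n ≤ m → ∀ J, ∫ x in T, D m J x = 0) →
      ∃ P ∈ poly d K, ∀ m ≤ K, ∀ J, ∫ x in T, (D m J x - iterPartial J P x) = 0 := by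
    intro n
    induction n with
    | zero =>
      intro _ D _ h0
      refine ⟨fun _ => 0, poly_const 0 K, fun m hm J => ?_⟩
      have : iterPartial J (fun _ : Space d => (0 : ℝ)) = fun _ => 0 := by
        ext x
        simp [iterPartial]
      simp [this, h0 m hm (Nat.zero_le m) J]
    | succ n ih =>
      intro hn D hD h0
      -- Only the means have to be symmetric in the indices for this polynomial to exist; this is
      -- why the jet records symmetry of integrals alone.
      obtain ⟨Q, hQ, hQ'⟩ := exists_poly_iterPartial_eq
        (fun J : Fin n → Fin d => (volume.real T)⁻¹ * ∫ x in T, D n J x)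
        (fun J σ => by simp only [hD.symm n (by omega) J σ])
      have hQs : ContDiff ℝ ∞ Q := poly_contDiff hQ
      obtain ⟨P, hP, hP'⟩ := ih (by omega) _ (hD.sub (isJet_iterPartial hb hQs K))
        (fun m hm hnm J => by
          rcases hnm.eq_or_lt with rfl | hlt
          · simp only [hQ']
            rw [integral_sub ((hD.memLp n hm J).integrable (by norm_num)) (integrable_const _)]
            simp [Measure.real, mul_inv_cancel_left₀ (a := (volume T).toReal) hvol]
          · simp only [iterPartial_poly hQ hlt, sub_zero]
            exact h0 m hm hlt J)
      refine ⟨fun x => Q x + P x, poly_add (poly_mono (by omega) hQ) hP, fun m hm J => ?_⟩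
      simp only [iterPartial_add hQs (poly_contDiff hP), ← sub_sub]
      exact hP' m hm J
  exact key (K + 1) le_rfl D h fun m hm hm' => absurd hm (by omega)

/-- The squared `L²` norm of the derivatives of order `m`. -/
def jetNormSq {d : ℕ} (T : Set (Space d)) (D : ∀ m : ℕ, (Fin m → Fin d) → Space d → ℝ) (m : ℕ) : ℝ :=
  ∑ J : Fin m → Fin d, ∫ x in T, D m J x ^ 2

theorem IsJet.integral_norm_sq {m : ℕ} (h : IsJet T K D) (hm : m < K) (J : Fin m → Fin d) :
    ∫ x in T, ‖(WithLp.toLp 2 fun j => D (m + 1) (Fin.snoc J j) x : Space d)‖ ^ 2 =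
      ∑ j, ∫ x in T, D (m + 1) (Fin.snoc J j) x ^ 2 := by
  simp only [EuclideanSpace.norm_sq_eq, Real.norm_eq_abs, sq_abs]
  exact integral_finsetSum _ fun j _ => (h.memLp (m + 1) hm _).integrable_sq

theorem jetNormSq_succ (m : ℕ) : jetNormSq T D (m + 1) =
    ∑ J : Fin m → Fin d, ∑ j, ∫ x in T, D (m + 1) (Fin.snoc J j) x ^ 2 := by
  unfold jetNormSq
  rw [← (Fin.snocEquiv fun _ => Fin d).sum_comp, Fintype.sum_prod_type, Finset.sum_comm]
  rfl

/-- Poincaré is iterated downwards from the top order; `m` counts the orders descended, each of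
which costs a factor `κ`. -/
theorem IsJet.jetNormSq_le {κ : ℝ} (hκ : 0 ≤ κ)
    (hpoincare : ∀ w G, IsH1 T w G → ∫ x in T, w x = 0 →
      ∫ x in T, w x ^ 2 ≤ κ * ∫ x in T, ‖G x‖ ^ 2) (h : IsJet T (K + 1) D)
    (h0 : ∀ m ≤ K, ∀ J, ∫ x in T, D m J x = 0) {m : ℕ} (hm : m ≤ K + 1) :
    jetNormSq T D (K + 1 - m) ≤ κ ^ m * jetNormSq T D (K + 1) := by
  induction m with
  | zero => simp
  | succ m ih =>
    have hs : K + 1 - m = (K + 1 - (m + 1)) + 1 := by omega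
    set n := K + 1 - (m + 1) with hn
    have h1 : jetNormSq T D n ≤ κ * jetNormSq T D (n + 1) := by
      rw [jetNormSq_succ, Finset.mul_sum]
      refine Finset.sum_le_sum fun J _ => ?_
      rw [← h.integral_norm_sq (by omega) J]
      exact hpoincare _ _ (h.isH1 n (by omega) J) (h0 n (by omega) J)
    calc jetNormSq T D n ≤ κ * jetNormSq T D (K + 1 - m) := by rwa [hs]
      _ ≤ κ * (κ ^ m * jetNormSq T D (K + 1)) := mul_le_mul_of_nonneg_left (ih (by omega)) hκ
      _ = κ ^ (m + 1) * jetNormSq T D (K + 1) := by ring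

/-- Approximation of a function of `H^{K+1}(T)` by a polynomial of degree `K`. -/
theorem IsJet.exists_poly_le (hb : Bornology.IsBounded T) (ho : IsOpen T) (hne : T.Nonempty)
    {κ : ℝ} (hκ : 0 ≤ κ)
    (hpoincare : ∀ w G, IsH1 T w G → ∫ x in T, w x = 0 →
      ∫ x in T, w x ^ 2 ≤ κ * ∫ x in T, ‖G x‖ ^ 2) (h : IsJet T (K + 1) D) :
    ∃ P ∈ poly d K,
      ∫ x in T, (D 0 Fin.elim0 x - P x) ^ 2 ≤ κ ^ (K + 1) * jetNormSq T D (K + 1) ∧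
      ∑ j, ∫ x in T, (D 1 (fun _ => j) x - partialDeriv j P x) ^ 2 ≤
        κ ^ K * jetNormSq T D (K + 1) := by
  have hfin : IsFiniteMeasure (volume.restrict T) := ⟨by simpa using hb.measure_lt_top⟩
  obtain ⟨P, hP, h0⟩ := (h.mono (Nat.le_succ K)).exists_poly hb ho hne
  have hPs : ContDiff ℝ ∞ P := poly_contDiff hP
  have hD := h.sub (isJet_iterPartial hb hPs (K + 1))
  have htop : jetNormSq T (fun m J x => D m J x - iterPartial J P x) (K + 1) =
      jetNormSq T D (K + 1) := by
    simp [jetNormSq, iterPartial_poly hP (Nat.lt_succ_self K)]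
  refine ⟨P, hP, ?_, ?_⟩
  · have := hD.jetNormSq_le hκ hpoincare h0 (m := K + 1) le_rfl
    rw [htop, Nat.sub_self, jetNormSq, Fintype.sum_unique] at this
    simpa only [iterPartial_zero, Subsingleton.elim (default : Fin 0 → Fin d) Fin.elim0] using this
  · have := hD.jetNormSq_le hκ hpoincare h0 (m := K) (Nat.le_succ K)
    rw [htop, Nat.add_sub_cancel_left, jetNormSq_succ, Fintype.sum_unique] at this
    refine le_trans (Finset.sum_le_sum fun j _ => le_of_eq ?_) this
    have e1 : (Fin.snoc (default : Fin 0 → Fin d) j : Fin 1 → Fin d) = fun _ => j := by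
      ext l
      rw [show l = Fin.last 0 from Subsingleton.elim (α := Fin 1) _ _, Fin.snoc_last]
    have e2 : iterPartial (fun _ : Fin 1 => j) P = partialDeriv j P := by
      rw [← e1, iterPartial_snoc hPs, iterPartial_zero]
    change _ = ∫ x in T, (D 1 (Fin.snoc default j : Fin 1 → Fin d) x -
      iterPartial (Fin.snoc default j : Fin 1 → Fin d) P x) ^ 2
    rw [e1, e2]

end jet

/-! ### `L²` norms of real functions -/

/-- The `L²` norm of a real function. -/
def l2norm {α : Type*} [MeasurableSpace α] (μ : Measure α) (f : α → ℝ) : ℝ :=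
  Real.sqrt (∫ x, f x ^ 2 ∂μ)

section l2norm
variable {α : Type*} [MeasurableSpace α] {μ : Measure α} {f g z : α → ℝ} {c : ℝ}

theorem l2norm_nonneg : 0 ≤ l2norm μ f := Real.sqrt_nonneg _

theorem l2norm_sq : l2norm μ f ^ 2 = ∫ x, f x ^ 2 ∂μ :=
  Real.sq_sqrt (integral_nonneg fun _ => sq_nonneg _)

theorem l2norm_le (hc : 0 ≤ c) (h : ∫ x, f x ^ 2 ∂μ ≤ c ^ 2) : l2norm μ f ≤ c :=
  Real.sqrt_le_iff.2 ⟨hc, h⟩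

theorem l2norm_congr (h : f =ᵐ[μ] g) : l2norm μ f = l2norm μ g := by
  unfold l2norm
  congr 1
  exact integral_congr_ae (by filter_upwards [h] with x hx; rw [hx])

theorem toReal_eLpNorm_two (hf : MemLp f 2 μ) : (eLpNorm f 2 μ).toReal = l2norm μ f := by
  rw [hf.eLpNorm_eq_integral_rpow_norm (by norm_num) (by norm_num),
    ENNReal.toReal_ofReal (by positivity), l2norm, Real.sqrt_eq_rpow]
  simp

theorem l2norm_sub_le (hf : MemLp f 2 μ) (hg : MemLp g 2 μ) :
    l2norm μ (fun x => f x - g x) ≤ l2norm μ f + l2norm μ g := by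
  rw [← toReal_eLpNorm_two hf, ← toReal_eLpNorm_two hg,
    ← toReal_eLpNorm_two (f := fun x => f x - g x) (hf.sub hg),
    ← ENNReal.toReal_add hf.eLpNorm_ne_top hg.eLpNorm_ne_top]
  exact ENNReal.toReal_mono (ENNReal.add_ne_top.2 ⟨hf.eLpNorm_ne_top, hg.eLpNorm_ne_top⟩)
    (eLpNorm_sub_le hf.1 hg.1 (by norm_num))

theorem integrable_mul_of_memLp_two (hf : MemLp f 2 μ) (hg : MemLp g 2 μ) :
    Integrable (fun x => f x * g x) μ := hf.integrable_mul hg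

theorem abs_integral_mul_le (hf : MemLp f 2 μ) (hg : MemLp g 2 μ) :
    |∫ x, f x * g x ∂μ| ≤ l2norm μ f * l2norm μ g := by
  have i1 : Integrable (fun x => f x ^ 2) μ := hf.integrable_sq
  have i2 : Integrable (fun x => g x ^ 2) μ := hg.integrable_sq
  have i3 := integrable_mul_of_memLp_two hf hg
  have h : ∀ t : ℝ, 0 ≤ (∫ x, f x ^ 2 ∂μ) * (t * t) + (2 * ∫ x, f x * g x ∂μ) * t +
      ∫ x, g x ^ 2 ∂μ := by
    intro t
    have h1 : 0 ≤ ∫ x, (t * t * f x ^ 2 + 2 * t * (f x * g x) + g x ^ 2) ∂μ :=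
      integral_nonneg fun x => by
        have := sq_nonneg (t * f x + g x)
        simp only [Pi.zero_apply]
        linarith
    have j1 : Integrable (fun x => t * t * f x ^ 2) μ := i1.const_mul _
    have j2 : Integrable (fun x => 2 * t * (f x * g x)) μ := i3.const_mul _
    have j3 : Integrable (fun x => t * t * f x ^ 2 + 2 * t * (f x * g x)) μ := j1.add j2
    rw [integral_add j3 i2, integral_add j1 j2, integral_const_mul, integral_const_mul] at h1
    linarith
  have h2 := discrim_le_zero h
  rw [discrim] at h2
  rw [← abs_of_nonneg (mul_nonneg (l2norm_nonneg (μ := μ) (f := f)) (l2norm_nonneg (f := g)))]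
  refine sq_le_sq.1 ?_
  rw [mul_pow, l2norm_sq, l2norm_sq]
  linarith

theorem abs_integral_mul_mul_le (hf : MemLp f 2 μ) (hg : MemLp g 2 μ)
    (hz : AEStronglyMeasurable z μ) (hc : 0 ≤ c) (hzc : ∀ᵐ x ∂μ, |z x| ≤ c) :
    |∫ x, f x * g x * z x ∂μ| ≤ c * (l2norm μ f * l2norm μ g) := by
  have hgz : MemLp (fun x => g x * z x) 2 μ := by
    refine (hg.const_mul c).mono (hg.1.mul hz) ?_
    filter_upwards [hzc] with x hx
    rw [norm_mul, norm_mul, mul_comm]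
    exact mul_le_mul_of_nonneg_right (hx.trans (le_abs_self c)) (norm_nonneg _)
  have h1 : l2norm μ (fun x => g x * z x) ≤ c * l2norm μ g := by
    refine l2norm_le (mul_nonneg hc l2norm_nonneg) ?_
    rw [mul_pow, l2norm_sq, ← integral_const_mul]
    refine integral_mono_ae hgz.integrable_sq (hg.integrable_sq.const_mul _) ?_
    filter_upwards [hzc] with x hx
    have : z x ^ 2 ≤ c ^ 2 := sq_le_sq.2 (by rwa [abs_of_nonneg hc])
    have := mul_le_mul_of_nonneg_left this (sq_nonneg (g x))
    simp only [mul_pow]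
    linarith
  simp only [mul_assoc]
  refine (abs_integral_mul_le hf hgz).trans ?_
  have := mul_le_mul_of_nonneg_left h1 (l2norm_nonneg (μ := μ) (f := f))
  linarith

end l2norm

section projection
variable {d l : ℕ} {μ : Measure (Space d)} {v p q : Space d → ℝ}

/-- Pythagoras for `v - q = (v - p) + (p - q)` bounds both orthogonal parts at once; the consistency
estimate uses each of them. -/
theorem IsL2Proj.l2norm_le (h : IsL2Proj μ l v p) (hq : q ∈ poly d l) (hv : MemLp v 2 μ)
    (hμ : ∀ p ∈ poly d l, MemLp p 2 μ) :
    l2norm μ (fun x => p x - q x) ≤ l2norm μ (fun x => v x - q x) ∧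
      l2norm μ (fun x => v x - p x) ≤ l2norm μ (fun x => v x - q x) := by
  have m1 : MemLp (fun x => v x - p x) 2 μ := hv.sub (hμ p h.1)
  have m2 : MemLp (fun x => p x - q x) 2 μ := (hμ p h.1).sub (hμ q hq)
  have h1 : ∫ x, (v x - q x) ^ 2 ∂μ = ∫ x, (v x - p x) ^ 2 ∂μ + ∫ x, (p x - q x) ^ 2 ∂μ := by
    have h2 := h.2 _ (poly_sub h.1 hq)
    have e : ∀ x, (v x - q x) ^ 2 =
        (v x - p x) ^ 2 + (p x - q x) ^ 2 + 2 * ((v x - p x) * (p x - q x)) := fun x => by ring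
    have j1 : Integrable (fun x => (v x - p x) ^ 2) μ := m1.integrable_sq
    have j2 : Integrable (fun x => (p x - q x) ^ 2) μ := m2.integrable_sq
    have j3 : Integrable (fun x => (v x - p x) ^ 2 + (p x - q x) ^ 2) μ := j1.add j2
    have j4 : Integrable (fun x => 2 * ((v x - p x) * (p x - q x))) μ :=
      (integrable_mul_of_memLp_two m1 m2).const_mul 2
    simp only [e]
    rw [integral_add j3 j4, integral_add j1 j2, integral_const_mul, h2]
    ring
  have n1 : 0 ≤ ∫ x, (v x - p x) ^ 2 ∂μ := integral_nonneg fun _ => sq_nonneg _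
  have n2 : 0 ≤ ∫ x, (p x - q x) ^ 2 ∂μ := integral_nonneg fun _ => sq_nonneg _
  exact ⟨Real.sqrt_le_sqrt (by linarith), Real.sqrt_le_sqrt (by linarith)⟩

end projection

/-! ### Inverse inequalities for polynomials -/

section inverse
variable {d : ℕ}

theorem memLp_poly_ball {p : Space d → ℝ} (hp : Continuous p) (x : Space d) (r : ℝ) (e : ℝ≥0∞) :
    MemLp p e (volume.restrict (Metric.ball x r)) := by
  have : IsFiniteMeasure ((volume : Measure (Space d)).restrict (Metric.ball x r)) :=
    ⟨by simpa using measure_ball_lt_top⟩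
  exact memLp_of_continuous hp Metric.isBounded_ball (ae_restrict_mem measurableSet_ball) e

/-- On the finite dimensional space `poly d l`, a linear form of each member of a pointwise
bounded family is bounded by the `L²` norm on the unit ball. -/
theorem exists_sq_le_integral_ball (d l : ℕ) {ι : Type*}
    (L : ι → polySubmodule d l →ₗ[ℝ] ℝ)
    (hL : ∀ p, ∃ C, ∀ i, |L i p| ≤ C) :
    ∃ C, 0 ≤ C ∧ ∀ i, ∀ p : polySubmodule d l,
      L i p ^ 2 ≤ C * ∫ x in Metric.ball 0 1, (p : Space d → ℝ) x ^ 2 := by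
  set B := Metric.ball (0 : Space d) 1
  set b := Module.finBasis ℝ (polySubmodule d l)
  choose M hM using fun j => hL (b j)
  have hmem : ∀ p ∈ poly d l, MemLp p 2 (volume.restrict B) := fun p hp =>
    memLp_poly_ball (poly_continuous hp) _ _ _
  have hg : ∀ j, ∃ g ∈ poly d l, ∀ p : polySubmodule d l,
      ∫ x in B, g x * (p : Space d → ℝ) x = b.coord j p := fun j => by
    -- The coordinate forms in a basis are `L²` pairings with polynomials, because a polynomial that
    -- vanishes almost everywhere on the ball is zero. Cauchy–Schwarz then bounds every coordinate
    -- by the `L²` norm.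
    refine exists_poly_integral_eq
      (fun p hp q hq => integrable_mul_of_memLp_two (hmem p hp) (hmem q hq)) _ fun p hp => ?_
    have h0 : ∀ x ∈ B, (p : Space d → ℝ) x = 0 := fun x hx =>
      Measure.eqOn_open_of_ae_eq hp Metric.isOpen_ball (poly_continuous p.2).continuousOn
        continuousOn_const hx
    have : p = 0 := Subtype.ext (funext fun x => poly_eq_zero p.2 Metric.isOpen_ball
      ⟨0, Metric.mem_ball_self one_pos⟩ h0 x)
    simp [this]
  choose g hg hgL using hg
  refine ⟨(∑ j, |M j| * l2norm (volume.restrict B) (g j)) ^ 2, sq_nonneg _, fun i p => ?_⟩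
  rw [← l2norm_sq, ← mul_pow]
  refine sq_le_sq.2 ?_
  refine le_trans ?_ (le_abs_self _)
  have h1 : L i p = ∑ j, b.coord j p * L i (b j) := by
    conv_lhs => rw [← b.sum_repr p]
    simp only [map_sum, map_smul, smul_eq_mul]
    rfl
  rw [h1, Finset.sum_mul]
  refine (Finset.abs_sum_le_sum_abs _ _).trans (Finset.sum_le_sum fun j _ => ?_)
  rw [abs_mul, ← hgL j p, mul_comm, mul_assoc]
  exact mul_le_mul ((hM j i).trans (le_abs_self _))
    (abs_integral_mul_le (hmem _ (hg j)) (hmem _ p.2)) (abs_nonneg _) (abs_nonneg _)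

/-- Evaluations of `p` and of its partial derivatives at points of a compact ball are pointwise
bounded families of linear forms on a finite dimensional space. The radius `q` is a parameter
because rescaled elements lie in a ball of radius `diam T / r`. -/
theorem exists_inverse_reference (d l : ℕ) (q : ℝ) : ∃ C, 0 ≤ C ∧ ∀ p ∈ poly d l,
    ∀ y ∈ Metric.closedBall (0 : Space d) q,
      p y ^ 2 ≤ C * ∫ x in Metric.ball 0 1, p x ^ 2 ∧
      ∀ j, partialDeriv j p y ^ 2 ≤ C * ∫ x in Metric.ball 0 1, p x ^ 2 := by
  have hbound : ∀ f : Space d → ℝ, Continuous f →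
      ∃ C, ∀ y ∈ Metric.closedBall (0 : Space d) q, |f y| ≤ C := fun f hf =>
    (isCompact_closedBall _ _).exists_bound_of_continuousOn hf.continuousOn
  obtain ⟨C₁, h1, hC₁⟩ := exists_sq_le_integral_ball d l
    (fun y : Metric.closedBall (0 : Space d) q =>
      { toFun := fun p => p.1 y.1
        map_add' := fun _ _ => rfl
        map_smul' := fun _ _ => rfl })
    (fun p => by
      obtain ⟨C, hC⟩ := hbound p.1 (poly_continuous p.2)
      exact ⟨C, fun y => hC y.1 y.2⟩)
  obtain ⟨C₂, h2, hC₂⟩ := exists_sq_le_integral_ball d l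
    (fun y : Metric.closedBall (0 : Space d) q × Fin d =>
      { toFun := fun p => partialDeriv y.2 p.1 y.1
        map_add' := fun p p' => by
          simp [partialDeriv, fderiv_add ((poly_contDiff p.2 (n := 1)).differentiable (by simp) _)
            ((poly_contDiff p'.2 (n := 1)).differentiable (by simp) _)]
        map_smul' := fun c p => by
          simp [partialDeriv, fderiv_const_smul
            ((poly_contDiff p.2 (n := 1)).differentiable (by simp) _)] })
    (fun p => by
      choose C hC using fun j => hbound (partialDeriv j p.1)
        (contDiff_partialDeriv (poly_contDiff p.2) j).continuous
      exact ⟨∑ j, |C j|, fun y => ((hC y.2 y.1.1 y.1.2).trans (le_abs_self _)).trans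
        (Finset.single_le_sum (f := fun j => |C j|) (fun _ _ => abs_nonneg _)
          (Finset.mem_univ y.2))⟩)
  refine ⟨C₁ + C₂, add_nonneg h1 h2, fun p hp y hy => ⟨?_, fun j => ?_⟩⟩
  · refine (hC₁ ⟨y, hy⟩ ⟨p, hp⟩).trans (mul_le_mul_of_nonneg_right (by linarith) ?_)
    exact integral_nonneg fun _ => sq_nonneg _
  · refine (hC₂ ⟨⟨y, hy⟩, j⟩ ⟨p, hp⟩).trans (mul_le_mul_of_nonneg_right (by linarith) ?_)
    exact integral_nonneg fun _ => sq_nonneg _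

/-- The constant of the inverse inequalities on `poly d l`. -/
def invConst (d l : ℕ) (q : ℝ) : ℝ := (exists_inverse_reference d l q).choose

theorem invConst_nonneg (d l : ℕ) (q : ℝ) : 0 ≤ invConst d l q :=
  (exists_inverse_reference d l q).choose_spec.1

theorem integral_ball_comp {d : ℕ} (f : Space d → ℝ) (z : Space d) {r : ℝ} (hr : 0 < r) :
    ∫ y in Metric.ball 0 1, f (z + r • y) = (r ^ d)⁻¹ * ∫ x in Metric.ball z r, f x := by
  rw [← integral_indicator measurableSet_ball, ← integral_indicator measurableSet_ball]
  have h1 : ∀ y, (Metric.ball (0 : Space d) 1).indicator (fun y => f (z + r • y)) y =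
      (fun y => (Metric.ball z r).indicator f (z + y)) (r • y) := by
    intro y
    have : y ∈ Metric.ball (0 : Space d) 1 ↔ z + r • y ∈ Metric.ball z r := by
      simp [norm_smul, abs_of_pos hr, hr]
    by_cases hy : y ∈ Metric.ball (0 : Space d) 1
    · simp only [indicator_of_mem hy, indicator_of_mem (this.1 hy)]
    · simp only [indicator_of_notMem hy, indicator_of_notMem (fun h => hy (this.2 h))]
  simp only [h1]
  rw [Measure.integral_comp_smul volume (fun y => (Metric.ball z r).indicator f (z + y)) r,
    integral_add_left_eq_self (fun y => (Metric.ball z r).indicator f y) z]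
  simp [abs_of_pos hr]

variable {l : ℕ} {T : Set (Space d)} {S : Finset (Finset (Space d))} {r : ℝ}

/-- Rescale an inscribed ball of radius `r` to the unit ball: `closure T` is carried into the ball
of radius `diam T / r`. The chain rule puts `r` in front of the derivative and the change of
variables produces `r⁻ᵈ`. -/
theorem IsSubmesh.inverse_pointwise (hS : IsSubmesh T S r) {p : Space d → ℝ} (hp : p ∈ poly d l)
    {x : Space d} (hx : x ∈ closure T) :
    p x ^ 2 ≤ invConst d l (Metric.diam T / r) * ((r ^ d)⁻¹ * ∫ x in T, p x ^ 2) ∧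
      ∀ j, (r * partialDeriv j p x) ^ 2 ≤
        invConst d l (Metric.diam T / r) * ((r ^ d)⁻¹ * ∫ x in T, p x ^ 2) := by
  obtain ⟨s, hs⟩ := hS.nonempty_simplices
  obtain ⟨z, hz⟩ := hS.exists_ball s hs
  have hr := hS.pos
  have hzT : Metric.ball z r ⊆ T :=
    (IsSubmesh.ball_subset_interior hz).trans (hS.interior_subset_element s hs)
  have hxz : z + r • r⁻¹ • (x - z) = x := by
    rw [smul_inv_smul₀ hr.ne']
    abel
  have hy : r⁻¹ • (x - z) ∈ Metric.closedBall (0 : Space d) (Metric.diam T / r) := by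
    rw [mem_closedBall_zero_iff, norm_smul, norm_inv, Real.norm_of_nonneg hr.le, ← dist_eq_norm,
      inv_mul_eq_div]
    exact div_le_div_of_nonneg_right
      (hS.dist_le hx (subset_closure (hzT (Metric.mem_ball_self hr)))) hr.le
  obtain ⟨h1, h2⟩ := (exists_inverse_reference d l (Metric.diam T / r)).choose_spec.2 _
    (poly_comp_affine hp z r) _ hy
  have hfin : IsFiniteMeasure (volume.restrict T) := ⟨by simpa using hS.volume_lt_top.lt_top⟩
  have hint : (∫ y in Metric.ball 0 1, p (z + r • y) ^ 2) ≤ (r ^ d)⁻¹ * ∫ x in T, p x ^ 2 := by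
    rw [integral_ball_comp (fun x => p x ^ 2) z hr]
    refine mul_le_mul_of_nonneg_left ?_ (by positivity)
    exact setIntegral_mono_set (isH1_of_contDiff hS.isBounded (poly_contDiff hp)).memLp.integrable_sq
      (Eventually.of_forall fun _ => sq_nonneg _) hzT.eventuallyLE
  have hder : ∀ (j : Fin d) y, partialDeriv j (fun y => p (z + r • y)) y =
      r * partialDeriv j p (z + r • y) := by
    intro j y
    have g1 : HasFDerivAt (fun y : Space d => z + r • y) (r • ContinuousLinearMap.id ℝ (Space d)) y :=
      ((hasFDerivAt_id y).const_smul r).const_add z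
    have g2 := ((poly_contDiff hp (n := 1)).differentiable (by simp) (z + r • y)).hasFDerivAt
    rw [partialDeriv, HasFDerivAt.fderiv (f := fun y => p (z + r • y)) (g2.comp y g1)]
    simp [partialDeriv]
  have hmul := mul_le_mul_of_nonneg_left hint (invConst_nonneg d l (Metric.diam T / r))
  refine ⟨?_, fun j => ?_⟩
  · rw [hxz] at h1
    exact h1.trans hmul
  · have := h2 j
    rw [hder, hxz] at this
    exact this.trans hmul

end inverse

/-! ### Projection on an element -/

section element
variable {d l : ℕ} {T : Set (Space d)} {S : Finset (Finset (Space d))} {r : ℝ}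
namespace IsSubmesh

theorem isFiniteMeasure (hS : IsSubmesh T S r) : IsFiniteMeasure (volume.restrict T) :=
  ⟨by simpa using hS.volume_lt_top.lt_top⟩

theorem memLp_continuous {E : Type*} [NormedAddCommGroup E] (hS : IsSubmesh T S r)
    {f : Space d → E} (hf : Continuous f) (p : ℝ≥0∞) : MemLp f p (volume.restrict T) :=
  have := hS.isFiniteMeasure
  memLp_of_continuous hf hS.isBounded (ae_restrict_mem hS.isOpen.measurableSet) p

theorem isL2Proj_lproj (hS : IsSubmesh T S r) {u : Space d → ℝ}
    (hu : MemLp u 2 (volume.restrict T)) :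
    IsL2Proj (volume.restrict T) l u (lproj (volume.restrict T) l u) :=
  HHO.isL2Proj_lproj
    (fun _ hp _ hq => integrable_mul_of_memLp_two (hS.memLp_continuous (poly_continuous hp) 2)
      (hS.memLp_continuous (poly_continuous hq) 2))
    (fun _ hp => integrable_mul_of_memLp_two hu (hS.memLp_continuous (poly_continuous hp) 2))

theorem ratio_nonneg (hS : IsSubmesh T S r) : 0 ≤ Metric.diam T / r :=
  div_nonneg Metric.diam_nonneg hS.pos.le

/-- The volume of the element is comparable to that of the inscribed balls. -/
theorem volume_mul_le (hS : IsSubmesh T S r) (hd : 1 ≤ d) : volume.real T * (r ^ d)⁻¹ ≤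
    volume.real (Metric.ball (0 : Space d) 1) * (Metric.diam T / r) ^ d := by
  have hr := hS.pos
  obtain ⟨z, hz⟩ := hS.isConnected.nonempty
  have : Nonempty (Fin d) := ⟨⟨0, hd⟩⟩
  have h1 : volume.real T ≤ volume.real (Metric.closedBall z (Metric.diam T)) :=
    measureReal_mono (fun x hx => hS.dist_le (subset_closure hx) (subset_closure hz))
      measure_closedBall_lt_top.ne
  rw [Measure.real, Measure.real, Measure.addHaar_closedBall _ _ Metric.diam_nonneg,
    ENNReal.toReal_mul, ENNReal.toReal_ofReal (by positivity), finrank_euclideanSpace_fin] at h1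
  rw [div_pow, ← div_eq_mul_inv, mul_div_assoc', mul_comm]
  rw [mul_comm] at h1
  refine div_le_div_of_nonneg_right ?_ (by positivity)
  rw [mul_comm (Metric.diam T ^ d)]
  exact h1

/-- The `L²` inverse inequality. -/
theorem l2norm_partialDeriv_le (hS : IsSubmesh T S r) (hd : 1 ≤ d) {p : Space d → ℝ}
    (hp : p ∈ poly d l) (j : Fin d) :
    l2norm (volume.restrict T) (partialDeriv j p) ≤
      Real.sqrt (invConst d l (Metric.diam T / r) *
        (volume.real (Metric.ball (0 : Space d) 1) * (Metric.diam T / r) ^ d)) * r⁻¹ *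
          l2norm (volume.restrict T) p := by
  have hr := hS.pos
  have hfin := hS.isFiniteMeasure
  set c := invConst d l (Metric.diam T / r)
  have hc : 0 ≤ c := invConst_nonneg _ _ _
  have hq := hS.ratio_nonneg
  refine HHO.l2norm_le (mul_nonneg (by positivity) l2norm_nonneg) ?_
  rw [mul_pow, mul_pow, Real.sq_sqrt (by positivity), l2norm_sq]
  have h1 : ∫ x in T, partialDeriv j p x ^ 2 ≤
      ∫ _ in T, (r⁻¹) ^ 2 * (c * ((r ^ d)⁻¹ * ∫ x in T, p x ^ 2)) := by
    refine setIntegral_mono_on ?_ (integrable_const _) hS.isOpen.measurableSet fun x hx => ?_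
    · exact (hS.memLp_continuous (contDiff_partialDeriv (poly_contDiff hp) j).continuous 2).integrable_sq
    · have := mul_le_mul_of_nonneg_left ((hS.inverse_pointwise hp (subset_closure hx)).2 j)
        (sq_nonneg r⁻¹)
      rwa [← mul_pow, inv_mul_cancel_left₀ hr.ne'] at this
  refine h1.trans ?_
  have h0 : 0 ≤ ∫ x in T, p x ^ 2 := integral_nonneg fun _ => sq_nonneg _
  have h2 := mul_le_mul_of_nonneg_left (hS.volume_mul_le hd)
    (show 0 ≤ (r⁻¹) ^ 2 * (c * ∫ x in T, p x ^ 2) by positivity)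
  simp only [integral_const, measureReal_restrict_apply_univ, smul_eq_mul]
  linarith

end IsSubmesh

/-- `u ∈ H¹(T)` has small `L²` norm and gradient, at the scale of `T`. -/
structure IsSmall (T : Set (Space d)) (α : ℝ) (u : Space d → ℝ) (G : Space d → Space d) : Prop where
  isH1 : IsH1 T u G
  l2norm_le : l2norm (volume.restrict T) u ≤ α * Metric.diam T
  l2norm_grad_le : ∀ j, l2norm (volume.restrict T) (fun x => G x j) ≤ α

section small
variable {u u' : Space d → ℝ} {G G' : Space d → Space d} {α β : ℝ}

theorem IsH1.memLp_grad_apply (hu : IsH1 T u G) (j : Fin d) :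
    MemLp (fun x => G x j) 2 (volume.restrict T) :=
  hu.memLp_grad.eval_piLp j

theorem IsSmall.sub (hfin : IsFiniteMeasure (volume.restrict T)) (h : IsSmall T α u G)
    (h' : IsSmall T β u' G') :
    IsSmall T (α + β) (fun x => u x - u' x) (fun x => G x - G' x) where
  isH1 := h.isH1.sub h'.isH1
  l2norm_le := (l2norm_sub_le h.isH1.memLp h'.isH1.memLp).trans (by
    have := add_le_add h.l2norm_le h'.l2norm_le
    linarith)
  l2norm_grad_le j := (l2norm_sub_le (h.isH1.memLp_grad_apply j) (h'.isH1.memLp_grad_apply j)).trans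
    (add_le_add (h.l2norm_grad_le j) (h'.l2norm_grad_le j))

theorem IsSmall.nonneg (h : IsSmall T α u G) (hd : 1 ≤ d) : 0 ≤ α :=
  l2norm_nonneg.trans (h.l2norm_grad_le ⟨0, hd⟩)

theorem IsSmall.mono (h : IsSmall T α u G) (hαβ : α ≤ β) : IsSmall T β u G where
  isH1 := h.isH1
  l2norm_le := h.l2norm_le.trans (mul_le_mul_of_nonneg_right hαβ Metric.diam_nonneg)
  l2norm_grad_le j := (h.l2norm_grad_le j).trans hαβ

/-- The constant in the stability of the `L²` projection. -/
def projConst (d l : ℕ) (q : ℝ) : ℝ :=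
  1 + Real.sqrt (invConst d l q * (volume.real (Metric.ball (0 : Space d) 1) * q ^ d)) * q

theorem one_le_projConst {q : ℝ} (hq : 0 ≤ q) : 1 ≤ projConst d l q :=
  le_add_of_nonneg_right (by positivity)

/-- Best approximation settles the `L²` part. For the gradient write `u - p = (u - P) - (p - P)` and
apply the inverse inequality to the polynomial `p - P`: its factor `r⁻¹` meets the factor `diam T`
in the size of `u - P`, which is the last `q` in `projConst`. -/
theorem IsSubmesh.isSmall_sub_lproj (hS : IsSubmesh T S r) (hd : 1 ≤ d) (hu : IsH1 T u G)
    {P : Space d → ℝ} (hP : P ∈ poly d l)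
    (h : IsSmall T α (fun x => u x - P x) (fun x => G x - gradient P x)) :
    IsSmall T (projConst d l (Metric.diam T / r) * α)
      (fun x => u x - lproj (volume.restrict T) l u x)
      (fun x => G x - gradient (lproj (volume.restrict T) l u) x) := by
  have hfin := hS.isFiniteMeasure
  set p := lproj (volume.restrict T) l u with hpdef
  have hp : p ∈ poly d l := lproj_mem _ _ _
  have hα := h.nonneg hd
  have hproj := (hS.isL2Proj_lproj hu.memLp).l2norm_le hP hu.memLp fun _ hp =>
    hS.memLp_continuous (poly_continuous hp) 2
  have hK := one_le_projConst (d := d) (l := l) hS.ratio_nonneg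
  refine ⟨hu.sub (isH1_of_contDiff hS.isBounded (poly_contDiff hp)), ?_, fun j => ?_⟩
  · refine hproj.2.trans (h.l2norm_le.trans ?_)
    exact mul_le_mul_of_nonneg_right (le_mul_of_one_le_left hα hK) Metric.diam_nonneg
  · have hD : ∀ x, partialDeriv j (fun x => p x - P x) x = partialDeriv j p x - partialDeriv j P x := by
      intro x
      unfold partialDeriv
      rw [fderiv_fun_sub ((poly_contDiff hp (n := 1)).differentiable (by simp) x)
        ((poly_contDiff hP (n := 1)).differentiable (by simp) x)]
      rfl
    have e : (fun x => (G x - gradient p x) j) = fun x => (G x - gradient P x) j -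
        partialDeriv j (fun x => p x - P x) x := by
      ext x
      rw [hD]
      simp [gradient]
    rw [e]
    have hpP := poly_sub hp hP
    refine (l2norm_sub_le (h.isH1.memLp_grad_apply j)
      (hS.memLp_continuous (contDiff_partialDeriv (poly_contDiff hpP) j).continuous 2)).trans ?_
    have h1 := hS.l2norm_partialDeriv_le hd hpP j
    have h2 := h1.trans (mul_le_mul_of_nonneg_left (hproj.1.trans h.l2norm_le)
      (mul_nonneg (Real.sqrt_nonneg _) (inv_nonneg.2 hS.pos.le)))
    have h3 := h.l2norm_grad_le j
    rw [projConst]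
    refine (add_le_add h3 h2).trans (le_of_eq ?_)
    ring

end small
end element

/-! ### Traces and projections on faces -/

section face
variable {d l : ℕ} {Ω T : Set (Space d)} {M : PolytopalMesh Ω} {S : Finset (Finset (Space d))}
  {r α : ℝ} {F : Set (Space d)} {u : Space d → ℝ} {G : Space d → Space d}

/-- The constant of the trace inequality. -/
def traceConst (d : ℕ) (q : ℝ) : ℝ := 5 * d * (d + 1) ^ 2 * q ^ (d + 1)

namespace IsCompatible

theorem memLp_continuous_face {E : Type*} [NormedAddCommGroup E] (h : IsCompatible M T S r)
    (hF : F ∈ M.facesOf T) {f : Space d → E} (hf : Continuous f) (p : ℝ≥0∞) :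
    MemLp f p ((μHE[d - 1] : Measure (Space d)).restrict F) := by
  have := h.isFiniteMeasure_face hF
  refine memLp_of_continuous hf h.isBounded.closure ?_ p
  filter_upwards [ae_restrict_mem (h.measurableSet_face hF)] with x hx
  exact frontier_subset_closure ((mem_facesOf.1 hF).2 hx)

theorem isL2Proj_lproj_face (h : IsCompatible M T S r) (hF : F ∈ M.facesOf T) (hu : IsH1 T u G) :
    IsL2Proj ((μHE[d - 1] : Measure (Space d)).restrict F) l (trace T u)
      (lproj ((μHE[d - 1] : Measure (Space d)).restrict F) l (trace T u)) :=
  HHO.isL2Proj_lproj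
    (fun _ hp _ hq => integrable_mul_of_memLp_two (h.memLp_continuous_face hF (poly_continuous hp) 2)
      (h.memLp_continuous_face hF (poly_continuous hq) 2))
    (fun _ hp => integrable_mul_of_memLp_two (h.memLp_trace hu hF)
      (h.memLp_continuous_face hF (poly_continuous hp) 2))

theorem trace_continuous (h : IsCompatible M T S r) (hF : F ∈ M.facesOf T)
    {q : Space d → ℝ} (hq : Continuous q) :
    ∀ᵐ x ∂(μHE[d - 1] : Measure (Space d)).restrict F, trace T q x = q x := by
  have h0 : IsH1 T (fun _ => 0) (gradient fun _ => 0) :=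
    isH1_of_contDiff h.isBounded contDiff_const
  filter_upwards [h.trace_sub_continuous h0 hF hq.neg] with x hx
  have h1 : trace T (fun _ => 0) x = 0 := by
    unfold trace
    simp only [average_zero]
    exact tendsto_const_nhds.limUnder_eq
  simpa [h1] using hx

/-- The function contributes `4 d` and the `d` components of the gradient contribute `d`, which
makes `5 d`; the number of simplices gives `(diam T / r)^d`, and `r⁻¹ (diam T)²` supplies the last
ratio and the factor `diam T`. -/
theorem l2norm_trace_le (h : IsCompatible M T S r) (hF : F ∈ M.facesOf T) (hu : IsSmall T α u G) :
    l2norm ((μHE[d - 1] : Measure (Space d)).restrict F) (trace T u) ≤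
      Real.sqrt (traceConst d (Metric.diam T / r) * Metric.diam T) * α := by
  have hd : 1 ≤ d := by have := h.two_le; omega
  have hα := hu.nonneg hd
  have hr := h.pos
  have hrh := h.toIsSubmesh.le_diam hd
  have hh : 0 < Metric.diam T := hr.trans_le hrh
  have hq := h.toIsSubmesh.ratio_nonneg
  set δ := Metric.diam T
  have h1 := (h.trace_properties hu.isH1 hF).2.2
  have nn1 : 0 ≤ ∫ x in T, ‖u x‖ ^ 2 := integral_nonneg fun _ => sq_nonneg _
  have nn2 : 0 ≤ ∫ x in T, ‖G x‖ ^ 2 := integral_nonneg fun _ => sq_nonneg _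
  rw [← ofReal_integral_norm_sq (h.memLp_trace hu.isH1 hF), ← ofReal_integral_norm_sq hu.isH1.memLp,
    ← ofReal_integral_norm_sq hu.isH1.memLp_grad, ← ENNReal.ofReal_mul (by positivity),
    ← ENNReal.ofReal_mul (by positivity), ← ENNReal.ofReal_add (by positivity) (by positivity),
    ← ENNReal.ofReal_mul (by positivity), ENNReal.ofReal_le_ofReal_iff (by positivity)] at h1
  refine HHO.l2norm_le (mul_nonneg (Real.sqrt_nonneg _) hα) ?_
  rw [mul_pow, Real.sq_sqrt (by unfold traceConst; positivity)]
  have h2 : ∫ x in T, ‖u x‖ ^ 2 ≤ (α * δ) ^ 2 := by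
    simp only [Real.norm_eq_abs, sq_abs]
    rw [← l2norm_sq]
    exact pow_le_pow_left₀ l2norm_nonneg hu.l2norm_le 2
  have h3 : ∫ x in T, ‖G x‖ ^ 2 ≤ d * α ^ 2 := by
    simp only [EuclideanSpace.norm_sq_eq, Real.norm_eq_abs, sq_abs]
    rw [integral_finsetSum _ fun j _ => (hu.isH1.memLp_grad_apply j).integrable_sq]
    refine (Finset.sum_le_card_nsmul _ _ (α ^ 2) fun j _ => ?_).trans (by simp)
    rw [← l2norm_sq]
    exact pow_le_pow_left₀ l2norm_nonneg (hu.l2norm_grad_le j) 2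
  have h4 := h.toIsSubmesh.card_le hd
  have h5 : (S.card : ℝ) * (d + 1) ^ 2 * r⁻¹ ≤ (δ / r) ^ d * (d + 1) ^ 2 * r⁻¹ := by gcongr
  simp only [Real.norm_eq_abs, sq_abs] at h1 h2
  refine h1.trans ((mul_le_mul h5 (add_le_add (mul_le_mul_of_nonneg_left h2 (by positivity))
    (mul_le_mul_of_nonneg_left h3 (by positivity))) (by positivity) (by positivity)).trans
      (le_of_eq ?_))
  rw [traceConst, pow_succ, show Metric.diam T = δ from rfl]
  ring

end IsCompatible
end face

theorem integrable_mul_mul {α : Type*} [MeasurableSpace α] {μ : Measure α} {f g z : α → ℝ} {c : ℝ}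
    (hf : MemLp f 2 μ) (hg : MemLp g 2 μ) (hz : AEStronglyMeasurable z μ)
    (hzc : ∀ᵐ x ∂μ, |z x| ≤ c) : Integrable (fun x => f x * g x * z x) μ :=
  (integrable_mul_of_memLp_two hf hg).mul_bdd hz hzc

/-- The constant in the consistency estimate. -/
def consistencyConst (d : ℕ) (q : ℝ) : ℝ := 3 + 2 * traceConst d q * (q ^ d * (d + 1))

/-! ### Consistency of one scalar component -/

section consistency
variable {d k : ℕ} {Ω T : Set (Space d)} {M : PolytopalMesh Ω} {S : Finset (Finset (Space d))}
  {r : ℝ} {u u' z : Space d → ℝ} {G G' : Space d → Space d} {α β Z c : ℝ}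
namespace IsCompatible

theorem norm_normal_apply_le (h : IsCompatible M T S r) {F : Set (Space d)}
    (hF : F ∈ M.facesOf T) (j : Fin d) : |outwardNormal T F j| ≤ 1 :=
  (PiLp.norm_apply_le (outwardNormal T F) j).trans (h.norm_normal hF).le

/-- The consistency terms on a face. -/
theorem abs_face_le (h : IsCompatible M T S r) {F : Set (Space d)} (hF : F ∈ M.facesOf T)
    (hZ : 0 ≤ Z) (hu : IsH1 T u G) (hu' : IsH1 T u' G') {p p' : Space d → ℝ} (hp : p ∈ poly d k)
    (hp' : p' ∈ poly d k) (hz : z ∈ poly d k) (hzZ : ∀ x ∈ closure T, |z x| ≤ Z)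
    (hα : IsSmall T α (fun x => u x - p x) fun x => G x - gradient p x)
    (hβ' : IsSmall T β (fun x => u' x - p' x) fun x => G' x - gradient p' x)
    (he : IsSmall T β (fun x => p' x - c) (gradient p')) :
    |∫ x in F, (lproj ((μHE[d - 1] : Measure (Space d)).restrict F) k (trace T u') x *
        (lproj ((μHE[d - 1] : Measure (Space d)).restrict F) k (trace T u) x - p x) * z x -
        trace T (fun x => u x - p x) x * (p' x * z x)) ∂(μHE[d - 1] : Measure (Space d))| ≤
      2 * traceConst d (Metric.diam T / r) * (α * β * Metric.diam T * Z) := by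
  set μ := (μHE[d - 1] : Measure (Space d)).restrict F
  have hd : 1 ≤ d := by have := h.two_le; omega
  have hq := h.toIsSubmesh.ratio_nonneg
  have hα0 := hα.nonneg hd
  have hβ0 := he.nonneg hd
  have hmc : ∀ p ∈ poly d k, MemLp p 2 μ := fun p hp =>
    h.memLp_continuous_face hF (poly_continuous hp) 2
  set f := lproj μ k (trace T u)
  set f' := lproj μ k (trace T u')
  have hf := h.isL2Proj_lproj_face (l := k) hF hu
  have hf' := h.isL2Proj_lproj_face (l := k) hF hu'
  have hft := hf.l2norm_le hp (h.memLp_trace hu hF) hmc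
  have hft' := hf'.l2norm_le hp' (h.memLp_trace hu' hF) hmc
  have ha := h.trace_sub_continuous hu hF (poly_continuous hp)
  have ha' := h.trace_sub_continuous hu' hF (poly_continuous hp')
  have het : l2norm μ (trace T fun x => p' x - c) = l2norm μ fun x => p' x - c :=
    l2norm_congr (h.trace_continuous hF ((poly_continuous hp').sub continuous_const))
  have hta := h.l2norm_trace_le hF hα
  have hta' := h.l2norm_trace_le hF hβ'
  have hte := h.l2norm_trace_le hF he
  rw [l2norm_congr ha] at hta
  rw [l2norm_congr ha'] at hta'
  rw [het] at hte
  set κ := Real.sqrt (traceConst d (Metric.diam T / r) * Metric.diam T) with hκ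
  have hκ2 : κ * κ = traceConst d (Metric.diam T / r) * Metric.diam T :=
    Real.mul_self_sqrt (mul_nonneg (by unfold traceConst; positivity) Metric.diam_nonneg)
  have hκ0 : 0 ≤ κ := Real.sqrt_nonneg _
  have hzm := (poly_continuous hz).aestronglyMeasurable (μ := μ)
  have hzb : ∀ᵐ x ∂μ, |z x| ≤ Z := by
    filter_upwards [ae_restrict_mem (h.measurableSet_face hF)] with x hx
    exact hzZ x (frontier_subset_closure ((mem_facesOf.1 hF).2 hx))
  have m1 : MemLp (fun x => f' x - p' x) 2 μ := hmc _ (poly_sub hf'.1 hp')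
  have m2 : MemLp (fun x => f x - p x) 2 μ := hmc _ (poly_sub hf.1 hp)
  have m3 : MemLp (fun x => p' x - c) 2 μ := hmc _ (poly_sub hp' (poly_const c k))
  have m4 : MemLp (fun x => trace T u x - f x) 2 μ := (h.memLp_trace hu hF).sub (hmc _ hf.1)
  have i1 := integrable_mul_mul m1 m2 hzm hzb
  have i2 := integrable_mul_mul m3 m4 hzm hzb
  have i3 : Integrable (fun x => c * ((trace T u x - f x) * z x)) μ :=
    (integrable_mul_of_memLp_two m4 (hmc _ hz)).const_mul c
  have i12 : Integrable (fun x => (f' x - p' x) * (f x - p x) * z x -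
    (p' x - c) * (trace T u x - f x) * z x) μ := i1.sub i2
  -- Almost everywhere on the face, with `τ` the trace of `u`, `f' (f - p) - (τ - p) p' = (f' - p')
  -- (f - p) - (p' - c) (τ - f) - c (τ - f)`. Multiplied by `z` and integrated, the last term
  -- vanishes because `f` is the projection of `τ` and `z` is a polynomial of degree at most `k`.
  have key : ∫ x in F, (f' x * (f x - p x) * z x -
      trace T (fun x => u x - p x) x * (p' x * z x)) ∂(μHE[d - 1] : Measure (Space d)) =
      (∫ x, (f' x - p' x) * (f x - p x) * z x ∂μ) -
        ∫ x, (p' x - c) * (trace T u x - f x) * z x ∂μ := by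
    have h0 := hf.2 z hz
    have e : ∫ x, (f' x * (f x - p x) * z x - trace T (fun x => u x - p x) x * (p' x * z x)) ∂μ =
        ∫ x, ((f' x - p' x) * (f x - p x) * z x - (p' x - c) * (trace T u x - f x) * z x -
          c * ((trace T u x - f x) * z x)) ∂μ := by
      refine integral_congr_ae ?_
      filter_upwards [ha] with x hx
      rw [hx]
      ring
    rw [e, integral_sub i12 i3, integral_sub i1 i2, integral_const_mul, h0]
    ring
  rw [key]
  have b1 := abs_integral_mul_mul_le m1 m2 hzm hZ hzb
  have b2 := abs_integral_mul_mul_le m3 m4 hzm hZ hzb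
  -- Differences of face and cell projections are controlled by the trace of the cell error, by best
  -- approximation on the face. The two trace factors combine to `κ²`, which is linear in `diam T`.
  have c1 : l2norm μ (fun x => f' x - p' x) * l2norm μ (fun x => f x - p x) ≤ κ * β * (κ * α) :=
    mul_le_mul (hft'.1.trans hta') (hft.1.trans hta) l2norm_nonneg (by positivity)
  have c2 : l2norm μ (fun x => p' x - c) * l2norm μ (fun x => trace T u x - f x) ≤
      κ * β * (κ * α) :=
    mul_le_mul hte (hft.2.trans hta) l2norm_nonneg (by positivity)
  have d1 := b1.trans (mul_le_mul_of_nonneg_left c1 hZ)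
  have d2 := b2.trans (mul_le_mul_of_nonneg_left c2 hZ)
  refine (abs_sub _ _).trans ((add_le_add d1 d2).trans (le_of_eq ?_))
  linear_combination (2 * Z * β * α) * hκ2

/-- The consistency estimate for one component of the convective derivative. -/
theorem abs_consistency_le (h : IsCompatible M T S r)
    (hZ : 0 ≤ Z) (hu : IsH1 T u G) (hu' : IsH1 T u' G') {p p' : Space d → ℝ}
    (hpu : IsL2Proj (volume.restrict T) k u p) (hp' : p' ∈ poly d k)
    (hz : z ∈ poly d k) (hzZ : ∀ x ∈ closure T, |z x| ≤ Z) (j : Fin d)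
    (hzD : ∀ x ∈ closure T, |Metric.diam T * partialDeriv j z x| ≤ Z)
    (hα : IsSmall T α (fun x => u x - p x) fun x => G x - gradient p x)
    (hα' : IsSmall T α (fun x => u' x - p' x) fun x => G' x - gradient p' x)
    (hβ' : IsSmall T β (fun x => u' x - p' x) fun x => G' x - gradient p' x)
    (he : IsSmall T β (fun x => p' x - c) (gradient p'))
    (hG : l2norm (volume.restrict T) (fun x => G x j) ≤ β) :
    |(∫ x in T, (p' x * partialDeriv j p x - u' x * G x j) * z x) +
      ∑ F : M.facesOf T, outwardNormal T F j * ∫ x in (F : Set (Space d)),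
        lproj ((μHE[d - 1] : Measure (Space d)).restrict F) k (trace T u') x *
          (lproj ((μHE[d - 1] : Measure (Space d)).restrict F) k (trace T u) x - p x) * z x
            ∂(μHE[d - 1] : Measure (Space d))| ≤
      consistencyConst d (Metric.diam T / r) * (α * β * Metric.diam T * Z) := by
  have hfin := h.toIsSubmesh.isFiniteMeasure
  have hd : 1 ≤ d := by have := h.two_le; omega
  have hq := h.toIsSubmesh.ratio_nonneg
  have hh : 0 < Metric.diam T := h.pos.trans_le (h.toIsSubmesh.le_diam hd)
  have hα0 := hα.nonneg hd
  have hβ0 := he.nonneg hd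
  have hp := hpu.1
  have hps : ContDiff ℝ ∞ p := poly_contDiff hp
  have hps' : ContDiff ℝ ∞ p' := poly_contDiff hp'
  have hzs : ContDiff ℝ ∞ z := poly_contDiff hz
  set μ := (volume : Measure (Space d)).restrict T with hμ
  have hmc : ∀ f : Space d → ℝ, Continuous f → MemLp f 2 μ := fun f hf =>
    h.toIsSubmesh.memLp_continuous hf 2
  have hTc : ∀ᵐ x ∂μ, x ∈ closure T := by
    filter_upwards [ae_restrict_mem h.isOpen.measurableSet] with x hx using subset_closure hx
  have hzm := (poly_continuous hz).aestronglyMeasurable (μ := μ)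
  have hzb : ∀ᵐ x ∂μ, |z x| ≤ Z := by filter_upwards [hTc] with x hx using hzZ x hx
  have hzm' : AEStronglyMeasurable (fun x => Metric.diam T * partialDeriv j z x) μ :=
    (continuous_const.mul (contDiff_partialDeriv hzs j).continuous).aestronglyMeasurable
  have hzb' : ∀ᵐ x ∂μ, |Metric.diam T * partialDeriv j z x| ≤ Z := by
    filter_upwards [hTc] with x hx using hzD x hx
  have mw : MemLp (fun x => u x - p x) 2 μ := hα.isH1.memLp
  have mw' : MemLp (fun x => u' x - p' x) 2 μ := hα'.isH1.memLp
  have mG : MemLp (fun x => G x j) 2 μ := hu.memLp_grad_apply j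
  have mp' : MemLp (partialDeriv j p') 2 μ := hmc _ (contDiff_partialDeriv hps' j).continuous
  have me : MemLp (fun x => p' x - c) 2 μ := hmc _ (hps'.continuous.sub continuous_const)
  have i1 := integrable_mul_mul mw' mG hzm hzb
  have i2 := integrable_mul_mul mw mp' hzm hzb
  have i3 := integrable_mul_mul mw me hzm' hzb'
  have mz' : MemLp (partialDeriv j z) 2 μ := hmc _ (contDiff_partialDeriv hzs j).continuous
  have i4 : Integrable (fun x => c * ((u x - p x) * partialDeriv j z x)) μ :=
    (integrable_mul_of_memLp_two mw mz').const_mul c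
  have hφs : ContDiff ℝ ∞ (fun x => p' x * z x) := hps'.mul hzs
  have hφm : MemLp (fun x => p' x * z x) 2 μ := hmc _ hφs.continuous
  have i5 : Integrable (ibpIntegrand (fun x => u x - p x) (fun x => G x - gradient p x)
      (fun x => p' x * z x) (EuclideanSpace.single j 1)) μ := by
    refine (integrable_mul_of_memLp_two (hα.isH1.memLp_grad.inner_const _) hφm).add
      (integrable_mul_of_memLp_two mw (hmc _ (contDiff_partialDeriv hφs j).continuous))
  have hibp := h.integral_by_parts hα.isH1 (EuclideanSpace.single j 1) hφs
  -- Orthogonality of the cell projection to `∂_j z`: it allows `p'` to be replaced by `p' - c` in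
  -- front of this derivative.
  have h0 : ∫ x, (u x - p x) * partialDeriv j z x ∂μ = 0 := hpu.2 _ (poly_fderiv_mem hz j)
  have hprod : ∀ x, partialDeriv j (fun x => p' x * z x) x =
      p' x * partialDeriv j z x + z x * partialDeriv j p' x := by
    intro x
    unfold partialDeriv
    rw [fderiv_fun_mul (hps'.differentiable (by simp) x) (hzs.differentiable (by simp) x)]
    simp
  -- Pointwise `p' ∂_j p - u' G_j = -(u' - p') G_j - p' (G_j - ∂_j p)`, and the last part times `z`
  -- is completed to the integrand of the integration by parts of `u - p` against `p' z`. The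
  -- factors `(diam T)⁻¹` and `diam T` cancel; they put `∂_j z` at the scale at which it is bounded
  -- by `Z`.
  have key : ∫ x in T, (p' x * partialDeriv j p x - u' x * G x j) * z x =
      -(∫ x, (u' x - p' x) * G x j * z x ∂μ) + (∫ x, (u x - p x) * partialDeriv j p' x * z x ∂μ) +
      (Metric.diam T)⁻¹ *
        (∫ x, (u x - p x) * (p' x - c) * (Metric.diam T * partialDeriv j z x) ∂μ) -
      ∫ x in T, ibpIntegrand (fun x => u x - p x) (fun x => G x - gradient p x)
        (fun x => p' x * z x) (EuclideanSpace.single j 1) x := by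
    have e : ∀ x, (p' x * partialDeriv j p x - u' x * G x j) * z x =
        -((u' x - p' x) * G x j * z x) + (u x - p x) * partialDeriv j p' x * z x +
        (Metric.diam T)⁻¹ * ((u x - p x) * (p' x - c) * (Metric.diam T * partialDeriv j z x)) +
        c * ((u x - p x) * partialDeriv j z x) -
        ibpIntegrand (fun x => u x - p x) (fun x => G x - gradient p x)
          (fun x => p' x * z x) (EuclideanSpace.single j 1) x := by
      intro x
      have e1 : inner ℝ (G x - gradient p x) (EuclideanSpace.single j (1 : ℝ)) =
          G x j - partialDeriv j p x := by
        simp [inner_eq_sum_mul, gradient]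
      have e2 := hprod x
      rw [partialDeriv] at e2
      rw [ibpIntegrand, e1, e2]
      field_simp
      ring
    have j1 : Integrable (fun x => -((u' x - p' x) * G x j * z x)) μ := i1.neg
    have j3 : Integrable (fun x => (Metric.diam T)⁻¹ *
        ((u x - p x) * (p' x - c) * (Metric.diam T * partialDeriv j z x))) μ := i3.const_mul _
    have j12 : Integrable (fun x => -((u' x - p' x) * G x j * z x) +
        (u x - p x) * partialDeriv j p' x * z x) μ := j1.add i2
    have j123 : Integrable (fun x => -((u' x - p' x) * G x j * z x) +
        (u x - p x) * partialDeriv j p' x * z x + (Metric.diam T)⁻¹ *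
        ((u x - p x) * (p' x - c) * (Metric.diam T * partialDeriv j z x))) μ := j12.add j3
    have j1234 : Integrable (fun x => -((u' x - p' x) * G x j * z x) +
        (u x - p x) * partialDeriv j p' x * z x + (Metric.diam T)⁻¹ *
        ((u x - p x) * (p' x - c) * (Metric.diam T * partialDeriv j z x)) +
        c * ((u x - p x) * partialDeriv j z x)) μ := j123.add i4
    simp only [e]
    rw [integral_sub j1234 i5, integral_add j123 i4, integral_add j12 j3, integral_add j1 i2,
      integral_neg, integral_const_mul, integral_const_mul, h0, mul_zero, add_zero]
  have hface : ∀ F : M.facesOf T, ∫ x in (F : Set (Space d)),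
      (lproj ((μHE[d - 1] : Measure (Space d)).restrict F) k (trace T u') x *
        (lproj ((μHE[d - 1] : Measure (Space d)).restrict F) k (trace T u) x - p x) * z x -
        trace T (fun x => u x - p x) x * (p' x * z x)) ∂(μHE[d - 1] : Measure (Space d)) =
      (∫ x in (F : Set (Space d)),
        lproj ((μHE[d - 1] : Measure (Space d)).restrict F) k (trace T u') x *
        (lproj ((μHE[d - 1] : Measure (Space d)).restrict F) k (trace T u) x - p x) * z x
          ∂(μHE[d - 1] : Measure (Space d))) -
      ∫ x in (F : Set (Space d)), trace T (fun x => u x - p x) x * (p' x * z x)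
          ∂(μHE[d - 1] : Measure (Space d)) := by
    intro F
    have := h.isFiniteMeasure_face F.2
    refine integral_sub ?_ ?_
    · refine MemLp.integrable (q := 1) le_rfl (h.memLp_continuous_face F.2 ?_ 1)
      exact ((poly_continuous (lproj_mem _ _ _)).mul
        ((poly_continuous (lproj_mem _ _ _)).sub hps.continuous)).mul hzs.continuous
    · exact integrable_mul_of_memLp_two (h.memLp_trace hα.isH1 F.2)
        (h.memLp_continuous_face F.2 hφs.continuous 2)
  have hnj : ∀ F : M.facesOf T,
      inner ℝ (outwardNormal T F) (EuclideanSpace.single j (1 : ℝ)) = outwardNormal T F j := by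
    intro F
    simp [inner_eq_sum_mul]
  simp only [hnj] at hibp
  have hβF : ∀ F : M.facesOf T, |outwardNormal T F j * ∫ x in (F : Set (Space d)),
      (lproj ((μHE[d - 1] : Measure (Space d)).restrict F) k (trace T u') x *
        (lproj ((μHE[d - 1] : Measure (Space d)).restrict F) k (trace T u) x - p x) * z x -
        trace T (fun x => u x - p x) x * (p' x * z x)) ∂(μHE[d - 1] : Measure (Space d))| ≤
      2 * traceConst d (Metric.diam T / r) * (α * β * Metric.diam T * Z) := by
    intro F
    rw [abs_mul]
    refine le_trans (mul_le_of_le_one_left (abs_nonneg _) (h.norm_normal_apply_le F.2 j)) ?_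
    exact h.abs_face_le F.2 hZ hu hu' hp hp' hz hzZ hα hβ' he
  have hsum := (Finset.abs_sum_le_sum_abs _ _).trans
    (Finset.sum_le_card_nsmul Finset.univ _ _ fun F _ => hβF F)
  have hN : ((Finset.univ : Finset (M.facesOf T)).card : ℝ) ≤
      (Metric.diam T / r) ^ d * (d + 1) := by
    rw [Finset.card_univ, Fintype.card_coe]
    refine le_trans (b := ((S.card * (d + 1) : ℕ) : ℝ)) (by exact_mod_cast h.card_facesOf_le) ?_
    push_cast
    exact mul_le_mul_of_nonneg_right (h.toIsSubmesh.card_le hd) (by positivity)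
  rw [nsmul_eq_mul] at hsum
  have hct : 0 ≤ traceConst d (Metric.diam T / r) := by unfold traceConst; positivity
  have hsum' := hsum.trans (mul_le_mul_of_nonneg_right hN
    (mul_nonneg (mul_nonneg zero_le_two hct) (by positivity)))
  rw [Finset.sum_congr rfl fun F _ => (congrArg _ (hface F)).trans (mul_sub _ _ _),
    Finset.sum_sub_distrib] at hsum'
  rw [← hibp] at hsum'
  -- The three volume terms account for the `3` in `consistencyConst`. Here `u' - p'` carries the
  -- high order bound `α`, because its partner `G_j` is only of first order; on the faces the same
  -- difference carries the low order bound `β`.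
  have b1 := (abs_integral_mul_mul_le mw' mG hzm hZ hzb).trans (mul_le_mul_of_nonneg_left
    (mul_le_mul hα'.l2norm_le hG l2norm_nonneg (by positivity)) hZ)
  have b2 := (abs_integral_mul_mul_le mw mp' hzm hZ hzb).trans (mul_le_mul_of_nonneg_left
    (mul_le_mul hα.l2norm_le (he.l2norm_grad_le j) l2norm_nonneg (by positivity)) hZ)
  have b3 := (abs_integral_mul_mul_le mw me hzm' hZ hzb').trans (mul_le_mul_of_nonneg_left
    (mul_le_mul hα.l2norm_le he.l2norm_le l2norm_nonneg (by positivity)) hZ)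
  have b3' := mul_le_mul_of_nonneg_left b3 (inv_nonneg.2 hh.le)
  rw [← abs_of_nonneg (inv_nonneg.2 hh.le), ← abs_mul, abs_of_nonneg (inv_nonneg.2 hh.le)] at b3'
  have e3 : (Metric.diam T)⁻¹ * (Z * (α * Metric.diam T * (β * Metric.diam T))) =
      α * β * Metric.diam T * Z := by
    field_simp
  rw [e3] at b3'
  rw [key, consistencyConst]
  rw [abs_le] at b1 b2 b3' hsum' ⊢
  constructor <;> linarith [b1.1, b1.2, b2.1, b2.2, b3'.1, b3'.2, hsum'.1, hsum'.2]

end IsCompatible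
end consistency

/-! ### Bounds by Sobolev seminorms -/

section sobolevBounds
variable {d m k l : ℕ} {T : Set (Space d)} {S : Finset (Finset (Space d))} {r : ℝ}
  {v : Space d → Space d} {p : ℝ≥0∞}

theorem MemSobolev.isWeakDeriv (hv : MemSobolev T m p v) (i : Fin d) (hl : l ≤ m)
    (J : Fin l → Fin d) : IsWeakDeriv T J (fun x => v x i) (weakDeriv T J fun x => v x i) := by
  obtain ⟨g, hg, -⟩ := hv.2 i l hl J
  exact hg.weakDeriv

theorem MemSobolev.memLp_weakDeriv (hT : IsOpen T) (hv : MemSobolev T m p v) (i : Fin d)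
    (hl : l ≤ m) (J : Fin l → Fin d) :
    MemLp (weakDeriv T J fun x => v x i) p (volume.restrict T) := by
  obtain ⟨g, hg, hgp⟩ := hv.2 i l hl J
  exact (memLp_congr_ae (hg.weakDeriv.ae_eq hT hg)).2 hgp

theorem MemSobolev.toReal_eLpNorm_le (hp : 0 < p.toReal) (i : Fin d) (J : Fin m → Fin d) :
    (eLpNorm (weakDeriv T J fun x => v x i) p (volume.restrict T)).toReal ≤
      sobolevSeminorm T m p v := by
  unfold sobolevSeminorm
  rw [one_div, Real.le_rpow_inv_iff_of_pos ENNReal.toReal_nonneg (by positivity) hp]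
  refine (Finset.single_le_sum (f := fun J => (eLpNorm (weakDeriv T J fun x => v x i) p
    (volume.restrict T)).toReal ^ p.toReal) (fun _ _ => by positivity) (Finset.mem_univ J)).trans ?_
  exact Finset.single_le_sum (f := fun i => ∑ J, (eLpNorm (weakDeriv T J fun x => v x i) p
    (volume.restrict T)).toReal ^ p.toReal) (fun _ _ => by positivity) (Finset.mem_univ i)

theorem sobolevSeminorm_nonneg : 0 ≤ sobolevSeminorm T m p v := by
  unfold sobolevSeminorm
  positivity

/-- The weak gradient of the `i`-th component. -/
def weakGrad (T : Set (Space d)) (v : Space d → Space d) (i : Fin d) : Space d → Space d :=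
  fun x => WithLp.toLp 2 fun j => weakDeriv T (fun _ : Fin 1 => j) (fun y => v y i) x

theorem snoc_default (J : Fin 0 → Fin d) (j : Fin d) :
    (Fin.snoc J j : Fin 1 → Fin d) = fun _ => j := by
  ext l
  rw [show l = Fin.last 0 from Subsingleton.elim (α := Fin 1) _ _, Fin.snoc_last]

/-- Symmetry in the indices is inherited from the test functions: a weak derivative for `J` is one
for every permutation of `J`, and weak derivatives are unique almost everywhere. -/
theorem MemSobolev.isJet [IsFiniteMeasure (volume.restrict T)] (hT : IsOpen T)
    (hv : MemSobolev T m 2 v) (i : Fin d) :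
    IsJet T m fun _ J => weakDeriv T J fun x => v x i where
  memLp _ hl J := hv.memLp_weakDeriv hT i hl J
  isH1 _ hl J := isH1_weakDeriv (hv.isWeakDeriv i hl.le J) (hv.memLp_weakDeriv hT i hl.le J)
    (fun _ => hv.isWeakDeriv i hl _) (fun _ => hv.memLp_weakDeriv hT i hl _)
  symm _ hl J σ := integral_congr_ae
    ((hv.isWeakDeriv i hl _).ae_eq hT ((hv.isWeakDeriv i hl J).perm σ))

theorem MemSobolev.isH1 [IsFiniteMeasure (volume.restrict T)] (hT : IsOpen T)
    (hv : MemSobolev T (k + 1) 2 v) (i : Fin d) : IsH1 T (fun x => v x i) (weakGrad T v i) := by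
  refine ((hv.isJet hT i).isH1 0 (Nat.succ_pos k) Fin.elim0).congr
    ((hv.isWeakDeriv i (Nat.zero_le _) _).ae_eq_self hT) (Eventually.of_forall fun x => ?_)
  ext j
  exact congrArg (fun J : Fin 1 → Fin d => weakDeriv T J (fun y => v y i) x) (snoc_default _ j)

theorem MemSobolev.jetNormSq_le [IsFiniteMeasure (volume.restrict T)] (hT : IsOpen T)
    (hv : MemSobolev T m 2 v) (i : Fin d) :
    jetNormSq T (fun _ J => weakDeriv T J fun x => v x i) m ≤ sobolevSeminorm T m 2 v ^ 2 := by
  have hs : sobolevSeminorm T m 2 v ^ 2 = ∑ i : Fin d, ∑ J : Fin m → Fin d,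
      (eLpNorm (weakDeriv T J fun x => v x i) 2 (volume.restrict T)).toReal ^ 2 := by
    unfold sobolevSeminorm
    rw [← Real.rpow_natCast, ← Real.rpow_mul (by positivity)]
    simp
  rw [hs]
  refine le_trans (le_of_eq ?_) (Finset.single_le_sum (f := fun i => ∑ J : Fin m → Fin d,
      (eLpNorm (weakDeriv T J fun x => v x i) 2 (volume.restrict T)).toReal ^ 2)
      (fun _ _ => by positivity) (Finset.mem_univ i))
  refine Finset.sum_congr rfl fun J _ => ?_
  rw [toReal_eLpNorm_two (hv.memLp_weakDeriv hT i le_rfl J), l2norm_sq]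

/-- Hölder, with exponent `1/2 - 1/4 = 1/4` on the volume. -/
theorem l2norm_le_toReal_eLpNorm_four [IsFiniteMeasure (volume.restrict T)] {f : Space d → ℝ}
    (hf : MemLp f 2 (volume.restrict T)) (hf4 : MemLp f 4 (volume.restrict T)) :
    l2norm (volume.restrict T) f ≤
      (eLpNorm f 4 (volume.restrict T)).toReal * volume.real T ^ (1 / 4 : ℝ) := by
  rw [← toReal_eLpNorm_two hf]
  have h := eLpNorm_le_eLpNorm_mul_rpow_measure_univ (μ := volume.restrict T) (p := 2) (q := 4)
    (by norm_num) hf.1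
  have hfin : volume T ≠ ⊤ := by
    have := measure_ne_top (volume.restrict T) univ
    rwa [Measure.restrict_apply_univ] at this
  have hq : (volume T) ^ (1 / 4 : ℝ) ≠ ⊤ := ENNReal.rpow_ne_top_of_nonneg (by norm_num) hfin
  rw [Measure.restrict_apply_univ, show (1 / (2 : ℝ≥0∞).toReal - 1 / (4 : ℝ≥0∞).toReal) = (1 / 4 : ℝ) by
    norm_num] at h
  refine (ENNReal.toReal_mono (ENNReal.mul_ne_top hf4.eLpNorm_ne_top hq) h).trans (le_of_eq ?_)
  rw [ENNReal.toReal_mul, ← ENNReal.toReal_rpow, Measure.real]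

/-- A constant that dominates `1` and the square root of the Poincaré constant. -/
def approxConst (d : ℕ) (q : ℝ) : ℝ := 1 + Real.sqrt (poincareConst d q)

theorem one_le_approxConst (d : ℕ) (q : ℝ) : 1 ≤ approxConst d q :=
  le_add_of_nonneg_right (Real.sqrt_nonneg _)

theorem poincareConst_le {q : ℝ} (hq : 0 ≤ q) : poincareConst d q ≤ approxConst d q ^ 2 := by
  have h := Real.sq_sqrt (poincareConst_nonneg (d := d) hq)
  have := Real.sqrt_nonneg (poincareConst d q)
  unfold approxConst
  nlinarith

namespace IsSubmesh

/-- High order polynomial approximation. -/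
theorem exists_poly_isSmall (hS : IsSubmesh T S r) (hd : 1 ≤ d) (hv : MemSobolev T (k + 1) 2 v)
    (i : Fin d) : ∃ P ∈ poly d k, IsSmall T
      (approxConst d (Metric.diam T / r) ^ (k + 1) * Metric.diam T ^ k *
        sobolevSeminorm T (k + 1) 2 v)
      (fun x => v x i - P x) fun x => weakGrad T v i x - gradient P x := by
  have hfin := hS.isFiniteMeasure
  have hq := hS.ratio_nonneg
  set s := approxConst d (Metric.diam T / r)
  set δ := Metric.diam T with hδ
  set A := sobolevSeminorm T (k + 1) 2 v
  have hδ0 : 0 ≤ δ := Metric.diam_nonneg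
  have hs : 1 ≤ s := one_le_approxConst _ _
  have hA : 0 ≤ A := sobolevSeminorm_nonneg
  have hκ : ∀ w G, IsH1 T w G → ∫ x in T, w x = 0 →
      ∫ x in T, w x ^ 2 ≤ (s * δ) ^ 2 * ∫ x in T, ‖G x‖ ^ 2 := fun w G hw h0 => by
    refine (hS.poincare_of_integral_eq_zero hd hw h0).trans ?_
    refine mul_le_mul_of_nonneg_right ?_ (integral_nonneg fun _ => sq_nonneg _)
    rw [mul_pow]
    exact mul_le_mul_of_nonneg_right (poincareConst_le hq) (sq_nonneg _)
  obtain ⟨P, hP, h1, h2⟩ := (hv.isJet hS.isOpen i).exists_poly_le hS.isBounded hS.isOpen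
    hS.isConnected.nonempty (sq_nonneg (s * δ)) hκ
  have hA2 := hv.jetNormSq_le hS.isOpen i
  have hPs : ContDiff ℝ ∞ P := poly_contDiff hP
  refine ⟨P, hP, (hv.isH1 hS.isOpen i).sub (isH1_of_contDiff hS.isBounded hPs), ?_, fun j => ?_⟩
  · refine HHO.l2norm_le (by positivity) ?_
    have e : ∫ x in T, (v x i - P x) ^ 2 =
        ∫ x in T, (weakDeriv T (Fin.elim0 : Fin 0 → Fin d) (fun x => v x i) x - P x) ^ 2 := by
      refine integral_congr_ae ?_
      filter_upwards [(hv.isWeakDeriv i (Nat.zero_le _) Fin.elim0).ae_eq_self hS.isOpen] with x hx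
      rw [hx]
    rw [e]
    refine (h1.trans (mul_le_mul_of_nonneg_left hA2 (by positivity))).trans (le_of_eq ?_)
    ring
  -- The gradient needs one Poincaré step less than the function; since the constant is at least
  -- `1`, the same power serves both.
  · have hsk : s ^ k ≤ s ^ (k + 1) := pow_le_pow_right₀ hs (Nat.le_succ k)
    have hb : l2norm (volume.restrict T) (fun x => (weakGrad T v i x - gradient P x) j) ≤
        s ^ k * δ ^ k * A := by
      refine HHO.l2norm_le (by positivity) ?_
      have h3 := Finset.single_le_sum (f := fun j => ∫ x in T,
        (weakDeriv T (fun _ : Fin 1 => j) (fun x => v x i) x - partialDeriv j P x) ^ 2)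
        (fun _ _ => integral_nonneg fun _ => sq_nonneg _) (Finset.mem_univ j)
      refine (h3.trans (h2.trans (mul_le_mul_of_nonneg_left hA2 (by positivity)))).trans
        (le_of_eq ?_)
      ring
    exact hb.trans (by gcongr)

/-- Approximation by constants. -/
theorem exists_const_isSmall (hS : IsSubmesh T S r) (hd : 1 ≤ d) {u : Space d → ℝ}
    {G : Space d → Space d} (hu : IsH1 T u G) {B : ℝ}
    (hB : ∀ j, l2norm (volume.restrict T) (fun x => G x j) ≤ B) :
    ∃ c, IsSmall T (approxConst d (Metric.diam T / r) * d * B) (fun x => u x - c) G := by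
  have hfin := hS.isFiniteMeasure
  have hq := hS.ratio_nonneg
  have hB0 : 0 ≤ B := l2norm_nonneg.trans (hB ⟨0, hd⟩)
  have hs : 1 ≤ approxConst d (Metric.diam T / r) := one_le_approxConst _ _
  have hd' : (1 : ℝ) ≤ d := by exact_mod_cast hd
  obtain ⟨c, hc⟩ := hS.poincare hd hu
  have hG : ∫ x in T, ‖G x‖ ^ 2 ≤ d * B ^ 2 := by
    simp only [EuclideanSpace.norm_sq_eq, Real.norm_eq_abs, sq_abs]
    rw [integral_finsetSum _ fun j _ => (hu.memLp_grad_apply j).integrable_sq]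
    refine (Finset.sum_le_card_nsmul _ _ (B ^ 2) fun j _ => ?_).trans (by simp)
    rw [← l2norm_sq]
    exact pow_le_pow_left₀ l2norm_nonneg (hB j) 2
  have h1 : IsH1 T (fun x => u x - c) G := by
    have := hu.sub (isH1_of_contDiff hS.isBounded (contDiff_const (c := c)))
    refine this.congr (ae_eq_refl _) (Eventually.of_forall fun x => ?_)
    ext j
    simp [gradient, partialDeriv]
  refine ⟨c, h1, ?_, fun j => (hB j).trans ?_⟩
  · refine HHO.l2norm_le (mul_nonneg (by positivity) Metric.diam_nonneg) ?_
    refine hc.trans ((mul_le_mul (mul_le_mul_of_nonneg_right (poincareConst_le hq) (sq_nonneg _)) hG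
      (integral_nonneg fun _ => sq_nonneg _) (by positivity)).trans ?_)
    -- Summing the `d` components gives `√d`, which is enlarged to `d`.
    have : (d : ℝ) ≤ d ^ 2 := by nlinarith
    have := mul_le_mul_of_nonneg_left this (show 0 ≤ approxConst d (Metric.diam T / r) ^ 2 *
      Metric.diam T ^ 2 * B ^ 2 by positivity)
    linarith
  · exact le_mul_of_one_le_left hB0 (one_le_mul_of_one_le_of_one_le hs hd')

/-- Uniform bounds for polynomials in terms of their `L⁴` norm. -/
theorem abs_poly_le (hS : IsSubmesh T S r) (hd : 1 ≤ d) {z : Space d → ℝ} (hz : z ∈ poly d l) {N : ℝ}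
    (hN : (eLpNorm z 4 (volume.restrict T)).toReal ≤ N) {x : Space d} (hx : x ∈ closure T) :
    |z x| ≤ (Metric.diam T / r) * Real.sqrt (invConst d l (Metric.diam T / r) *
        (volume.real (Metric.ball (0 : Space d) 1) * (Metric.diam T / r) ^ d)) *
          (volume.real T ^ (1 / 4 : ℝ))⁻¹ * N ∧
      ∀ j, |Metric.diam T * partialDeriv j z x| ≤
        (Metric.diam T / r) * Real.sqrt (invConst d l (Metric.diam T / r) *
        (volume.real (Metric.ball (0 : Space d) 1) * (Metric.diam T / r) ^ d)) *
          (volume.real T ^ (1 / 4 : ℝ))⁻¹ * N := by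
  have hfin := hS.isFiniteMeasure
  have hr := hS.pos
  have hq := hS.ratio_nonneg
  have hq1 : 1 ≤ Metric.diam T / r := (one_le_div hr).2 (hS.le_diam hd)
  have hN0 : 0 ≤ N := ENNReal.toReal_nonneg.trans hN
  have hV : 0 < volume.real T := by
    exact ENNReal.toReal_pos (hS.isOpen.measure_pos volume hS.isConnected.nonempty).ne'
      hS.volume_lt_top
  set t := volume.real T ^ (1 / 4 : ℝ) with ht
  have ht0 : 0 < t := Real.rpow_pos_of_pos hV _
  have ht4 : t ^ 4 = volume.real T := by
    rw [ht, ← Real.rpow_natCast, ← Real.rpow_mul hV.le]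
    norm_num
  set c := invConst d l (Metric.diam T / r)
  have hc : 0 ≤ c := invConst_nonneg _ _ _
  set b := volume.real (Metric.ball (0 : Space d) 1) * (Metric.diam T / r) ^ d with hb
  have hb0 : 0 ≤ b := by positivity
  have h2 : ∫ x in T, z x ^ 2 ≤ (N * t) ^ 2 := by
    rw [← l2norm_sq]
    refine pow_le_pow_left₀ l2norm_nonneg ((l2norm_le_toReal_eLpNorm_four
      (hS.memLp_continuous (poly_continuous hz) 2) (hS.memLp_continuous (poly_continuous hz) 4)).trans
      (mul_le_mul_of_nonneg_right hN ht0.le)) 2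
  -- The inverse inequality supplies `r⁻ᵈ`, comparable to `|T|⁻¹ = t⁻⁴`, and Hölder supplies `t²`;
  -- the product `t⁻²` is the square of the factor `|T|^{-1/4}` claimed.
  have h3 : (r ^ d)⁻¹ ≤ b * (t ^ 4)⁻¹ := by
    have := mul_le_mul_of_nonneg_right (hS.volume_mul_le hd) (inv_nonneg.2 hV.le)
    rw [mul_right_comm, mul_inv_cancel₀ hV.ne', one_mul] at this
    rwa [ht4]
  have h4 : c * ((r ^ d)⁻¹ * ∫ x in T, z x ^ 2) ≤ (Real.sqrt (c * b) * t⁻¹ * N) ^ 2 := by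
    have := mul_le_mul_of_nonneg_left (mul_le_mul h3 h2 (integral_nonneg fun _ => sq_nonneg _)
      (by positivity)) hc
    refine this.trans (le_of_eq ?_)
    rw [mul_pow, mul_pow, mul_pow (Real.sqrt _), Real.sq_sqrt (by positivity)]
    field_simp
  obtain ⟨h5, h6⟩ := hS.inverse_pointwise hz hx
  have hX : 0 ≤ Real.sqrt (c * b) * t⁻¹ * N := by positivity
  have h7 := abs_le_of_sq_le_sq (h5.trans h4) hX
  have e : (Metric.diam T / r) * Real.sqrt (c * b) * t⁻¹ * N =
      (Metric.diam T / r) * (Real.sqrt (c * b) * t⁻¹ * N) := by ring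
  rw [e]
  refine ⟨h7.trans (le_mul_of_one_le_left hX hq1), fun j => ?_⟩
  have h8 := abs_le_of_sq_le_sq ((h6 j).trans h4) hX
  -- The leading ratio `diam T / r` in the common bound converts the scale `r` of the inverse
  -- inequality into `diam T`; for `z` itself it is harmless, being at least `1`.
  have e2 : Metric.diam T * partialDeriv j z x =
      (Metric.diam T / r) * (r * partialDeriv j z x) := by field_simp
  rw [e2, abs_mul, abs_of_nonneg hq]
  exact mul_le_mul_of_nonneg_left h8 hq

end IsSubmesh
end sobolevBounds

/-! ### The discrete directional derivative in components -/

section dirDeriv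
variable {d k : ℕ} {Ω T : Set (Space d)} {M : PolytopalMesh Ω} {S : Finset (Finset (Space d))}
  {r : ℝ}

theorem vecPoly_contDiff {p : Space d → Space d} (hp : p ∈ vecPoly d k) {n : WithTop ℕ∞} :
    ContDiff ℝ n p :=
  (contDiff_piLp 2).2 fun i => poly_contDiff (hp i)

theorem fderiv_vecPoly_apply {p : Space d → Space d} (hp : p ∈ vecPoly d k) (x e : Space d)
    (i : Fin d) : (fderiv ℝ p x e) i = ∑ j, e j * partialDeriv j (fun y => p y i) x := by
  have h1 := ((vecPoly_contDiff hp (n := 1)).differentiable (by simp) x).hasFDerivAt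
  have h2 : HasFDerivAt (fun y => p y i)
      ((EuclideanSpace.proj i : Space d →L[ℝ] ℝ).comp (fderiv ℝ p x)) x :=
    (EuclideanSpace.proj i : Space d →L[ℝ] ℝ).hasFDerivAt.comp x h1
  have h3 : (fderiv ℝ p x e) i = fderiv ℝ (fun y => p y i) x e := by
    rw [h2.fderiv]
    rfl
  rw [h3, ← inner_gradient, inner_eq_sum_mul]
  simp [gradient, mul_comm]

/-- The contribution of the components `i` of the field and `j` of the transporting field to the
discrete directional derivative. -/
def dirDerivTerm (w v : LocalUnknowns M T k) (i j : Fin d) (z : Space d → ℝ) : ℝ :=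
  (∫ x in T, w.cell x j * partialDeriv j (fun y => v.cell y i) x * z x) +
    ∑ F : M.facesOf T, outwardNormal T F j * ∫ x in (F : Set (Space d)),
      w.face F x j * (v.face F x i - v.cell x i) * z x ∂(μHE[d - 1] : Measure (Space d))

namespace IsCompatible

theorem integrable_continuous (h : IsCompatible M T S r) {f : Space d → ℝ} (hf : Continuous f) :
    IntegrableOn f T := by
  have := h.toIsSubmesh.isFiniteMeasure
  exact (h.toIsSubmesh.memLp_continuous hf 1).integrable le_rfl

theorem integrable_continuous_face (h : IsCompatible M T S r) {F : Set (Space d)}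
    (hF : F ∈ M.facesOf T) {f : Space d → ℝ} (hf : Continuous f) :
    IntegrableOn f F (μHE[d - 1] : Measure (Space d)) := by
  have := h.isFiniteMeasure_face hF
  exact (h.memLp_continuous_face hF hf 1).integrable le_rfl

theorem dirDeriv_rhs_eq (h : IsCompatible M T S r) (w v : LocalUnknowns M T k)
    {z : Space d → Space d} (hz : z ∈ vecPoly d k) :
    (∫ x in T, inner ℝ (fderiv ℝ v.cell x (w.cell x)) (z x)) +
      ∑ F : M.facesOf T, ∫ x in (F : Set (Space d)),
        inner ℝ (w.face F x) (outwardNormal T F) * inner ℝ (v.face F x - v.cell x) (z x)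
          ∂(μHE[d - 1] : Measure (Space d)) =
      ∑ i, ∑ j, dirDerivTerm w v i j fun x => z x i := by
  have cw := fun j => poly_continuous (w.cell_mem j)
  have cv := fun i => poly_continuous (v.cell_mem i)
  have cz := fun i => poly_continuous (hz i)
  have cdv : ∀ i j, Continuous (partialDeriv j fun y => v.cell y i) := fun i j =>
    (contDiff_partialDeriv (poly_contDiff (v.cell_mem i)) j).continuous
  have e1 : ∫ x in T, inner ℝ (fderiv ℝ v.cell x (w.cell x)) (z x) =
      ∑ i, ∑ j, ∫ x in T, w.cell x j * partialDeriv j (fun y => v.cell y i) x * z x i := by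
    simp only [inner_eq_sum_mul, fderiv_vecPoly_apply v.cell_mem, Finset.sum_mul]
    rw [integral_finsetSum]
    · refine Finset.sum_congr rfl fun i _ => integral_finsetSum _ fun j _ => ?_
      exact h.integrable_continuous (((cw j).mul (cdv i j)).mul (cz i))
    · exact fun i _ => integrable_finsetSum _ fun j _ =>
        h.integrable_continuous (((cw j).mul (cdv i j)).mul (cz i))
  have e2 : ∀ F : M.facesOf T, ∫ x in (F : Set (Space d)),
      inner ℝ (w.face F x) (outwardNormal T F) * inner ℝ (v.face F x - v.cell x) (z x)
        ∂(μHE[d - 1] : Measure (Space d)) =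
      ∑ i, ∑ j, outwardNormal T F j * ∫ x in (F : Set (Space d)),
        w.face F x j * (v.face F x i - v.cell x i) * z x i
          ∂(μHE[d - 1] : Measure (Space d)) := by
    intro F
    have cwF := fun j => poly_continuous (w.face_mem F j)
    have cvF := fun i => poly_continuous (v.face_mem F i)
    have hi : ∀ i j, IntegrableOn (fun x => outwardNormal T F j *
        (w.face F x j * (v.face F x i - v.cell x i) * z x i)) F
          (μHE[d - 1] : Measure (Space d)) := fun i j =>
      h.integrable_continuous_face F.2
        (continuous_const.mul (((cwF j).mul ((cvF i).sub (cv i))).mul (cz i)))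
    have e : ∀ x, inner ℝ (w.face F x) (outwardNormal T F) * inner ℝ (v.face F x - v.cell x) (z x) =
        ∑ i, ∑ j, outwardNormal T F j *
          (w.face F x j * (v.face F x i - v.cell x i) * z x i) := by
      intro x
      rw [inner_eq_sum_mul, inner_eq_sum_mul, Finset.sum_mul_sum, Finset.sum_comm]
      refine Finset.sum_congr rfl fun i _ => Finset.sum_congr rfl fun j _ => ?_
      simp only [PiLp.sub_apply]
      ring
    simp only [e]
    rw [integral_finsetSum _ fun i _ => integrable_finsetSum _ fun j _ => hi i j]
    refine Finset.sum_congr rfl fun i _ => ?_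
    rw [integral_finsetSum _ fun j _ => hi i j]
    exact Finset.sum_congr rfl fun j _ => integral_const_mul _ _
  rw [e1, Finset.sum_congr rfl fun F _ => e2 F,
    Finset.sum_comm (s := (Finset.univ : Finset (M.facesOf T))), ← Finset.sum_add_distrib]
  refine Finset.sum_congr rfl fun i _ => ?_
  rw [Finset.sum_comm (s := (Finset.univ : Finset (M.facesOf T))), ← Finset.sum_add_distrib]
  rfl

/-- Existence, component by component, by representing the right-hand side as an `L²(T)` pairing. A
polynomial that vanishes almost everywhere on the open set `T` vanishes identically, so the face
integrals are also zero for it and the representation applies. -/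
theorem isDirDeriv_dirDeriv (h : IsCompatible M T S r) (w v : LocalUnknowns M T k) :
    IsDirDeriv w v (dirDeriv w v) := by
  refine Classical.epsilon_spec (p := IsDirDeriv w v) ?_
  have cw := fun j => poly_continuous (w.cell_mem j)
  have cv := fun i => poly_continuous (v.cell_mem i)
  have cdv : ∀ i j, Continuous (partialDeriv j fun y => v.cell y i) := fun i j =>
    (contDiff_partialDeriv (poly_contDiff (v.cell_mem i)) j).continuous
  have hadd : ∀ i j, ∀ z ∈ poly d k, ∀ z' ∈ poly d k, dirDerivTerm w v i j (fun x => z x + z' x) =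
      dirDerivTerm w v i j z + dirDerivTerm w v i j z' := by
    intro i j z hz z' hz'
    unfold dirDerivTerm
    have e : ∀ F : M.facesOf T, outwardNormal T F j * ∫ x in (F : Set (Space d)),
        w.face F x j * (v.face F x i - v.cell x i) * (z x + z' x)
          ∂(μHE[d - 1] : Measure (Space d)) =
        outwardNormal T F j * (∫ x in (F : Set (Space d)),
          w.face F x j * (v.face F x i - v.cell x i) * z x ∂(μHE[d - 1] : Measure (Space d))) +
        outwardNormal T F j * ∫ x in (F : Set (Space d)),
          w.face F x j * (v.face F x i - v.cell x i) * z' x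
            ∂(μHE[d - 1] : Measure (Space d)) := by
      intro F
      have c1 := (poly_continuous (w.face_mem F j)).mul
        ((poly_continuous (v.face_mem F i)).sub (cv i))
      have i1 : ∀ z ∈ poly d k, IntegrableOn (fun x => w.face F x j *
          (v.face F x i - v.cell x i) * z x) F (μHE[d - 1] : Measure (Space d)) := fun z hz =>
        h.integrable_continuous_face F.2 (c1.mul (poly_continuous hz))
      simp only [mul_add (_ * (_ - _))]
      rw [integral_add (i1 z hz) (i1 z' hz'), mul_add]
    have c2 := (cw j).mul (cdv i j)
    have i2 : ∀ z ∈ poly d k, IntegrableOn (fun x => w.cell x j *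
        partialDeriv j (fun y => v.cell y i) x * z x) T := fun z hz =>
      h.integrable_continuous (c2.mul (poly_continuous hz))
    rw [Finset.sum_congr rfl fun F _ => e F, Finset.sum_add_distrib]
    simp only [mul_add (_ * partialDeriv _ _ _)]
    rw [integral_add (i2 z hz) (i2 z' hz')]
    ring
  have hsmul : ∀ i j c (z : Space d → ℝ), dirDerivTerm w v i j (fun x => c * z x) =
      c * dirDerivTerm w v i j z := by
    intro i j c z
    unfold dirDerivTerm
    simp only [mul_left_comm _ c, integral_const_mul, mul_add, Finset.mul_sum]
  have hg : ∀ i, ∃ g ∈ poly d k, ∀ p : polySubmodule d k,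
      ∫ x in T, g x * (p : Space d → ℝ) x = ∑ j, dirDerivTerm w v i j p := by
    intro i
    refine exists_poly_integral_eq
      (fun p hp q hq => h.integrable_continuous ((poly_continuous hp).mul (poly_continuous hq)))
      { toFun := fun p => ∑ j, dirDerivTerm w v i j p
        map_add' := fun p q => by
          rw [← Finset.sum_add_distrib]
          exact Finset.sum_congr rfl fun j _ => hadd i j _ p.2 _ q.2
        map_smul' := fun c p => by
          rw [RingHom.id_apply, smul_eq_mul, Finset.mul_sum]
          exact Finset.sum_congr rfl fun j _ => hsmul i j c _ } fun p hp => ?_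
    have h0 : ∀ x ∈ T, (p : Space d → ℝ) x = 0 := fun x hx =>
      Measure.eqOn_open_of_ae_eq hp h.isOpen (poly_continuous p.2).continuousOn
        continuousOn_const hx
    have hp0 : (p : Space d → ℝ) = fun _ => 0 :=
      funext fun x => poly_eq_zero p.2 h.isOpen h.isConnected.nonempty h0 x
    simp [dirDerivTerm, hp0]
  choose g hg hgz using hg
  refine ⟨fun x => WithLp.toLp 2 fun i => g i x, fun i => hg i, fun z hz => ?_⟩
  rw [h.dirDeriv_rhs_eq w v hz]
  simp only [inner_eq_sum_mul]
  rw [integral_finsetSum]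
  · exact Finset.sum_congr rfl fun i _ => hgz i ⟨_, hz i⟩
  · exact fun i _ => h.integrable_continuous ((poly_continuous (hg i)).mul (poly_continuous (hz i)))

end IsCompatible
end dirDeriv

/-- The constant of the uniform bounds of polynomials by their `L⁴` norm. -/
def supConst (d l : ℕ) (q : ℝ) : ℝ :=
  q * Real.sqrt (invConst d l q * (volume.real (Metric.ball (0 : Space d) 1) * q ^ d))

/-- The constant of the consistency estimate of the discrete directional derivative. -/
def dirDerivConst (d k : ℕ) (q : ℝ) : ℝ :=
  d ^ 2 * (consistencyConst d q * (projConst d k q * approxConst d q ^ (k + 1) *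
    ((1 + projConst d k q) * (approxConst d q * d)) * supConst d k q))

/-! ### The final estimate -/

section main
variable {d k : ℕ} {Ω T : Set (Space d)} {M : PolytopalMesh Ω} {S : Finset (Finset (Space d))}
  {r : ℝ} {v : Space d → Space d} {z : Space d → Space d}

theorem dirDerivConst_nonneg {q : ℝ} (hq : 0 ≤ q) : 0 ≤ dirDerivConst d k q := by
  have h1 := one_le_projConst (d := d) (l := k) hq
  have h2 := one_le_approxConst d q
  have h3 := invConst_nonneg d k q
  unfold dirDerivConst consistencyConst traceConst supConst
  positivity

namespace IsCompatible

/-- The scalar estimate is used with `α` of order `(diam T)^k A`, `β` of order `W t` and `Z` of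
order `N / t`, where `t = |T|^{1/4}`. The powers of `t` cancel, and the additional `diam T` of the
scalar estimate raises the exponent to `k + 1`. -/
theorem abs_dirDerivTerm_sub_le (h : IsCompatible M T S r) (hv4 : MemSobolev T 1 4 v)
    (hv : MemSobolev T (k + 1) 2 v) (hz : z ∈ vecPoly d k) (i j : Fin d) :
    |dirDerivTerm (interp M T k v) (interp M T k v) i j (fun x => z x i) -
      ∫ x in T, v x j * weakDeriv T (fun _ : Fin 1 => j) (fun y => v y i) x * z x i| ≤
    consistencyConst d (Metric.diam T / r) * (projConst d k (Metric.diam T / r) *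
      approxConst d (Metric.diam T / r) ^ (k + 1) * ((1 + projConst d k (Metric.diam T / r)) *
      (approxConst d (Metric.diam T / r) * d)) * supConst d k (Metric.diam T / r)) *
      Metric.diam T ^ (k + 1) * sobolevSeminorm T (k + 1) 2 v * sobolevSeminorm T 1 4 v *
      (eLpNorm z 4 (volume.restrict T)).toReal := by
  have hS := h.toIsSubmesh
  have hfin := hS.isFiniteMeasure
  have hd : 1 ≤ d := by have := h.two_le; omega
  have hd' : (1 : ℝ) ≤ d := by exact_mod_cast hd
  have hq := hS.ratio_nonneg
  set q := Metric.diam T / r with hqdef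
  set K := projConst d k q with hK
  set s := approxConst d q with hs
  have hK1 : 1 ≤ K := one_le_projConst hq
  have hs1 : 1 ≤ s := one_le_approxConst d q
  set A := sobolevSeminorm T (k + 1) 2 v
  set W := sobolevSeminorm T 1 4 v
  set N := (eLpNorm z 4 (volume.restrict T)).toReal with hN
  set t := volume.real T ^ (1 / 4 : ℝ)
  have hA : 0 ≤ A := sobolevSeminorm_nonneg
  have hW : 0 ≤ W := sobolevSeminorm_nonneg
  have hN0 : 0 ≤ N := ENNReal.toReal_nonneg
  have ht : 0 < t := Real.rpow_pos_of_pos (ENNReal.toReal_pos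
    (h.isOpen.measure_pos volume h.isConnected.nonempty).ne' hS.volume_lt_top) _
  have hH := fun i => hv.isH1 h.isOpen i
  have hB : ∀ i j, l2norm (volume.restrict T) (fun x => weakGrad T v i x j) ≤ W * t := by
    intro i j
    refine (l2norm_le_toReal_eLpNorm_four ((hH i).memLp_grad_apply j)
      (hv4.memLp_weakDeriv h.isOpen i le_rfl _)).trans (mul_le_mul_of_nonneg_right ?_ ht.le)
    exact MemSobolev.toReal_eLpNorm_le (by norm_num) i _
  have hα : ∀ i, IsSmall T (K * (s ^ (k + 1) * Metric.diam T ^ k * A))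
      (fun x => v x i - lproj (volume.restrict T) k (fun y => v y i) x)
      (fun x => weakGrad T v i x - gradient (lproj (volume.restrict T) k fun y => v y i) x) := by
    intro i
    obtain ⟨P, hP, hPs⟩ := hS.exists_poly_isSmall hd hv i
    exact hS.isSmall_sub_lproj hd (hH i) hP hPs
  have hβ : ∀ i, ∃ c, IsSmall T ((1 + K) * (s * d) * (W * t))
      (fun x => v x i - lproj (volume.restrict T) k (fun y => v y i) x)
      (fun x => weakGrad T v i x - gradient (lproj (volume.restrict T) k fun y => v y i) x) ∧
      IsSmall T ((1 + K) * (s * d) * (W * t))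
        (fun x => lproj (volume.restrict T) k (fun y => v y i) x - c)
        (gradient (lproj (volume.restrict T) k fun y => v y i)) := by
    intro i
    obtain ⟨c, hc⟩ := hS.exists_const_isSmall hd (hH i) (hB i)
    have hgc : ∀ x, gradient (fun _ : Space d => c) x = 0 := by
      intro x
      ext j
      simp [gradient, partialDeriv]
    have h1 := hS.isSmall_sub_lproj hd (hH i) (poly_const c k) (α := s * d * (W * t))
      (by simpa only [hgc, sub_zero] using hc)
    refine ⟨c, h1.mono ?_, ?_⟩
    · have : 0 ≤ s * d * (W * t) := by positivity
      change K * (s * d * (W * t)) ≤ _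
      linarith
    -- The deviation of the projection from the constant is `(v_i - c) - (v_i - p)`; the two
    -- summands explain the factor `1 + K`.
    · have h2 := hc.sub hfin h1
      simp only [sub_sub_sub_cancel_left, sub_sub_cancel] at h2
      exact h2.mono (le_of_eq (by ring))
  obtain ⟨c, hβj, hej⟩ := hβ j
  have hzi : (eLpNorm (fun x => z x i) 4 (volume.restrict T)).toReal ≤ N := by
    refine ENNReal.toReal_mono (hS.memLp_continuous (vecPoly_contDiff hz (n := 0)).continuous
      4).eLpNorm_ne_top (eLpNorm_mono fun x => PiLp.norm_apply_le (z x) i)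
  have hzsup := fun x (hx : x ∈ closure T) => hS.abs_poly_le hd (hz i) hzi hx
  have hZ0 : 0 ≤ supConst d k q * t⁻¹ * N := by
    have := invConst_nonneg d k q
    unfold supConst
    positivity
  have key := h.abs_consistency_le (Z := supConst d k q * t⁻¹ * N) hZ0 (hH i) (hH j)
    (hS.isL2Proj_lproj (hH i).memLp) (lproj_mem _ _ _) (hz i) (fun x hx => (hzsup x hx).1) j
    (fun x hx => (hzsup x hx).2 j) (hα i) (hα j) hβj hej ((hB i j).trans (by
      refine le_mul_of_one_le_left (by positivity) ?_
      exact one_le_mul_of_one_le_of_one_le (by linarith)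
        (one_le_mul_of_one_le_of_one_le hs1 hd')))
  have hi1 : Integrable (fun x => lproj (volume.restrict T) k (fun y => v y j) x *
      partialDeriv j (lproj (volume.restrict T) k fun y => v y i) x * z x i)
      (volume.restrict T) := by
    refine h.integrable_continuous (((poly_continuous (lproj_mem _ _ _)).mul ?_).mul
      (poly_continuous (hz i)))
    exact (contDiff_partialDeriv (poly_contDiff (lproj_mem _ _ _)) j).continuous
  have hi2 : Integrable (fun x => v x j * weakGrad T v i x j * z x i) (volume.restrict T) := by
    refine integrable_mul_mul (c := supConst d k q * t⁻¹ * N) (hH j).memLp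
      ((hH i).memLp_grad_apply j) (poly_continuous (hz i)).aestronglyMeasurable ?_
    filter_upwards [ae_restrict_mem h.isOpen.measurableSet] with x hx
    exact (hzsup x (subset_closure hx)).1
  simp only [sub_mul] at key
  rw [integral_sub hi1 hi2] at key
  refine le_trans (le_of_eq ?_) (key.trans (le_of_eq ?_))
  · congr 1
    rw [sub_add_eq_add_sub]
    rfl
  · rw [pow_succ]
    field_simp
    ring

theorem abs_integral_dirDeriv_sub_convective_le (h : IsCompatible M T S r)
    (hv4 : MemSobolev T 1 4 v) (hv : MemSobolev T (k + 1) 2 v) (hz : z ∈ vecPoly d k) :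
    |∫ x in T, inner ℝ
      (dirDeriv (interp M T k v) (interp M T k v) x - convective T v x) (z x)| ≤
    dirDerivConst d k (Metric.diam T / r) * Metric.diam T ^ (k + 1) *
      sobolevSeminorm T (k + 1) 2 v * sobolevSeminorm T 1 4 v *
      (eLpNorm z 4 (volume.restrict T)).toReal := by
  have hS := h.toIsSubmesh
  have hfin := hS.isFiniteMeasure
  obtain ⟨hg, hgz⟩ := h.isDirDeriv_dirDeriv (interp M T k v) (interp M T k v)
  have hH := fun i => hv.isH1 h.isOpen i
  have hzb : ∀ i, ∃ C, ∀ x ∈ closure T, |z x i| ≤ C := fun i =>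
    hS.isBounded.isCompact_closure.exists_bound_of_continuousOn (poly_continuous (hz i)).continuousOn
  have hint : ∀ i j, Integrable (fun x => v x j *
      weakDeriv T (fun _ : Fin 1 => j) (fun y => v y i) x * z x i) (volume.restrict T) := by
    intro i j
    obtain ⟨C, hC⟩ := hzb i
    refine integrable_mul_mul (c := C) (hH j).memLp ((hH i).memLp_grad_apply j)
      (poly_continuous (hz i)).aestronglyMeasurable ?_
    filter_upwards [ae_restrict_mem h.isOpen.measurableSet] with x hx
    exact hC x (subset_closure hx)
  have hconv : ∀ x, inner ℝ (convective T v x) (z x) = ∑ i, ∑ j, v x j *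
      weakDeriv T (fun _ : Fin 1 => j) (fun y => v y i) x * z x i := by
    intro x
    simp [inner_eq_sum_mul, convective, Finset.sum_mul]
  have hconvi : Integrable (fun x => inner ℝ (convective T v x) (z x)) (volume.restrict T) := by
    simp only [hconv]
    exact integrable_finsetSum _ fun i _ => integrable_finsetSum _ fun j _ => hint i j
  have hgi : Integrable (fun x => inner ℝ (dirDeriv (interp M T k v) (interp M T k v) x) (z x))
      (volume.restrict T) :=
    h.integrable_continuous ((vecPoly_contDiff hg (n := 0)).continuous.inner
      (vecPoly_contDiff hz (n := 0)).continuous)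
  simp only [inner_sub_left]
  rw [integral_sub hgi hconvi, hgz z hz, h.dirDeriv_rhs_eq _ _ hz]
  simp only [hconv]
  rw [integral_finsetSum _ fun i _ => integrable_finsetSum _ fun j _ => hint i j,
    Finset.sum_congr rfl fun i _ => integral_finsetSum _ fun j _ => hint i j,
    -- Both sides are now double sums over `i` and `j`; the `d²` identical bounds give the factor `d
    -- ^ 2` of `dirDerivConst`.
    ← Finset.sum_sub_distrib, Finset.sum_congr rfl fun i _ => (Finset.sum_sub_distrib _ _).symm]
  refine (Finset.abs_sum_le_sum_abs _ _).trans ((Finset.sum_le_sum fun i _ =>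
    (Finset.abs_sum_le_sum_abs _ _).trans (Finset.sum_le_sum fun j _ =>
      h.abs_dirDerivTerm_sub_le hv4 hv hz i j)).trans (le_of_eq ?_))
  simp only [Finset.sum_const, Finset.card_univ, Fintype.card_fin, nsmul_eq_mul, dirDerivConst]
  ring

end IsCompatible
end main

end HHO

end

theorem proposition2 (d : ℕ) (hd : d = 2 ∨ d = 3) (k : ℕ) (ϱ : ℝ) (hϱ : 0 < ϱ) :
    ∃ C : ℝ, 0 < C ∧
      ∀ (Ω : Set (HHO.Space d)), HHO.IsPolytope Ω →
      ∀ M : HHO.PolytopalMesh Ω, M.IsRegular ϱ →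
      ∀ T ∈ M.elements, ∀ v : HHO.Space d → HHO.Space d,
        HHO.MemSobolev T 1 4 v → HHO.MemSobolev T (k + 1) 2 v →
      ∀ z ∈ HHO.vecPoly d k,
        |∫ x in T, inner ℝ
            (HHO.dirDeriv (HHO.interp M T k v) (HHO.interp M T k v) x - HHO.convective T v x)
            (z x)| ≤
          C * Metric.diam T ^ (k + 1) * HHO.sobolevSeminorm T (k + 1) 2 v *
            HHO.sobolevSeminorm T 1 4 v * (eLpNorm z 4 (volume.restrict T)).toReal := by
  have hd2 : 2 ≤ d := by omega
  have hq : 0 ≤ (ϱ ^ 2 / 2)⁻¹ := by positivity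
  have hC : 0 ≤ HHO.dirDerivConst d k (ϱ ^ 2 / 2)⁻¹ := HHO.dirDerivConst_nonneg hq
  -- Adding `1` makes the constant strictly positive.
  refine ⟨HHO.dirDerivConst d k (ϱ ^ 2 / 2)⁻¹ + 1, by linarith, ?_⟩
  intro Ω _ M hM T hT v hv4 hv z hz
  obtain ⟨S, hS, hcompat⟩ := HHO.exists_isSubmesh (by omega) hϱ hM hT
  have hdiam : 0 < Metric.diam T := by
    have := hS.pos
    exact pos_of_mul_pos_right this (by positivity)
  -- The radius of the inscribed balls is a fixed multiple of `diam T`, so the ratio on which all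
  -- constants depend is independent of the mesh and of the element.
  have hratio : Metric.diam T / (ϱ ^ 2 / 2 * Metric.diam T) = (ϱ ^ 2 / 2)⁻¹ := by
    field_simp
  have hK : HHO.IsCompatible M T S (ϱ ^ 2 / 2 * Metric.diam T) :=
    { hS with mem := hT, two_le := hd2, compat := hcompat }
  have h := hK.abs_integral_dirDeriv_sub_convective_le hv4 hv hz
  rw [hratio] at h
  refine h.trans ?_
  have hA : 0 ≤ HHO.sobolevSeminorm T (k + 1) 2 v := HHO.sobolevSeminorm_nonneg
  have hW : 0 ≤ HHO.sobolevSeminorm T 1 4 v := HHO.sobolevSeminorm_nonneg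
  gcongr
  linarith
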